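/- Let $p=e_*+2s_*$ and let $e,s$ range over $1\le e\le e_*$, $e_*<s\le e_*+s_*$. Let $0<\gamma_e<1/2$ and $\gamma_s\in\mathbb C$ with $\operatorname{Re}\gamma_s<1/2$, $\operatorname{Im}\gamma_s\ge0$, $\gamma_s\ne0$. In $\mathbb C^{2p}$ with coordinates $z=(z',z'')$, $z'=(z_1,\dots,z_p)$, $z''=(z_{p+1},\dots,z_{2p})$, consider the product quadric $$Q:\quad z_{p+e}=(z_e+2\gamma_e\bar z_e)^2,\quad z_{p+s}=(z_s+2\gamma_s\bar z_{s+s_*})^2,\quad z_{p+s+s_*}=(z_{s+s_*}+2(1-\bar\gamma_s)\bar z_s)^2 .$$ Let $M$ be a germ at $0$ of a real analytic submanifold $z_{p+j}=E_j(z',\bar z')$, $1\le j\le p$, that is a third order perturbation of $Q$, i.e. $E=Q(z',\bar z')+O(|z'|^3)$ as convergent power series in $(z',\bar z')$. A deck transformation is a germ $\tau$ of biholomorphism of $(\mathbb C^{2p},0)$ with $\pi_1\circ\tau=\pi_1$, where $\pi_1(z',w')=(z',E(z',w'))$. Put $j^*=j$ for $j=e$, $s^*=s+s_*$, $(s+s_*)^*=s$,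 and let $c_e=\gamma_e$, $c_s=\gamma_s$, $c_{s+s_*}=1-\bar\gamma_s$. We say that $M$ has an abelian CR singularity if $\pi_1$ has the maximal number $2^p$ of deck transformations and the germs $\sigma_j=\tau_{1j}\circ\tau_{2j^*}$, $1\le j\le p$, commute pairwise; here $\tau_{1j}$ is the deck transformation whose linear part is $w_j\mapsto -w_j-c_{j^*}^{-1}z_{j^*}$ (all other coordinates being fixed), and $\tau_{2j}=\rho\tau_{1j}\rho$ with $\rho(z',w')=(\bar w',\bar z')$. Let $\lambda_e>1$ be the root of $\gamma_e\lambda^2-\lambda+\gamma_e=0$, let $\lambda_s^2=\bar\gamma_s^{-1}-1$ with $0\le\arg\lambda_s\le\pi/2$, and let $\lambda_{s+s_*}=\bar\lambda_s^{-1}$. Call a tuple of convergent power series $\Lambda_{1j}(\zeta)$, $\zeta\in\mathbb C^p$, $1\le j\le p$, admissible if $\Lambda_{1j}(0)=\lambda_j$ and $$\Lambda_{1e}=\overline{\Lambda_{1e}\circ\rho_z},\qquad \Lambda_{1s}^{-1}=\overline{\Lambda_{1(s+s_*)}\circ\rho_z},\qquad (\rho_z\zeta)_j=\bar\zeta_{j^*}.$$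 Put $$A_e=\frac{1+\Lambda_{1e}^2}{(1-\Lambda_{1e}^2)^2},\quad A_j=\frac{\Lambda_{1j}+\Lambda_{1j}^3}{(1-\Lambda_{1j}^2)^2}\ (j=s,s+s_*),\quad B_j=\frac{\Lambda_{1j}}{(1-\Lambda_{1j}^2)^2}\ (j=e,s,s+s_*).$$ (i) For every admissible $\Lambda$ the equations $$\zeta_e=A_e(\zeta)|z_e|^2-B_e(\zeta)(z_e^2+\bar z_e^2),$$ $$\zeta_s=A_s(\zeta)z_s\bar z_{s+s_*}-B_s(\zeta)\bigl(z_s^2+\Lambda_{1s}^2(\zeta)\bar z_{s+s_*}^2\bigr),$$ $$\zeta_{s+s_*}=A_{s+s_*}(\zeta)\bar z_sz_{s+s_*}-B_{s+s_*}(\zeta)\bigl(z_{s+s_*}^2+\Lambda_{1(s+s_*)}^2(\zeta)\bar z_s^2\bigr)$$ have a unique solution $\zeta(z',\bar z')$ given by convergent power series with $\zeta(0)=0$. Let $\widehat M_\Lambda$ be the germ $z_{p+j}=\Lambda_{1j}(\zeta)\zeta_j$, $1\le j\le p$, with this $\zeta$. (ii) Every $M$ as above with an abelian CR singularity is holomorphically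 equivalent, as a germ at $0$, to $\widehat M_\Lambda$ for some admissible $\Lambda$. (iii) The $\Lambda_{1j}$ are otherwise arbitrary: for every admissible $\Lambda$, $\widehat M_\Lambda$ is holomorphically equivalent to some third order perturbation $M$ of $Q$ with an abelian CR singularity. (iv) For every admissible $\Lambda$, the map $z_{p+j}=\zeta_j\Lambda_{1j}(\zeta)$ has near $0$ an inverse of the form $\zeta_j=z_{p+j}\tilde\Lambda_{1j}(z'')$ with convergent $\tilde\Lambda_{1j}$, and $\widehat M_\Lambda$ is contained in $z_{p+e}=\bar z_{p+e}$, $z_{p+s}\tilde\Lambda_{1s}^2(z'')=\bar z_{p+s+s_*}$. (v) For every $M$ as in (ii), in suitable holomorphic coordinates fixing the origin, $M$ is contained in the linear subspace $z_{p+e}=\bar z_{p+e}$, $z_{p+s}=\bar z_{p+s+s_*}$. -/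

import Mathlib

open Filter Topology Asymptotics
open scoped ComplexConjugate

/-- Indices of the coordinates `z_1, …, z_p`, `p = e + 2 s`: the `e` elliptic indices, then the
indices `s`, then their partners `s + s_*`. -/
abbrev CIdx (e s : ℕ) : Type := Fin e ⊕ (Fin s ⊕ Fin s)

/-- The space `ℂ^p`. -/
abbrev Cp (e s : ℕ) : Type := CIdx e s → ℂ

/-- The space `ℂ^(2p) = ℂ^p × ℂ^p`, used with coordinates `(z', z'')` for the ambient space and with
coordinates `(z', w')` for the complexification of a real submanifold. -/
abbrev C2p (e s : ℕ) : Type := Cp e s × Cp e s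

variable {e s : ℕ}

/-- The index involution that fixes the elliptic indices and exchanges `s` with `s + s_*`. -/
def partner : CIdx e s → CIdx e s
  | Sum.inl i => Sum.inl i
  | Sum.inr (Sum.inl i) => Sum.inr (Sum.inr i)
  | Sum.inr (Sum.inr i) => Sum.inr (Sum.inl i)

/-- Componentwise complex conjugation `z ↦ z̄`. -/
def conjVec (z : Cp e s) : Cp e s := fun j => conj (z j)

/-- The anti-holomorphic involution `ρ (z', w') = (w̄', z̄')`. -/
def rho (x : C2p e s) : C2p e s := (conjVec x.2, conjVec x.1)

/-- The anti-holomorphic involution `ρ_z : ζ_e ↦ ζ̄_e, ζ_s ↦ ζ̄_{s+s_*}, ζ_{s+s_*} ↦ ζ̄_s`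
(value at `ζ`). -/
def rhoZ (ζ : Cp e s) : Cp e s := fun j => conj (ζ (partner j))

/-! ### Germs of biholomorphisms and of submanifolds -/

/-- `Φ` represents a germ of biholomorphism of `(ℂ^(2p), 0)`. -/
def IsBiholGerm (Φ : C2p e s → C2p e s) : Prop :=
  AnalyticAt ℂ Φ 0 ∧ Φ 0 = 0 ∧ (fderiv ℂ Φ 0).IsInvertible

/-- The germs at `0` of the sets `M` and `N` are holomorphically equivalent. -/
def HolEquivalent (M N : Set (C2p e s)) : Prop :=
  ∃ Φ : C2p e s → C2p e s, IsBiholGerm Φ ∧ ∀ᶠ z in 𝓝 0, (z ∈ M ↔ Φ z ∈ N)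

/-- The real submanifold `z'' = E(z', z̄')`. -/
def realGraph (E : C2p e s → Cp e s) : Set (C2p e s) :=
  {z | z.2 = E (z.1, conjVec z.1)}

/-! ### Product quadrics -/

/-- The coefficients `γ_e`, `γ_s`, `1 - γ̄_s`. -/
noncomputable def quadCoef (γe : Fin e → ℝ) (γs : Fin s → ℂ) : CIdx e s → ℂ
  | Sum.inl i => (γe i : ℂ)
  | Sum.inr (Sum.inl i) => γs i
  | Sum.inr (Sum.inr i) => 1 - conj (γs i)

/-- The complexified defining function of the product quadric
`z_{p+e} = (z_e + 2 γ_e z̄_e)²`,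
`z_{p+s} = (z_s + 2 γ_s z̄_{s+s_*})²`, `z_{p+s+s_*} = (z_{s+s_*} + 2 (1 - γ̄_s) z̄_s)²`. -/
noncomputable def productQuadric (γe : Fin e → ℝ) (γs : Fin s → ℂ) (x : C2p e s) : Cp e s :=
  fun j => (x.1 j + 2 * quadCoef γe γs j * x.2 (partner j)) ^ 2

/-- `E(z', w')` is a convergent power series with `E = productQuadric + O(3)`. -/
def IsThirdOrderPerturbation (γe : Fin e → ℝ) (γs : Fin s → ℂ) (E : C2p e s → Cp e s) : Prop :=
  AnalyticAt ℂ E 0 ∧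
    (fun x => E x - productQuadric γe γs x) =O[𝓝 0] (fun x => ‖x‖ ^ 3)

/-! ### Deck transformations and abelian CR singularities -/

/-- The projection `π₁ (z, w) = z` of the complexification
`z'' = E(z', w'), w'' = Ē(w', z')`, in the coordinates `(z', w')`. -/
def piOne (E : C2p e s → Cp e s) (x : C2p e s) : C2p e s := (x.1, E x)

/-- `τ` represents a deck transformation of `π₁`. -/
def IsDeck (E : C2p e s → Cp e s) (τ : C2p e s → C2p e s) : Prop :=
  IsBiholGerm τ ∧ (piOne E ∘ τ) =ᶠ[𝓝 0] piOne E

/-- The set of (germs of) deck transformations of `π₁`. -/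
def deckGerms (E : C2p e s → Cp e s) : Set (Germ (𝓝 (0 : C2p e s)) (C2p e s)) :=
  {g | ∃ τ : C2p e s → C2p e s, IsDeck E τ ∧ g = (τ : Germ (𝓝 (0 : C2p e s)) (C2p e s))}

/-- The generator `T_{1j}` of the deck transformations of the product quadric: it changes the sign
of `z_k + 2 γ w_j` (with `k` the partner of `j` and `γ` the coefficient of index `k`) and fixes all
coordinates except `w_j`. Its fixed-point set is a hyperplane. -/
noncomputable def quadricInvolution (γe : Fin e → ℝ) (γs : Fin s → ℂ) (j : CIdx e s)
    (x : C2p e s) : C2p e s :=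
  (x.1, Function.update x.2 j
    (-x.2 j - (quadCoef γe γs (partner j))⁻¹ * x.1 (partner j)))

/-- `σ_j = τ_{1j} ∘ τ_{2k}` where `τ_{2k} = ρ τ_{1k} ρ` and `k` is the partner of `j`: so
`σ_e = τ_{1e} τ_{2e}`, `σ_s = τ_{1s} τ_{2(s+s_*)}`, `σ_{s+s_*} = τ_{1(s+s_*)} τ_{2s}`. -/
def sigmaMap (τ : CIdx e s → C2p e s → C2p e s) (j : CIdx e s) : C2p e s → C2p e s :=
  τ j ∘ (rho ∘ τ (partner j) ∘ rho)

/-- The submanifold with complexified defining function `E` (a third order perturbation of the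
product quadric) has an abelian CR singularity at `0`: `π₁` has the maximal number `2^p` of deck
transformations, and the `σ_j` commute pairwise as germs. Here `τ_{1j}` is the deck transformation
with linear part `T_{1j}`. -/
def HasAbelianCRSingularity (γe : Fin e → ℝ) (γs : Fin s → ℂ) (E : C2p e s → Cp e s) : Prop :=
  (deckGerms E).ncard = 2 ^ Fintype.card (CIdx e s) ∧
  ∃ τ : CIdx e s → C2p e s → C2p e s,
    (∀ j, IsDeck E (τ j) ∧
      (fun x => τ j x - quadricInvolution γe γs j x) =O[𝓝 0] (fun x => ‖x‖ ^ 2)) ∧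
    ∀ i j, (sigmaMap τ i ∘ sigmaMap τ j) =ᶠ[𝓝 0] (sigmaMap τ j ∘ sigmaMap τ i)

/-- The germ of `M` at `0` is a real analytic third order perturbation of the product quadric with
an abelian CR singularity at `0`. -/
def IsAbelianPerturbation (γe : Fin e → ℝ) (γs : Fin s → ℂ) (M : Set (C2p e s)) : Prop :=
  ∃ E : C2p e s → Cp e s, (∀ᶠ z in 𝓝 0, (z ∈ M ↔ z ∈ realGraph E)) ∧
    IsThirdOrderPerturbation γe γs E ∧ HasAbelianCRSingularity γe γs E

/-! ### The normal form -/

/-- `λ_e > 1` is the larger root of `γ_e λ² - λ + γ_e = 0`; `λ_s` is the square root of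
`γ̄_s⁻¹ - 1` with argument in `[0, π/2]`; and `λ_{s+s_*} = (λ̄_s)⁻¹`. -/
noncomputable def lam (γe : Fin e → ℝ) (γs : Fin s → ℂ) : CIdx e s → ℂ
  | Sum.inl i => (((1 + Real.sqrt (1 - 4 * γe i ^ 2)) / (2 * γe i) : ℝ) : ℂ)
  | Sum.inr (Sum.inl i) => ((conj (γs i))⁻¹ - 1) ^ (1 / 2 : ℂ)
  | Sum.inr (Sum.inr i) => (conj (((conj (γs i))⁻¹ - 1) ^ (1 / 2 : ℂ)))⁻¹

/-- The convergent power series `Λ_{1j}(ζ)` satisfy `Λ_{1j}(0) = λ_j`,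
`Λ_{1e} = conj (Λ_{1e} ∘ ρ_z)` and `Λ_{1s}⁻¹ = conj (Λ_{1(s+s_*)} ∘ ρ_z)`. -/
def IsAdmissible (γe : Fin e → ℝ) (γs : Fin s → ℂ) (Λ : Cp e s → Cp e s) : Prop :=
  AnalyticAt ℂ Λ 0 ∧ Λ 0 = lam γe γs ∧
  (∀ i : Fin e, ∀ᶠ ζ in 𝓝 0, Λ ζ (Sum.inl i) = conj (Λ (rhoZ ζ) (Sum.inl i))) ∧
  (∀ i : Fin s, ∀ᶠ ζ in 𝓝 0,
    (Λ ζ (Sum.inr (Sum.inl i)))⁻¹ = conj (Λ (rhoZ ζ) (Sum.inr (Sum.inr i))))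

/-- The coefficients `A_e = (1 + Λ²)/(1 - Λ²)²` and, for `j = s, s + s_*`,
`A_j = (Λ + Λ³)/(1 - Λ²)²`. -/
noncomputable def coefA (Λ : Cp e s → Cp e s) (ζ : Cp e s) : CIdx e s → ℂ
  | Sum.inl i => (1 + Λ ζ (Sum.inl i) ^ 2) / (1 - Λ ζ (Sum.inl i) ^ 2) ^ 2
  | Sum.inr k => (Λ ζ (Sum.inr k) + Λ ζ (Sum.inr k) ^ 3) / (1 - Λ ζ (Sum.inr k) ^ 2) ^ 2

/-- The coefficients `B_j = Λ/(1 - Λ²)²`. -/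
noncomputable def coefB (Λ : Cp e s → Cp e s) (ζ : Cp e s) (j : CIdx e s) : ℂ :=
  Λ ζ j / (1 - Λ ζ j ^ 2) ^ 2

/-- Right-hand sides of the quadratic equations for `ζ`, at the point `z' = z`. -/
noncomputable def quadRHS (Λ : Cp e s → Cp e s) (ζ z : Cp e s) : CIdx e s → ℂ
  | Sum.inl i =>
      coefA Λ ζ (Sum.inl i) * (z (Sum.inl i) * conj (z (Sum.inl i)))
        - coefB Λ ζ (Sum.inl i) * (z (Sum.inl i) ^ 2 + conj (z (Sum.inl i)) ^ 2)
  | Sum.inr k =>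
      coefA Λ ζ (Sum.inr k) * (z (Sum.inr k) * conj (z (partner (Sum.inr k))))
        - coefB Λ ζ (Sum.inr k) *
          (z (Sum.inr k) ^ 2 + Λ ζ (Sum.inr k) ^ 2 * conj (z (partner (Sum.inr k))) ^ 2)

/-- `ζ(z', z̄')`, with `ζ` a convergent power series vanishing at `0`, solves the quadratic
equations. -/
def IsSolution (Λ : Cp e s → Cp e s) (ζ : C2p e s → Cp e s) : Prop :=
  AnalyticAt ℂ ζ 0 ∧ ζ 0 = 0 ∧
    ∀ᶠ z : Cp e s in 𝓝 0, ζ (z, conjVec z) = quadRHS Λ (ζ (z, conjVec z)) z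

/-- The normal form `z_{p+j} = Λ_{1j}(ζ) ζ_j` with `ζ = ζ(z', z̄')`. -/
def normalForm (Λ : Cp e s → Cp e s) (ζ : C2p e s → Cp e s) : Set (C2p e s) :=
  realGraph fun x j => Λ (ζ x) j * ζ x j

/-- `ζ_j = z_{p+j} Λ'_j(z'')` is the inverse, near `0`, of `z_{p+j} = ζ_j Λ_j(ζ)`. -/
def IsInverseFactor (Λ Λ' : Cp e s → Cp e s) : Prop :=
  AnalyticAt ℂ Λ' 0 ∧
  (∀ᶠ ζ : Cp e s in 𝓝 0, ∀ j, ζ j * Λ ζ j * Λ' (fun k => ζ k * Λ ζ k) j = ζ j) ∧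
  (∀ᶠ y : Cp e s in 𝓝 0, ∀ j, y j * Λ' y j * Λ (fun k => y k * Λ' y k) j = y j)

set_option linter.unusedSectionVars false

section WienerAlgebra

/-- The product of powers `∏ i, U i ^ α i`. -/
def pw {ι A : Type*} [Fintype ι] [CommMonoid A] (U : ι → A) (α : ι →₀ ℕ) : A := ∏ i, U i ^ α i

theorem pw_add {ι A : Type*} [Fintype ι] [CommMonoid A] (U : ι → A) (α β : ι →₀ ℕ) :
    pw U (α + β) = pw U α * pw U β := by
  simp [pw, pow_add, Finset.prod_mul_distrib]

theorem pw_zero {ι A : Type*} [Fintype ι] [CommMonoid A] (U : ι → A) : pw U 0 = 1 := by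
  simp [pw]

theorem pw_mul {ι A : Type*} [Fintype ι] [CommMonoid A] (U V : ι → A) (α : ι →₀ ℕ) :
    pw (fun i => U i * V i) α = pw U α * pw V α := by
  simp [pw, mul_pow, Finset.prod_mul_distrib]

theorem map_pw {ι A B F : Type*} [Fintype ι] [CommMonoid A] [CommMonoid B] [FunLike F A B]
    [MonoidHomClass F A B] (φ : F) (U : ι → A) (α : ι →₀ ℕ) :
    φ (pw U α) = pw (fun i => φ (U i)) α := by
  simp [pw, map_prod, map_pow]

theorem pw_const {ι A : Type*} [Fintype ι] [CommMonoid A] (t : A) (α : ι →₀ ℕ) :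
    pw (fun _ => t) α = t ^ α.degree := by
  rw [pw, Finset.prod_pow_eq_pow_sum, Finsupp.degree_eq_sum]

theorem norm_pw_le_one {ι A : Type*} [Fintype ι] [NormedCommRing A] [NormOneClass A] {U : ι → A}
    (hU : ∀ i, ‖U i‖ ≤ 1) (α : ι →₀ ℕ) : ‖pw U α‖ ≤ 1 := by
  refine (Finset.norm_prod_le _ _).trans (Finset.prod_le_one (fun _ _ => norm_nonneg _) fun i _ => ?_)
  exact (norm_pow_le _ _).trans (pow_le_one₀ (norm_nonneg _) (hU i))

theorem norm_pw_le {ι A : Type*} [Fintype ι] [NormedCommRing A] [NormOneClass A] {U : ι → A} {r : ℝ}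
    (hU : ∀ i, ‖U i‖ ≤ r) (α : ι →₀ ℕ) : ‖pw U α‖ ≤ r ^ α.degree := by
  refine (Finset.norm_prod_le _ _).trans ?_
  rw [← pw_const (ι := ι) r α, pw]
  refine Finset.prod_le_prod (fun _ _ => norm_nonneg _) fun i _ => ?_
  exact (norm_pow_le _ _).trans (pow_le_pow_left₀ (norm_nonneg _) (hU i) _)

theorem summable_antidiagonal {ι : Type*} [DecidableEq ι] {f g : (ι →₀ ℕ) → ℝ}
    (hf : Summable f) (hg : Summable g) (hf0 : ∀ α, 0 ≤ f α) (hg0 : ∀ α, 0 ≤ g α) :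
    Summable fun γ => ∑ kl ∈ Finset.HasAntidiagonal.antidiagonal γ, f kl.1 * g kl.2 :=
  summable_sum_mul_antidiagonal_of_summable_mul (hf.mul_of_nonneg hg hf0 hg0)

theorem norm_coeff_mul_le {ι : Type*} [DecidableEq ι] (f g : MvPowerSeries ι ℂ) (γ : ι →₀ ℕ) :
    ‖MvPowerSeries.coeff γ (f * g)‖ ≤ ∑ kl ∈ Finset.HasAntidiagonal.antidiagonal γ,
      ‖MvPowerSeries.coeff kl.1 f‖ * ‖MvPowerSeries.coeff kl.2 g‖ := by
  rw [MvPowerSeries.coeff_mul]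
  refine (norm_sum_le _ _).trans (le_of_eq (Finset.sum_congr rfl fun _ _ => norm_mul _ _))

/-- The power series whose coefficients are absolutely summable. -/
def wiener (ι : Type*) : Subalgebra ℂ (MvPowerSeries ι ℂ) where
  carrier := {f | Summable fun α => ‖MvPowerSeries.coeff α f‖}
  mul_mem' := by
    classical
    intro f g hf hg
    have h := summable_antidiagonal (f := fun α => ‖MvPowerSeries.coeff α f‖)
      (g := fun α => ‖MvPowerSeries.coeff α g‖) hf hg (fun _ => norm_nonneg _) fun _ => norm_nonneg _
    exact Summable.of_nonneg_of_le (fun _ => norm_nonneg _) (norm_coeff_mul_le f g) h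
  add_mem' := by
    intro f g hf hg
    refine Summable.of_nonneg_of_le (fun _ => norm_nonneg _) (fun α => ?_) (hf.add hg)
    simpa using norm_add_le _ _
  algebraMap_mem' := by
    classical
    intro c
    refine summable_of_hasFiniteSupport ((Set.finite_singleton (0 : ι →₀ ℕ)).subset ?_)
    intro α hα
    by_contra h
    apply hα
    have : α ≠ 0 := h
    simp [MvPowerSeries.algebraMap_apply, MvPowerSeries.coeff_C, this]

/-- The Wiener algebra of absolutely convergent power series on the closed unit polydisc. -/
abbrev Wiener (ι : Type*) : Type _ := wiener ι

namespace Wiener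

variable {ι : Type*}

/-- The coefficient of an absolutely convergent power series. -/
noncomputable def co (f : Wiener ι) (α : ι →₀ ℕ) : ℂ := MvPowerSeries.coeff α f.1

theorem summable (f : Wiener ι) : Summable fun α => ‖f.co α‖ := f.2

@[ext] theorem ext {f g : Wiener ι} (h : ∀ α, f.co α = g.co α) : f = g :=
  Subtype.ext (MvPowerSeries.ext h)

@[simp] theorem co_add (f g : Wiener ι) (α) : (f + g).co α = f.co α + g.co α := by simp [co]
@[simp] theorem co_sub (f g : Wiener ι) (α) : (f - g).co α = f.co α - g.co α := by simp [co]
@[simp] theorem co_neg (f : Wiener ι) (α) : (-f).co α = -f.co α := by simp [co]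
@[simp] theorem co_zero (α) : (0 : Wiener ι).co α = 0 := by simp [co]
@[simp] theorem co_smul (c : ℂ) (f : Wiener ι) (α) : (c • f).co α = c * f.co α := by simp [co]

theorem co_one [DecidableEq ι] (α) : (1 : Wiener ι).co α = if α = 0 then 1 else 0 := by
  simp [co, MvPowerSeries.coeff_one]

theorem co_mul [DecidableEq ι] (f g : Wiener ι) (γ) :
    (f * g).co γ = ∑ kl ∈ Finset.HasAntidiagonal.antidiagonal γ, f.co kl.1 * g.co kl.2 := by
  simp [co, MvPowerSeries.coeff_mul]

/-- The element with prescribed summable coefficients. -/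
def ofCo (c : (ι →₀ ℕ) → ℂ) (hc : Summable fun α => ‖c α‖) : Wiener ι := ⟨c, hc⟩

@[simp] theorem co_ofCo (c : (ι →₀ ℕ) → ℂ) (hc : Summable fun α => ‖c α‖) (α) :
    (ofCo c hc).co α = c α := rfl

noncomputable instance : NormedCommRing (Wiener ι) where
  norm f := ∑' α, ‖f.co α‖
  dist f g := ∑' α, ‖(-f + g).co α‖
  dist_self f := by simp
  dist_comm f g := tsum_congr fun α => by
    rw [← norm_neg]; congr 1; simp
  dist_triangle f g h := by
    rw [← (summable _).tsum_add (summable _)]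
    refine (summable _).tsum_le_tsum (fun α => ?_) ((summable _).add (summable _))
    refine le_trans (le_of_eq ?_) (norm_add_le _ _)
    congr 1; simp
  eq_of_dist_eq_zero {f g} h := by
    have h' := (hasSum_zero_iff_of_nonneg (fun α => norm_nonneg ((-f + g).co α))).1
      (h ▸ (summable (-f + g)).hasSum)
    refine ext fun α => ?_
    have := congrFun h' α
    simp only [co_add, co_neg, Pi.zero_apply, norm_eq_zero] at this
    linear_combination -this
  dist_eq f g := rfl
  mul_comm := mul_comm
  norm_mul_le f g := by
    classical
    have h := summable_antidiagonal (f := fun α => ‖f.co α‖) (g := fun α => ‖g.co α‖) (summable f)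
      (summable g) (fun _ => norm_nonneg _) fun _ => norm_nonneg _
    calc ∑' α, ‖(f * g).co α‖ ≤ _ := (summable (f * g)).tsum_le_tsum
          (fun α => norm_coeff_mul_le f.1 g.1 α) h
      _ = _ := ((summable f).tsum_mul_tsum_eq_tsum_sum_antidiagonal (summable g)
        ((summable f).mul_of_nonneg (summable g) (fun _ => norm_nonneg _)
          fun _ => norm_nonneg _)).symm

theorem norm_def (f : Wiener ι) : ‖f‖ = ∑' α, ‖f.co α‖ := rfl

noncomputable instance : NormedAlgebra ℂ (Wiener ι) where
  norm_smul_le c f := by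
    simp only [norm_def, co_smul, norm_mul, tsum_mul_left]; rfl

instance : NormOneClass (Wiener ι) where
  norm_one := by
    classical
    rw [norm_def, tsum_eq_single 0 (fun α hα => by simp [co_one, hα])]
    simp [co_one]

theorem norm_co_le (f : Wiener ι) (α) : ‖f.co α‖ ≤ ‖f‖ :=
  (summable f).le_tsum α fun _ _ => norm_nonneg _

/-- Coefficients as continuous linear functionals. -/
noncomputable def coL (α : ι →₀ ℕ) : Wiener ι →L[ℂ] ℂ :=
  LinearMap.mkContinuous ⟨⟨fun f => f.co α, fun f g => co_add f g α⟩, fun c f => co_smul c f α⟩ 1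
    fun f => by simpa using norm_co_le f α

@[simp] theorem coL_apply (α : ι →₀ ℕ) (f : Wiener ι) : coL α f = f.co α := rfl

instance : CompleteSpace (Wiener ι) := by
  have hmem : ∀ f : Wiener ι, Memℓp (fun α => f.co α) 1 := fun f =>
    memℓp_gen (by simpa using summable f)
  have hsum : ∀ g : lp (fun _ : ι →₀ ℕ => ℂ) 1, Summable fun α => ‖g α‖ := fun g => by
    simpa using (memℓp_gen_iff (by norm_num)).1 (lp.memℓp g)
  let φ : Wiener ι ≃ᵢ lp (fun _ : ι →₀ ℕ => ℂ) 1 :=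
    IsometryEquiv.mk ⟨fun f => ⟨fun α => f.co α, hmem f⟩, fun g => ofCo (fun α => g α) (hsum g),
      fun f => rfl, fun g => rfl⟩ (Isometry.of_dist_eq fun f g => by
        rw [dist_eq_norm, dist_eq_norm, lp.norm_eq_tsum_rpow (by norm_num), norm_def]
        simp
        rfl)
  exact φ.completeSpace

section lift

variable {B : Type*} [NormedAddCommGroup B] [NormedSpace ℂ B] [CompleteSpace B]
  {B' : Type*} [NormedAddCommGroup B'] [NormedSpace ℂ B'] [CompleteSpace B']

/-- The linear map sending the monomial of exponent `α` to `b α`. -/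
noncomputable def lift (b : (ι →₀ ℕ) → B) (f : Wiener ι) : B := ∑' α, f.co α • b α

theorem lift_summable_norm {b : (ι →₀ ℕ) → B} {C : ℝ} (hb : ∀ α, ‖b α‖ ≤ C) (f : Wiener ι) :
    Summable fun α => ‖f.co α • b α‖ := by
  refine Summable.of_nonneg_of_le (fun _ => norm_nonneg _) (fun α => ?_) ((summable f).mul_right C)
  rw [norm_smul]
  exact mul_le_mul_of_nonneg_left (hb α) (norm_nonneg _)

theorem lift_summable {b : (ι →₀ ℕ) → B} {C : ℝ} (hb : ∀ α, ‖b α‖ ≤ C) (f : Wiener ι) :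
    Summable fun α => f.co α • b α := (lift_summable_norm hb f).of_norm

theorem lift_hasSum {b : (ι →₀ ℕ) → B} {C : ℝ} (hb : ∀ α, ‖b α‖ ≤ C) (f : Wiener ι) :
    HasSum (fun α => f.co α • b α) (lift b f) := (lift_summable hb f).hasSum

theorem norm_lift_le {b : (ι →₀ ℕ) → B} {C : ℝ} (hb : ∀ α, ‖b α‖ ≤ C) (f : Wiener ι) :
    ‖lift b f‖ ≤ C * ‖f‖ := by
  refine (norm_tsum_le_tsum_norm (lift_summable_norm hb f)).trans ?_
  rw [norm_def, ← tsum_mul_left]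
  refine (lift_summable_norm hb f).tsum_le_tsum (fun α => ?_) ((summable f).mul_left C)
  rw [norm_smul, mul_comm]
  exact mul_le_mul_of_nonneg_right (hb α) (norm_nonneg _)

theorem lift_add {b : (ι →₀ ℕ) → B} {C : ℝ} (hb : ∀ α, ‖b α‖ ≤ C) (f g : Wiener ι) :
    lift b (f + g) = lift b f + lift b g := by
  simp only [lift, co_add, add_smul]
  exact (lift_summable hb f).tsum_add (lift_summable hb g)

theorem lift_smul (b : (ι →₀ ℕ) → B) (c : ℂ) (f : Wiener ι) :
    lift b (c • f) = c • lift b f := by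
  simp only [lift, co_smul, mul_smul]
  exact tsum_const_smul'' c

/-- The lift of a bounded family as a continuous linear map. -/
noncomputable def liftL (b : (ι →₀ ℕ) → B) (C : ℝ) (hb : ∀ α, ‖b α‖ ≤ C) : Wiener ι →L[ℂ] B :=
  LinearMap.mkContinuous ⟨⟨lift b, lift_add hb⟩, lift_smul b⟩ C (norm_lift_le hb)

@[simp] theorem liftL_apply (b : (ι →₀ ℕ) → B) (C : ℝ) (hb : ∀ α, ‖b α‖ ≤ C) (f : Wiener ι) :
    liftL b C hb f = lift b f := rfl

theorem map_lift {b : (ι →₀ ℕ) → B} {C : ℝ} (hb : ∀ α, ‖b α‖ ≤ C) (φ : B →L[ℂ] B') (f : Wiener ι) :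
    φ (lift b f) = lift (fun α => φ (b α)) f := by
  rw [lift, φ.map_tsum (lift_summable hb f)]
  simp [lift]

theorem lift_congr {b b' : (ι →₀ ℕ) → B} {f : Wiener ι} (h : ∀ α, f.co α ≠ 0 → b α = b' α) :
    lift b f = lift b' f := by
  refine tsum_congr fun α => ?_
  by_cases h0 : f.co α = 0
  · simp [h0]
  · rw [h α h0]

theorem norm_lift_sub_le {b b' : (ι →₀ ℕ) → B} {C C' D : ℝ} (hb : ∀ α, ‖b α‖ ≤ C)
    (hb' : ∀ α, ‖b' α‖ ≤ C') (h : ∀ α, ‖b α - b' α‖ ≤ D) (f : Wiener ι) :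
    ‖lift b f - lift b' f‖ ≤ D * ‖f‖ := by
  have : lift b f - lift b' f = lift (fun α => b α - b' α) f := by
    rw [lift, lift, ← (lift_summable hb f).tsum_sub (lift_summable hb' f)]
    simp [lift, smul_sub]
  rw [this]
  exact norm_lift_le h f

end lift

end Wiener

end WienerAlgebra

namespace Wiener

section evaluation

variable {ι κ : Type*} [Fintype ι] [Fintype κ]
variable {B : Type*} [NormedAddCommGroup B] [NormedSpace ℂ B] [CompleteSpace B]

open Classical in
/-- The monomial of exponent `α`. -/
noncomputable def mono (α : ι →₀ ℕ) : Wiener ι :=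
  ofCo (fun β => if β = α then 1 else 0)
    (summable_of_hasFiniteSupport ((Set.finite_singleton α).subset fun β hβ => by
      by_contra h; exact hβ (by simp [show β ≠ α from h])))

theorem co_mono [DecidableEq ι] (α β : ι →₀ ℕ) : (mono α).co β = if β = α then 1 else 0 := by
  rw [mono, co_ofCo]; congr

theorem lift_mono (b : (ι →₀ ℕ) → B) (α : ι →₀ ℕ) : lift b (mono α) = b α := by
  classical
  rw [lift, tsum_eq_single α fun β hβ => by simp [co_mono, hβ]]
  simp [co_mono]

theorem norm_mono (α : ι →₀ ℕ) : ‖mono α‖ = 1 := by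
  classical
  rw [norm_def, tsum_eq_single α fun β hβ => by simp [co_mono, hβ]]
  simp [co_mono]

theorem norm_mono_le (α : ι →₀ ℕ) : ‖mono α‖ ≤ 1 := (norm_mono α).le

theorem co_lift {b : (ι →₀ ℕ) → Wiener κ} {C : ℝ} (hb : ∀ α, ‖b α‖ ≤ C) (f : Wiener ι)
    (γ : κ →₀ ℕ) : (lift b f).co γ = ∑' α, f.co α * (b α).co γ := by
  rw [← coL_apply, map_lift hb]; simp [lift]

theorem mono_zero : mono (0 : ι →₀ ℕ) = 1 := by
  classical
  ext γ; simp [co_mono, co_one]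

theorem mono_mul (α β : ι →₀ ℕ) : mono α * mono β = mono (α + β) := by
  classical
  ext γ
  rw [co_mul, co_mono]
  simp only [co_mono, mul_ite, mul_one, mul_zero]
  by_cases h : γ = α + β
  · rw [if_pos h, Finset.sum_eq_single (α, β)]
    · simp
    · rintro ⟨x, y⟩ _ hne
      by_cases hx : x = α <;> by_cases hy : y = β <;> simp_all
    · intro h'; exact absurd (Finset.HasAntidiagonal.mem_antidiagonal.2 h.symm) h'
  · rw [if_neg h]
    refine Finset.sum_eq_zero fun kl hkl => ?_
    have := Finset.HasAntidiagonal.mem_antidiagonal.1 hkl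
    by_cases hx : kl.1 = α <;> by_cases hy : kl.2 = β <;> simp_all

/-- The coordinate function of index `i`. -/
noncomputable def X (i : ι) : Wiener ι := mono (Finsupp.single i 1)

theorem norm_X (i : ι) : ‖X i‖ = 1 := norm_mono _

theorem X_pow (i : ι) (n : ℕ) : X i ^ n = mono (Finsupp.single i n) := by
  induction n with
  | zero => simp [mono_zero]
  | succ n ih => rw [pow_succ, ih, X, mono_mul, ← Finsupp.single_add]

theorem pw_X (α : ι →₀ ℕ) : pw X α = mono α := by
  classical
  have h : ∀ S : Finset ι, ∏ i ∈ S, X i ^ α i = mono (∑ i ∈ S, Finsupp.single i (α i)) := by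
    intro S
    induction S using Finset.induction_on with
    | empty => simp [mono_zero]
    | insert i S hi ih => rw [Finset.prod_insert hi, Finset.sum_insert hi, ih, X_pow, mono_mul]
  rw [pw, h, Finsupp.univ_sum_single]

/-- Evaluation at a point of the closed unit polydisc. -/
noncomputable def ev (x : ι → ℂ) (f : Wiener ι) : ℂ := lift (pw x) f

theorem pw_le {x : ι → ℂ} (hx : ‖x‖ ≤ 1) (α : ι →₀ ℕ) : ‖pw x α‖ ≤ 1 :=
  norm_pw_le_one ((pi_norm_le_iff_of_nonneg zero_le_one).1 hx) α

/-- Evaluation as a continuous linear functional. -/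
noncomputable def evL (x : ι → ℂ) (hx : ‖x‖ ≤ 1) : Wiener ι →L[ℂ] ℂ := liftL (pw x) 1 (pw_le hx)

theorem evL_apply (x : ι → ℂ) (hx : ‖x‖ ≤ 1) (f : Wiener ι) : evL x hx f = ev x f := rfl

theorem ev_mono (x : ι → ℂ) (α) : ev x (mono α) = pw x α := lift_mono _ _

theorem ev_X (x : ι → ℂ) (i) : ev x (X i) = x i := by
  classical
  rw [X, ev_mono, pw, Finset.prod_eq_single i] <;> simp +contextual [eq_comm]

theorem ev_one (x : ι → ℂ) : ev x 1 = 1 := by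
  rw [← mono_zero, ev_mono, pw_zero]

theorem ev_zero' (x : ι → ℂ) : ev x 0 = 0 := by simp [ev, lift]

theorem ev_smul (x : ι → ℂ) (c : ℂ) (f : Wiener ι) : ev x (c • f) = c * ev x f := lift_smul _ _ _

theorem ev_neg (x : ι → ℂ) (f : Wiener ι) : ev x (-f) = - ev x f := by
  have := ev_smul x (-1) f
  simpa using this

theorem ev_add {x : ι → ℂ} (hx : ‖x‖ ≤ 1) (f g : Wiener ι) : ev x (f + g) = ev x f + ev x g :=
  lift_add (pw_le hx) f g

theorem ev_sub {x : ι → ℂ} (hx : ‖x‖ ≤ 1) (f g : Wiener ι) : ev x (f - g) = ev x f - ev x g := by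
  rw [sub_eq_add_neg, ev_add hx, ev_neg, sub_eq_add_neg]

theorem norm_ev_le {x : ι → ℂ} (hx : ‖x‖ ≤ 1) (f : Wiener ι) : ‖ev x f‖ ≤ ‖f‖ :=
  (norm_lift_le (pw_le hx) f).trans (by rw [one_mul])

theorem ev_mul {x : ι → ℂ} (hx : ‖x‖ ≤ 1) (f g : Wiener ι) : ev x (f * g) = ev x f * ev x g := by
  classical
  have key : ∀ f : Wiener ι, Summable fun α => ‖f.co α * pw x α‖ := lift_summable_norm (pw_le hx)
  have hfg := summable_mul_of_summable_norm (key f) (key g)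
  have h := Summable.tsum_mul_tsum_eq_tsum_sum_antidiagonal (f := fun α => f.co α * pw x α)
    (g := fun α => g.co α * pw x α) (key f).of_norm (key g).of_norm hfg
  have hev : ∀ f : Wiener ι, ev x f = ∑' α, f.co α * pw x α := fun _ => rfl
  rw [hev, hev, hev, h]
  refine tsum_congr fun γ => ?_
  rw [co_mul, Finset.sum_mul]
  refine Finset.sum_congr rfl fun kl hkl => ?_
  rw [← Finset.HasAntidiagonal.mem_antidiagonal.1 hkl, pw_add]
  ring

/-- Evaluation as a ring homomorphism. -/
noncomputable def evHom (x : ι → ℂ) (hx : ‖x‖ ≤ 1) : Wiener ι →+* ℂ where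
  toFun := ev x
  map_one' := ev_one x
  map_mul' := ev_mul hx
  map_zero' := ev_zero' x
  map_add' := ev_add hx

theorem ev_pow {x : ι → ℂ} (hx : ‖x‖ ≤ 1) (f : Wiener ι) (n : ℕ) : ev x (f ^ n) = ev x f ^ n :=
  map_pow (evHom x hx) f n

theorem ev_pw {x : ι → ℂ} (hx : ‖x‖ ≤ 1) (U : κ → Wiener ι) (α : κ →₀ ℕ) :
    ev x (pw U α) = pw (fun k => ev x (U k)) α :=
  map_pw (evHom x hx) U α

theorem ev_lift {x : ι → ℂ} (hx : ‖x‖ ≤ 1) {b : (κ →₀ ℕ) → Wiener ι} {C : ℝ}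
    (hb : ∀ α, ‖b α‖ ≤ C) (f : Wiener κ) : ev x (lift b f) = lift (fun α => ev x (b α)) f := by
  rw [← evL_apply x hx, map_lift hb]; rfl

/-- Composition of power series. -/
noncomputable def comp (U : κ → Wiener ι) (f : Wiener κ) : Wiener ι := lift (pw U) f

theorem ev_comp {x : ι → ℂ} (hx : ‖x‖ ≤ 1) {U : κ → Wiener ι} (hU : ∀ k, ‖U k‖ ≤ 1)
    (f : Wiener κ) : ev x (comp U f) = ev (fun k => ev x (U k)) f := by
  rw [comp, ev_lift hx (norm_pw_le_one hU)]
  simp only [ev_pw hx]; rfl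

theorem norm_comp_le {U : κ → Wiener ι} (hU : ∀ k, ‖U k‖ ≤ 1) (f : Wiener κ) :
    ‖comp U f‖ ≤ ‖f‖ :=
  (norm_lift_le (norm_pw_le_one hU) f).trans (by rw [one_mul])

/-- Rescaling of the variables. -/
noncomputable def scale (t : ℂ) (f : Wiener ι) : Wiener ι := comp (fun i => t • X i) f

theorem norm_smul_X_le {t : ℂ} (ht : ‖t‖ ≤ 1) (i : ι) : ‖t • X i‖ ≤ 1 := by
  rw [norm_smul, norm_X, mul_one]; exact ht

theorem ev_scale {x : ι → ℂ} (hx : ‖x‖ ≤ 1) {t : ℂ} (ht : ‖t‖ ≤ 1) (f : Wiener ι) :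
    ev x (scale t f) = ev (t • x) f := by
  rw [scale, ev_comp hx (norm_smul_X_le ht)]
  congr 1
  funext i
  rw [ev_smul, ev_X]; rfl

theorem pw_smul {A : Type*} [CommRing A] [Algebra ℂ A] (t : ℂ) (U : ι → A) (α : ι →₀ ℕ) :
    pw (fun i => t • U i) α = t ^ α.degree • pw U α := by
  simp only [Algebra.smul_def]
  rw [pw_mul, pw_const, map_pow]

theorem co_scale {t : ℂ} (ht : ‖t‖ ≤ 1) (f : Wiener ι) (α) :
    (scale t f).co α = t ^ α.degree * f.co α := by
  classical
  rw [scale, comp, co_lift (norm_pw_le_one (norm_smul_X_le ht)), tsum_eq_single α]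
  · rw [pw_smul, co_smul, pw_X]; simp [co_mono, mul_comm]
  · intro β hβ
    rw [pw_smul, co_smul, pw_X]; simp [co_mono, hβ.symm]

end evaluation

end Wiener

namespace Wiener

section germs

variable {ι κ : Type*} [Fintype ι] [Fintype κ]

/-- Every analytic germ is, after rescaling, given by an absolutely convergent power series. -/
theorem exists_ev_eq {f : (ι → ℂ) → ℂ} (hf : AnalyticAt ℂ f 0) :
    ∃ t : ℝ, 0 < t ∧ ∃ a : Wiener ι, ∀ x : ι → ℂ, ‖x‖ ≤ 1 → f ((t : ℂ) • x) = ev x a := by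
  classical
  obtain ⟨p, r, hp⟩ := hf
  obtain ⟨r', hr'0, hr'⟩ := ENNReal.lt_iff_exists_nnreal_btwn.1 hp.r_pos
  have hr'0 : 0 < r' := by exact_mod_cast hr'0
  obtain ⟨C, hC0, hC⟩ := p.norm_mul_pow_le_of_lt_radius (hr'.trans_le hp.r_le)
  obtain ⟨N, hNdef⟩ : ∃ N : ℝ, N = Fintype.card ι := ⟨_, rfl⟩
  have hN : 0 ≤ N := hNdef ▸ Nat.cast_nonneg _
  set t : ℝ := r' / (2 * (N + 1)) with ht
  have ht0 : 0 < t := by positivity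
  have htr : t < r' := by
    rw [ht, div_lt_iff₀ (by positivity)]
    have : (0 : ℝ) < r' := hr'0
    nlinarith
  let c : (d : ℕ) → (Fin d → ι) → ℂ := fun d w => p d fun i => Pi.single (w i) 1
  let A : ℕ → Wiener ι := fun d => ∑ w : Fin d → ι, ((t : ℂ) ^ d * c d w) • ∏ i, X (w i)
  have hc : ∀ d w, ‖c d w‖ ≤ ‖p d‖ := fun d w => by
    refine ((p d).le_opNorm _).trans (mul_le_of_le_one_right (norm_nonneg _) ?_)
    refine Finset.prod_le_one (fun _ _ => norm_nonneg _) fun i _ => ?_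
    rw [pi_norm_le_iff_of_nonneg zero_le_one]
    intro j
    rcases eq_or_ne j (w i) with h | h
    · simp [h]
    · simp [Pi.single_eq_of_ne h]
  have hA : ∀ d, ‖A d‖ ≤ C * (1 / 2) ^ d := fun d => by
    calc ‖A d‖ ≤ ∑ w : Fin d → ι, t ^ d * ‖p d‖ := by
          refine norm_sum_le_of_le _ fun w _ => ?_
          rw [norm_smul, norm_mul, norm_pow, Complex.norm_real, Real.norm_of_nonneg ht0.le]
          have h1 : ‖∏ i, (X (w i) : Wiener ι)‖ ≤ 1 :=
            (Finset.norm_prod_le _ _).trans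
              (Finset.prod_le_one (fun _ _ => norm_nonneg _) fun i _ => (norm_X _).le)
          have h2 := hc d w
          calc t ^ d * ‖c d w‖ * _ ≤ t ^ d * ‖c d w‖ * 1 := by gcongr
            _ ≤ _ := by rw [mul_one]; gcongr
      _ = (N * t) ^ d * ‖p d‖ := by
          simp [Finset.card_univ, mul_pow, hNdef]; ring
      _ ≤ (r' / 2) ^ d * ‖p d‖ := by
          gcongr
          rw [ht, ← mul_div_assoc, div_le_div_iff₀ (by positivity) (by positivity)]
          have : (0 : ℝ) < r' := hr'0
          nlinarith
      _ = ‖p d‖ * r' ^ d * (1 / 2) ^ d := by rw [div_pow, div_pow, one_pow]; ring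
      _ ≤ _ := by gcongr; exact hC d
  have hsum : Summable A :=
    Summable.of_norm_bounded ((summable_geometric_of_lt_one (by norm_num) (by norm_num)).mul_left C)
      hA
  refine ⟨t, ht0, ∑' d, A d, fun x hx => ?_⟩
  have hmem : (t : ℂ) • x ∈ Metric.eball (0 : ι → ℂ) r := by
    refine Metric.eball_subset_eball hr'.le ?_
    rw [Metric.mem_eball, edist_zero_right, enorm_lt_coe, ← NNReal.coe_lt_coe, coe_nnnorm, norm_smul,
      Complex.norm_real, Real.norm_of_nonneg ht0.le]
    nlinarith
  have h1 := (hp.hasSum hmem).tsum_eq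
  rw [zero_add] at h1
  rw [← h1, ← evL_apply x hx, (evL x hx).map_tsum hsum]
  refine tsum_congr fun d => ?_
  have hx' : (t : ℂ) • x = ∑ j, ((t : ℂ) * x j) • (Pi.single j 1 : ι → ℂ) := by
    ext k; simp [Finset.sum_apply, Pi.single_apply]
  rw [hx', (p d).map_sum, map_sum]
  refine Finset.sum_congr rfl fun w _ => ?_
  rw [ContinuousMultilinearMap.map_smul_univ, evL_apply, ev_smul]
  have : ev x (∏ i, X (w i)) = ∏ i, x (w i) := by
    rw [show ev x (∏ i, X (w i)) = ∏ i, ev x (X (w i)) from map_prod (evHom x hx) _ _]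
    simp only [ev_X]
  rw [this, Finset.prod_mul_distrib, Finset.prod_const, Finset.card_univ, Fintype.card_fin,
    smul_eq_mul]
  ring

/-- The exponents of given degree. -/
noncomputable def expo (ι : Type*) [Fintype ι] (d : ℕ) : Finset (ι →₀ ℕ) := by
  classical exact Finset.finsuppAntidiag Finset.univ d

theorem mem_expo {d : ℕ} {α : ι →₀ ℕ} : α ∈ expo ι d ↔ α.degree = d := by
  classical
  rw [expo, Finset.mem_finsuppAntidiag, Finsupp.degree_eq_sum]
  simp

theorem exists_word (α : ι →₀ ℕ) {d : ℕ} (h : α.degree = d) :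
    ∃ w : Fin d → ι, ∀ x : ι → ℂ, ∏ i, x (w i) = pw x α := by
  classical
  have hl : (Finsupp.toMultiset α).toList.length = d := by
    rw [Multiset.length_toList, Finsupp.card_toMultiset, ← h, Finsupp.degree_eq_sum]
    exact Finsupp.sum_fintype _ _ fun _ => rfl
  subst hl
  refine ⟨fun i => (Finsupp.toMultiset α).toList.get i, fun x => ?_⟩
  rw [← List.prod_ofFn, ← Function.comp_def x, ← List.map_ofFn, List.ofFn_get, ← Multiset.prod_coe,
    ← Multiset.map_coe, Multiset.coe_toList, Finset.prod_multiset_map_count, pw]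
  refine (Finset.prod_congr rfl fun i _ => by rw [Finsupp.count_toMultiset]).trans
    (Finset.prod_subset (Finset.subset_univ _) fun i _ hi => ?_)
  rw [Finsupp.toFinset_toMultiset, Finsupp.notMem_support_iff] at hi
  rw [hi, pow_zero]

theorem analyticAt_ev (a : Wiener ι) : AnalyticAt ℂ (fun x => ev x a) 0 := by
  classical
  choose w hw using fun (d : ℕ) (α : expo ι d) => exists_word α.1 (mem_expo.1 α.2)
  let M : (d : ℕ) → expo ι d → ContinuousMultilinearMap ℂ (fun _ : Fin d => ι → ℂ) ℂ := fun d α =>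
    (ContinuousMultilinearMap.mkPiAlgebra ℂ (Fin d) ℂ).compContinuousLinearMap
      fun i => ContinuousLinearMap.proj (w d α i)
  have hM : ∀ d α, ‖M d α‖ ≤ 1 := fun d α => by
    refine ContinuousMultilinearMap.opNorm_le_bound zero_le_one fun m => ?_
    rw [one_mul]
    simp only [M, ContinuousMultilinearMap.compContinuousLinearMap_apply,
      ContinuousMultilinearMap.mkPiAlgebra_apply, ContinuousLinearMap.proj_apply, norm_prod]
    exact Finset.prod_le_prod (fun _ _ => norm_nonneg _) fun i _ => norm_le_pi_norm _ _
  let P : FormalMultilinearSeries ℂ (ι → ℂ) ℂ := fun d => ∑ α : expo ι d, a.co α • M d α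
  have hP : ∀ d, ‖P d‖ ≤ ‖a‖ := fun d => by
    calc ‖P d‖ ≤ ∑ α : expo ι d, ‖a.co α‖ := by
          refine norm_sum_le_of_le _ fun α _ => ?_
          rw [norm_smul]
          exact mul_le_of_le_one_right (norm_nonneg _) (hM d α)
      _ = ∑ α ∈ expo ι d, ‖a.co α‖ := Finset.sum_coe_sort (expo ι d) fun α => ‖a.co α‖
      _ ≤ _ := (summable a).sum_le_tsum _ fun _ _ => norm_nonneg _
  refine ⟨P, 1, ?_, zero_lt_one, ?_⟩
  · exact_mod_cast P.le_radius_of_bound ‖a‖ (r := 1) fun n => by simpa using hP n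
  · intro y hy
    have hy1 : ‖y‖ ≤ 1 := by
      rw [Metric.mem_eball, edist_zero_right] at hy
      have : ‖y‖ₑ < ((1 : NNReal) : ENNReal) := by simpa using hy
      rw [enorm_lt_coe] at this
      exact_mod_cast this.le
    rw [zero_add]
    have h := (lift_hasSum (pw_le hy1) a).tsum_fiberwise (fun α : ι →₀ ℕ => α.degree)
    refine (congrArg (fun g => HasSum g (ev y a)) (funext fun d => ?_)).mp h
    have : ((fun α : ι →₀ ℕ => α.degree) ⁻¹' {d}) = (expo ι d : Set (ι →₀ ℕ)) := by
      ext α; simp [mem_expo]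
    rw [this, Finset.tsum_subtype' (expo ι d) (fun α => a.co α • pw y α)]
    simp only [P, _root_.sum_apply, _root_.smul_apply]
    rw [← Finset.sum_coe_sort (expo ι d) fun α => a.co α • pw y α]
    refine Finset.sum_congr rfl fun α _ => ?_
    rw [← hw d α]
    simp [M]

theorem ev_eq_sum_add {a : Wiener ι} {k : ℕ} (h : ∀ α : ι →₀ ℕ, α.degree < k → a.co α = 0)
    {x : ι → ℂ} (hx : ‖x‖ ≤ 1) {t : ℝ} (ht0 : 0 ≤ t) (ht : t ≤ 1) :
    ‖ev ((t : ℂ) • x) a - (t : ℂ) ^ k * ∑ α ∈ expo ι k, a.co α * pw x α‖ ≤ t ^ (k + 1) * ‖a‖ := by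
  classical
  have hk : (t : ℂ) ^ k * ∑ α ∈ expo ι k, a.co α * pw x α =
      lift (fun α => if α.degree = k then (t : ℂ) ^ k * pw x α else 0) a := by
    rw [lift, tsum_eq_sum (s := expo ι k), Finset.mul_sum]
    · refine Finset.sum_congr rfl fun α hα => ?_
      rw [if_pos (mem_expo.1 hα), smul_eq_mul]; ring
    · intro α hα
      rw [if_neg fun h => hα (mem_expo.2 h), smul_zero]
  have hpw : ∀ α, pw ((t : ℂ) • x) α = (t : ℂ) ^ α.degree * pw x α := fun α => by
    rw [← smul_eq_mul, ← pw_smul]; rfl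
  have hn : ∀ n : ℕ, ‖(t : ℂ) ^ n‖ = t ^ n := fun n => by
    rw [norm_pow, Complex.norm_real, Real.norm_of_nonneg ht0]
  have e1 : ev ((t : ℂ) • x) a = lift (fun α => if α.degree < k then 0 else
      (t : ℂ) ^ α.degree * pw x α) a := by
    refine lift_congr fun α hα => ?_
    rw [if_neg fun hlt => hα (h α hlt), hpw]
  rw [e1, hk]
  have hb : ∀ (n : ℕ) (α : ι →₀ ℕ), ‖(t : ℂ) ^ n * pw x α‖ ≤ t ^ n := fun n α => by
    rw [norm_mul, hn]
    exact mul_le_of_le_one_right (by positivity) (pw_le hx α)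
  refine norm_lift_sub_le (C := 1) (C' := 1) (fun α => ?_) (fun α => ?_) (fun α => ?_) a
  · split_ifs
    · simp
    · exact (hb _ _).trans (pow_le_one₀ ht0 ht)
  · split_ifs
    · exact (hb _ _).trans (pow_le_one₀ ht0 ht)
    · simp
  · rcases lt_trichotomy α.degree k with hlt | heq | hgt
    · rw [if_pos hlt, if_neg hlt.ne]; simp; positivity
    · rw [if_neg heq.not_lt, if_pos heq, heq]; simp; positivity
    · rw [if_neg hgt.not_gt, if_neg hgt.ne', sub_zero]
      exact (hb _ _).trans (pow_le_pow_of_le_one ht0 ht hgt)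

theorem sum_expo_eq_zero {c : (ι →₀ ℕ) → ℂ} {k : ℕ}
    (h : ∀ x : ι → ℝ, (∀ i, 0 ≤ x i ∧ x i ≤ 1) →
      ∑ α ∈ expo ι k, c α * pw (fun i => (x i : ℂ)) α = 0) {α : ι →₀ ℕ} (hα : α.degree = k) :
    c α = 0 := by
  classical
  let p : MvPolynomial ι ℂ := ∑ β ∈ expo ι k, MvPolynomial.monomial β (c β)
  have hp : p = 0 := by
    refine MvPolynomial.funext_set (fun _ : ι => (fun r : ℝ => (r : ℂ)) '' Set.Icc 0 1) (fun _ => ?_) ?_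
    · exact (Set.Icc_infinite zero_lt_one).image Complex.ofReal_injective.injOn
    · intro x hx
      choose y hy hyx using fun i => hx i (Set.mem_univ i)
      rw [map_zero, ← h y fun i => hy i]
      simp only [p, map_sum, MvPolynomial.eval_monomial]
      refine Finset.sum_congr rfl fun β _ => ?_
      rw [Finsupp.prod_fintype _ _ (fun _ => pow_zero _), pw]
      simp only [← hyx]
  have := congrArg (MvPolynomial.coeff α) hp
  simpa [p, MvPolynomial.coeff_sum, MvPolynomial.coeff_monomial, mem_expo, hα] using this

/-- The coefficients of degree at most `d` vanish if the series is small along all real rays. -/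
theorem co_eq_zero_of_isLittleO {a : Wiener ι} {d : ℕ}
    (h : ∀ x : ι → ℝ, (∀ i, 0 ≤ x i ∧ x i ≤ 1) →
      (fun t : ℝ => ev ((t : ℂ) • fun i => (x i : ℂ)) a) =o[𝓝[>] 0] fun t => t ^ d)
    {α : ι →₀ ℕ} (hα : α.degree ≤ d) : a.co α = 0 := by
  induction hk : α.degree using Nat.strong_induction_on generalizing α with
  | _ k ih =>
    refine sum_expo_eq_zero (c := a.co) (fun x hx => ?_) hk
    set x' : ι → ℂ := fun i => (x i : ℂ)
    have hx' : ‖x'‖ ≤ 1 := by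
      rw [pi_norm_le_iff_of_nonneg zero_le_one]
      intro i
      simp only [x', Complex.norm_real, Real.norm_eq_abs, abs_of_nonneg (hx i).1, (hx i).2]
    set S := ∑ α ∈ expo ι k, a.co α * pw x' α
    have hlow : ∀ β : ι →₀ ℕ, β.degree < k → a.co β = 0 := fun β hβ =>
      ih _ hβ (by omega) rfl
    have h1 : (fun t : ℝ => (t : ℂ) ^ k * S) =o[𝓝[>] 0] fun t => t ^ k := by
      have hkd : (fun t : ℝ => t ^ d) =O[𝓝[>] 0] fun t => t ^ k := by
        refine IsBigO.of_bound 1 ?_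
        filter_upwards [self_mem_nhdsWithin, Ioc_mem_nhdsGT (zero_lt_one' ℝ)] with t _ ht
        rw [one_mul, norm_pow, norm_pow, Real.norm_of_nonneg ht.1.le]
        exact pow_le_pow_of_le_one ht.1.le ht.2 (by omega)
      have h2 : (fun t : ℝ => ev ((t : ℂ) • x') a - (t : ℂ) ^ k * S) =o[𝓝[>] 0] fun t => t ^ k := by
        have h3 : (fun t : ℝ => ev ((t : ℂ) • x') a - (t : ℂ) ^ k * S) =O[𝓝[>] 0]
            fun t => t ^ (k + 1) := by
          refine IsBigO.of_bound ‖a‖ ?_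
          filter_upwards [Ioc_mem_nhdsGT (zero_lt_one' ℝ)] with t ht
          rw [norm_pow, Real.norm_of_nonneg ht.1.le, mul_comm ‖a‖]
          exact ev_eq_sum_add hlow hx' ht.1.le ht.2
        have h4 : (fun t : ℝ => t ^ (k + 1)) =o[𝓝 0] fun t => t ^ k :=
          isLittleO_pow_pow (Nat.lt_succ_self k)
        exact h3.trans_isLittleO (h4.mono nhdsWithin_le_nhds)
      exact (((h x hx).trans_isBigO hkd).sub h2).congr_left fun t => by simp only [x']; ring
    by_contra hS
    have h4 := h1.bound (show (0 : ℝ) < ‖S‖ / 2 by positivity)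
    obtain ⟨t, ht, ht0⟩ := (h4.and self_mem_nhdsWithin).exists
    have ht0 : 0 < t := ht0
    rw [norm_mul, norm_pow, norm_pow, Complex.norm_real, mul_comm] at ht
    have h5 : 0 < ‖t‖ ^ k := pow_pos (norm_pos_iff.2 ht0.ne') k
    have h6 : 0 < ‖S‖ := norm_pos_iff.2 hS
    nlinarith

end germs

end Wiener

theorem norm_pow_sub_pow_le_div {A : Type*} [NormedCommRing A] [NormOneClass A] {p q : A} {r : ℝ}
    (hr : r < 1) (hp : ‖p‖ ≤ r) (hq : ‖q‖ ≤ r) (n : ℕ) :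
    ‖p ^ n - q ^ n‖ ≤ (1 - r)⁻¹ * ‖p - q‖ := by
  have hr0 : 0 ≤ r := (norm_nonneg _).trans hp
  have h1 : 0 < 1 - r := by linarith
  induction n with
  | zero => simp; positivity
  | succ n ih =>
    have e1 : p ^ (n + 1) - q ^ (n + 1) = p * (p ^ n - q ^ n) + (p - q) * q ^ n := by ring
    have h2 : ‖q ^ n‖ ≤ 1 := (norm_pow_le _ _).trans (pow_le_one₀ (norm_nonneg _) (by linarith))
    calc ‖p ^ (n + 1) - q ^ (n + 1)‖ ≤ ‖p‖ * ‖p ^ n - q ^ n‖ + ‖p - q‖ * ‖q ^ n‖ := by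
          rw [e1]
          exact (norm_add_le _ _).trans (add_le_add (norm_mul_le _ _) (norm_mul_le _ _))
      _ ≤ r * ((1 - r)⁻¹ * ‖p - q‖) + ‖p - q‖ * 1 := by gcongr
      _ = _ := by field_simp; ring

theorem pw_single {ι A : Type*} [Fintype ι] [CommMonoid A] (U : ι → A) (i : ι) (n : ℕ) :
    pw U (Finsupp.single i n) = U i ^ n := by
  classical
  rw [pw, Finset.prod_eq_single i]
  · simp
  · intro j _ hj; simp [Finsupp.single_eq_of_ne hj]
  · simp

theorem norm_pw_le_half {ι A : Type*} [Fintype ι] [NormedCommRing A] [NormOneClass A]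
    {U : ι → A} (hU : ∀ i, ‖U i‖ ≤ 1 / 2) {α : ι →₀ ℕ} (hα : α ≠ 0) : ‖pw U α‖ ≤ 1 / 2 := by
  refine (norm_pw_le hU α).trans ?_
  exact pow_le_of_le_one (by norm_num) (by norm_num) (by rwa [Ne, Finsupp.degree_eq_zero_iff])

theorem norm_pw_sub_pw_le {ι A : Type*} [Fintype ι] [NormedCommRing A] [NormOneClass A]
    {U V : ι → A} {D : ℝ} (hD0 : 0 ≤ D) (hU : ∀ i, ‖U i‖ ≤ 1 / 2) (hV : ∀ i, ‖V i‖ ≤ 1 / 2)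
    (hD : ∀ i, ‖U i - V i‖ ≤ D) (α : ι →₀ ℕ) : ‖pw U α - pw V α‖ ≤ 2 * D := by
  induction α using Finsupp.induction_linear with
  | zero => rw [pw_zero, pw_zero, sub_self, norm_zero]; positivity
  | single i n =>
    rw [pw_single, pw_single]
    refine (norm_pow_sub_pow_le_div (by norm_num) (hU i) (hV i) n).trans ?_
    have := hD i
    norm_num; exact this
  | add α β hα hβ =>
    by_cases h1 : α = 0
    · simpa [h1] using hβ
    by_cases h2 : β = 0
    · simpa [h2] using hα
    rw [pw_add, pw_add, show pw U α * pw U β - pw V α * pw V β =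
      pw U α * (pw U β - pw V β) + (pw U α - pw V α) * pw V β by ring]
    calc _ ≤ ‖pw U α‖ * ‖pw U β - pw V β‖ + ‖pw U α - pw V α‖ * ‖pw V β‖ :=
          (norm_add_le _ _).trans (add_le_add (norm_mul_le _ _) (norm_mul_le _ _))
      _ ≤ 1 / 2 * (2 * D) + 2 * D * (1 / 2) := by
          gcongr
          · exact norm_pw_le_half hU h1
          · exact norm_pw_le_half hV h2
      _ = _ := by ring

namespace Wiener

section support

variable {ι κ : Type*} [Fintype ι] [Fintype κ]

/-- All exponents of the series lie in `S`. -/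
def SuppIn (S : Set (ι →₀ ℕ)) (f : Wiener ι) : Prop := ∀ α, α ∉ S → f.co α = 0

theorem SuppIn.mem {S : Set (ι →₀ ℕ)} {f : Wiener ι} (h : SuppIn S f) {α} (hα : f.co α ≠ 0) :
    α ∈ S := by
  by_contra h'; exact hα (h α h')

theorem SuppIn.mono {S T : Set (ι →₀ ℕ)} {f : Wiener ι} (h : SuppIn S f) (hST : S ⊆ T) :
    SuppIn T f := fun α hα => h α fun h' => hα (hST h')

theorem SuppIn.add {S : Set (ι →₀ ℕ)} {f g : Wiener ι} (hf : SuppIn S f) (hg : SuppIn S g) :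
    SuppIn S (f + g) := fun α hα => by simp [hf α hα, hg α hα]

theorem SuppIn.sub {S : Set (ι →₀ ℕ)} {f g : Wiener ι} (hf : SuppIn S f) (hg : SuppIn S g) :
    SuppIn S (f - g) := fun α hα => by simp [hf α hα, hg α hα]

theorem SuppIn.smul {S : Set (ι →₀ ℕ)} {f : Wiener ι} (c : ℂ) (hf : SuppIn S f) :
    SuppIn S (c • f) := fun α hα => by simp [hf α hα]

theorem SuppIn.mul {S T Q : Set (ι →₀ ℕ)} {f g : Wiener ι} (hf : SuppIn S f) (hg : SuppIn T g)
    (h : ∀ α ∈ S, ∀ β ∈ T, α + β ∈ Q) : SuppIn Q (f * g) := by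
  classical
  intro γ hγ
  rw [co_mul]
  refine Finset.sum_eq_zero fun kl hkl => ?_
  rw [Finset.HasAntidiagonal.mem_antidiagonal] at hkl
  by_cases h1 : kl.1 ∈ S
  · by_cases h2 : kl.2 ∈ T
    · exact absurd (hkl ▸ h _ h1 _ h2) hγ
    · rw [hg _ h2, mul_zero]
  · rw [hf _ h1, zero_mul]

theorem suppIn_mono {S : Set (ι →₀ ℕ)} {α : ι →₀ ℕ} (h : α ∈ S) : SuppIn S (mono α) := by
  classical
  intro β hβ
  rw [co_mono, if_neg]
  rintro rfl
  exact hβ h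

theorem suppIn_one {S : Set (ι →₀ ℕ)} (h : 0 ∈ S) : SuppIn S (1 : Wiener ι) :=
  mono_zero (ι := ι) ▸ suppIn_mono h

theorem suppIn_lift {S : Set (κ →₀ ℕ)} {b : (ι →₀ ℕ) → Wiener κ} {C : ℝ} (hb : ∀ α, ‖b α‖ ≤ C)
    {f : Wiener ι} (h : ∀ α, f.co α ≠ 0 → SuppIn S (b α)) : SuppIn S (lift b f) := by
  intro γ hγ
  rw [co_lift hb]
  refine (tsum_congr fun α => ?_).trans tsum_zero
  by_cases hα : f.co α = 0
  · rw [hα, zero_mul]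
  · rw [h α hα γ hγ, mul_zero]

theorem isClosed_suppIn (S : Set (ι →₀ ℕ)) : IsClosed {f : Wiener ι | SuppIn S f} := by
  simp only [SuppIn, Set.ofPred_forall]
  exact isClosed_iInter fun α => isClosed_iInter fun _ =>
    isClosed_eq (coL α).continuous continuous_const

/-- The exponents of degree at least `n`. -/
def degGe (ι : Type*) [Fintype ι] (n : ℕ) : Set (ι →₀ ℕ) := {α | n ≤ α.degree}

theorem suppIn_pw {U : κ → Wiener ι} (hU : ∀ k, SuppIn (degGe ι 1) (U k)) (α : κ →₀ ℕ) :
    SuppIn (degGe ι α.degree) (pw U α) := by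
  classical
  have hpow : ∀ k n, SuppIn (degGe ι n) (U k ^ n) := fun k n => by
    induction n with
    | zero => rw [pow_zero]; exact suppIn_one (Nat.zero_le _)
    | succ n ih =>
      rw [pow_succ]
      refine ih.mul (hU k) fun β hβ γ hγ => ?_
      simp only [degGe, Set.mem_ofPred_eq, map_add] at *
      omega
  have h : ∀ S : Finset κ, SuppIn (degGe ι (∑ k ∈ S, α k)) (∏ k ∈ S, U k ^ α k) := fun S => by
    induction S using Finset.induction_on with
    | empty => exact suppIn_one (Nat.zero_le _)
    | insert k S hk ih =>
      rw [Finset.prod_insert hk, Finset.sum_insert hk]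
      refine (hpow k _).mul ih fun β hβ γ hγ => ?_
      simp only [degGe, Set.mem_ofPred_eq, map_add] at *
      omega
  rw [Finsupp.degree_eq_sum]
  exact h _

theorem suppIn_comp {U : κ → Wiener ι} (hU1 : ∀ k, ‖U k‖ ≤ 1) (hU : ∀ k, SuppIn (degGe ι 1) (U k))
    {n : ℕ} {f : Wiener κ} (hf : SuppIn (degGe κ n) f) : SuppIn (degGe ι n) (comp U f) :=
  suppIn_lift (norm_pw_le_one hU1) fun α hα => (suppIn_pw hU α).mono fun β hβ =>
    le_trans (show n ≤ α.degree from hf.mem hα) hβ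

theorem norm_comp_sub_comp_le {U V : κ → Wiener ι} {D : ℝ} (hD0 : 0 ≤ D) (hU : ∀ k, ‖U k‖ ≤ 1 / 2)
    (hV : ∀ k, ‖V k‖ ≤ 1 / 2) (hD : ∀ k, ‖U k - V k‖ ≤ D) (f : Wiener κ) :
    ‖comp U f - comp V f‖ ≤ 2 * D * ‖f‖ :=
  norm_lift_sub_le (norm_pw_le_one fun k => (hU k).trans (by norm_num))
    (norm_pw_le_one fun k => (hV k).trans (by norm_num)) (norm_pw_sub_pw_le hD0 hU hV hD) f

end support

section swap

variable {ι : Type*} [Fintype ι] [DecidableEq ι] (a b : ι)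

/-- Exchange of the variables of index `a` and `b`. -/
noncomputable def hat (f : Wiener ι) : Wiener ι := comp (fun i => X (Equiv.swap a b i)) f

theorem ev_hat {x : ι → ℂ} (hx : ‖x‖ ≤ 1) (f : Wiener ι) :
    ev x (hat a b f) = ev (fun i => x (Equiv.swap a b i)) f := by
  rw [hat, ev_comp hx fun i => (norm_X _).le]
  simp only [ev_X]

theorem norm_hat_le (f : Wiener ι) : ‖hat a b f‖ ≤ ‖f‖ := norm_comp_le (fun _ => (norm_X _).le) f

theorem hat_sub (f g : Wiener ι) : hat a b (f - g) = hat a b f - hat a b g :=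
  (liftL _ 1 (norm_pw_le_one fun i => (norm_X (Equiv.swap a b i)).le)).map_sub f g

/-- Exchange of the entries of index `a` and `b` of an exponent. -/
noncomputable def swapExp (α : ι →₀ ℕ) : ι →₀ ℕ := Finsupp.equivMapDomain (Equiv.swap a b) α

theorem swapExp_apply (α : ι →₀ ℕ) (i : ι) : swapExp a b α i = α (Equiv.swap a b i) := by
  rw [swapExp, Finsupp.equivMapDomain_apply, Equiv.symm_swap]

theorem swapExp_swapExp (α : ι →₀ ℕ) : swapExp a b (swapExp a b α) = α := by
  ext i; simp [swapExp_apply]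

theorem degree_swapExp (α : ι →₀ ℕ) : (swapExp a b α).degree = α.degree := by
  rw [Finsupp.degree_eq_sum, Finsupp.degree_eq_sum]
  simp only [swapExp_apply]
  exact Equiv.sum_comp (Equiv.swap a b) α

theorem pw_swap {A : Type*} [CommMonoid A] (U : ι → A) (α : ι →₀ ℕ) :
    pw (fun i => U (Equiv.swap a b i)) α = pw U (swapExp a b α) := by
  simp only [pw, swapExp_apply]
  rw [← Equiv.prod_comp (Equiv.swap a b)]
  simp

theorem co_hat (f : Wiener ι) (α) : (hat a b f).co α = f.co (swapExp a b α) := by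
  rw [hat, comp, co_lift (norm_pw_le_one fun i => (norm_X _).le),
    tsum_eq_single (swapExp a b α)]
  · rw [pw_swap, pw_X, co_mono, swapExp_swapExp]; simp
  · intro β hβ
    rw [pw_swap, pw_X, co_mono, if_neg, mul_zero]
    rintro rfl
    exact hβ (swapExp_swapExp a b β).symm

/-- The weight of an exponent under the action `(x_a, x_b) ↦ (m x_a, m⁻¹ x_b)`. -/
def wt (α : ι →₀ ℕ) : ℤ := α a - α b

theorem wt_add (α β : ι →₀ ℕ) : wt a b (α + β) = wt a b α + wt a b β := by
  simp [wt]; ring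

theorem wt_swapExp (α : ι →₀ ℕ) : wt a b (swapExp a b α) = - wt a b α := by
  simp [wt, swapExp_apply]

/-- The map `(x_a, x_b) ↦ (m x_a, m⁻¹ x_b)`. -/
noncomputable def sc (m : ℂ) (x : ι → ℂ) : ι → ℂ := fun i =>
  if i = a then m * x i else if i = b then m⁻¹ * x i else x i

variable {a b}

theorem pw_sc (hab : a ≠ b) {m : ℂ} (hm : m ≠ 0) (x : ι → ℂ) (α : ι →₀ ℕ) :
    pw (sc a b m x) α = m ^ wt a b α * pw x α := by
  have h : sc a b m x = fun i => (if i = a then m else if i = b then m⁻¹ else 1) * x i := by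
    funext i
    simp only [sc]
    split_ifs <;> simp
  rw [h, pw_mul]
  congr 1
  rw [pw, ← Finset.mul_prod_erase _ _ (Finset.mem_univ a),
    ← Finset.mul_prod_erase _ _ (Finset.mem_erase.2 ⟨hab.symm, Finset.mem_univ b⟩),
    Finset.prod_eq_one, if_pos rfl, if_neg hab.symm, if_pos rfl, mul_one, wt, zpow_sub₀ hm,
    zpow_natCast, zpow_natCast, inv_pow, div_eq_mul_inv]
  intro i hi
  simp only [Finset.mem_erase] at hi
  rw [if_neg hi.2.1, if_neg hi.1, one_pow]

variable (a b)

/-- The family `c_k q^|k| X^α`, where `k` is the weight of `α`. -/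
noncomputable def famR (c : ℤ → ℂ) (q : Wiener ι) (α : ι →₀ ℕ) : Wiener ι :=
  c (wt a b α) • (q ^ (wt a b α).natAbs * mono α)

/-- Multiplication of the component of weight `k` by `c_k q^|k|`. -/
noncomputable def opR (c : ℤ → ℂ) (q : Wiener ι) (g : Wiener ι) : Wiener ι :=
  lift (famR a b c q) g

variable {a b}

theorem norm_famR_le {c : ℤ → ℂ} {M r : ℝ} (hc : ∀ k, ‖c k‖ * r ^ k.natAbs ≤ M) {q : Wiener ι}
    (hq : ‖q‖ ≤ r) (α : ι →₀ ℕ) : ‖famR a b c q α‖ ≤ M := by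
  refine le_trans ?_ (hc (wt a b α))
  rw [famR, norm_smul]
  gcongr
  calc _ ≤ ‖q ^ (wt a b α).natAbs‖ * ‖mono α‖ := norm_mul_le _ _
    _ ≤ _ := by
      rw [norm_mono, mul_one]
      exact (norm_pow_le _ _).trans (pow_le_pow_left₀ (norm_nonneg _) hq _)

theorem norm_opR_le {c : ℤ → ℂ} {M r : ℝ} (hc : ∀ k, ‖c k‖ * r ^ k.natAbs ≤ M) {q : Wiener ι}
    (hq : ‖q‖ ≤ r) (g : Wiener ι) : ‖opR a b c q g‖ ≤ M * ‖g‖ :=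
  norm_lift_le (norm_famR_le hc hq) g

theorem famR_bound {c : ℤ → ℂ} {M r : ℝ} (hr0 : 0 ≤ r) (hr : r ≤ 1) (hc : ∀ k, ‖c k‖ ≤ M) (k : ℤ) :
    ‖c k‖ * r ^ k.natAbs ≤ M :=
  (mul_le_of_le_one_right (norm_nonneg _) (pow_le_one₀ hr0 hr)).trans (hc k)

theorem norm_opR_sub_le {c : ℤ → ℂ} {M r : ℝ} (hr : r < 1) (hc : ∀ k, ‖c k‖ ≤ M)
    {p q : Wiener ι} (hp : ‖p‖ ≤ r) (hq : ‖q‖ ≤ r) (g : Wiener ι) :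
    ‖opR a b c p g - opR a b c q g‖ ≤ M * ((1 - r)⁻¹ * ‖p - q‖) * ‖g‖ := by
  have hr0 : 0 ≤ r := (norm_nonneg _).trans hp
  refine norm_lift_sub_le (norm_famR_le (famR_bound hr0 hr.le hc) hp)
    (norm_famR_le (famR_bound hr0 hr.le hc) hq) (fun α => ?_) g
  rw [famR, famR, ← smul_sub, ← sub_mul, norm_smul]
  refine mul_le_mul (hc _) ?_ (norm_nonneg _) ((norm_nonneg _).trans (hc 0))
  refine (norm_mul_le _ _).trans ?_
  rw [norm_mono, mul_one]
  exact norm_pow_sub_pow_le_div hr hp hq _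

theorem suppIn_pow {q : Wiener ι} (hq : SuppIn {α | wt a b α = 0} q) (n : ℕ) :
    SuppIn {α | wt a b α = 0} (q ^ n) := by
  induction n with
  | zero => rw [pow_zero]; exact suppIn_one (by simp [wt])
  | succ n ih =>
    rw [pow_succ]
    exact ih.mul hq fun α hα β hβ => by
      simp only [Set.mem_ofPred_eq, wt_add] at *; omega

theorem suppIn_famR {q : Wiener ι} (hq : SuppIn {α | wt a b α = 0} q) (c : ℤ → ℂ) (α : ι →₀ ℕ) :
    SuppIn {β | wt a b β = wt a b α ∧ α.degree ≤ β.degree} (famR a b c q α) := by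
  refine SuppIn.smul _ ((suppIn_pow hq _).mul (suppIn_mono (S := {α}) rfl) ?_)
  rintro β hβ γ rfl
  simp only [Set.mem_ofPred_eq, wt_add, map_add] at *
  constructor
  · omega
  · omega

theorem suppIn_opR {q : Wiener ι} {r M : ℝ} {c : ℤ → ℂ} (hc : ∀ k, ‖c k‖ * r ^ k.natAbs ≤ M)
    (hqr : ‖q‖ ≤ r) (hq : SuppIn {α | wt a b α = 0} q) {P : ℤ → Prop} {n : ℕ} {g : Wiener ι}
    (hg : ∀ α, g.co α ≠ 0 → c (wt a b α) ≠ 0 → P (wt a b α))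
    (hn : SuppIn (degGe ι n) g) :
    SuppIn {α | P (wt a b α) ∧ n ≤ α.degree} (opR a b c q g) := by
  refine suppIn_lift (norm_famR_le hc hqr) fun α hα => ?_
  by_cases h0 : c (wt a b α) = 0
  · rw [famR, h0, zero_smul]; exact fun _ _ => rfl
  · refine (suppIn_famR hq c α).mono fun β hβ => ⟨?_, ?_⟩
    · rw [hβ.1]; exact hg α hα h0
    · exact le_trans (hn.mem hα) hβ.2

/-- Evaluation of `opR` on series of weights `≥ 0`. -/
theorem ev_opR {c : ℤ → ℂ} {M r : ℝ} (hc : ∀ k, ‖c k‖ * r ^ k.natAbs ≤ M) {q : Wiener ι}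
    (hq : ‖q‖ ≤ r) {x : ι → ℂ} (hx : ‖x‖ ≤ 1) (g : Wiener ι) :
    ev x (opR a b c q g) = lift (fun α => c (wt a b α) * (ev x q ^ (wt a b α).natAbs * pw x α)) g := by
  rw [opR, ev_lift hx (norm_famR_le hc hq)]
  congr 1
  funext α
  rw [famR, ev_smul, ev_mul hx, ev_pow hx, ev_mono]

end swap

end Wiener

namespace Wiener

section fixedPoint

variable {ι : Type*} [Fintype ι] [DecidableEq ι] (a b : ι)

/-- The perturbed coordinates, symmetric under the exchange of `a` and `b`. -/
noncomputable def psi (u : ι → Wiener ι) (i : ι) : Wiener ι :=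
  if i = a then X a + u a else if i = b then X b + hat a b (u a) else X i + (u i + hat a b (u i))

/-- The nonlinearity. -/
noncomputable def nonlin (g : ι → Wiener ι) (u : ι → Wiener ι) (i : ι) : Wiener ι :=
  comp (fun j => (1 / 4 : ℂ) • psi a b u j) (g i)

/-- Division by `X a` of the component of weight one. -/
noncomputable def divX (f : Wiener ι) : Wiener ι :=
  lift (fun α => if wt a b α = 1 then mono (α - Finsupp.single a 1) else 0) f

/-- Indicator of the weights `≥ n`. -/
noncomputable def cGe (n : ℤ) (k : ℤ) : ℂ := if n ≤ k then 1 else 0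

/-- Indicator of the weights `≤ 0`. -/
noncomputable def cLe (k : ℤ) : ℂ := if k ≤ 0 then 1 else 0

/-- The coefficient `μ` on weights `≥ 2`, the coefficient `μ⁻¹` on weights `≤ 0`. -/
noncomputable def cMix (μ : ℂ) (k : ℤ) : ℂ := if 2 ≤ k then μ else if k ≤ 0 then μ⁻¹ else 0

/-- The map whose fixed point is the normalizing transformation. -/
noncomputable def stepU (μ : ℂ) (g : ι → Wiener ι) (p : (ι → Wiener ι) × Wiener ι) (i : ι) :
    Wiener ι :=
  if i = a then opR a b (cMix μ) p.2 (p.1 a) +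
      (opR a b (cGe 2) p.2 (nonlin a b g p.1 a) - μ⁻¹ • opR a b cLe 1 (nonlin a b g p.1 a))
  else if i = b then 0 else opR a b (cGe 1) p.2 (p.1 i + nonlin a b g p.1 i)

/-- The equation of the multiplier. -/
noncomputable def stepQ (μ : ℂ) (g : ι → Wiener ι) (p : (ι → Wiener ι) × Wiener ι) : Wiener ι :=
  μ⁻¹ • (1 - p.2 * divX a b (nonlin a b g p.1 a))

variable {a b}

theorem norm_cGe_le (n k : ℤ) : ‖cGe n k‖ ≤ 1 := by unfold cGe; split_ifs <;> simp
theorem norm_cLe_le (k : ℤ) : ‖cLe k‖ ≤ 1 := by unfold cLe; split_ifs <;> simp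

theorem norm_cMix_le {μ : ℂ} (hμ : 1 < ‖μ‖) (k : ℤ) : ‖cMix μ k‖ ≤ ‖μ‖ := by
  have h : ‖μ⁻¹‖ ≤ 1 := by rw [norm_inv]; exact inv_le_one_of_one_le₀ hμ.le
  unfold cMix; split_ifs
  · exact le_rfl
  · exact h.trans hμ.le
  · simp

theorem cMix_bound {μ : ℂ} {r θ : ℝ} (hr0 : 0 ≤ r) (hr1 : r ≤ 1) (h1 : ‖μ‖ * r ^ 2 ≤ θ)
    (h2 : ‖μ‖⁻¹ ≤ θ) (k : ℤ) : ‖cMix μ k‖ * r ^ k.natAbs ≤ θ := by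
  have hθ : 0 ≤ θ := (by positivity : 0 ≤ ‖μ‖⁻¹).trans h2
  unfold cMix; split_ifs with h h'
  · refine le_trans ?_ h1
    gcongr ?_ * ?_
    exact pow_le_pow_of_le_one hr0 hr1 (by omega)
  · rw [norm_inv]
    exact (mul_le_of_le_one_right (by positivity) (pow_le_one₀ hr0 hr1)).trans h2
  · simpa using hθ

theorem cGe_bound {r : ℝ} (hr0 : 0 ≤ r) (hr1 : r ≤ 1) (k : ℤ) :
    ‖cGe 1 k‖ * r ^ k.natAbs ≤ r := by
  unfold cGe; split_ifs with h
  · rw [norm_one, one_mul]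
    exact pow_le_of_le_one hr0 hr1 (by omega)
  · simpa using hr0

theorem norm_divX_fam (α : ι →₀ ℕ) :
    ‖(if wt a b α = 1 then mono (α - Finsupp.single a 1) else 0 : Wiener ι)‖ ≤ 1 := by
  split_ifs
  · exact norm_mono_le _
  · simp

theorem norm_divX_le (f : Wiener ι) : ‖divX a b f‖ ≤ ‖f‖ :=
  (norm_lift_le norm_divX_fam f).trans (by rw [one_mul])

theorem divX_sub (f g : Wiener ι) : divX a b (f - g) = divX a b f - divX a b g :=
  (liftL _ 1 norm_divX_fam).map_sub f g

theorem opR_sub {c : ℤ → ℂ} {M r : ℝ} (hc : ∀ k, ‖c k‖ * r ^ k.natAbs ≤ M) {q : Wiener ι}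
    (hq : ‖q‖ ≤ r) (f g : Wiener ι) :
    opR a b c q (f - g) = opR a b c q f - opR a b c q g :=
  (liftL _ M (norm_famR_le hc hq)).map_sub f g

theorem norm_opR_sub_le' {c : ℤ → ℂ} {M M' r D : ℝ} (hr : r < 1) (hc : ∀ k, ‖c k‖ ≤ M)
    (hc' : ∀ k, ‖c k‖ * r ^ k.natAbs ≤ M')
    {p q : Wiener ι} (hp : ‖p‖ ≤ r) (hq : ‖q‖ ≤ r) (hpq : ‖p - q‖ ≤ D) {f g : Wiener ι} {E : ℝ}
    (hg : ‖g‖ ≤ E) :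
    ‖opR a b c p f - opR a b c q g‖ ≤ M' * ‖f - g‖ + M * ((1 - r)⁻¹ * D) * E := by
  have hM : 0 ≤ M := (norm_nonneg _).trans (hc 0)
  have h1 : 0 < 1 - r := by linarith
  have hD : 0 ≤ D := (norm_nonneg _).trans hpq
  calc _ = ‖opR a b c p (f - g) + (opR a b c p g - opR a b c q g)‖ := by
        rw [opR_sub hc' hp]; congr 1; ring
    _ ≤ _ := (norm_add_le _ _).trans (add_le_add (norm_opR_le hc' hp _)
        (norm_opR_sub_le hr hc hp hq g))
    _ ≤ _ := by gcongr

theorem norm_psi_le {u : ι → Wiener ι} (hu : ∀ i, ‖u i‖ ≤ 1 / 2) (i : ι) : ‖psi a b u i‖ ≤ 2 := by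
  have h := norm_hat_le a b
  unfold psi; split_ifs
  · linarith [norm_add_le (X a) (u a), hu a, norm_X a]
  · linarith [norm_add_le (X b) (hat a b (u a)), hu a, norm_X b, h (u a)]
  · linarith [norm_add_le (X i) (u i + hat a b (u i)), norm_add_le (u i) (hat a b (u i)), hu i,
      norm_X i, h (u i)]

theorem norm_psi_sub_le {u v : ι → Wiener ι} {D : ℝ} (hD : ∀ i, ‖u i - v i‖ ≤ D) (i : ι) :
    ‖psi a b u i - psi a b v i‖ ≤ 2 * D := by
  have h := norm_hat_le a b
  have h0 : 0 ≤ D := (norm_nonneg _).trans (hD i)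
  unfold psi; split_ifs
  · rw [add_sub_add_left_eq_sub]; linarith [hD a]
  · rw [add_sub_add_left_eq_sub, ← hat_sub]; linarith [hD a, h (u a - v a)]
  · rw [add_sub_add_left_eq_sub, add_sub_add_comm, ← hat_sub]
    linarith [hD i, h (u i - v i), norm_add_le (u i - v i) (hat a b (u i - v i))]

theorem norm_quarter_smul {f : Wiener ι} {r : ℝ} (h : ‖f‖ ≤ r) : ‖(1 / 4 : ℂ) • f‖ ≤ r / 4 := by
  rw [norm_smul]; norm_num; linarith

theorem norm_quarter_psi_le {u : ι → Wiener ι} (hu : ∀ i, ‖u i‖ ≤ 1 / 2) (i : ι) :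
    ‖(1 / 4 : ℂ) • psi a b u i‖ ≤ 1 / 2 := by
  linarith [norm_quarter_smul (norm_psi_le (a := a) (b := b) hu i)]

theorem norm_nonlin_le {g u : ι → Wiener ι} (hu : ∀ i, ‖u i‖ ≤ 1 / 2) (i : ι) :
    ‖nonlin a b g u i‖ ≤ ‖g i‖ :=
  norm_comp_le (fun j => (norm_quarter_psi_le hu j).trans (by norm_num)) _

theorem norm_nonlin_sub_le {g u v : ι → Wiener ι} {D : ℝ} (hu : ∀ i, ‖u i‖ ≤ 1 / 2)
    (hv : ∀ i, ‖v i‖ ≤ 1 / 2) (hD : ∀ i, ‖u i - v i‖ ≤ D) (i : ι) :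
    ‖nonlin a b g u i - nonlin a b g v i‖ ≤ D * ‖g i‖ := by
  have h0 : 0 ≤ D := (norm_nonneg _).trans (hD i)
  have := norm_comp_sub_comp_le (D := D / 2) (by positivity) (norm_quarter_psi_le (a := a) (b := b) hu)
    (norm_quarter_psi_le (a := a) (b := b) hv)
    (fun j => by
      rw [← smul_sub]
      linarith [norm_quarter_smul (norm_psi_sub_le (a := a) (b := b) hD j)]) (g i)
  refine this.trans (le_of_eq (by ring))

theorem suppIn_X (i : ι) : SuppIn (degGe ι 1) (X i) :=
  suppIn_mono (by simp [degGe])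

theorem suppIn_hat {n : ℕ} {f : Wiener ι} (hf : SuppIn (degGe ι n) f) :
    SuppIn (degGe ι n) (hat a b f) :=
  suppIn_comp (fun _ => (norm_X _).le) (fun _ => suppIn_X _) hf

theorem suppIn_psi {u : ι → Wiener ι} (hu : ∀ i, SuppIn (degGe ι 2) (u i)) (i : ι) :
    SuppIn (degGe ι 1) (psi a b u i) := by
  have h12 : degGe ι 2 ⊆ degGe ι 1 := fun α (h : 2 ≤ α.degree) => show 1 ≤ α.degree by omega
  have hu1 : ∀ i, SuppIn (degGe ι 1) (u i) := fun i => (hu i).mono h12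
  unfold psi; split_ifs
  · exact (suppIn_X _).add (hu1 _)
  · exact (suppIn_X _).add (suppIn_hat (hu1 _))
  · exact (suppIn_X _).add ((hu1 _).add (suppIn_hat (hu1 _)))

theorem suppIn_nonlin {g u : ι → Wiener ι} (hu : ∀ i, SuppIn (degGe ι 2) (u i))
    (hu2 : ∀ i, ‖u i‖ ≤ 1 / 2) (hg : ∀ i, SuppIn (degGe ι 2) (g i)) (i : ι) :
    SuppIn (degGe ι 2) (nonlin a b g u i) :=
  suppIn_comp (fun j => (norm_quarter_psi_le hu2 j).trans (by norm_num))
    (fun j => (suppIn_psi hu j).smul _) (hg i)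

theorem suppIn_divX {f : Wiener ι} (hf : SuppIn (degGe ι 2) f) :
    SuppIn {α | wt a b α = 0 ∧ 1 ≤ α.degree} (divX a b f) := by
  refine suppIn_lift norm_divX_fam fun α hα => ?_
  by_cases h : wt a b α = 1
  · rw [if_pos h]
    have h1 : Finsupp.single a 1 ≤ α := by
      rw [Finsupp.single_le_iff]
      simp only [wt] at h
      omega
    obtain ⟨β, rfl⟩ := exists_add_of_le h1
    rw [add_tsub_cancel_left]
    have h2 : 2 ≤ (Finsupp.single a 1 + β).degree := hf.mem hα
    refine suppIn_mono ?_
    simp only [map_add, Finsupp.degree_single, wt_add, Set.mem_ofPred_eq] at *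
    by_cases hab : a = b
    · subst hab; simp [wt] at h
    · have : wt a b (Finsupp.single a 1) = 1 := by simp [wt, hab]
      omega
  · rw [if_neg h]; exact fun _ _ => rfl

/-- The constraints on the unknowns of the fixed point problem. -/
structure Constr (a b : ι) (δ r : ℝ) (p : (ι → Wiener ι) × Wiener ι) : Prop where
  norm_u : ∀ i, ‖p.1 i‖ ≤ δ
  norm_q : ‖p.2‖ ≤ r
  supp_q : SuppIn {α | wt a b α = 0} p.2
  supp_a : SuppIn {α | wt a b α ≠ 1} (p.1 a)
  supp_u : ∀ i, i ≠ a → SuppIn {α | 0 < wt a b α} (p.1 i)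
  deg_u : ∀ i, SuppIn (degGe ι 2) (p.1 i)

theorem isClosed_constr (δ r : ℝ) : IsClosed {p | Constr a b δ r p} := by
  have : {p | Constr a b δ r p} =
      {p : (ι → Wiener ι) × Wiener ι | ∀ i, ‖p.1 i‖ ≤ δ} ∩ {p | ‖p.2‖ ≤ r} ∩
      {p | p.2 ∈ {f | SuppIn {α | wt a b α = 0} f}} ∩
      {p | p.1 a ∈ {f | SuppIn {α | wt a b α ≠ 1} f}} ∩
      (⋂ i, ⋂ (_ : i ≠ a), {p | p.1 i ∈ {f | SuppIn {α | 0 < wt a b α} f}}) ∩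
      (⋂ i, {p | p.1 i ∈ {f | SuppIn (degGe ι 2) f}}) := by
    ext p
    simp only [Set.mem_ofPred_eq, Set.mem_inter_iff, Set.mem_iInter]
    exact ⟨fun h => ⟨⟨⟨⟨⟨h.1, h.2⟩, h.3⟩, h.4⟩, h.5⟩, h.6⟩,
      fun h => ⟨h.1.1.1.1.1, h.1.1.1.1.2, h.1.1.1.2, h.1.1.2, h.1.2, h.2⟩⟩
  rw [this]
  refine ((((IsClosed.inter ?_ ?_).inter ?_).inter ?_).inter ?_).inter ?_
  · rw [Set.ofPred_forall]
    exact isClosed_iInter fun i => isClosed_le (by fun_prop) continuous_const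
  · exact isClosed_le (by fun_prop) continuous_const
  · exact (isClosed_suppIn _).preimage continuous_snd
  · exact (isClosed_suppIn _).preimage (by fun_prop)
  · exact isClosed_iInter fun i => isClosed_iInter fun _ =>
      (isClosed_suppIn _).preimage (by fun_prop)
  · exact isClosed_iInter fun i => (isClosed_suppIn _).preimage (by fun_prop)

set_option maxHeartbeats 1600000 in
theorem exists_fixedPoint {μ : ℂ} (hμ : 1 < ‖μ‖) : ∃ ε > 0, ∃ r < 1, ∀ g : ι → Wiener ι,
    (∀ i, ‖g i‖ ≤ ε) → (∀ i, SuppIn (degGe ι 2) (g i)) →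
    ∃ p : (ι → Wiener ι) × Wiener ι, Constr a b (1 / 2) r p ∧ (∀ i, stepU a b μ g p i = p.1 i) ∧
      stepQ a b μ g p = p.2 := by
  have hμ0 : 0 < ‖μ‖ := by linarith
  have hκ : ‖μ‖⁻¹ < 1 := inv_lt_one_of_one_lt₀ hμ
  have hκ0 : 0 < ‖μ‖⁻¹ := by positivity
  obtain ⟨r, hr1, hr2⟩ := exists_between (show ‖μ‖⁻¹ < √(‖μ‖⁻¹) from by
    rw [Real.lt_sqrt hκ0.le]; nlinarith)
  have hr0 : 0 < r := hκ0.trans hr1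
  have hr : r < 1 := hr2.trans ((Real.sqrt_lt' one_pos).2 (by simpa using hκ))
  have hrr : ‖μ‖ * r ^ 2 < 1 := by
    have : r ^ 2 < ‖μ‖⁻¹ := (Real.lt_sqrt hr0.le).1 hr2
    calc ‖μ‖ * r ^ 2 < ‖μ‖ * ‖μ‖⁻¹ := by gcongr
      _ = 1 := mul_inv_cancel₀ hμ0.ne'
  obtain ⟨θ, hθ⟩ : ∃ θ, θ = max (‖μ‖ * r ^ 2) r := ⟨_, rfl⟩
  have hθ1 : θ < 1 := hθ ▸ max_lt hrr hr
  have h1θ : ‖μ‖ * r ^ 2 ≤ θ := hθ ▸ le_max_left _ _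
  have hrθ : r ≤ θ := hθ ▸ le_max_right _ _
  obtain ⟨K, hK⟩ : ∃ K, K = (1 - r)⁻¹ := ⟨_, rfl⟩
  have hK0 : 0 < K := by rw [hK]; exact inv_pos.2 (by linarith)
  obtain ⟨η, hη⟩ : ∃ η, η = (1 - θ) / 8 := ⟨_, rfl⟩
  have hη0 : 0 < η := by rw [hη]; linarith
  obtain ⟨δ, hδ⟩ : ∃ δ, δ = min (1 / 2) (η / (‖μ‖ * K)) := ⟨_, rfl⟩
  have hδ0 : 0 < δ := by rw [hδ]; positivity
  have hδ2 : δ ≤ 1 / 2 := hδ ▸ min_le_left _ _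
  have hδη : ‖μ‖ * K * δ ≤ η := by
    calc ‖μ‖ * K * δ ≤ ‖μ‖ * K * (η / (‖μ‖ * K)) := by
          gcongr; exact hδ ▸ min_le_right _ _
      _ = η := by field_simp
  have hKδ : K * δ ≤ η := by
    refine le_trans ?_ hδη
    nlinarith [mul_pos hK0 hδ0]
  obtain ⟨ε, hε⟩ : ∃ ε, ε = min (min (η * δ) (η / (K + 2))) (r - ‖μ‖⁻¹) := ⟨_, rfl⟩
  have hε0 : 0 < ε := by
    rw [hε]; exact lt_min (lt_min (by positivity) (by positivity)) (by linarith)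
  have hε1 : ε ≤ η * δ := hε ▸ (min_le_left _ _).trans (min_le_left _ _)
  have hε2 : (K + 2) * ε ≤ η := by
    calc (K + 2) * ε ≤ (K + 2) * (η / (K + 2)) := by
          gcongr; exact hε ▸ (min_le_left _ _).trans (min_le_right _ _)
      _ = η := by field_simp
  have hε3 : ε ≤ r - ‖μ‖⁻¹ := hε ▸ min_le_right _ _
  have hεη : ε ≤ η := by nlinarith
  have hKε : K * ε ≤ η := by nlinarith
  refine ⟨ε, hε0, r, hr, fun g hg hg2 => ?_⟩
  have hbMix := cMix_bound hr0.le hr.le h1θ (hr1.le.trans hrθ)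
  have hbG2 := famR_bound hr0.le hr.le (norm_cGe_le 2)
  have hbG1 := cGe_bound hr0.le hr.le
  have hbL := famR_bound (r := 1) zero_le_one le_rfl norm_cLe_le
  have hnone : ‖(1 : Wiener ι)‖ ≤ 1 := norm_one.le
  have hinv : ‖μ⁻¹‖ ≤ 1 := by rw [norm_inv]; exact hκ.le
  let f : (ι → Wiener ι) × Wiener ι → (ι → Wiener ι) × Wiener ι :=
    fun p => (stepU a b μ g p, stepQ a b μ g p)
  let S : Set ((ι → Wiener ι) × Wiener ι) := {p | Constr a b δ r p}
  have hmaps : Set.MapsTo f S S := by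
    intro p hp
    have hu2 : ∀ i, ‖p.1 i‖ ≤ 1 / 2 := fun i => (hp.norm_u i).trans hδ2
    have hG : ∀ i, ‖nonlin a b g p.1 i‖ ≤ ε := fun i => (norm_nonlin_le hu2 i).trans (hg i)
    have hGd := suppIn_nonlin (a := a) (b := b) hp.deg_u hu2 hg2
    have hdd := suppIn_divX (a := a) (b := b) (hGd a)
    have s1 : SuppIn {α | wt a b α ≠ 1 ∧ 2 ≤ α.degree} (opR a b (cMix μ) p.2 (p.1 a)) :=
      suppIn_opR hbMix hp.norm_q hp.supp_q (P := fun k => k ≠ 1)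
        (fun α hα _ => hp.supp_a.mem hα) (hp.deg_u a)
    have s2 : SuppIn {α | wt a b α ≠ 1 ∧ 2 ≤ α.degree}
        (opR a b (cGe 2) p.2 (nonlin a b g p.1 a)) :=
      suppIn_opR hbG2 hp.norm_q hp.supp_q (P := fun k => k ≠ 1)
        (fun α _ hc h1 => hc (by rw [h1]; rfl)) (hGd a)
    have s3 : SuppIn {α | wt a b α ≠ 1 ∧ 2 ≤ α.degree}
        (opR a b cLe 1 (nonlin a b g p.1 a)) :=
      suppIn_opR hbL hnone (suppIn_one (by simp [wt])) (P := fun k => k ≠ 1)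
        (fun α _ hc h1 => hc (by rw [h1]; rfl)) (hGd a)
    have s4 : ∀ i, SuppIn {α | 0 < wt a b α ∧ 2 ≤ α.degree}
        (opR a b (cGe 1) p.2 (p.1 i + nonlin a b g p.1 i)) := fun i =>
      suppIn_opR hbG1 hp.norm_q hp.supp_q (P := fun k => 0 < k)
        (fun α _ hc => by
          by_contra h1
          exact hc (if_neg (by omega))) ((hp.deg_u i).add (hGd i))
    have sa := s1.add (s2.sub (s3.smul μ⁻¹))
    refine ⟨fun i => ?_, ?_, ?_, ?_, fun i hi => ?_, fun i => ?_⟩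
    · simp only [f, stepU]
      split_ifs
      · have n1 := norm_opR_le (a := a) (b := b) hbMix hp.norm_q (p.1 a)
        have n2 := norm_opR_le (a := a) (b := b) hbG2 hp.norm_q (nonlin a b g p.1 a)
        have n3 := norm_opR_le (a := a) (b := b) hbL hnone (nonlin a b g p.1 a)
        have n4 : ‖μ⁻¹ • opR a b cLe 1 (nonlin a b g p.1 a)‖ ≤ ε := by
          rw [norm_smul]
          have := hG a
          nlinarith [norm_nonneg (opR a b cLe 1 (nonlin a b g p.1 a)), norm_nonneg μ⁻¹]
        refine (norm_add_le _ _).trans ((add_le_add n1 (norm_sub_le _ _)).trans ?_)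
        have := hG a
        have := hp.norm_u a
        have : θ * ‖p.1 a‖ ≤ θ * δ := by gcongr; exact hr0.le.trans hrθ
        nlinarith
      · simpa using hδ0.le
      · have n1 := norm_opR_le (a := a) (b := b) hbG1 hp.norm_q (p.1 i + nonlin a b g p.1 i)
        have n2 := norm_add_le (p.1 i) (nonlin a b g p.1 i)
        have := hG i
        have := hp.norm_u i
        refine n1.trans ?_
        calc r * _ ≤ θ * (δ + ε) := by
              exact mul_le_mul hrθ (by linarith) (norm_nonneg _) (hr0.le.trans hrθ)
          _ ≤ δ := by nlinarith
    · simp only [f, stepQ]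
      rw [norm_smul, norm_inv]
      have n1 := norm_sub_le (1 : Wiener ι) (p.2 * divX a b (nonlin a b g p.1 a))
      have n2 := norm_mul_le p.2 (divX a b (nonlin a b g p.1 a))
      have n3 := (norm_divX_le (a := a) (b := b) (nonlin a b g p.1 a)).trans (hG a)
      have n4 : ‖p.2‖ * ‖divX a b (nonlin a b g p.1 a)‖ ≤ 1 * ε := by
        gcongr; exact hp.norm_q.trans hr.le
      rw [norm_one] at n1
      calc ‖μ‖⁻¹ * _ ≤ ‖μ‖⁻¹ * (1 + ε) := by gcongr; linarith
        _ ≤ r := by nlinarith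
    · refine SuppIn.smul _ ((suppIn_one (by simp [wt])).sub (hp.supp_q.mul hdd ?_))
      intro α hα β hβ
      simp only [Set.mem_ofPred_eq, wt_add] at *
      omega
    · simp only [f, stepU, if_true]
      exact sa.mono fun α hα => hα.1
    · simp only [f, stepU, if_neg hi]
      split_ifs
      · exact fun _ _ => rfl
      · exact (s4 i).mono fun α hα => hα.1
    · simp only [f, stepU]
      split_ifs
      · exact sa.mono fun α hα => hα.2
      · exact fun _ _ => rfl
      · exact (s4 i).mono fun α hα => hα.2
  have hlip : ∀ p ∈ S, ∀ p' ∈ S, ‖f p - f p'‖ ≤ (1 - η) * ‖p - p'‖ := by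
    intro p hp p' hp'
    obtain ⟨D, hD⟩ : ∃ D, D = ‖p - p'‖ := ⟨_, rfl⟩
    have hD0 : 0 ≤ D := hD ▸ norm_nonneg _
    have hDu : ∀ i, ‖p.1 i - p'.1 i‖ ≤ D := fun i =>
      (norm_le_pi_norm (p.1 - p'.1) i).trans (hD ▸ norm_fst_le (p - p'))
    have hDq : ‖p.2 - p'.2‖ ≤ D := hD ▸ norm_snd_le (p - p')
    have hu2 : ∀ i, ‖p.1 i‖ ≤ 1 / 2 := fun i => (hp.norm_u i).trans hδ2
    have hu2' : ∀ i, ‖p'.1 i‖ ≤ 1 / 2 := fun i => (hp'.norm_u i).trans hδ2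
    have hG : ∀ i, ‖nonlin a b g p.1 i‖ ≤ ε := fun i => (norm_nonlin_le hu2 i).trans (hg i)
    have hG' : ∀ i, ‖nonlin a b g p'.1 i‖ ≤ ε := fun i => (norm_nonlin_le hu2' i).trans (hg i)
    have hGG : ∀ i, ‖nonlin a b g p.1 i - nonlin a b g p'.1 i‖ ≤ D * ε := fun i =>
      (norm_nonlin_sub_le hu2 hu2' hDu i).trans (by gcongr; exact hg i)
    have hKδD : K * δ * D ≤ η * D := by gcongr
    have hKεD : K * ε * D ≤ η * D := by gcongr
    have hεD : ε * D ≤ η * D := by gcongr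
    have hμD : ‖μ‖ * K * δ * D ≤ η * D := by gcongr
    have hηD : 8 * η * D = (1 - θ) * D := by rw [hη]; ring
    rw [← hD, Prod.norm_def]
    refine max_le ?_ ?_
    · rw [pi_norm_le_iff_of_nonneg (mul_nonneg (by rw [hη]; linarith [hr0.le.trans hrθ]) hD0)]
      intro i
      simp only [f, Prod.fst_sub, Pi.sub_apply, stepU]
      split_ifs
      · have n1 := norm_opR_sub_le' (a := a) (b := b) hr (norm_cMix_le hμ) hbMix hp.norm_q
          hp'.norm_q hDq (f := p.1 a) (hp'.norm_u a)
        have n2 := norm_opR_sub_le' (a := a) (b := b) hr (norm_cGe_le 2) hbG2 hp.norm_q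
          hp'.norm_q hDq (f := nonlin a b g p.1 a) (hG' a)
        have n3 : ‖μ⁻¹ • opR a b cLe 1 (nonlin a b g p.1 a) -
            μ⁻¹ • opR a b cLe 1 (nonlin a b g p'.1 a)‖ ≤ D * ε := by
          rw [← smul_sub, ← opR_sub hbL hnone, norm_smul]
          have h1 := norm_opR_le (a := a) (b := b) hbL hnone
            (nonlin a b g p.1 a - nonlin a b g p'.1 a)
          have h2 := hGG a
          nlinarith [norm_nonneg (opR a b cLe 1 (nonlin a b g p.1 a - nonlin a b g p'.1 a)),
            norm_nonneg μ⁻¹]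
        rw [← hK] at n1 n2
        rw [add_sub_add_comm, sub_sub_sub_comm]
        refine (norm_add_le _ _).trans ((add_le_add n1 ((norm_sub_le _ _).trans
          (add_le_add n2 n3))).trans ?_)
        have h1 : θ * ‖p.1 a - p'.1 a‖ ≤ θ * D := by gcongr; exacts [hr0.le.trans hrθ, hDu a]
        have h2 := hGG a
        have hηD0 : 0 ≤ η * D := by positivity
        linarith
      · simp only [sub_self, norm_zero]
        exact mul_nonneg (by rw [hη]; linarith [hr0.le.trans hrθ]) hD0
      · have n1 := norm_opR_sub_le' (a := a) (b := b) hr (norm_cGe_le 1) hbG1 hp.norm_q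
          hp'.norm_q hDq (f := p.1 i + nonlin a b g p.1 i)
          ((norm_add_le _ _).trans (add_le_add (hp'.norm_u i) (hG' i)))
        rw [← hK, add_sub_add_comm] at n1
        refine n1.trans ?_
        have h1 := (norm_add_le (p.1 i - p'.1 i) (nonlin a b g p.1 i - nonlin a b g p'.1 i)).trans
          (add_le_add (hDu i) (hGG i))
        have h2 : r * ‖p.1 i - p'.1 i + (nonlin a b g p.1 i - nonlin a b g p'.1 i)‖ ≤
            θ * (D + D * ε) := mul_le_mul hrθ h1 (norm_nonneg _) (hr0.le.trans hrθ)
        have h3 : θ * (D * ε) ≤ D * ε := mul_le_of_le_one_left (by positivity) hθ1.le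
        have h4 : K * δ * D = 1 * (K * D) * δ := by ring
        have h5 : K * ε * D = 1 * (K * D) * ε := by ring
        have hηD0 : 0 ≤ η * D := by positivity
        linarith
    · simp only [f, Prod.snd_sub, stepQ]
      rw [← smul_sub, norm_smul, sub_sub_sub_cancel_left]
      set G := nonlin a b g p.1 a
      set G' := nonlin a b g p'.1 a
      have e1 : p'.2 * divX a b G' - p.2 * divX a b G =
          -((p.2 - p'.2) * divX a b G' + p.2 * divX a b (G - G')) := by
        rw [divX_sub]; ring
      have n1 : ‖p'.2 * divX a b G' - p.2 * divX a b G‖ ≤ D * ε + 1 * (D * ε) := by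
        rw [e1, norm_neg]
        refine (norm_add_le _ _).trans (add_le_add ((norm_mul_le _ _).trans ?_)
          ((norm_mul_le _ _).trans ?_))
        · gcongr; exact (norm_divX_le _).trans (hG' a)
        · gcongr
          · exact hp.norm_q.trans hr.le
          · exact (norm_divX_le _).trans (hGG a)
      have : ‖μ⁻¹‖ * ‖p'.2 * divX a b G' - p.2 * divX a b G‖ ≤ 1 * (D * ε + 1 * (D * ε)) := by
        gcongr
      nlinarith [mul_nonneg (hr0.le.trans hrθ) hD0]
  have hSc : IsComplete S := (isClosed_constr δ r).isComplete
  have h0S : (0, 0) ∈ S := ⟨fun i => by simpa using hδ0.le, by simpa using hr0.le, fun _ _ => rfl,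
    fun _ _ => rfl, fun _ _ _ _ => rfl, fun _ _ _ => rfl⟩
  have hη1 : 0 ≤ 1 - η := by rw [hη]; linarith [hr0.le.trans hrθ]
  have hcoe : (((1 - η).toNNReal : NNReal) : ℝ) = 1 - η := Real.coe_toNNReal _ hη1
  have hcontr : ContractingWith (1 - η).toNNReal (hmaps.restrict f S S) := by
    refine ⟨?_, LipschitzWith.of_dist_le_mul fun x y => ?_⟩
    · rw [← NNReal.coe_lt_coe, hcoe, NNReal.coe_one]; linarith
    · have := hlip x.1 x.2 y.1 y.2
      rw [← dist_eq_norm, ← dist_eq_norm, ← hcoe] at this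
      exact this
  obtain ⟨p, hpS, hfix, -⟩ := hcontr.exists_fixedPoint' hSc hmaps h0S (edist_ne_top _ _)
  have hfix : f p = p := hfix
  refine ⟨p, ⟨fun i => (hpS.norm_u i).trans hδ2, hpS.norm_q, hpS.supp_q, hpS.supp_a, hpS.supp_u,
    hpS.deg_u⟩, fun i => ?_, ?_⟩
  · exact congrFun (congrArg Prod.fst hfix) i
  · exact congrArg Prod.snd hfix

end fixedPoint

end Wiener

namespace Wiener

section leading

variable {ι : Type*} [Fintype ι]

/-- The homogeneous component of degree `d`, as a function. -/
noncomputable def hom (N : Wiener ι) (d : ℕ) (x : ι → ℂ) : ℂ := ∑ α ∈ expo ι d, N.co α * pw x α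

theorem continuous_hom (N : Wiener ι) (d : ℕ) : Continuous (hom N d) := by
  unfold hom pw; fun_prop

theorem hom_smul (N : Wiener ι) (d : ℕ) (c : ℂ) (x : ι → ℂ) : hom N d (c • x) = c ^ d * hom N d x := by
  rw [hom, hom, Finset.mul_sum]
  refine Finset.sum_congr rfl fun α hα => ?_
  have : pw (c • x) α = c ^ α.degree * pw x α := by
    rw [← smul_eq_mul, ← pw_smul]; rfl
  rw [this, mem_expo.1 hα]; ring

theorem isLittleO_ev_comp {N : Wiener ι} {d : ℕ} (hN : ∀ α : ι →₀ ℕ, α.degree < d → N.co α = 0)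
    {H : (ι → ℂ) → ι → ℂ} {A : (ι → ℂ) →L[ℂ] ι → ℂ} (hH : HasFDerivAt H A 0) (hH0 : H 0 = 0)
    (x : ι → ℂ) :
    (fun t : ℝ => ev (H ((t : ℂ) • x)) N - (t : ℂ) ^ d * hom N d (A x)) =o[𝓝[>] 0]
      fun t => t ^ d := by
  let y : ℝ → ι → ℂ := fun t => (t : ℂ)⁻¹ • H ((t : ℂ) • x)
  have hy : Tendsto y (𝓝[>] 0) (𝓝 (A x)) := by
    have h1 : HasFDerivAt H (A.restrictScalars ℝ) 0 := hH.restrictScalars ℝ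
    have h2 : HasDerivAt (fun t : ℝ => (t : ℂ) • x) x 0 := by
      simpa using (Complex.ofRealCLM.hasDerivAt (x := (0 : ℝ))).smul_const x
    have h3 : HasDerivAt (fun t : ℝ => H ((t : ℂ) • x)) (A x) 0 := by
      have h1' : HasFDerivAt H (A.restrictScalars ℝ) (((0 : ℝ) : ℂ) • x) := by simpa using h1
      exact h1'.comp_hasDerivAt (0 : ℝ) h2
    have h4 := (hasDerivAt_iff_tendsto_slope.1 h3).mono_left
      (nhdsWithin_mono (0 : ℝ) fun t (ht : 0 < t) => ne_of_gt ht)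
    refine h4.congr fun t => ?_
    simp only [slope_def_module, sub_zero, Complex.ofReal_zero, zero_smul, hH0, y]
    ext i; simp
  obtain ⟨C, hC1, hC⟩ : ∃ C : ℝ, 1 ≤ C ∧ ‖A x‖ < C := ⟨‖A x‖ + 1, by simp, by linarith⟩
  have hC0 : 0 < C := by linarith
  have hyC : ∀ᶠ t in 𝓝[>] (0 : ℝ), ‖y t‖ < C := hy.norm.eventually_lt_const hC
  have h1 : (fun t : ℝ => ev (H ((t : ℂ) • x)) N - (t : ℂ) ^ d * hom N d (y t)) =O[𝓝[>] 0]
      fun t => t ^ (d + 1) := by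
    refine IsBigO.of_bound (C ^ (d + 1) * ‖N‖) ?_
    filter_upwards [hyC, Ioc_mem_nhdsGT (show (0 : ℝ) < C⁻¹ by positivity)] with t ht1 ht
    have ht0 : (0 : ℝ) < t := ht.1
    have htc : (t : ℂ) ≠ 0 := by exact_mod_cast ht0.ne'
    have hCc : (C : ℂ) ≠ 0 := by exact_mod_cast hC0.ne'
    have hx1 : ‖(C : ℂ)⁻¹ • y t‖ ≤ 1 := by
      rw [norm_smul, norm_inv, Complex.norm_real, Real.norm_of_nonneg hC0.le]
      rw [inv_mul_le_iff₀ hC0]; linarith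
    have hCt : C * t ≤ 1 := by
      calc C * t ≤ C * C⁻¹ := by gcongr; exact ht.2
        _ = 1 := mul_inv_cancel₀ hC0.ne'
    have h := ev_eq_sum_add hN hx1 (t := C * t) (by positivity) hCt
    have e1 : ((C * t : ℝ) : ℂ) • (C : ℂ)⁻¹ • y t = H ((t : ℂ) • x) := by
      simp only [y, smul_smul]
      push_cast
      rw [show (C : ℂ) * t * ((C : ℂ)⁻¹ * (t : ℂ)⁻¹) = 1 by field_simp, one_smul]
    have e2 : ((C * t : ℝ) : ℂ) ^ d * hom N d ((C : ℂ)⁻¹ • y t) = (t : ℂ) ^ d * hom N d (y t) := by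
      rw [hom_smul, ← mul_assoc, ← mul_pow]
      push_cast
      rw [show (C : ℂ) * t * (C : ℂ)⁻¹ = t by field_simp]
    rw [e1] at h
    change ‖_ - ((C * t : ℝ) : ℂ) ^ d * hom N d ((C : ℂ)⁻¹ • y t)‖ ≤ _ at h
    rw [e2] at h
    refine h.trans (le_of_eq ?_)
    rw [norm_pow, Real.norm_of_nonneg ht0.le, mul_pow]; ring
  have h2 : (fun t : ℝ => (t : ℂ) ^ d * (hom N d (y t) - hom N d (A x))) =o[𝓝[>] 0]
      fun t => t ^ d := by
    have h3 : (fun t => hom N d (y t) - hom N d (A x)) =o[𝓝[>] 0] fun _ : ℝ => (1 : ℝ) := by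
      rw [isLittleO_one_iff]
      simpa using (((continuous_hom N d).tendsto _).comp hy).sub_const (hom N d (A x))
    have h4 : (fun t : ℝ => (t : ℂ) ^ d) =O[𝓝[>] 0] fun t : ℝ => t ^ d :=
      IsBigO.of_bound 1 (Eventually.of_forall fun t => by simp)
    simpa using h4.mul_isLittleO h3
  have h5 : (fun t : ℝ => t ^ (d + 1)) =o[𝓝[>] 0] fun t => t ^ d :=
    (isLittleO_pow_pow (Nat.lt_succ_self d)).mono nhdsWithin_le_nhds
  exact ((h1.trans_isLittleO h5).add h2).congr_left fun t => by ring

theorem co_eq_zero_of_eventually {a : Wiener ι} (h : ∀ᶠ x in 𝓝 (0 : ι → ℂ), ev x a = 0) : a = 0 := by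
  ext α
  rw [co_zero]
  refine co_eq_zero_of_isLittleO (d := α.degree) (fun x _ => ?_) le_rfl
  have h1 : Tendsto (fun t : ℝ => (t : ℂ) • fun i => (x i : ℂ)) (𝓝[>] 0) (𝓝 0) := by
    refine Tendsto.mono_left ?_ nhdsWithin_le_nhds
    have : Continuous fun t : ℝ => (t : ℂ) • fun i => (x i : ℂ) := by fun_prop
    simpa using this.tendsto 0
  refine (isLittleO_zero _ _).congr' ?_ EventuallyEq.rfl
  filter_upwards [h1.eventually h] with t ht using ht.symm

theorem ev_injective {a b : Wiener ι} (h : ∀ᶠ x in 𝓝 (0 : ι → ℂ), ev x a = ev x b) : a = b := by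
  refine sub_eq_zero.1 (co_eq_zero_of_eventually ?_)
  filter_upwards [h, Metric.closedBall_mem_nhds (0 : ι → ℂ) one_pos] with x hx hx1
  rw [ev_sub (by simpa using hx1), hx, sub_self]

theorem exists_min_degree {a : Wiener ι} (h : a ≠ 0) :
    ∃ d, (∀ α : ι →₀ ℕ, α.degree < d → a.co α = 0) ∧ ∃ α : ι →₀ ℕ, α.degree = d ∧ a.co α ≠ 0 := by
  classical
  have hex : ∃ d, ∃ α : ι →₀ ℕ, α.degree = d ∧ a.co α ≠ 0 := by
    by_contra hne
    push Not at hne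
    exact h (ext fun α => hne _ α rfl)
  refine ⟨Nat.find hex, fun α hα => ?_, Nat.find_spec hex⟩
  by_contra h0
  exact Nat.find_min hex hα ⟨α, rfl, h0⟩

variable [DecidableEq ι] {a b : ι}

theorem hasFDerivAt_sc {m : (ι → ℂ) → ℂ} (hm : DifferentiableAt ℂ m 0) (hm0 : m 0 ≠ 0) :
    ∃ A : (ι → ℂ) →L[ℂ] ι → ℂ, HasFDerivAt (fun x => sc a b (m x) x) A 0 ∧
      ∀ x, A x = sc a b (m 0) x := by
  let A : (ι → ℂ) →L[ℂ] ι → ℂ := ContinuousLinearMap.pi fun i =>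
    (if i = a then m 0 else if i = b then (m 0)⁻¹ else 1) • ContinuousLinearMap.proj i
  refine ⟨A, ?_, fun x => ?_⟩
  · rw [hasFDerivAt_pi]
    intro i
    simp only [sc]
    have hp : HasFDerivAt (fun x : ι → ℂ => x i) (ContinuousLinearMap.proj (R := ℂ) i) 0 :=
      (ContinuousLinearMap.proj (R := ℂ) (φ := fun _ : ι => ℂ) i).hasFDerivAt
    split_ifs
    · exact (hm.hasFDerivAt.mul hp).congr_fderiv (by ext; simp)
    · exact ((hm.inv hm0).hasFDerivAt.mul hp).congr_fderiv (by ext; simp)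
    · simpa using hp
  · funext i
    simp only [A, ContinuousLinearMap.pi_apply, sc]
    split_ifs <;> simp

theorem hom_sc (hab : a ≠ b) (N : Wiener ι) (d : ℕ) {m : ℂ} (hm : m ≠ 0) (x : ι → ℂ) :
    hom N d (sc a b m x) = ∑ α ∈ expo ι d, m ^ wt a b α * N.co α * pw x α := by
  refine Finset.sum_congr rfl fun α _ => ?_
  rw [pw_sc hab hm]; ring

/-- A series without terms of weight `l` vanishes if `N ∘ S - m' N` only has terms of weight `l`. -/
theorem eq_zero_of_twisted (hab : a ≠ b) {μ : ℂ} (hμ : 1 < ‖μ‖) {l : ℤ} {m m' : (ι → ℂ) → ℂ}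
    (hm : DifferentiableAt ℂ m 0) (hm0 : m 0 = μ) (hm' : ContinuousAt m' 0) (hm'0 : m' 0 = μ ^ l)
    {N G : Wiener ι} (hN : ∀ α, wt a b α = l → N.co α = 0) (hG : ∀ α, wt a b α ≠ l → G.co α = 0)
    (h : ∀ᶠ x in 𝓝 (0 : ι → ℂ), ev (sc a b (m x) x) N - m' x * ev x N = ev x G) : N = 0 := by
  have hμ0 : μ ≠ 0 := by rintro rfl; simp at hμ; linarith
  by_contra hN0
  obtain ⟨d, hd, α, hα, hαN⟩ := exists_min_degree hN0
  obtain ⟨A, hA, hAx⟩ := hasFDerivAt_sc hm (hm0.symm ▸ hμ0)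
  rw [hm0] at hAx
  let Q : Wiener ι := ∑ β ∈ expo ι d, ((μ ^ wt a b β - μ ^ l) * N.co β) • mono β
  have hQco : ∀ β : ι →₀ ℕ, β.degree = d → Q.co β = (μ ^ wt a b β - μ ^ l) * N.co β := by
    intro β hβ
    rw [← coL_apply, map_sum, Finset.sum_eq_single β]
    · rw [coL_apply, co_smul, co_mono, if_pos rfl, mul_one]
    · intro γ _ hγ
      rw [coL_apply, co_smul, co_mono, if_neg hγ.symm, mul_zero]
    · intro h'; exact absurd (mem_expo.2 hβ) h'
  have hQev : ∀ x : ι → ℂ, ‖x‖ ≤ 1 → ev x Q = hom N d (sc a b μ x) - μ ^ l * hom N d x := by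
    intro x hx
    rw [← evL_apply x hx, map_sum, hom_sc hab N d hμ0, hom, Finset.mul_sum,
      ← Finset.sum_sub_distrib]
    refine Finset.sum_congr rfl fun β _ => ?_
    rw [evL_apply, ev_smul, ev_mono]; ring
  have key : (G - Q).co α = 0 := by
    refine co_eq_zero_of_isLittleO (d := d) (fun x hx01 => ?_) hα.le
    set z : ι → ℂ := fun i => (x i : ℂ)
    have hz : ‖z‖ ≤ 1 := by
      rw [pi_norm_le_iff_of_nonneg zero_le_one]
      intro i
      simp only [z, Complex.norm_real, Real.norm_eq_abs, abs_of_nonneg (hx01 i).1, (hx01 i).2]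
    have ht0 : Tendsto (fun t : ℝ => (t : ℂ) • z) (𝓝[>] 0) (𝓝 0) := by
      refine Tendsto.mono_left ?_ nhdsWithin_le_nhds
      have : Continuous fun t : ℝ => (t : ℂ) • z := by fun_prop
      simpa using this.tendsto 0
    have h1 := isLittleO_ev_comp hd hA (by funext i; simp [sc]) z
    have h2 := isLittleO_ev_comp hd (hasFDerivAt_id (𝕜 := ℂ) (0 : ι → ℂ)) rfl z
    have hm't : Tendsto (fun t : ℝ => m' ((t : ℂ) • z)) (𝓝[>] 0) (𝓝 (μ ^ l)) := by
      rw [← hm'0]; exact hm'.tendsto.comp ht0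
    have h3 : (fun t : ℝ => m' ((t : ℂ) • z) * (ev ((t : ℂ) • z) N - (t : ℂ) ^ d * hom N d z))
        =o[𝓝[>] 0] fun t => t ^ d := by
      have := (hm't.isBigO_one ℝ).mul_isLittleO h2
      simpa using this
    have h4 : (fun t : ℝ => (m' ((t : ℂ) • z) - μ ^ l) * ((t : ℂ) ^ d * hom N d z))
        =o[𝓝[>] 0] fun t => t ^ d := by
      have h5 : (fun t : ℝ => m' ((t : ℂ) • z) - μ ^ l) =o[𝓝[>] 0] fun _ : ℝ => (1 : ℝ) := by
        rw [isLittleO_one_iff]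
        simpa using hm't.sub_const (μ ^ l)
      have h6 : (fun t : ℝ => (t : ℂ) ^ d * hom N d z) =O[𝓝[>] 0] fun t : ℝ => t ^ d :=
        IsBigO.of_bound ‖hom N d z‖ (Eventually.of_forall fun t => by simp [mul_comm])
      simpa using h5.mul_isBigO h6
    refine ((h1.sub h3).sub h4).congr' ?_ EventuallyEq.rfl
    filter_upwards [ht0.eventually h, Ioc_mem_nhdsGT (zero_lt_one' ℝ)] with t ht ht1
    have htz : ‖(t : ℂ) • z‖ ≤ 1 := by
      rw [norm_smul, Complex.norm_real, Real.norm_of_nonneg ht1.1.le]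
      have := norm_nonneg z
      nlinarith [ht1.1, ht1.2]
    have hsc : sc a b μ ((t : ℂ) • z) = (t : ℂ) • sc a b μ z := by
      funext i; simp only [sc, Pi.smul_apply, smul_eq_mul]; split_ifs <;> ring
    rw [ev_sub htz, ← ht, hQev _ htz, hsc, hom_smul, hom_smul, hAx]
    ring
  rw [co_sub, hQco α hα] at key
  by_cases hw : wt a b α = l
  · exact hαN (hN α hw)
  · rw [hG α hw, zero_sub, neg_eq_zero, mul_eq_zero] at key
    rcases key with key | key
    · refine hw ?_
      have h1 : ‖μ‖ ^ wt a b α = ‖μ‖ ^ l := by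
        rw [← norm_zpow, ← norm_zpow, sub_eq_zero.1 key]
      exact zpow_right_injective₀ (by linarith) hμ.ne' h1
    · exact hαN key

end leading

end Wiener

namespace Wiener

section conjugation

variable {ι : Type*} [Fintype ι]

theorem norm_scale_le {n : ℕ} {f : Wiener ι} (hf : SuppIn (degGe ι n) f) {t : ℂ} (ht : ‖t‖ ≤ 1) :
    ‖scale t f‖ ≤ ‖t‖ ^ n * ‖f‖ := by
  rw [norm_def, norm_def, ← tsum_mul_left]
  refine Summable.tsum_le_tsum (fun α => ?_) (summable _) ((summable f).mul_left _)
  rw [co_scale ht, norm_mul, norm_pow]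
  by_cases h : f.co α = 0
  · simp [h]
  · gcongr ?_ * _
    exact pow_le_pow_of_le_one (norm_nonneg _) ht (hf.mem h)

theorem tendsto_ofReal_smul (z : ι → ℂ) : Tendsto (fun t : ℝ => (t : ℂ) • z) (𝓝[>] 0) (𝓝 0) := by
  refine Tendsto.mono_left ?_ nhdsWithin_le_nhds
  have : Continuous fun t : ℝ => (t : ℂ) • z := by fun_prop
  simpa using this.tendsto 0

theorem norm_ofReal_le_one {x : ι → ℝ} (hx : ∀ i, 0 ≤ x i ∧ x i ≤ 1) :
    ‖fun i => (x i : ℂ)‖ ≤ 1 := by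
  rw [pi_norm_le_iff_of_nonneg zero_le_one]
  intro i
  simp only [Complex.norm_real, Real.norm_eq_abs, abs_of_nonneg (hx i).1, (hx i).2]

/-- A germ of order at least two becomes small after rescaling. -/
theorem exists_small_rescaling {f : (ι → ℂ) → ℂ} (hf : AnalyticAt ℂ f 0)
    (h2 : f =o[𝓝 0] fun x => x) {ε : ℝ} (hε : 0 < ε) :
    ∀ᶠ s : ℝ in 𝓝[>] 0, ∃ g : Wiener ι, ‖g‖ ≤ ε ∧ SuppIn (degGe ι 2) g ∧
      ∀ x : ι → ℂ, ‖x‖ ≤ 1 → ev x g = (s : ℂ)⁻¹ * f ((4 * s : ℂ) • x) := by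
  obtain ⟨t, ht0, a, ha⟩ := exists_ev_eq hf
  have htc : (t : ℂ) ≠ 0 := by exact_mod_cast ht0.ne'
  have ha2 : SuppIn (degGe ι 2) a := by
    intro α hα
    refine co_eq_zero_of_isLittleO (d := 1) (fun x hx => ?_) (by simp [degGe] at hα; omega)
    set z : ι → ℂ := fun i => (x i : ℂ)
    have h1 : Tendsto (fun r : ℝ => (t : ℂ) • (r : ℂ) • z) (𝓝[>] 0) (𝓝 0) := by
      simpa using (tendsto_ofReal_smul z).const_smul (t : ℂ)
    have h3 := h2.comp_tendsto h1
    have h4 : ((fun x : ι → ℂ => x) ∘ fun r : ℝ => (t : ℂ) • (r : ℂ) • z) =O[𝓝[>] 0]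
        fun r : ℝ => r ^ 1 := by
      refine IsBigO.of_bound (‖(t : ℂ)‖ * ‖z‖) (Eventually.of_forall fun r => ?_)
      simp [norm_smul]; apply le_of_eq; ring
    refine (h3.trans_isBigO h4).congr' ?_ EventuallyEq.rfl
    filter_upwards [Ioc_mem_nhdsGT (zero_lt_one' ℝ)] with r hr
    refine ha _ ?_
    rw [norm_smul, Complex.norm_real, Real.norm_of_nonneg hr.1.le]
    exact mul_le_one₀ hr.2 (norm_nonneg _) (norm_ofReal_le_one hx)
  have hlim : Tendsto (fun s : ℝ => 16 / t ^ 2 * ‖a‖ * s) (𝓝[>] 0) (𝓝 0) := by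
    refine Tendsto.mono_left ?_ nhdsWithin_le_nhds
    have : Continuous fun s : ℝ => 16 / t ^ 2 * ‖a‖ * s := by fun_prop
    simpa using this.tendsto 0
  filter_upwards [hlim.eventually_lt_const hε, Ioc_mem_nhdsGT (show 0 < t / 4 by positivity)]
    with s hs hs1
  have hs0 : 0 < s := hs1.1
  have hsc : (s : ℂ) ≠ 0 := by exact_mod_cast hs0.ne'
  have hr : ‖(((4 * s / t : ℝ)) : ℂ)‖ = 4 * s / t := by
    rw [Complex.norm_real, Real.norm_of_nonneg (by positivity)]
  have hr1 : ‖(((4 * s / t : ℝ)) : ℂ)‖ ≤ 1 := by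
    rw [hr, div_le_one ht0]; linarith [hs1.2]
  refine ⟨(s : ℂ)⁻¹ • scale ((4 * s / t : ℝ) : ℂ) a, ?_, ?_, fun x hx => ?_⟩
  · rw [norm_smul, norm_inv, Complex.norm_real, Real.norm_of_nonneg hs0.le]
    calc _ ≤ s⁻¹ * ((4 * s / t) ^ 2 * ‖a‖) := by
          gcongr; simpa only [hr] using norm_scale_le ha2 hr1
      _ = 16 / t ^ 2 * ‖a‖ * s := by field_simp; norm_num [mul_comm]
      _ ≤ ε := hs.le
  · intro α hα
    rw [co_smul, co_scale hr1, ha2 α hα]; simp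
  · have hx' : ‖((4 * s / t : ℝ) : ℂ) • x‖ ≤ 1 := by
      rw [norm_smul]; exact mul_le_one₀ hr1 (norm_nonneg _) hx
    rw [ev_smul, ev_scale hx hr1, ← ha _ hx', smul_smul]
    congr 3
    push_cast; field_simp

variable [DecidableEq ι] {a b : ι}

theorem ev_sc (hab : a ≠ b) {m : ℂ} (hm : m ≠ 0) (x : ι → ℂ) (f : Wiener ι) :
    ev (sc a b m x) f = lift (fun α => m ^ wt a b α * pw x α) f := by
  unfold ev; congr 1; funext α; exact pw_sc hab hm x α

theorem ev_sc_of_wt_zero (hab : a ≠ b) {m : ℂ} (hm : m ≠ 0) (x : ι → ℂ) {f : Wiener ι}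
    (hf : SuppIn {α | wt a b α = 0} f) : ev (sc a b m x) f = ev x f := by
  rw [ev_sc hab hm, ev]
  refine lift_congr fun α hα => ?_
  rw [show wt a b α = 0 from hf.mem hα, zpow_zero, one_mul]

theorem ev_sc_opR (hab : a ≠ b) {c : ℤ → ℂ} {M : ℝ} (hM : ∀ k, ‖c k‖ ≤ M) (hc : ∀ k < 0, c k = 0)
    {q : Wiener ι} (hq1 : ‖q‖ ≤ 1) (hq : SuppIn {α | wt a b α = 0} q) {x : ι → ℂ}
    (hqx : ev x q ≠ 0) (hS : ‖sc a b (ev x q)⁻¹ x‖ ≤ 1) (h : Wiener ι) :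
    ev (sc a b (ev x q)⁻¹ x) (opR a b c q h) = lift (fun α => c (wt a b α) * pw x α) h := by
  rw [ev_opR (famR_bound zero_le_one le_rfl hM) hq1 hS, ev_sc_of_wt_zero hab (inv_ne_zero hqx) x hq]
  refine lift_congr fun α _ => ?_
  rw [pw_sc hab (inv_ne_zero hqx)]
  rcases lt_or_ge (wt a b α) 0 with h0 | h0
  · rw [hc _ h0, zero_mul, zero_mul]
  · obtain ⟨n, hn⟩ := Int.eq_ofNat_of_zero_le h0
    rw [hn, zpow_natCast, Int.natAbs_natCast, ← mul_assoc (_ ^ n), ← mul_pow, mul_inv_cancel₀ hqx,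
      one_pow, one_mul]

theorem ev_sc_of_wt_le (hab : a ≠ b) {κ : ℂ} (hκ : κ ≠ 0) (x : ι → ℂ) (f : Wiener ι)
    (hf : SuppIn {α | wt a b α ≤ 0} f) :
    ev (sc a b κ⁻¹ x) f = lift (fun α => cLe (wt a b α) * (κ ^ (wt a b α).natAbs * pw x α)) f := by
  rw [ev_sc hab (inv_ne_zero hκ)]
  refine lift_congr fun α hα => ?_
  have h0 : wt a b α ≤ 0 := hf.mem hα
  rw [cLe, if_pos h0, one_mul]
  obtain ⟨n, hn⟩ := Int.eq_ofNat_of_zero_le (show 0 ≤ - wt a b α by omega)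
  rw [show wt a b α = -(n : ℤ) by omega, Int.natAbs_neg, Int.natAbs_natCast, inv_zpow, zpow_neg,
    inv_inv, zpow_natCast]

theorem ev_divX {x : ι → ℂ} (hx : ‖x‖ ≤ 1) (f : Wiener ι) :
    x a * ev x (divX a b f) = lift (fun α => (if wt a b α = 1 then 1 else 0) * pw x α) f := by
  rw [divX, ev_lift hx norm_divX_fam, ← smul_eq_mul, lift, lift, ← tsum_const_smul'']
  refine tsum_congr fun α => ?_
  by_cases h : wt a b α = 1
  · rw [if_pos h, if_pos h, one_mul, ev_mono, smul_comm]
    congr 1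
    have hle : Finsupp.single a 1 ≤ α := by
      rw [Finsupp.single_le_iff]; simp only [wt] at h; omega
    conv_rhs => rw [← add_tsub_cancel_of_le hle, pw_add, ← ev_mono, ← X, ev_X]
    rfl
  · rw [if_neg h, if_neg h, ev_zero']; simp

theorem lift_mul_left_const (c : ℂ) (β : (ι →₀ ℕ) → ℂ) (f : Wiener ι) :
    lift (fun α => c * β α) f = c * lift β f := by
  rw [lift, lift, ← tsum_mul_left]
  exact tsum_congr fun α => by simp only [smul_eq_mul]; ring

theorem lift_add_left {β γ : (ι →₀ ℕ) → ℂ} {C C' : ℝ} (hβ : ∀ α, ‖β α‖ ≤ C) (hγ : ∀ α, ‖γ α‖ ≤ C')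
    (f : Wiener ι) : lift (fun α => β α + γ α) f = lift β f + lift γ f := by
  rw [lift, lift, lift, ← (lift_summable hβ f).tsum_add (lift_summable hγ f)]
  exact tsum_congr fun α => by rw [smul_add]

theorem opR_eq_add {c c' c'' : ℤ → ℂ} {M : ℝ} (hM' : ∀ k, ‖c' k‖ ≤ M) (hM'' : ∀ k, ‖c'' k‖ ≤ M)
    (h : ∀ k, c k = c' k + c'' k) {q : Wiener ι} (hq : ‖q‖ ≤ 1) (f : Wiener ι) :
    opR a b c q f = opR a b c' q f + opR a b c'' q f := by
  rw [opR, opR, opR, lift, lift, lift,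
    ← (lift_summable (norm_famR_le (famR_bound zero_le_one le_rfl hM') hq) f).tsum_add
      (lift_summable (norm_famR_le (famR_bound zero_le_one le_rfl hM'') hq) f)]
  refine tsum_congr fun α => ?_
  rw [famR, famR, famR, h, add_smul, smul_add]

/-- The component of index `a` of the fixed point equation. -/
theorem ev_sc_psi_left (hab : a ≠ b) {μ : ℂ} (hμ : 1 < ‖μ‖) {r : ℝ} (hr : r < 1)
    {g : ι → Wiener ι} {p : (ι → Wiener ι) × Wiener ι} (hp : Constr a b (1 / 2) r p)
    (hu : ∀ i, stepU a b μ g p i = p.1 i) (hq : stepQ a b μ g p = p.2) {x : ι → ℂ} (hx : ‖x‖ ≤ 1)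
    (hqx : ev x p.2 ≠ 0) (hS : ‖sc a b (ev x p.2)⁻¹ x‖ ≤ 1) :
    ev (sc a b (ev x p.2)⁻¹ x) (psi a b p.1 a) =
      μ * ev x (psi a b p.1 a) + ev x (nonlin a b g p.1 a) := by
  have hμ0 : μ ≠ 0 := by rintro rfl; simp at hμ; linarith
  obtain ⟨u, q⟩ := p
  simp only at *
  set G := nonlin a b g u a
  have hq1 : ‖q‖ ≤ 1 := hp.norm_q.trans hr.le
  have hinv : ‖μ⁻¹‖ ≤ 1 := by rw [norm_inv]; exact inv_le_one_of_one_le₀ hμ.le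
  have hb1 : ∀ k, ‖μ * cGe 2 k‖ ≤ ‖μ‖ := fun k => by
    rw [norm_mul]; exact mul_le_of_le_one_right (norm_nonneg _) (norm_cGe_le _ _)
  have hb2 : ∀ k, ‖μ⁻¹ * cLe k‖ ≤ ‖μ‖ := fun k => by
    rw [norm_mul]; exact (mul_le_one₀ hinv (norm_nonneg _) (norm_cLe_le k)).trans hμ.le
  have hcmix : ∀ k, cMix μ k = μ * cGe 2 k + μ⁻¹ * cLe k := fun k => by
    unfold cMix cGe cLe; split_ifs <;> first | omega | simp
  set U1 : Wiener ι := opR a b (fun k => μ * cGe 2 k) q (u a) + opR a b (cGe 2) q G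
  set U2 : Wiener ι := opR a b (fun k => μ⁻¹ * cLe k) q (u a) - μ⁻¹ • opR a b cLe 1 G
  have hU : u a = U1 + U2 := by
    rw [← hu a, stepU, if_pos rfl, opR_eq_add hb1 hb2 hcmix hq1]
    simp only [U1, U2, G]; abel
  have hdeg : ∀ f : Wiener ι, SuppIn (degGe ι 0) f := fun f α hα => absurd (Nat.zero_le _) hα
  have hone : SuppIn {α | wt a b α = 0} (1 : Wiener ι) := suppIn_one (by simp [wt])
  have hsq : ∀ {c : ℤ → ℂ} {M : ℝ} {q : Wiener ι} (_ : ∀ k, ‖c k‖ ≤ M) (_ : ‖q‖ ≤ 1)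
      (_ : SuppIn {α | wt a b α = 0} q) (P : ℤ → Prop) (_ : ∀ k, c k ≠ 0 → P k) (f : Wiener ι),
      SuppIn {α | P (wt a b α)} (opR a b c q f) := fun hM hq1 hq P hP f =>
    (suppIn_opR (famR_bound zero_le_one le_rfl hM) hq1 hq (fun α _ h => hP _ h) (hdeg f)).mono
      fun α hα => hα.1
  have hcg : ∀ k, cGe 2 k ≠ 0 → 2 ≤ k := fun k hk => by
    by_contra h; exact hk (by rw [cGe, if_neg h])
  have hcl : ∀ k, cLe k ≠ 0 → k ≤ 0 := fun k hk => by
    by_contra h; exact hk (by rw [cLe, if_neg h])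
  have hU1 : SuppIn {α | 2 ≤ wt a b α} U1 :=
    (hsq hb1 hq1 hp.supp_q _ (fun k hk => hcg k (right_ne_zero_of_mul hk)) _).add
      (hsq (norm_cGe_le 2) hq1 hp.supp_q _ hcg _)
  have hU2 : SuppIn {α | wt a b α ≤ 0} U2 :=
    (hsq hb2 hq1 hp.supp_q _ (fun k hk => hcl k (right_ne_zero_of_mul hk)) _).sub
      ((hsq norm_cLe_le norm_one.le hone _ hcl _).smul _)
  have hbp : ∀ {c : ℤ → ℂ} {M : ℝ} (_ : ∀ k, ‖c k‖ ≤ M) (α : ι →₀ ℕ),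
      ‖c (wt a b α) * pw x α‖ ≤ M * 1 := fun hM α => by
    rw [norm_mul]
    exact mul_le_mul (hM _) (pw_le hx α) (norm_nonneg _) ((norm_nonneg _).trans (hM 0))
  have hevq : ‖ev x q‖ ≤ 1 := (norm_ev_le hx q).trans hq1
  have hbq : ∀ {c : ℤ → ℂ} {M : ℝ} (_ : ∀ k, ‖c k‖ ≤ M) (α : ι →₀ ℕ),
      ‖c (wt a b α) * (ev x q ^ (wt a b α).natAbs * pw x α)‖ ≤ M * (1 * 1) := fun hM α => by
    rw [norm_mul, norm_mul, norm_pow]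
    exact mul_le_mul (hM _) (mul_le_mul (pow_le_one₀ (norm_nonneg _) hevq) (pw_le hx α)
      (norm_nonneg _) zero_le_one) (by positivity) ((norm_nonneg _).trans (hM 0))
  -- values at the image point
  have e1 : ev (sc a b (ev x q)⁻¹ x) U1 =
      μ * lift (fun α => cGe 2 (wt a b α) * pw x α) (u a) +
        lift (fun α => cGe 2 (wt a b α) * pw x α) G := by
    rw [ev_add hS, ev_sc_opR hab hb1 (fun k hk => by rw [cGe, if_neg (by omega), mul_zero]) hq1
      hp.supp_q hqx hS, ev_sc_opR hab (norm_cGe_le 2) (fun k hk => by rw [cGe, if_neg (by omega)]) hq1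
      hp.supp_q hqx hS, ← lift_mul_left_const]
    simp only [mul_assoc]
  have e2 : ev (sc a b (ev x q)⁻¹ x) U2 =
      lift (fun α => cLe (wt a b α) * (ev x q ^ (wt a b α).natAbs * pw x α)) (u a) := by
    rw [ev_sc_of_wt_le hab hqx x U2 hU2, hU, lift_add (hbq norm_cLe_le), right_eq_add]
    refine (tsum_congr fun α => ?_).trans tsum_zero
    by_cases h : U1.co α = 0
    · rw [h, zero_smul]
    · have : 2 ≤ wt a b α := hU1.mem h
      simp only [cLe]
      rw [if_neg (by omega), zero_mul, smul_zero]
  have e3 : lift (fun α => cGe 2 (wt a b α) * pw x α) (u a) = ev x U1 := by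
    rw [hU, lift_add (hbp (norm_cGe_le 2))]
    have h1 : lift (fun α => cGe 2 (wt a b α) * pw x α) U1 = ev x U1 :=
      lift_congr fun α hα => by rw [cGe, if_pos (show 2 ≤ wt a b α from hU1.mem hα), one_mul]
    have h2 : lift (fun α => cGe 2 (wt a b α) * pw x α) U2 = 0 := by
      refine (tsum_congr fun α => ?_).trans tsum_zero
      by_cases h : U2.co α = 0
      · rw [h, zero_smul]
      · have : wt a b α ≤ 0 := hU2.mem h
        simp only [cGe]
        rw [if_neg (by omega), zero_mul, smul_zero]
    rw [h1, h2, add_zero]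
  have e4 : μ * ev x U2 =
      lift (fun α => cLe (wt a b α) * (ev x q ^ (wt a b α).natAbs * pw x α)) (u a) -
        lift (fun α => cLe (wt a b α) * pw x α) G := by
    rw [ev_sub hx, ev_smul, ev_opR (famR_bound zero_le_one le_rfl hb2) hq1 hx,
      ev_opR (famR_bound zero_le_one le_rfl norm_cLe_le) norm_one.le hx]
    simp only [ev_one, one_pow, one_mul, mul_assoc]
    rw [lift_mul_left_const, mul_sub, mul_inv_cancel_left₀ hμ0, mul_inv_cancel_left₀ hμ0]
  have e5 : ev x G = lift (fun α => cGe 2 (wt a b α) * pw x α) G +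
      lift (fun α => cLe (wt a b α) * pw x α) G + x a * ev x (divX a b G) := by
    rw [ev_divX hx, ← lift_add_left (hbp (norm_cGe_le 2)) (hbp norm_cLe_le),
      ← lift_add_left (fun α => (norm_add_le _ _).trans
        (add_le_add (hbp (norm_cGe_le 2) α) (hbp norm_cLe_le α))) (C' := 1) (fun α => by
          split_ifs
          · simpa using pw_le hx α
          · simp)]
    refine lift_congr fun α _ => ?_
    unfold cGe cLe; split_ifs <;> first | omega | simp
  have e6 : (ev x q)⁻¹ = μ + ev x (divX a b G) := by
    have h := congrArg (ev x) hq
    rw [stepQ, ev_smul, ev_sub hx, ev_one, ev_mul hx] at h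
    change μ⁻¹ * (1 - ev x q * ev x (divX a b G)) = ev x q at h
    field_simp at h ⊢
    linear_combination h
  have e7 : sc a b (ev x q)⁻¹ x a = (μ + ev x (divX a b G)) * x a := by rw [sc, if_pos rfl, e6]
  have e8 : ev (sc a b (ev x q)⁻¹ x) (u a) = μ * ev x (u a) +
      (ev x G - x a * ev x (divX a b G)) := by
    conv_lhs => rw [hU, ev_add hS, e1, e2, e3]
    conv_rhs => rw [hU, ev_add hx, e5]
    linear_combination -e4
  rw [psi, if_pos rfl, ev_add hS, ev_add hx, ev_X, ev_X, e7, e8]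
  ring

/-- In the components of other indices the error only has weights `≤ 0`. -/
theorem exists_ev_sc_psi (hab : a ≠ b) {μ : ℂ} {r : ℝ} (hr : r < 1)
    {g : ι → Wiener ι} {p : (ι → Wiener ι) × Wiener ι} (hp : Constr a b (1 / 2) r p)
    (hu : ∀ i, stepU a b μ g p i = p.1 i) {i : ι} (hia : i ≠ a) (hib : i ≠ b) :
    ∃ E : Wiener ι, SuppIn {α | wt a b α ≤ 0} E ∧ ∀ x : ι → ℂ, ‖x‖ ≤ 1 → ev x p.2 ≠ 0 →
      ‖sc a b (ev x p.2)⁻¹ x‖ ≤ 1 → ev (sc a b (ev x p.2)⁻¹ x) (psi a b p.1 i) =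
        ev x (psi a b p.1 i) + ev x (nonlin a b g p.1 i) + ev x E := by
  obtain ⟨u, q⟩ := p
  simp only at *
  set G := nonlin a b g u i
  have hq1 : ‖q‖ ≤ 1 := hp.norm_q.trans hr.le
  have hdeg : ∀ f : Wiener ι, SuppIn (degGe ι 0) f := fun f α hα => absurd (Nat.zero_le _) hα
  have hone : SuppIn {α | wt a b α = 0} (1 : Wiener ι) := suppIn_one (by simp [wt])
  have hcl : ∀ k, cLe k ≠ 0 → k ≤ 0 := fun k hk => by
    by_contra h; exact hk (by rw [cLe, if_neg h])
  have hat0 : SuppIn {α | wt a b α ≤ 0} (hat a b (u i)) := fun α hα => by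
    rw [co_hat]
    refine hp.supp_u i hia _ fun h => hα ?_
    simp only [Set.mem_ofPred_eq, wt_swapExp] at *; omega
  have hL : ∀ {q : Wiener ι} (_ : ‖q‖ ≤ 1) (_ : SuppIn {α | wt a b α = 0} q) (f : Wiener ι),
      SuppIn {α | wt a b α ≤ 0} (opR a b cLe q f) := fun hq1 hq f =>
    (suppIn_opR (P := fun k => k ≤ 0) (famR_bound zero_le_one le_rfl norm_cLe_le) hq1 hq
      (fun α _ h => hcl _ h) (hdeg f)).mono fun α hα => hα.1
  refine ⟨opR a b cLe q (hat a b (u i)) - hat a b (u i) - opR a b cLe 1 G,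
    ((hL hq1 hp.supp_q _).sub hat0).sub (hL norm_one.le hone _), fun x hx hqx hS => ?_⟩
  have hbp : ∀ {c : ℤ → ℂ} {M : ℝ} (_ : ∀ k, ‖c k‖ ≤ M) (α : ι →₀ ℕ),
      ‖c (wt a b α) * pw x α‖ ≤ M * 1 := fun hM α => by
    rw [norm_mul]
    exact mul_le_mul (hM _) (pw_le hx α) (norm_nonneg _) ((norm_nonneg _).trans (hM 0))
  have e1 : ev (sc a b (ev x q)⁻¹ x) (u i) =
      ev x (u i) + lift (fun α => cGe 1 (wt a b α) * pw x α) G := by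
    have h := hu i
    rw [stepU, if_neg hia, if_neg hib] at h
    conv_lhs => rw [← h]
    rw [ev_sc_opR hab (norm_cGe_le 1) (fun k hk => by rw [cGe, if_neg (by omega)]) hq1
      hp.supp_q hqx hS, lift_add (hbp (norm_cGe_le 1))]
    congr 1
    refine lift_congr fun α hα => ?_
    have : 0 < wt a b α := (hp.supp_u i hia).mem hα
    rw [cGe, if_pos (by omega), one_mul]
  have e2 : ev (sc a b (ev x q)⁻¹ x) (hat a b (u i)) = ev x (opR a b cLe q (hat a b (u i))) := by
    rw [ev_sc_of_wt_le hab hqx x _ hat0, ev_opR (famR_bound zero_le_one le_rfl norm_cLe_le) hq1 hx]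
  have e3 : ev x G = lift (fun α => cGe 1 (wt a b α) * pw x α) G + ev x (opR a b cLe 1 G) := by
    rw [ev_opR (famR_bound zero_le_one le_rfl norm_cLe_le) norm_one.le hx]
    simp only [ev_one, one_pow, one_mul]
    rw [← lift_add_left (hbp (norm_cGe_le 1)) (hbp norm_cLe_le)]
    refine lift_congr fun α _ => ?_
    unfold cGe cLe; split_ifs <;> first | omega | simp
  rw [psi, if_neg hia, if_neg hib, ev_add hS, ev_add hS, ev_add hx, ev_add hx, ev_sub hx, ev_sub hx,
    ev_X, ev_X, e1, e2, sc, if_neg hia, if_neg hib]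
  linear_combination -e3

/-- Uniqueness argument: a family of errors satisfying the reversibility relations vanishes. -/
theorem eq_zero_of_reversible {μ : ℂ} (hab : a ≠ b) (hμ0 : μ ≠ 0) {e : ι → Wiener ι}
    {G : (ι → ℂ) → ι → ℂ} {A : (ι → ℂ) →L[ℂ] ι → ℂ} (hG : HasFDerivAt G A 0) (hG0 : G 0 = 0)
    (hA : ∀ x, A x = fun i => sc a b μ x (Equiv.swap a b i)) (ha : e a = 0)
    (hsupp : ∀ i, i ≠ a → i ≠ b → SuppIn {α | wt a b α ≤ 0} (e i))
    (hb : (fun x => ev x (e b)) =o[𝓝 0] fun x i => ev x (e i))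
    (hc : ∀ i, i ≠ a → i ≠ b →
      (fun x => ev (G x) (e i) + ev x (e i)) =o[𝓝 0] fun x i => ev x (e i)) : ∀ i, e i = 0 := by
  by_contra hne
  push Not at hne
  have hex : ∃ d, ∃ i, ∃ α : ι →₀ ℕ, α.degree = d ∧ (e i).co α ≠ 0 := by
    obtain ⟨i, hi⟩ := hne
    obtain ⟨d, -, α, hα, h⟩ := exists_min_degree hi
    exact ⟨d, i, α, hα, h⟩
  classical
  obtain ⟨d, hd, i, α, hα, hiα⟩ : ∃ d, (∀ i (α : ι →₀ ℕ), α.degree < d → (e i).co α = 0) ∧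
      ∃ i, ∃ α : ι →₀ ℕ, α.degree = d ∧ (e i).co α ≠ 0 := by
    refine ⟨Nat.find hex, fun i α hα => ?_, Nat.find_spec hex⟩
    by_contra h0
    exact Nat.find_min hex hα ⟨i, α, rfl, h0⟩
  have hray : ∀ z : ι → ℂ, (fun t : ℝ => fun i => ev ((t : ℂ) • z) (e i)) =O[𝓝[>] 0]
      fun t => t ^ d := by
    intro z
    rw [isBigO_pi]
    intro i
    have h1 := isLittleO_ev_comp (hd i) (hasFDerivAt_id (𝕜 := ℂ) (0 : ι → ℂ)) rfl z
    have h2 : (fun t : ℝ => (t : ℂ) ^ d * hom (e i) d z) =O[𝓝[>] 0] fun t : ℝ => t ^ d :=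
      IsBigO.of_bound ‖hom (e i) d z‖ (Eventually.of_forall fun t => by simp [mul_comm])
    exact (h1.isBigO.add h2).congr_left fun t => by simp
  have hib' : i ≠ b := by
    rintro rfl
    exact hiα (co_eq_zero_of_isLittleO (d := d) (fun x _ =>
      (hb.comp_tendsto (tendsto_ofReal_smul _)).trans_isBigO (hray _)) hα.le)
  have hia : i ≠ a := by
    rintro rfl
    rw [ha, co_zero] at hiα; exact hiα rfl
  have key : ∀ β : ι →₀ ℕ, β.degree = d →
      μ ^ wt a b β * (e i).co (swapExp a b β) + (e i).co β = 0 := by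
    let Q : Wiener ι := ∑ β ∈ expo ι d,
      (μ ^ wt a b β * (e i).co (swapExp a b β) + (e i).co β) • mono β
    have hQco : ∀ β : ι →₀ ℕ, β.degree = d →
        Q.co β = μ ^ wt a b β * (e i).co (swapExp a b β) + (e i).co β := by
      intro β hβ
      rw [← coL_apply, map_sum, Finset.sum_eq_single β]
      · rw [coL_apply, co_smul, co_mono, if_pos rfl, mul_one]
      · intro γ _ hγ
        rw [coL_apply, co_smul, co_mono, if_neg hγ.symm, mul_zero]
      · intro h'; exact absurd (mem_expo.2 hβ) h'
    have hQev : ∀ x : ι → ℂ, ‖x‖ ≤ 1 → ev x Q = hom (e i) d (A x) + hom (e i) d x := by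
      intro x hx
      rw [← evL_apply x hx, map_sum, hA]
      simp only [evL_apply, ev_smul, ev_mono, add_mul, Finset.sum_add_distrib]
      congr 1
      rw [hom]
      refine Finset.sum_bij' (fun β _ => swapExp a b β) (fun β _ => swapExp a b β) ?_ ?_ ?_ ?_ ?_
      · intro β hβ; rw [mem_expo] at *; rw [degree_swapExp, hβ]
      · intro β hβ; rw [mem_expo] at *; rw [degree_swapExp, hβ]
      · intro β _; exact swapExp_swapExp a b β
      · intro β _; exact swapExp_swapExp a b β
      · intro β _
        rw [pw_swap, swapExp_swapExp, pw_sc hab hμ0]; ring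
    intro β hβ
    rw [← hQco β hβ]
    refine co_eq_zero_of_isLittleO (d := d) (fun x hx => ?_) hβ.le
    set z : ι → ℂ := fun i => (x i : ℂ)
    have hz : ‖z‖ ≤ 1 := norm_ofReal_le_one hx
    have h1 := isLittleO_ev_comp (hd i) hG hG0 z
    have h2 := isLittleO_ev_comp (hd i) (hasFDerivAt_id (𝕜 := ℂ) (0 : ι → ℂ)) rfl z
    have h3 := ((hc i hia hib').comp_tendsto (tendsto_ofReal_smul z)).trans_isBigO (hray z)
    refine ((h3.sub h1).sub h2).congr' ?_ EventuallyEq.rfl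
    filter_upwards [Ioc_mem_nhdsGT (zero_lt_one' ℝ)] with t ht1
    have htz : ‖(t : ℂ) • z‖ ≤ 1 := by
      rw [norm_smul, Complex.norm_real, Real.norm_of_nonneg ht1.1.le]
      exact mul_le_one₀ ht1.2 (norm_nonneg _) hz
    rw [hQev _ htz, map_smul, hom_smul, hom_smul]
    simp only [Function.comp_apply, id_eq, ContinuousLinearMap.id_apply]
    ring
  have hs := hsupp i hia hib'
  have hw : wt a b α ≤ 0 := hs.mem hiα
  have hk := key α hα
  rcases hw.lt_or_eq with h | h
  · rw [hs (swapExp a b α) (by simp only [Set.mem_ofPred_eq, wt_swapExp]; omega), mul_zero,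
      zero_add] at hk
    exact hiα hk
  · have hsw : swapExp a b α = α := by
      ext j
      have hab' : α a = α b := by simp only [wt] at h; omega
      rw [swapExp_apply]
      rcases eq_or_ne j a with rfl | hja
      · rw [Equiv.swap_apply_left, hab']
      · rcases eq_or_ne j b with rfl | hjb
        · rw [Equiv.swap_apply_right, hab']
        · rw [Equiv.swap_apply_of_ne_of_ne hja hjb]
    rw [hsw, h, zpow_zero, one_mul, ← two_mul] at hk
    exact hiα (by simpa using hk)

end conjugation

end Wiener

namespace Wiener

section normalForm

variable {ι κ : Type*} [Fintype ι] [Fintype κ]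

theorem eventually_exists_ev_eq {f : (ι → ℂ) → ℂ} (hf : AnalyticAt ℂ f 0) :
    ∀ᶠ t : ℝ in 𝓝[>] 0, ∃ a : Wiener ι, ∀ x : ι → ℂ, ‖x‖ ≤ 1 → f ((t : ℂ) • x) = ev x a := by
  obtain ⟨t, ht0, a, ha⟩ := exists_ev_eq hf
  have htc : (t : ℂ) ≠ 0 := by exact_mod_cast ht0.ne'
  filter_upwards [Ioc_mem_nhdsGT ht0] with r hr
  have hr1 : ‖((r / t : ℝ) : ℂ)‖ ≤ 1 := by
    rw [Complex.norm_real, Real.norm_of_nonneg (div_nonneg hr.1.le ht0.le), div_le_one ht0]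
    exact hr.2
  refine ⟨scale ((r / t : ℝ) : ℂ) a, fun x hx => ?_⟩
  rw [ev_scale hx hr1, ← ha, smul_smul]
  · congr 2; push_cast; field_simp
  · rw [norm_smul]; exact mul_le_one₀ hr1 (norm_nonneg _) hx

theorem eventually_exists_ev_eq_pi {f : (ι → ℂ) → κ → ℂ} (hf : AnalyticAt ℂ f 0) :
    ∀ᶠ t : ℝ in 𝓝[>] 0, ∃ a : κ → Wiener ι, ∀ x : ι → ℂ, ‖x‖ ≤ 1 →
      ∀ i, f ((t : ℂ) • x) i = ev x (a i) := by
  have h : ∀ i, AnalyticAt ℂ (fun x => f x i) 0 := fun i =>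
    ((ContinuousLinearMap.proj (R := ℂ) (φ := fun _ : κ => ℂ) i).analyticAt _).comp hf
  filter_upwards [eventually_all.2 fun i => eventually_exists_ev_eq (h i)] with t ht
  choose a ha using ht
  exact ⟨a, fun x hx i => ha i x hx⟩

theorem ev_zero_left (f : Wiener ι) : ev 0 f = f.co 0 := by
  rw [ev, lift, tsum_eq_single 0 fun α hα => ?_]
  · rw [pw_zero, smul_eq_mul, mul_one]
  · obtain ⟨i, hi⟩ := Finsupp.ne_iff.1 hα
    rw [pw, Finset.prod_eq_zero (Finset.mem_univ i) (by simpa using hi), smul_zero]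

theorem norm_ev_le_pow {n : ℕ} {f : Wiener ι} (hf : SuppIn (degGe ι n) f) {x : ι → ℂ}
    (hx : ‖x‖ ≤ 1) (hx0 : x ≠ 0) : ‖ev x f‖ ≤ ‖x‖ ^ n * ‖f‖ := by
  have h0 : (‖x‖ : ℂ) ≠ 0 := by exact_mod_cast norm_ne_zero_iff.2 hx0
  have h1 : ‖(‖x‖ : ℂ)⁻¹ • x‖ ≤ 1 := by
    rw [norm_smul, norm_inv, Complex.norm_real, norm_norm, inv_mul_cancel₀ (norm_ne_zero_iff.2 hx0)]
  have h2 : ‖(‖x‖ : ℂ)‖ ≤ 1 := by rwa [Complex.norm_real, norm_norm]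
  have h3 := norm_ev_le h1 (scale (‖x‖ : ℂ) f)
  rw [ev_scale h1 h2, smul_inv_smul₀ h0] at h3
  refine h3.trans ((norm_scale_le hf h2).trans_eq ?_)
  rw [Complex.norm_real, norm_norm]

theorem isLittleO_ev {f : Wiener ι} (hf : SuppIn (degGe ι 2) f) :
    (fun x => ev x f) =o[𝓝 0] fun x : ι → ℂ => x := by
  refine IsBigO.trans_isLittleO (g := fun x : ι → ℂ => ‖x‖ ^ 2) ?_ ?_
  · refine IsBigO.of_bound ‖f‖ ?_
    filter_upwards [Metric.closedBall_mem_nhds (0 : ι → ℂ) one_pos] with x hx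
    by_cases hx0 : x = 0
    · rw [hx0, ev_zero_left, hf 0 (by simp [degGe])]; simp
    · rw [norm_pow, norm_norm, mul_comm]
      exact norm_ev_le_pow hf (by simpa using hx) hx0
  · exact isLittleO_norm_pow_id one_lt_two

theorem _root_.AnalyticAt.tendsto_zero {V W : Type*} [NormedAddCommGroup V] [NormedSpace ℂ V]
    [NormedAddCommGroup W] [NormedSpace ℂ W] {f : V → W} (hf : AnalyticAt ℂ f 0) (h0 : f 0 = 0) :
    Tendsto f (𝓝 0) (𝓝 0) := by
  have := hf.continuousAt.tendsto
  rwa [h0] at this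

theorem tendsto_const_smul_zero (c : ℂ) : Tendsto (fun y : ι → ℂ => c • y) (𝓝 0) (𝓝 0) :=
  (continuous_const_smul c).tendsto' 0 0 (smul_zero c)

variable [DecidableEq ι] (a b : ι)

/-- Exchange of the coordinates of index `a` and `b`. -/
def swapV (x : ι → ℂ) : ι → ℂ := fun i => x (Equiv.swap a b i)

/-- `swapV` as a continuous linear map. -/
noncomputable def swapL : (ι → ℂ) →L[ℂ] ι → ℂ :=
  ContinuousLinearMap.pi fun i => ContinuousLinearMap.proj (Equiv.swap a b i)

/-- `sc` as a continuous linear map. -/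
noncomputable def scL (m : ℂ) : (ι → ℂ) →L[ℂ] ι → ℂ := ContinuousLinearMap.pi fun i =>
  (if i = a then m else if i = b then m⁻¹ else 1) • ContinuousLinearMap.proj i

theorem swapL_apply (x : ι → ℂ) : swapL a b x = swapV a b x := rfl

theorem scL_apply (m : ℂ) (x : ι → ℂ) : scL a b m x = sc a b m x := by
  funext i; simp only [scL, ContinuousLinearMap.pi_apply, sc]; split_ifs <;> simp

theorem norm_swapV (x : ι → ℂ) : ‖swapV a b x‖ = ‖x‖ := by
  refine le_antisymm ?_ ?_
  · exact (pi_norm_le_iff_of_nonneg (norm_nonneg _)).2 fun i => norm_le_pi_norm x _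
  · refine (pi_norm_le_iff_of_nonneg (norm_nonneg _)).2 fun i => ?_
    simpa [swapV] using norm_le_pi_norm (swapV a b x) (Equiv.swap a b i)

variable {a b}

theorem swapV_swapV (x : ι → ℂ) : swapV a b (swapV a b x) = x := by
  funext i; simp [swapV]

theorem sc_swapV_sc (hab : a ≠ b) {m : ℂ} (hm : m ≠ 0) (x : ι → ℂ) :
    sc a b m (swapV a b (sc a b m x)) = swapV a b x := by
  funext i
  by_cases hia : i = a
  · subst hia; simp [sc, swapV, hab.symm, hm]
  · by_cases hib : i = b
    · subst hib; simp [sc, swapV, hab.symm, hm]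
    · simp [sc, swapV, Equiv.swap_apply_of_ne_of_ne hia hib, hia, hib]

theorem hat_of_wt_zero {f : Wiener ι} (hf : SuppIn {α | wt a b α = 0} f) : hat a b f = f := by
  ext α
  rw [co_hat]
  by_cases h : wt a b α = 0
  · congr 1
    ext j
    have hab' : α a = α b := by simp only [wt] at h; omega
    rw [swapExp_apply]
    rcases eq_or_ne j a with rfl | hja
    · rw [Equiv.swap_apply_left, hab']
    · rcases eq_or_ne j b with rfl | hjb
      · rw [Equiv.swap_apply_right, hab']
      · rw [Equiv.swap_apply_of_ne_of_ne hja hjb]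
  · rw [hf α h, hf _ (by simpa [wt_swapExp] using h)]

theorem ev_swapV_psi (hab : a ≠ b) (u : ι → Wiener ι) {x : ι → ℂ} (hx : ‖x‖ ≤ 1) (i : ι) :
    ev (swapV a b x) (psi a b u i) = ev x (psi a b u (Equiv.swap a b i)) := by
  have hx' : ‖swapV a b x‖ ≤ 1 := by rwa [norm_swapV]
  have h1 : ∀ f, ev (swapV a b x) f = ev x (hat a b f) := fun f => (ev_hat a b hx f).symm
  have h2 : ∀ f, ev (swapV a b x) (hat a b f) = ev x f := fun f => by
    rw [ev_hat a b hx']; exact congrArg (fun y => ev y f) (swapV_swapV x)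
  rcases eq_or_ne i a with rfl | hia
  · rw [Equiv.swap_apply_left, psi, if_pos rfl, psi, if_neg hab.symm, if_pos rfl, ev_add hx',
      ev_add hx, ev_X, ev_X, h1]
    simp [swapV]
  · rcases eq_or_ne i b with rfl | hib
    · rw [Equiv.swap_apply_right, psi, if_neg hab.symm, if_pos rfl, psi, if_pos rfl, ev_add hx',
        ev_add hx, ev_X, ev_X, h2]
      simp [swapV]
    · rw [Equiv.swap_apply_of_ne_of_ne hia hib, psi, if_neg hia, if_neg hib, ev_add hx', ev_add hx',
        ev_add hx, ev_add hx, ev_X, ev_X, h1 (u i), h2, add_comm (ev x (hat a b (u i)))]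
      simp [swapV, Equiv.swap_apply_of_ne_of_ne hia hib]

theorem analyticAt_ev_pi (f : κ → Wiener ι) : AnalyticAt ℂ (fun x i => ev x (f i)) 0 :=
  AnalyticAt.pi fun i => analyticAt_ev (f i)

theorem analyticAt_sc {m : (ι → ℂ) → ℂ} {x₀ : ι → ℂ} (hm : AnalyticAt ℂ m x₀) (hm0 : m x₀ ≠ 0) :
    AnalyticAt ℂ (fun x => sc a b (m x) x) x₀ := by
  refine AnalyticAt.pi fun i => ?_
  have hp : AnalyticAt ℂ (fun x : ι → ℂ => x i) x₀ :=
    (ContinuousLinearMap.proj (R := ℂ) (φ := fun _ : ι => ℂ) i).analyticAt _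
  simp only [sc]
  split_ifs
  · exact hm.mul hp
  · exact (hm.inv hm0).mul hp
  · exact hp

set_option maxHeartbeats 1000000 in
/-- Normal form of a pair of reversible germs whose linear part is hyperbolic on two coordinates and
trivial on the others. -/
theorem exists_normalForm_pair (hab : a ≠ b) {μ : ℂ} (hμ : 1 < ‖μ‖) {σ : (ι → ℂ) → ι → ℂ}
    (hσ : AnalyticAt ℂ σ 0) (hσ' : (fun x => σ x - sc a b μ x) =o[𝓝 0] fun x => x)
    (hrev : ∀ᶠ x in 𝓝 0, swapV a b (σ (swapV a b (σ x))) = x) :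
    ∃ Ψ : (ι → ℂ) → ι → ℂ, AnalyticAt ℂ Ψ 0 ∧ Ψ 0 = 0 ∧
      (∃ c : ℂ, c ≠ 0 ∧ HasFDerivAt Ψ (c • ContinuousLinearMap.id ℂ (ι → ℂ)) 0) ∧
      ∃ q : Wiener ι, ‖q‖ < 1 ∧ SuppIn {α | wt a b α = 0} q ∧ ev 0 q = μ⁻¹ ∧
        (∀ᶠ x in 𝓝 0, σ (Ψ x) = Ψ (sc a b (ev x q)⁻¹ x)) ∧
        ∀ᶠ x in 𝓝 0, Ψ (swapV a b x) = swapV a b (Ψ x) := by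
  have hμ0 : μ ≠ 0 := by rintro rfl; simp at hμ; linarith
  have hsc0 : ∀ m, sc a b m (0 : ι → ℂ) = 0 := fun m => by funext i; simp [sc]
  have hσ0 : σ 0 = 0 := by
    have := (hσ'.bound one_pos).self_of_nhds
    simpa [hsc0] using this
  obtain ⟨ε, hε, r, hr, hfix⟩ := exists_fixedPoint (a := a) (b := b) hμ
  have hcomp : ∀ i, AnalyticAt ℂ (fun x => σ x i - sc a b μ x i) 0 := fun i => by
    have h1 : AnalyticAt ℂ (fun x => σ x - sc a b μ x) 0 :=
      hσ.sub (((scL a b μ).analyticAt 0).congr (Eventually.of_forall (scL_apply a b μ)))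
    exact ((ContinuousLinearMap.proj (R := ℂ) (φ := fun _ : ι => ℂ) i).analyticAt _).comp h1
  have hsmall : ∀ i, (fun x => σ x i - sc a b μ x i) =o[𝓝 0] fun x => x := fun i =>
    (isLittleO_pi.1 hσ') i
  obtain ⟨s, hs, hs0⟩ := ((eventually_all.2 fun i =>
    exists_small_rescaling (hcomp i) (hsmall i) hε).and (self_mem_nhdsWithin (s := Set.Ioi 0))).exists
  have hs0 : 0 < s := hs0
  have hsc : (s : ℂ) ≠ 0 := by exact_mod_cast hs0.ne'
  choose g hgε hg2 hg using hs
  obtain ⟨⟨u, q⟩, hp, hu, hq⟩ := hfix g hgε hg2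
  have hq1 : ‖q‖ < 1 := lt_of_le_of_lt hp.norm_q hr
  have hun : ∀ i, ‖u i‖ ≤ 1 / 2 := hp.norm_u
  let Ψ : (ι → ℂ) → ι → ℂ := fun x i => ev x (psi a b u i)
  have hΨan : AnalyticAt ℂ Ψ 0 := analyticAt_ev_pi _
  have hX1 : ∀ i : ι, SuppIn (degGe ι 1) (X i) := suppIn_X
  have hΨ0 : Ψ 0 = 0 := by
    funext i
    change ev 0 _ = 0
    rw [ev_zero_left, suppIn_psi hp.deg_u i 0 (by simp [degGe])]
  have hhat : ∀ i, SuppIn (degGe ι 2) (hat a b (u i)) := fun i => suppIn_hat (hp.deg_u i)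
  have hΨ' : HasFDerivAt Ψ (ContinuousLinearMap.id ℂ (ι → ℂ)) 0 := by
    rw [hasFDerivAt_iff_isLittleO_nhds_zero]
    have : ∀ i, ∃ f, SuppIn (degGe ι 2) f ∧ psi a b u i = X i + f := fun i => by
      unfold psi; split_ifs with h1 h2
      · exact ⟨_, hp.deg_u a, by rw [h1]⟩
      · exact ⟨_, hhat a, by rw [h2]⟩
      · exact ⟨_, (hp.deg_u i).add (hhat i), rfl⟩
    choose f hf2 hf using this
    refine isLittleO_pi.2 fun i => (isLittleO_ev (hf2 i)).congr' ?_ EventuallyEq.rfl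
    filter_upwards [Metric.closedBall_mem_nhds (0 : ι → ℂ) one_pos] with x hx
    have hx1 : ‖x‖ ≤ 1 := by simpa using hx
    simp only [zero_add, hΨ0, sub_zero, ContinuousLinearMap.id_apply, Pi.sub_apply, Ψ]
    rw [hf, ev_add hx1, ev_X]; ring
  have hq0 : ev 0 q = μ⁻¹ := by
    have h := congrArg (ev 0) hq
    rw [stepQ, ev_smul, ev_sub (by simp), ev_one, ev_mul (by simp), ev_zero_left (divX _ _ _)] at h
    rw [suppIn_divX (suppIn_nonlin hp.deg_u hun hg2 a) 0 (by simp), mul_zero, sub_zero, mul_one] at h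
    exact h.symm
  let m : (ι → ℂ) → ℂ := fun x => (ev x q)⁻¹
  have hq00 : ev 0 q ≠ 0 := by rw [hq0]; exact inv_ne_zero hμ0
  have hm : AnalyticAt ℂ m 0 := (analyticAt_ev q).inv hq00
  have hm0 : m 0 = μ := by simp only [m, hq0, inv_inv]
  let S : (ι → ℂ) → ι → ℂ := fun x => sc a b (m x) x
  have hS : AnalyticAt ℂ S 0 := analyticAt_sc hm (hm0 ▸ hμ0)
  have hS0 : S 0 = 0 := hsc0 _
  have hne : ∀ᶠ x in 𝓝 (0 : ι → ℂ), ev x q ≠ 0 := (analyticAt_ev q).continuousAt.eventually_ne hq00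
  have hball : ∀ᶠ x in 𝓝 (0 : ι → ℂ), ‖x‖ ≤ 1 := by
    filter_upwards [Metric.closedBall_mem_nhds (0 : ι → ℂ) one_pos] with x hx
    simpa using hx
  have hSt : Tendsto S (𝓝 0) (𝓝 0) := hS.tendsto_zero hS0
  have hSball : ∀ᶠ x in 𝓝 (0 : ι → ℂ), ‖S x‖ ≤ 1 := hSt.eventually hball
  let σs : (ι → ℂ) → ι → ℂ := fun y => (s : ℂ)⁻¹ • σ ((s : ℂ) • y)
  have hσs : ∀ x : ι → ℂ, ‖x‖ ≤ 1 → ∀ i,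
      σs (Ψ x) i = sc a b μ (Ψ x) i + ev x (nonlin a b g u i) := by
    intro x hx i
    have hn := norm_quarter_psi_le (a := a) (b := b) hun
    have h1 : ev x (nonlin a b g u i) = ev ((1 / 4 : ℂ) • Ψ x) (g i) := by
      rw [nonlin, ev_comp hx fun j => (hn j).trans (by norm_num)]
      congr 1; funext j; rw [ev_smul]; rfl
    have h2 : ‖(1 / 4 : ℂ) • Ψ x‖ ≤ 1 := by
      refine (pi_norm_le_iff_of_nonneg zero_le_one).2 fun j => ?_
      rw [Pi.smul_apply, smul_eq_mul, ← ev_smul]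
      exact (norm_ev_le hx _).trans ((hn j).trans (by norm_num))
    rw [h1, hg i _ h2, smul_smul, show (4 * s : ℂ) * (1 / 4) = s by ring]
    have h3 : sc a b μ ((s : ℂ) • Ψ x) i = s * sc a b μ (Ψ x) i := by
      simp only [sc, Pi.smul_apply, smul_eq_mul]; split_ifs <;> ring
    rw [h3]
    simp only [σs, Pi.smul_apply, smul_eq_mul]
    field_simp; ring
  have hσsan : AnalyticAt ℂ σs 0 := by
    have h1 : AnalyticAt ℂ (fun y : ι → ℂ => (s : ℂ) • y) 0 :=
      ((s : ℂ) • ContinuousLinearMap.id ℂ (ι → ℂ)).analyticAt 0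
    have h2 : AnalyticAt ℂ σ ((s : ℂ) • (0 : ι → ℂ)) := by rwa [smul_zero]
    exact (h2.fun_comp h1).fun_const_smul
  have hσs0 : σs 0 = 0 := by simp [σs, hσ0]
  have hσs' : HasStrictFDerivAt σs (scL a b μ) 0 := by
    have h0 : HasFDerivAt σ (scL a b μ) ((s : ℂ) • (0 : ι → ℂ)) := by
      rw [smul_zero, hasFDerivAt_iff_isLittleO_nhds_zero]
      simpa [hσ0, scL_apply] using hσ'
    have h1 : HasFDerivAt (fun y : ι → ℂ => (s : ℂ) • y)
        ((s : ℂ) • ContinuousLinearMap.id ℂ (ι → ℂ)) 0 :=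
      ((s : ℂ) • ContinuousLinearMap.id ℂ (ι → ℂ)).hasFDerivAt
    have h2 : HasFDerivAt σs (scL a b μ) 0 := by
      refine ((h0.comp 0 h1).const_smul (s : ℂ)⁻¹).congr_fderiv ?_
      ext1 x
      change (s : ℂ)⁻¹ • scL a b μ ((s : ℂ) • x) = _
      rw [map_smul, inv_smul_smul₀ hsc]
    have h3 := hσsan.hasStrictFDerivAt
    rwa [h2.fderiv] at h3
  let E : (ι → ℂ) → ι → ℂ := fun x => Ψ (S x) - σs (Ψ x)
  have hEan : AnalyticAt ℂ E 0 :=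
    (AnalyticAt.fun_comp (hS0.symm ▸ hΨan) hS).sub (AnalyticAt.fun_comp (hΨ0.symm ▸ hσsan) hΨan)
  have hEa : ∀ᶠ x in 𝓝 (0 : ι → ℂ), E x a = 0 := by
    filter_upwards [hne, hball, hSball] with x h1 h2 h3
    have h4 := ev_sc_psi_left hab hμ hr hp hu hq h2 h1 h3
    simp only [E, Pi.sub_apply]
    rw [hσs x h2, sc, if_pos rfl, sub_eq_zero]
    exact h4
  have hEc : ∀ i, i ≠ a → i ≠ b → ∃ F : Wiener ι, SuppIn {α | wt a b α ≤ 0} F ∧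
      ∀ᶠ x in 𝓝 (0 : ι → ℂ), E x i = ev x F := by
    intro i hia hib
    obtain ⟨F, hF, hF'⟩ := exists_ev_sc_psi (μ := μ) hab hr hp hu hia hib
    refine ⟨F, hF, ?_⟩
    filter_upwards [hne, hball, hSball] with x h1 h2 h3
    have h4 := hF' x h2 h1 h3
    simp only [E, Pi.sub_apply]
    rw [hσs x h2, sc, if_neg hia, if_neg hib]
    change ev (S x) _ = ev x _ + _ + _ at h4
    simp only [Ψ]
    rw [h4]; ring
  have hΨsw : ∀ x : ι → ℂ, ‖x‖ ≤ 1 → Ψ (swapV a b x) = swapV a b (Ψ x) := fun x hx => by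
    funext i; exact ev_swapV_psi hab u hx i
  let G : (ι → ℂ) → ι → ℂ := fun x => swapV a b (S x)
  have hmG : ∀ᶠ x in 𝓝 (0 : ι → ℂ), m (G x) = m x := by
    filter_upwards [hne, hball, hSball] with x h1 h2 h3
    simp only [m, G]
    congr 1
    have := ev_hat a b h3 q
    rw [hat_of_wt_zero hp.supp_q] at this
    exact this.symm.trans (ev_sc_of_wt_zero hab (inv_ne_zero h1) x hp.supp_q)
  have hGG : ∀ᶠ x in 𝓝 (0 : ι → ℂ), G (G x) = x := by
    filter_upwards [hmG, hne] with x h1 h2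
    change swapV a b (sc a b (m (G x)) (G x)) = x
    rw [h1]
    change swapV a b (sc a b (m x) (swapV a b (sc a b (m x) x))) = x
    rw [sc_swapV_sc hab (inv_ne_zero h2), swapV_swapV]
  have hGan : AnalyticAt ℂ G 0 := ((swapL a b).analyticAt _).fun_comp hS
  have hG0 : G 0 = 0 := by simp only [G, hS0]; rfl
  have hGt : Tendsto G (𝓝 0) (𝓝 0) := hGan.tendsto_zero hG0
  have hΨt : Tendsto Ψ (𝓝 0) (𝓝 0) := hΨan.tendsto_zero hΨ0
  have hσst : Tendsto σs (𝓝 0) (𝓝 0) := hσsan.tendsto_zero hσs0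
  let R : (ι → ℂ) → ι → ℂ := fun y => swapV a b (σs y)
  have hswt : Tendsto (swapV a b) (𝓝 0) (𝓝 (0 : ι → ℂ)) :=
    (swapL a b).continuous.tendsto' 0 0 (map_zero _)
  have hRt : Tendsto R (𝓝 0) (𝓝 0) := hswt.comp hσst
  have hRR : ∀ᶠ y in 𝓝 (0 : ι → ℂ), R (R y) = y := by
    have h1 : Tendsto (fun y : ι → ℂ => (s : ℂ) • y) (𝓝 0) (𝓝 0) := tendsto_const_smul_zero _
    filter_upwards [h1.eventually hrev] with y hy
    have h2 : (s : ℂ) • swapV a b ((s : ℂ)⁻¹ • σ ((s : ℂ) • y)) = swapV a b (σ ((s : ℂ) • y)) := by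
      funext i; simp [swapV, hsc]
    change swapV a b ((s : ℂ)⁻¹ • σ ((s : ℂ) • swapV a b ((s : ℂ)⁻¹ • σ ((s : ℂ) • y)))) = y
    rw [h2]
    have h3 : swapV a b ((s : ℂ)⁻¹ • σ (swapV a b (σ ((s : ℂ) • y)))) =
      (s : ℂ)⁻¹ • swapV a b (σ (swapV a b (σ ((s : ℂ) • y)))) := rfl
    rw [h3, hy, inv_smul_smul₀ hsc]
  have hR' : HasStrictFDerivAt R ((swapL a b).comp (scL a b μ)) 0 :=
    (swapL a b).hasStrictFDerivAt.comp 0 hσs'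
  have hE' : ∀ᶠ x in 𝓝 (0 : ι → ℂ), Ψ (G x) - R (Ψ x) = swapV a b (E x) := by
    filter_upwards [hSball] with x hx
    simp only [G, R, hΨsw _ hx, E]; rfl
  have hlit : (fun x => swapV a b (E (G x)) + swapV a b (sc a b μ (swapV a b (E x)))) =o[𝓝 0]
      E := by
    have h1 : Tendsto (fun x => (Ψ (G x), R (Ψ x))) (𝓝 0) (𝓝 ((0 : ι → ℂ), (0 : ι → ℂ))) :=
      (hΨt.comp hGt).prodMk_nhds (hRt.comp hΨt)
    have h2 := hR'.isLittleO.comp_tendsto h1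
    have h7 : ((fun p : (ι → ℂ) × (ι → ℂ) => p.1 - p.2) ∘ fun x => (Ψ (G x), R (Ψ x))) =O[𝓝 0]
        E := by
      refine IsBigO.of_bound 1 ?_
      filter_upwards [hE'] with x hx
      simp only [Function.comp_apply]
      rw [hx, norm_swapV, one_mul]
    refine (h2.trans_isBigO h7).neg_left.congr' ?_ EventuallyEq.rfl
    filter_upwards [hE', hGt.eventually hE', hGG, hΨt.eventually hRR] with x h3 h4 h5 h6
    simp only [Function.comp_apply]
    rw [h3, h6, ← h4, h5, ContinuousLinearMap.comp_apply, scL_apply, swapL_apply]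
    abel
  obtain ⟨t, ⟨ev_eq, ht0⟩, ht1⟩ := (((eventually_exists_ev_eq_pi hEan).and
    (self_mem_nhdsWithin (s := Set.Ioi 0))).and (Ioc_mem_nhdsGT (zero_lt_one' ℝ))).exists
  obtain ⟨e, he⟩ := ev_eq
  have ht0 : 0 < t := ht0
  have htc : (t : ℂ) ≠ 0 := by exact_mod_cast ht0.ne'
  have htn : ‖(t : ℂ)‖ ≤ 1 := by rw [Complex.norm_real, Real.norm_of_nonneg ht0.le]; exact ht1.2
  have htt : Tendsto (fun y : ι → ℂ => (t : ℂ) • y) (𝓝 0) (𝓝 0) :=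
    tendsto_const_smul_zero _
  have htt' : Tendsto (fun y : ι → ℂ => (t : ℂ)⁻¹ • y) (𝓝 0) (𝓝 0) :=
    tendsto_const_smul_zero _
  have hmt : AnalyticAt ℂ (fun x => m ((t : ℂ) • x)) 0 :=
    AnalyticAt.fun_comp (by rwa [smul_zero])
      (((t : ℂ) • ContinuousLinearMap.id ℂ (ι → ℂ)).analyticAt 0)
  obtain ⟨A, hA, hAx⟩ := hasFDerivAt_sc (a := a) (b := b) hmt.differentiableAt
    (by simpa [hm0] using hμ0)
  have hGt' : ∀ x, G ((t : ℂ) • x) = (t : ℂ) • swapV a b (sc a b (m ((t : ℂ) • x)) x) := by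
    intro x
    funext i
    simp only [G, S, swapV, sc, Pi.smul_apply, smul_eq_mul]
    split_ifs <;> ring
  have hGt1 : HasFDerivAt (fun x => swapV a b (sc a b (m ((t : ℂ) • x)) x)) ((swapL a b).comp A) 0 :=
    (swapL a b).hasFDerivAt.comp 0 hA
  have hGt1t : Tendsto (fun x => swapV a b (sc a b (m ((t : ℂ) • x)) x)) (𝓝 0) (𝓝 0) := by
    have := hGt1.continuousAt.tendsto
    simp only [hsc0] at this
    exact this
  have hbase : (fun x => E ((t : ℂ) • x)) =ᶠ[𝓝 0] fun x i => ev x (e i) := by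
    filter_upwards [hball] with x hx
    funext i; exact he x hx i
  have hcmp := isLittleO_pi.1 ((hlit.comp_tendsto htt).congr' EventuallyEq.rfl hbase)
  have hzero : ∀ i, e i = 0 := by
    refine eq_zero_of_reversible hab hμ0 hGt1 (by simp only [hsc0]; rfl) (fun x => ?_) ?_ ?_ ?_ ?_
    · rw [ContinuousLinearMap.comp_apply, swapL_apply, hAx, smul_zero, hm0]; rfl
    · refine co_eq_zero_of_eventually ?_
      filter_upwards [htt.eventually hEa, hball] with x h1 h2
      rw [← he x h2, h1]
    · intro i hia hib
      obtain ⟨F, hF, hF'⟩ := hEc i hia hib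
      have : e i = scale t F := ev_injective (by
        filter_upwards [htt.eventually hF', hball] with x h1 h2
        rw [← he x h2, h1, ev_scale h2 htn])
      intro α hα
      rw [this, co_scale htn, hF α hα, mul_zero]
    · refine ((hcmp b).const_mul_left μ⁻¹).congr' ?_ EventuallyEq.rfl
      filter_upwards [htt.eventually (hGt.eventually hEa), htt.eventually hEa, hball] with x h1 h2 h3
      simp only [Function.comp_apply, Pi.add_apply, swapV, Equiv.swap_apply_right, sc, if_true,
        Equiv.swap_apply_left]
      rw [h1, zero_add, he x h3, inv_mul_cancel_left₀ hμ0]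
    · intro i hia hib
      refine (hcmp i).congr' ?_ EventuallyEq.rfl
      filter_upwards [hball, hGt1t.eventually hball] with x h1 h2
      simp only [Function.comp_apply, Pi.add_apply]
      rw [← he x h1, ← he _ h2, ← hGt']
      simp [swapV, sc, Equiv.swap_apply_of_ne_of_ne hia hib, hia, hib]
  have hEzero : ∀ᶠ x in 𝓝 (0 : ι → ℂ), E x = 0 := by
    filter_upwards [htt'.eventually hball] with x hx
    funext i
    have := he _ hx i
    rwa [smul_inv_smul₀ htc, hzero, ev_zero'] at this
  refine ⟨fun x => (s : ℂ) • Ψ x, hΨan.fun_const_smul, by simp only [hΨ0, smul_zero],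
    ⟨s, hsc, hΨ'.const_smul (s : ℂ)⟩, q, hq1, hp.supp_q, hq0, ?_, ?_⟩
  · filter_upwards [hEzero] with x hx
    have h1 : Ψ (S x) = σs (Ψ x) := sub_eq_zero.1 hx
    change _ = (s : ℂ) • Ψ (S x)
    rw [h1]
    simp only [σs, smul_inv_smul₀ hsc]
  · filter_upwards [hball] with x hx
    rw [hΨsw x hx]; rfl

end normalForm

end Wiener

namespace Wiener

theorem eventually_norm_le_one {ι : Type*} [Fintype ι] : ∀ᶠ x in 𝓝 (0 : ι → ℂ), ‖x‖ ≤ 1 := by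
  filter_upwards [Metric.closedBall_mem_nhds (0 : ι → ℂ) one_pos] with x hx
  simpa using hx

section multiplier

variable {ι : Type*} [Fintype ι] [DecidableEq ι]

/-- The series `q` is the inverse of a hyperbolic multiplier. -/
structure IsMult (a b : ι) (μ : ℂ) (q : Wiener ι) : Prop where
  norm_lt : ‖q‖ < 1
  supp : SuppIn {α | wt a b α = 0} q
  val : ev 0 q = μ⁻¹

/-- The map `(x_a, x_b) ↦ (q⁻¹ x_a, q x_b)`. -/
noncomputable def smap (a b : ι) (q : Wiener ι) (x : ι → ℂ) : ι → ℂ := sc a b (ev x q)⁻¹ x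

/-- The component of weight `l`. -/
noncomputable def wtPart (a b : ι) (l : ℤ) (f : Wiener ι) : Wiener ι :=
  ofCo (fun α => if wt a b α = l then f.co α else 0) (Summable.of_nonneg_of_le
    (fun _ => norm_nonneg _) (fun α => by split_ifs <;> simp) (summable f))

variable {a b : ι} {μ : ℂ} {q : Wiener ι}

theorem suppIn_wtPart (l : ℤ) (f : Wiener ι) : SuppIn {α | wt a b α = l} (wtPart a b l f) :=
  fun _ hα => if_neg hα

theorem co_sub_wtPart (l : ℤ) (f : Wiener ι) {α : ι →₀ ℕ} (hα : wt a b α = l) :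
    (f - wtPart a b l f).co α = 0 := by
  rw [co_sub, wtPart, co_ofCo, if_pos hα, sub_self]

theorem IsMult.scale (h : IsMult a b μ q) {t : ℝ} (ht0 : 0 < t) (ht : t ≤ 1) :
    IsMult a b μ (scale (t : ℂ) q) := by
  have htn : ‖(t : ℂ)‖ ≤ 1 := by rw [Complex.norm_real, Real.norm_of_nonneg ht0.le]; exact ht
  refine ⟨lt_of_le_of_lt (norm_comp_le (norm_smul_X_le htn) q) h.norm_lt, fun α hα => ?_, ?_⟩
  · rw [co_scale htn, h.supp α hα, mul_zero]
  · rw [ev_scale (by simp) htn, smul_zero, h.val]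

theorem smap_smul {t : ℝ} (ht0 : 0 < t) (ht : t ≤ 1) (q : Wiener ι) {x : ι → ℂ} (hx : ‖x‖ ≤ 1) :
    smap a b q ((t : ℂ) • x) = (t : ℂ) • smap a b (Wiener.scale (t : ℂ) q) x := by
  have htn : ‖(t : ℂ)‖ ≤ 1 := by rw [Complex.norm_real, Real.norm_of_nonneg ht0.le]; exact ht
  funext i
  simp only [smap, ev_scale hx htn, sc, Pi.smul_apply, smul_eq_mul]
  split_ifs <;> ring

namespace IsMult

theorem ev_ne_zero (h : IsMult a b μ q) (hμ : μ ≠ 0) : ev 0 q ≠ 0 := by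
  rw [h.val]; exact inv_ne_zero hμ

theorem analyticAt_inv (h : IsMult a b μ q) (hμ : μ ≠ 0) : AnalyticAt ℂ (fun x => (ev x q)⁻¹) 0 :=
  (analyticAt_ev q).inv (h.ev_ne_zero hμ)

theorem analyticAt_smap (h : IsMult a b μ q) (hμ : μ ≠ 0) : AnalyticAt ℂ (smap a b q) 0 :=
  analyticAt_sc (h.analyticAt_inv hμ) (inv_ne_zero (h.ev_ne_zero hμ))

theorem smap_zero (q : Wiener ι) : smap a b q 0 = 0 := by
  funext i; simp [smap, sc]

theorem eventually_good (h : IsMult a b μ q) (hμ : μ ≠ 0) : ∀ᶠ x in 𝓝 (0 : ι → ℂ),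
    ‖x‖ ≤ 1 ∧ ev x q ≠ 0 ∧ ‖smap a b q x‖ ≤ 1 := by
  filter_upwards [eventually_norm_le_one,
    (analyticAt_ev q).continuousAt.eventually_ne (h.ev_ne_zero hμ),
    ((h.analyticAt_smap hμ).tendsto_zero (smap_zero q)).eventually eventually_norm_le_one]
    with x h1 h2 h3 using ⟨h1, h2, h3⟩

theorem ev_smap_of_wt (hab : a ≠ b) {l : ℤ} {f : Wiener ι} (hf : SuppIn {α | wt a b α = l} f)
    {x : ι → ℂ} (hx : ev x q ≠ 0) : ev (smap a b q x) f = (ev x q)⁻¹ ^ l * ev x f := by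
  change _ = _ * lift (pw x) f
  rw [smap, ev_sc hab (inv_ne_zero hx), ← lift_mul_left_const]
  refine lift_congr fun α hα => ?_
  rw [show wt a b α = l from hf.mem hα]

theorem eq_zero_of_smap (h : IsMult a b μ q) (hab : a ≠ b) (hμ : 1 < ‖μ‖) {l : ℤ}
    {m' : (ι → ℂ) → ℂ} (hm' : ContinuousAt m' 0) (hm'0 : m' 0 = μ ^ l) {N G : Wiener ι}
    (hN : ∀ α, wt a b α = l → N.co α = 0) (hG : SuppIn {α | wt a b α = l} G)
    (hNG : ∀ᶠ x in 𝓝 (0 : ι → ℂ), ev (smap a b q x) N - m' x * ev x N = ev x G) : N = 0 := by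
  have hμ0 : μ ≠ 0 := by rintro rfl; simp at hμ; linarith
  exact eq_zero_of_twisted hab hμ (m := fun x => (ev x q)⁻¹)
    (h.analyticAt_inv hμ0).differentiableAt (by rw [h.val, inv_inv]) hm' hm'0 hN hG hNG

theorem suppIn_of_invariant (h : IsMult a b μ q) (hab : a ≠ b) (hμ : 1 < ‖μ‖) {f : Wiener ι}
    (hf : ∀ᶠ x in 𝓝 (0 : ι → ℂ), ev (smap a b q x) f = ev x f) :
    SuppIn {α | wt a b α = 0} f := by
  have hμ0 : μ ≠ 0 := by rintro rfl; simp at hμ; linarith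
  have h0 : f - wtPart a b 0 f = 0 := by
    refine h.eq_zero_of_smap hab hμ (l := 0) (m' := fun _ => 1) (G := 0) continuousAt_const
      (by simp) (fun α hα => co_sub_wtPart 0 f hα) (fun _ _ => co_zero _) ?_
    filter_upwards [hf, h.eventually_good hμ0] with x h1 ⟨h2, h3, h4⟩
    rw [ev_sub h4, ev_sub h2, h1, ev_smap_of_wt hab (suppIn_wtPart 0 f) h3, ev_zero']; simp
  rw [sub_eq_zero.1 h0]; exact suppIn_wtPart 0 f

/-- A semi-invariant series whose factor starts with `μ ^ l` has weight `l`. -/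
theorem suppIn_of_semiinvariant (h : IsMult a b μ q) (hab : a ≠ b) (hμ : 1 < ‖μ‖) {l : ℤ}
    {f k : Wiener ι} (hk : ∀ᶠ x in 𝓝 (0 : ι → ℂ), ev (smap a b q x) k = ev x k)
    (hk0 : ev 0 k = 0)
    (hf : ∀ᶠ x in 𝓝 (0 : ι → ℂ), ev (smap a b q x) f = ((ev x q)⁻¹ ^ l + ev x k) * ev x f) :
    SuppIn {α | wt a b α = l} f ∧ k * f = 0 := by
  have hμ0 : μ ≠ 0 := by rintro rfl; simp at hμ; linarith
  have hk' := h.suppIn_of_invariant hab hμ hk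
  have hw := suppIn_wtPart (a := a) (b := b) l f
  have hq := h.ev_ne_zero hμ0
  have hkf : SuppIn {α | wt a b α = l} (k * wtPart a b l f) :=
    hk'.mul hw fun α hα β hβ => by
      simp only [Set.mem_ofPred_eq, wt_add] at *; omega
  have h0 : f - wtPart a b l f = 0 := by
    refine h.eq_zero_of_smap hab hμ (l := l) (m' := fun x => (ev x q)⁻¹ ^ l + ev x k)
      (G := k * wtPart a b l f) ?_ (by rw [hk0, h.val, inv_inv, add_zero])
      (fun α hα => co_sub_wtPart l f hα) hkf ?_
    · exact (((h.analyticAt_inv hμ0).continuousAt).zpow₀ l (Or.inl (inv_ne_zero hq))).add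
        (analyticAt_ev k).continuousAt
    · filter_upwards [hf, h.eventually_good hμ0] with x h1 ⟨h2, h3, h4⟩
      rw [ev_sub h4, ev_sub h2, h1, ev_smap_of_wt hab hw h3, ev_mul h2]; ring
  have hf' : SuppIn {α | wt a b α = l} f := by rw [sub_eq_zero.1 h0]; exact hw
  refine ⟨hf', co_eq_zero_of_eventually ?_⟩
  filter_upwards [hf, h.eventually_good hμ0] with x h1 ⟨h2, h3, h4⟩
  rw [ev_smap_of_wt hab hf' h3] at h1
  rw [ev_mul h2]; linear_combination -h1

theorem coboundary_eq_zero (h : IsMult a b μ q) (hab : a ≠ b) (hμ : 1 < ‖μ‖) {f g : Wiener ι}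
    (hg : ∀ᶠ x in 𝓝 (0 : ι → ℂ), ev (smap a b q x) g = ev x g)
    (hf : ∀ᶠ x in 𝓝 (0 : ι → ℂ), ev (smap a b q x) f - ev x f = ev x g) : g = 0 := by
  have hμ0 : μ ≠ 0 := by rintro rfl; simp at hμ; linarith
  have h0 : f - wtPart a b 0 f = 0 := by
    refine h.eq_zero_of_smap hab hμ (l := 0) (m' := fun _ => 1) (G := g) continuousAt_const
      (by simp) (fun α hα => co_sub_wtPart 0 f hα) (h.suppIn_of_invariant hab hμ hg) ?_
    filter_upwards [hf, h.eventually_good hμ0] with x h1 ⟨h2, h3, h4⟩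
    rw [ev_sub h4, ev_sub h2, ← h1, ev_smap_of_wt hab (suppIn_wtPart 0 f) h3]; simp
  refine co_eq_zero_of_eventually ?_
  filter_upwards [hf, h.eventually_good hμ0] with x h1 ⟨h2, h3, h4⟩
  rw [← h1, sub_eq_zero.1 h0, ev_smap_of_wt hab (suppIn_wtPart 0 f) h3]; simp

/-- The multipliers solving the cohomological equation. -/
noncomputable def solM (q : Wiener ι) (k : ℤ) : Wiener ι :=
  if k = 0 then 0 else if 0 < k then q ^ k.natAbs * Ring.inverse (1 - q ^ k.natAbs)
  else -Ring.inverse (1 - q ^ k.natAbs)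

theorem norm_inverse_le (hq : ‖q‖ < 1) {n : ℕ} (hn : n ≠ 0) :
    IsUnit (1 - q ^ n) ∧ ‖Ring.inverse (1 - q ^ n)‖ ≤ (1 - ‖q‖)⁻¹ := by
  have h1 : ‖q ^ n‖ ≤ ‖q‖ := (norm_pow_le _ _).trans (pow_le_of_le_one (norm_nonneg _) hq.le hn)
  have h2 : ‖q ^ n‖ < 1 := h1.trans_lt hq
  refine ⟨isUnit_one_sub_of_norm_lt_one h2, ?_⟩
  rw [NormedRing.inverse_one_sub _ h2, Units.oneSub]
  refine (tsum_geometric_le_of_norm_lt_one (q ^ n) h2).trans ?_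
  rw [norm_one, sub_self, zero_add]
  gcongr

theorem norm_solM_le (hq : ‖q‖ < 1) (k : ℤ) : ‖solM q k‖ ≤ (1 - ‖q‖)⁻¹ := by
  have h0 : 0 ≤ (1 - ‖q‖)⁻¹ := inv_nonneg.2 (by linarith)
  unfold solM; split_ifs with h1 h2
  · simpa using h0
  · refine (norm_mul_le _ _).trans ?_
    rw [← one_mul (1 - ‖q‖)⁻¹]
    exact mul_le_mul ((norm_pow_le _ _).trans (pow_le_one₀ (norm_nonneg _) hq.le))
      (norm_inverse_le hq (by omega)).2 (norm_nonneg _) zero_le_one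
  · rw [norm_neg]; exact (norm_inverse_le hq (by omega)).2

theorem ev_solM (hq : ‖q‖ < 1) {x : ι → ℂ} (hx : ‖x‖ ≤ 1) (hqx : ev x q ≠ 0) {k : ℤ} (hk : k ≠ 0) :
    ev x (solM q k) * ((ev x q)⁻¹ ^ k - 1) = 1 := by
  have hk' : k.natAbs ≠ 0 := by omega
  have h1 : ev x (Ring.inverse (1 - q ^ k.natAbs)) * (1 - ev x q ^ k.natAbs) = 1 := by
    have h2 := congrArg (ev x) (Ring.inverse_mul_cancel _ (norm_inverse_le hq hk').1)
    rwa [ev_mul hx, ev_sub hx, ev_one, ev_pow hx] at h2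
  have hp : ev x q ^ k.natAbs ≠ 0 := pow_ne_zero _ hqx
  rw [solM, if_neg hk]
  split_ifs with h
  · have h3 : (ev x q)⁻¹ ^ k = (ev x q ^ k.natAbs)⁻¹ := by
      conv_lhs => rw [show k = (k.natAbs : ℤ) by omega]
      rw [zpow_natCast, inv_pow]
    rw [ev_mul hx, ev_pow hx, h3]
    field_simp
    linear_combination h1
  · have h3 : (ev x q)⁻¹ ^ k = ev x q ^ k.natAbs := by
      conv_lhs => rw [show k = -(k.natAbs : ℤ) by omega]
      rw [inv_zpow', neg_neg, zpow_natCast]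
    rw [ev_neg, h3]
    linear_combination h1

theorem ev_smap_solM (h : IsMult a b μ q) (hab : a ≠ b) (hμ : 1 < ‖μ‖) (k : ℤ) :
    SuppIn {α | wt a b α = 0} (solM q k) := by
  have hμ0 : μ ≠ 0 := by rintro rfl; simp at hμ; linarith
  by_cases hk : k = 0
  · rw [solM, if_pos hk]; exact fun _ _ => co_zero _
  refine h.suppIn_of_invariant hab hμ ?_
  have hgood := h.eventually_good hμ0
  filter_upwards [hgood, ((h.analyticAt_smap hμ0).tendsto_zero (smap_zero q)).eventually hgood]
    with x ⟨h1, h2, h3⟩ ⟨h4, h5, h6⟩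
  have e1 := ev_solM h.norm_lt h1 h2 hk
  have e2 := ev_solM h.norm_lt h4 h5 hk
  rw [ev_smap_of_wt hab h.supp h2, zpow_zero, one_mul] at e2
  exact mul_right_cancel₀ (right_ne_zero_of_mul (e1.trans_ne one_ne_zero)) (e2.trans e1.symm)

/-- Every series is the sum of an invariant one and a coboundary. -/
theorem exists_coboundary (h : IsMult a b μ q) (hab : a ≠ b) (hμ : 1 < ‖μ‖) (f : Wiener ι) :
    ∃ g k : Wiener ι, SuppIn {α | wt a b α = 0} g ∧ ∀ᶠ x in 𝓝 (0 : ι → ℂ),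
      ev x f = ev x g + (ev (smap a b q x) k - ev x k) := by
  have hμ0 : μ ≠ 0 := by rintro rfl; simp at hμ; linarith
  have hb : ∀ α : ι →₀ ℕ, ‖solM q (wt a b α) * mono α‖ ≤ (1 - ‖q‖)⁻¹ := fun α =>
    (norm_mul_le _ _).trans (by rw [norm_mono, mul_one]; exact norm_solM_le h.norm_lt _)
  refine ⟨wtPart a b 0 f, lift (fun α => solM q (wt a b α) * mono α) f, suppIn_wtPart 0 f, ?_⟩
  filter_upwards [h.eventually_good hμ0] with x ⟨h1, h2, h3⟩
  have hbx : ∀ y : ι → ℂ, ‖y‖ ≤ 1 → ∀ α, ‖ev y (solM q (wt a b α) * mono α)‖ ≤ (1 - ‖q‖)⁻¹ :=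
    fun y hy α => (norm_ev_le hy _).trans (hb α)
  have hpart : ev x (wtPart a b 0 f) = ∑' α, f.co α • if wt a b α = 0 then pw x α else 0 := by
    refine tsum_congr fun α => ?_
    rw [wtPart, co_ofCo]; split_ifs <;> simp
  have hpb : ∀ α, ‖if wt a b α = 0 then pw x α else 0‖ ≤ 1 := fun α => by
    split_ifs
    · exact pw_le h1 α
    · simp
  rw [ev_lift h3 hb, ev_lift h1 hb, hpart, ev, lift, lift, lift,
    ← (lift_summable (hbx _ h3) f).tsum_sub (lift_summable (hbx _ h1) f),
    ← (lift_summable hpb f).tsum_add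
      ((lift_summable (hbx _ h3) f).sub (lift_summable (hbx _ h1) f))]
  refine tsum_congr fun α => ?_
  rw [← smul_sub, ← smul_add, ev_mul h3, ev_mul h1,
    ev_smap_of_wt hab (h.ev_smap_solM hab hμ _) h2, zpow_zero, one_mul,
    ev_smap_of_wt hab (suppIn_mono (S := {β | wt a b β = wt a b α}) rfl) h2]
  congr 1
  by_cases hk : wt a b α = 0
  · rw [if_pos hk, hk, solM, if_pos rfl, ev_zero', ev_mono]; simp
  · rw [if_neg hk, ev_mono]
    linear_combination -pw x α * ev_solM h.norm_lt h1 h2 hk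

end IsMult

/-- A series of weight one is divisible by `X a`. -/
theorem ev_eq_mul_divX {f : Wiener ι} (hf : SuppIn {α | wt a b α = 1} f) {x : ι → ℂ}
    (hx : ‖x‖ ≤ 1) : ev x f = x a * ev x (divX a b f) := by
  rw [ev_divX hx]
  refine lift_congr fun α hα => ?_
  rw [if_pos (show wt a b α = 1 from hf.mem hα), one_mul]

theorem suppIn_divX_zero (hab : a ≠ b) (f : Wiener ι) :
    SuppIn {α | wt a b α = 0} (divX a b f) := by
  refine suppIn_lift norm_divX_fam fun α _ => ?_
  by_cases h : wt a b α = 1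
  · rw [if_pos h]
    refine suppIn_mono ?_
    have : 1 ≤ α a := by simp only [wt] at h; omega
    simp only [wt, Set.mem_ofPred_eq, Finsupp.tsub_apply, Finsupp.single_eq_same,
      Finsupp.single_eq_of_ne hab.symm] at *
    omega
  · rw [if_neg h]; exact fun _ _ => co_zero _

theorem wt_symm (α : ι →₀ ℕ) : wt b a α = - wt a b α := by simp [wt]

end multiplier

end Wiener

section locMaps

variable {V W U : Type*} [NormedAddCommGroup V] [NormedSpace ℂ V] [NormedAddCommGroup W]
  [NormedSpace ℂ W] [NormedAddCommGroup U] [NormedSpace ℂ U]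

/-- `φ` represents a germ of holomorphic map preserving the origin. -/
def IsLoc (φ : V → W) : Prop := AnalyticAt ℂ φ 0 ∧ φ 0 = 0

theorem IsLoc.tendsto {φ : V → W} (h : IsLoc φ) : Tendsto φ (𝓝 0) (𝓝 0) := h.1.tendsto_zero h.2

theorem IsLoc.comp {φ : W → U} {ψ : V → W} (hφ : IsLoc φ) (hψ : IsLoc ψ) : IsLoc (φ ∘ ψ) :=
  ⟨AnalyticAt.comp (hψ.2.symm ▸ hφ.1) hψ.1, by simp [hψ.2, hφ.2]⟩

theorem AnalyticAt.comp_isLoc {f : W → U} {φ : V → W} (hf : AnalyticAt ℂ f 0) (hφ : IsLoc φ) :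
    AnalyticAt ℂ (f ∘ φ) 0 :=
  AnalyticAt.comp (hφ.2.symm ▸ hf) hφ.1

theorem ContinuousLinearMap.isLoc (L : V →L[ℂ] W) : IsLoc L := ⟨L.analyticAt 0, map_zero L⟩

theorem ContinuousLinearEquiv.isLoc (L : V ≃L[ℂ] W) : IsLoc L :=
  (L : V →L[ℂ] W).isLoc

theorem isLoc_id : IsLoc (id : V → V) := (ContinuousLinearMap.id ℂ V).isLoc

theorem HasFDerivAt.comp_isLoc {φ : W → U} {ψ : V → W} {A : W →L[ℂ] U} {B : V →L[ℂ] W}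
    (hφ : HasFDerivAt φ A 0) (hψ : HasFDerivAt ψ B 0) (h0 : ψ 0 = 0) :
    HasFDerivAt (φ ∘ ψ) (A.comp B) 0 :=
  HasFDerivAt.comp 0 (h0.symm ▸ hφ) hψ

/-- The two maps are inverse germs of biholomorphisms. -/
structure IsInv (φ : V → W) (ψ : W → V) : Prop where
  loc : IsLoc φ
  loc' : IsLoc ψ
  left : ψ ∘ φ =ᶠ[𝓝 0] id
  right : φ ∘ ψ =ᶠ[𝓝 0] id

theorem IsInv.symm {φ : V → W} {ψ : W → V} (h : IsInv φ ψ) : IsInv ψ φ :=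
  ⟨h.loc', h.loc, h.right, h.left⟩

theorem ContinuousLinearEquiv.isInv (L : V ≃L[ℂ] W) : IsInv L L.symm :=
  ⟨L.isLoc, L.symm.isLoc, Eventually.of_forall fun x => L.symm_apply_apply x,
    Eventually.of_forall fun x => L.apply_symm_apply x⟩

theorem IsInv.comp {φ : V → W} {φ' : W → V} {ψ : W → U} {ψ' : U → W} (hψ : IsInv ψ ψ')
    (hφ : IsInv φ φ') : IsInv (ψ ∘ φ) (φ' ∘ ψ') := by
  refine ⟨hψ.loc.comp hφ.loc, hφ.loc'.comp hψ.loc', ?_, ?_⟩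
  · filter_upwards [hφ.left, hφ.loc.tendsto.eventually hψ.left] with x h1 h2
    simp only [Function.comp_apply, id_eq] at *
    rw [h2, h1]
  · filter_upwards [hψ.right, hψ.loc'.tendsto.eventually hφ.right] with x h1 h2
    simp only [Function.comp_apply, id_eq] at *
    rw [h2, h1]

theorem exists_isInv [CompleteSpace V] [CompleteSpace W] {φ : V → W} (hφ : IsLoc φ) {A : V ≃L[ℂ] W}
    (hA : HasFDerivAt φ (A : V →L[ℂ] W) 0) :
    ∃ ψ : W → V, IsInv φ ψ ∧ HasFDerivAt ψ (A.symm : W →L[ℂ] V) 0 := by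
  have hs : HasStrictFDerivAt φ (A : V →L[ℂ] W) 0 := by
    have := hφ.1.hasStrictFDerivAt
    rwa [hA.fderiv] at this
  have han : AnalyticAt ℂ (hs.localInverse φ A 0) (φ 0) :=
    (hs.toOpenPartialHomeomorph φ).analyticAt_symm' (i := A) hs.mem_toOpenPartialHomeomorph_source
      hφ.1 hA.fderiv
  have h1 := hs.eventually_left_inverse
  have h2 := hs.eventually_right_inverse
  have h3 := hs.to_localInverse
  rw [hφ.2] at han h2 h3
  refine ⟨hs.localInverse φ A 0, ⟨hφ, ⟨han, ?_⟩, h1, h2⟩, h3.hasFDerivAt⟩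
  have := h1.self_of_nhds
  rwa [hφ.2] at this

end locMaps

section germRing

variable (V : Type*) {W U : Type*} [NormedAddCommGroup V] [NormedSpace ℂ V] [NormedAddCommGroup W]
  [NormedSpace ℂ W] [NormedAddCommGroup U] [NormedSpace ℂ U]

/-- The ring of germs at the origin of holomorphic functions. -/
def anGerm : Subring (Germ (𝓝 (0 : V)) ℂ) where
  carrier := {g | ∃ f : V → ℂ, AnalyticAt ℂ f 0 ∧ (f : Germ (𝓝 (0 : V)) ℂ) = g}
  mul_mem' := by
    rintro _ _ ⟨f, hf, rfl⟩ ⟨g, hg, rfl⟩; exact ⟨f * g, hf.mul hg, rfl⟩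
  one_mem' := ⟨1, analyticAt_const, rfl⟩
  add_mem' := by
    rintro _ _ ⟨f, hf, rfl⟩ ⟨g, hg, rfl⟩; exact ⟨f + g, hf.add hg, rfl⟩
  zero_mem' := ⟨0, analyticAt_const, rfl⟩
  neg_mem' := by
    rintro _ ⟨f, hf, rfl⟩; exact ⟨-f, hf.neg, rfl⟩

/-- The ring of germs at the origin of holomorphic functions, as a type. -/
abbrev AGerm : Type _ := anGerm V

variable {V}

namespace AGerm

/-- The germ of a holomorphic function. -/
def mk (f : V → ℂ) (hf : AnalyticAt ℂ f 0) : AGerm V := ⟨f, f, hf, rfl⟩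

theorem mk_eq_mk {f g : V → ℂ} {hf : AnalyticAt ℂ f 0} {hg : AnalyticAt ℂ g 0} :
    mk f hf = mk g hg ↔ f =ᶠ[𝓝 0] g :=
  Subtype.ext_iff.trans Germ.coe_eq

/-- A representative of a germ. -/
noncomputable def rep (x : AGerm V) : V → ℂ := x.2.choose

theorem analyticAt_rep (x : AGerm V) : AnalyticAt ℂ x.rep 0 := x.2.choose_spec.1

theorem mk_rep (x : AGerm V) : mk x.rep x.analyticAt_rep = x := Subtype.ext x.2.choose_spec.2

theorem rep_mk (f : V → ℂ) (hf : AnalyticAt ℂ f 0) : (mk f hf).rep =ᶠ[𝓝 0] f :=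
  mk_eq_mk.1 (mk_rep (mk f hf))

theorem ext_rep {x y : AGerm V} (h : x.rep =ᶠ[𝓝 0] y.rep) : x = y := by
  rw [← mk_rep x, ← mk_rep y]; exact mk_eq_mk.2 h

theorem rep_add (x y : AGerm V) : (x + y).rep =ᶠ[𝓝 0] x.rep + y.rep := by
  conv_lhs => rw [← mk_rep x, ← mk_rep y]
  exact rep_mk _ (x.analyticAt_rep.add y.analyticAt_rep)

theorem rep_mul (x y : AGerm V) : (x * y).rep =ᶠ[𝓝 0] x.rep * y.rep := by
  conv_lhs => rw [← mk_rep x, ← mk_rep y]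
  exact rep_mk _ (x.analyticAt_rep.mul y.analyticAt_rep)

theorem rep_sub (x y : AGerm V) : (x - y).rep =ᶠ[𝓝 0] x.rep - y.rep := by
  conv_lhs => rw [← mk_rep x, ← mk_rep y]
  exact rep_mk _ (x.analyticAt_rep.sub y.analyticAt_rep)

theorem rep_zero : (0 : AGerm V).rep =ᶠ[𝓝 0] 0 := rep_mk _ (analyticAt_const (v := (0 : ℂ)))

theorem rep_one : (1 : AGerm V).rep =ᶠ[𝓝 0] 1 := rep_mk _ (analyticAt_const (v := (1 : ℂ)))

/-- The value at the origin. -/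
noncomputable def val : AGerm V →+* ℂ := Germ.valueRingHom.comp (anGerm V).subtype

theorem val_mk (f : V → ℂ) (hf : AnalyticAt ℂ f 0) : val (mk f hf) = f 0 := rfl

theorem val_eq (x : AGerm V) : val x = x.rep 0 := by
  conv_lhs => rw [← mk_rep x]
  rfl

/-- The constant germs. -/
noncomputable def C : ℂ →+* AGerm V where
  toFun c := mk (fun _ => c) analyticAt_const
  map_one' := rfl
  map_zero' := rfl
  map_add' _ _ := rfl
  map_mul' _ _ := rfl

theorem val_C (c : ℂ) : val (C c : AGerm V) = c := rfl

/-- Composition with a germ of holomorphic map. -/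
noncomputable def pull (φ : V → W) (hφ : IsLoc φ) : AGerm W →+* AGerm V where
  toFun x := mk (x.rep ∘ φ) (x.analyticAt_rep.comp_isLoc hφ)
  map_one' := Subtype.ext (Germ.coe_eq.2 (rep_one.comp_tendsto hφ.tendsto))
  map_zero' := Subtype.ext (Germ.coe_eq.2 (rep_zero.comp_tendsto hφ.tendsto))
  map_add' x y := Subtype.ext (Germ.coe_eq.2 ((rep_add x y).comp_tendsto hφ.tendsto))
  map_mul' x y := Subtype.ext (Germ.coe_eq.2 ((rep_mul x y).comp_tendsto hφ.tendsto))

theorem pull_mk (φ : V → W) (hφ : IsLoc φ) (f : W → ℂ) (hf : AnalyticAt ℂ f 0) :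
    pull φ hφ (mk f hf) = mk (f ∘ φ) (hf.comp_isLoc hφ) :=
  Subtype.ext (Germ.coe_eq.2 ((rep_mk f hf).comp_tendsto hφ.tendsto))

theorem rep_pull (φ : V → W) (hφ : IsLoc φ) (x : AGerm W) :
    (pull φ hφ x).rep =ᶠ[𝓝 0] x.rep ∘ φ :=
  rep_mk _ (x.analyticAt_rep.comp_isLoc hφ)

theorem pull_pull {φ : V → W} (hφ : IsLoc φ) {ψ : W → U} (hψ : IsLoc ψ) (x : AGerm U) :
    pull φ hφ (pull ψ hψ x) = pull (ψ ∘ φ) (hψ.comp hφ) x := by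
  conv_lhs => rw [← mk_rep x]
  rw [pull_mk, pull_mk]; rfl

theorem pull_congr {φ ψ : V → W} (hφ : IsLoc φ) (hψ : IsLoc ψ) (h : φ =ᶠ[𝓝 0] ψ) :
    pull φ hφ = pull ψ hψ := by
  ext1 x
  refine Subtype.ext (Germ.coe_eq.2 ?_)
  filter_upwards [h] with y hy
  simp [hy]

theorem pull_id : pull (id : V → V) isLoc_id = RingHom.id _ := by
  ext1 x; exact mk_rep x

theorem val_pull (φ : V → W) (hφ : IsLoc φ) (x : AGerm W) : val (pull φ hφ x) = val x := by
  rw [val_eq x]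
  change x.rep (φ 0) = _
  rw [hφ.2]

theorem pull_C (φ : V → W) (hφ : IsLoc φ) (c : ℂ) : pull φ hφ (C c) = C c :=
  pull_mk φ hφ (fun _ => c) analyticAt_const

theorem IsInv.pull_left {φ : V → W} {ψ : W → V} (h : IsInv φ ψ) (x : AGerm V) :
    pull φ h.loc (pull ψ h.loc' x) = x := by
  rw [pull_pull, pull_congr _ isLoc_id h.left, pull_id]; rfl

/-- The derivative at the origin. -/
noncomputable def der (x : AGerm V) : V →L[ℂ] ℂ := fderiv ℂ x.rep 0

theorem der_mk {f : V → ℂ} (hf : AnalyticAt ℂ f 0) {A : V →L[ℂ] ℂ} (hA : HasFDerivAt f A 0) :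
    der (mk f hf) = A := by
  rw [der, (rep_mk f hf).fderiv_eq, hA.fderiv]

theorem hasFDerivAt_rep (x : AGerm V) : HasFDerivAt x.rep x.der 0 :=
  x.analyticAt_rep.differentiableAt.hasFDerivAt

theorem der_add (x y : AGerm V) : der (x + y) = der x + der y := by
  rw [der, (rep_add x y).fderiv_eq]
  exact (x.hasFDerivAt_rep.add y.hasFDerivAt_rep).fderiv

theorem der_sub (x y : AGerm V) : der (x - y) = der x - der y := by
  rw [der, (rep_sub x y).fderiv_eq]
  exact (x.hasFDerivAt_rep.sub y.hasFDerivAt_rep).fderiv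

theorem der_mul (x y : AGerm V) : der (x * y) = val x • der y + val y • der x := by
  rw [der, (rep_mul x y).fderiv_eq, val_eq, val_eq]
  exact (x.hasFDerivAt_rep.mul y.hasFDerivAt_rep).fderiv

theorem der_pull (φ : V → W) (hφ : IsLoc φ) {A : V →L[ℂ] W} (hA : HasFDerivAt φ A 0) (x : AGerm W) :
    der (pull φ hφ x) = (der x).comp A := by
  rw [der, (rep_pull φ hφ x).fderiv_eq]
  exact (x.hasFDerivAt_rep.comp_isLoc hA hφ.2).fderiv

theorem isUnit_of_val_ne_zero {x : AGerm V} (h : val x ≠ 0) : IsUnit x := by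
  rw [val_eq] at h
  have hi : AnalyticAt ℂ (fun y => (x.rep y)⁻¹) 0 := x.analyticAt_rep.inv h
  refine IsUnit.of_mul_eq_one (mk _ hi) (ext_rep ?_)
  filter_upwards [rep_mul x (mk _ hi), rep_one (V := V), rep_mk _ hi,
    x.analyticAt_rep.continuousAt.eventually_ne h] with y h1 h2 h3 h4
  rw [h1, h2, Pi.mul_apply, h3]
  exact mul_inv_cancel₀ h4

theorem exists_sqrt {x : AGerm V} {r : ℂ} (hr : r ≠ 0) (h : val x = r ^ 2) :
    ∃ y : AGerm V, y ^ 2 = x ∧ val y = r := by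
  have h1 : AnalyticAt ℂ (fun y => x.rep y / r ^ 2) 0 := x.analyticAt_rep.div_const
  have h2 : x.rep 0 / r ^ 2 = 1 := by rw [← val_eq, h, div_self (pow_ne_zero 2 hr)]
  have h3 : AnalyticAt ℂ (fun y => r * Complex.exp (1 / 2 * Complex.log (x.rep y / r ^ 2))) 0 :=
    analyticAt_const.mul ((analyticAt_const.mul (h1.clog (by rw [h2]; simp))).cexp)
  refine ⟨mk _ h3, ?_, by simp [val_mk, h2]⟩
  refine (sq _).trans (ext_rep ?_)
  have h4 : ∀ᶠ y in 𝓝 (0 : V), x.rep y / r ^ 2 ≠ 0 :=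
    h1.continuousAt.eventually_ne (by rw [h2]; exact one_ne_zero)
  filter_upwards [rep_mul (mk _ h3) (mk _ h3), rep_mk _ h3, h4] with y e1 e2 e3
  rw [e1, Pi.mul_apply, e2]
  calc _ = r ^ 2 * (Complex.exp (1 / 2 * Complex.log (x.rep y / r ^ 2)) *
        Complex.exp (1 / 2 * Complex.log (x.rep y / r ^ 2))) := by ring
    _ = r ^ 2 * (x.rep y / r ^ 2) := by
      rw [← Complex.exp_add, ← add_mul, add_halves, one_mul, Complex.exp_log e3]
    _ = _ := by field_simp

end AGerm

end germRing

namespace Wiener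

variable {ι : Type*} [Fintype ι]

theorem analyticAt_ev_inv_smul (a : Wiener ι) (t : ℂ) :
    AnalyticAt ℂ (fun x => ev (t • x) a) 0 :=
  (analyticAt_ev a).comp_isLoc (t • ContinuousLinearMap.id ℂ (ι → ℂ)).isLoc

/-- Complex conjugation of the coefficients. -/
noncomputable def conjCo (a : Wiener ι) : Wiener ι :=
  ofCo (fun α => conj (a.co α)) (by simpa using summable a)

theorem ev_conjCo (a : Wiener ι) (x : ι → ℂ) :
    ev x (conjCo a) = conj (ev (fun i => conj (x i)) a) := by
  rw [ev, lift, ev, lift, Complex.conj_tsum]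
  refine tsum_congr fun α => ?_
  rw [conjCo, co_ofCo, smul_eq_mul, smul_eq_mul, map_mul, map_pw]
  simp

end Wiener

theorem analyticAt_conj_conj {ι : Type*} [Fintype ι] {f : (ι → ℂ) → ℂ} (hf : AnalyticAt ℂ f 0) :
    AnalyticAt ℂ (fun x : ι → ℂ => conj (f fun i => conj (x i))) 0 := by
  obtain ⟨t, ht0, a, ha⟩ := Wiener.exists_ev_eq hf
  have htc : (t : ℂ) ≠ 0 := by exact_mod_cast ht0.ne'
  refine (Wiener.analyticAt_ev_inv_smul (Wiener.conjCo a) (t : ℂ)⁻¹).congr ?_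
  filter_upwards [(Wiener.tendsto_const_smul_zero (ι := ι) (t : ℂ)⁻¹).eventually
    Wiener.eventually_norm_le_one] with x hx
  rw [Wiener.ev_conjCo, ← ha]
  · congr 2
    funext i
    simp [htc]
  · refine (pi_norm_le_iff_of_nonneg zero_le_one).2 fun i => ?_
    rw [RCLike.norm_conj]
    exact (norm_le_pi_norm _ i).trans hx

theorem AGerm.isDomain_pi (ι : Type*) [Fintype ι] : IsDomain (AGerm (ι → ℂ)) := by
  have : Nontrivial (AGerm (ι → ℂ)) :=
    ⟨0, 1, fun h => by simpa using congrArg AGerm.val h⟩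
  have : NoZeroDivisors (AGerm (ι → ℂ)) := ⟨fun {x y} hxy => by
    obtain ⟨t, ⟨⟨a, ha⟩, ⟨b, hb⟩⟩, ht⟩ :=
      (((Wiener.eventually_exists_ev_eq x.analyticAt_rep).and
        (Wiener.eventually_exists_ev_eq y.analyticAt_rep)).and
        (self_mem_nhdsWithin (s := Set.Ioi 0))).exists
    have htc : (t : ℂ) ≠ 0 := by exact_mod_cast (ne_of_gt ht : t ≠ 0)
    have key : ∀ z : AGerm (ι → ℂ), ∀ c : Wiener ι,
        (∀ x : ι → ℂ, ‖x‖ ≤ 1 → z.rep ((t : ℂ) • x) = Wiener.ev x c) → c = 0 → z = 0 := by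
      rintro z c hc rfl
      refine AGerm.ext_rep ?_
      filter_upwards [AGerm.rep_zero, (Wiener.tendsto_const_smul_zero (ι := ι) (t : ℂ)⁻¹).eventually
        Wiener.eventually_norm_le_one] with w h1 h2
      have := hc _ h2
      rwa [smul_inv_smul₀ htc, Wiener.ev_zero', ← Pi.zero_apply (M := fun _ => ℂ) w, ← h1] at this
    have hab : a * b = 0 := by
      refine Wiener.co_eq_zero_of_eventually ?_
      have h1 : ∀ᶠ w in 𝓝 0, x.rep w * y.rep w = 0 := by
        filter_upwards [AGerm.rep_mul x y, AGerm.rep_zero (V := ι → ℂ)] with w h1 h2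
        rw [← Pi.mul_apply, ← h1, hxy, h2]; rfl
      filter_upwards [(Wiener.tendsto_const_smul_zero (ι := ι) (t : ℂ)).eventually h1,
        Wiener.eventually_norm_le_one] with w h1 h2
      rw [Wiener.ev_mul h2, ← ha w h2, ← hb w h2, h1]
    exact (mul_eq_zero.1 hab).imp (key x a ha) (key y b hb)⟩
  exact NoZeroDivisors.to_isDomain _

theorem AGerm.isDomain_of_equiv {V : Type*} [NormedAddCommGroup V] [NormedSpace ℂ V] {ι : Type*}
    [Fintype ι] (L : V ≃L[ℂ] (ι → ℂ)) : IsDomain (AGerm V) := by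
  have := AGerm.isDomain_pi ι
  refine Function.Injective.isDomain (AGerm.pull L.symm L.symm.isLoc) ?_
  exact Function.LeftInverse.injective (g := AGerm.pull L L.isLoc) fun x =>
    AGerm.IsInv.pull_left L.isInv x

open Wiener

/-- The properties of a reversible pair of germs that are used in the normalization: `s` and `t` are
the induced ring homomorphisms, `m` is the multiplier, `ξ` and `η` are the semi-invariants. -/
structure IsPair {V : Type*} [NormedAddCommGroup V] [NormedSpace ℂ V] (s t : AGerm V →+* AGerm V)
    (μ : ℂ) (m ξ η : AGerm V) (a b : V) : Prop where
  val_m : AGerm.val m = μ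
  inv_m : s m = m
  eig_fst : s ξ = m * ξ
  eig_snd : m * s η = η
  der_fst : AGerm.der ξ a ≠ 0
  der_snd : AGerm.der η b ≠ 0
  cob : ∀ f, ∃ g h, s g = g ∧ f = g + (s h - h)
  indep : ∀ g h, s g = g → g = s h - h → g = 0
  refl : ∀ f, s f = f → t f = f
  div_fst : ∀ f m', f ≠ 0 → s f = m' * f → s m' = m' → AGerm.val m' = μ →
    m' = m ∧ ∃ g, s g = g ∧ f = ξ * g
  div_snd : ∀ f m', f ≠ 0 → s f = m' * f → s m' = m' → AGerm.val m' * μ = 1 →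
    m' * m = 1 ∧ ∃ g, s g = g ∧ f = η * g

theorem IsPair.symm {V : Type*} [NormedAddCommGroup V] [NormedSpace ℂ V] {s t : AGerm V →+* AGerm V}
    {μ : ℂ} {m m' ξ η : AGerm V} {a b : V} (h : IsPair s t μ m ξ η a b) (hm : m * m' = 1) :
    IsPair s t μ⁻¹ m' η ξ b a := by
  have hv : μ * AGerm.val m' = 1 := by rw [← h.val_m, ← map_mul, hm, map_one]
  have hμ : μ ≠ 0 := left_ne_zero_of_mul_eq_one hv
  have hm' : s m' = m' := by
    have h1 := congrArg s hm
    rw [map_mul, h.inv_m, map_one] at h1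
    calc s m' = (m * m') * s m' := by rw [hm, one_mul]
      _ = m' * (m * s m') := by ring
      _ = m' := by rw [h1, mul_one]
  refine ⟨eq_inv_of_mul_eq_one_right hv, hm', ?_, ?_, h.der_snd, h.der_fst, h.cob, h.indep, h.refl,
    fun f n hf h1 h2 h3 => ?_, fun f n hf h1 h2 h3 => ?_⟩
  · calc s η = (m * m') * s η := by rw [hm, one_mul]
      _ = m' * (m * s η) := by ring
      _ = m' * η := by rw [h.eig_snd]
  · rw [h.eig_fst, ← mul_assoc, mul_comm m', hm, one_mul]
  · obtain ⟨h4, h5⟩ := h.div_snd f n hf h1 h2 (by rw [h3, inv_mul_cancel₀ hμ])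
    refine ⟨?_, h5⟩
    calc n = n * m * m' := by rw [mul_assoc, hm, mul_one]
      _ = m' := by rw [h4, one_mul]
  · obtain ⟨h4, h5⟩ := h.div_fst f n hf h1 h2 (by field_simp at h3; exact h3)
    exact ⟨by rw [h4, hm], h5⟩

section model

variable {ι : Type*} [Fintype ι]

/-- The series `A` represents the germ `f` in the coordinates scaled by `t`. -/
def IsRep (t : ℝ) (f : AGerm (ι → ℂ)) (A : Wiener ι) : Prop :=
  ∀ᶠ x in 𝓝 (0 : ι → ℂ), f.rep ((t : ℂ) • x) = ev x A

theorem eventually_exists_isRep (f : AGerm (ι → ℂ)) : ∀ᶠ t : ℝ in 𝓝[>] 0, ∃ A, IsRep t f A := by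
  filter_upwards [eventually_exists_ev_eq f.analyticAt_rep] with t ⟨A, hA⟩
  exact ⟨A, eventually_norm_le_one.mono hA⟩

theorem IsRep.of_ev {t : ℝ} (ht : t ≠ 0) (A : Wiener ι) :
    IsRep t (AGerm.mk _ (analyticAt_ev_inv_smul A (t : ℂ)⁻¹)) A := by
  have htc : (t : ℂ) ≠ 0 := by exact_mod_cast ht
  filter_upwards [(tendsto_const_smul_zero (ι := ι) (t : ℂ)).eventually
    (AGerm.rep_mk _ (analyticAt_ev_inv_smul A (t : ℂ)⁻¹))] with x hx
  rw [hx, inv_smul_smul₀ htc]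

theorem exists_isRep_of_ev {t : ℝ} (ht : t ≠ 0) (A : Wiener ι) : ∃ f, IsRep t f A :=
  ⟨_, IsRep.of_ev ht A⟩

theorem IsRep.unique {t : ℝ} (ht : t ≠ 0) {f g : AGerm (ι → ℂ)} {A : Wiener ι} (hf : IsRep t f A)
    (hg : IsRep t g A) : f = g := by
  have htc : (t : ℂ) ≠ 0 := by exact_mod_cast ht
  refine AGerm.ext_rep ?_
  filter_upwards [(tendsto_const_smul_zero (ι := ι) (t : ℂ)⁻¹).eventually (hf.and hg)]
    with x ⟨h1, h2⟩
  rw [smul_inv_smul₀ htc] at h1 h2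
  rw [h1, h2]

theorem IsRep.eq_series {t : ℝ} {f : AGerm (ι → ℂ)} {A B : Wiener ι} (hf : IsRep t f A)
    (hg : IsRep t f B) : A = B :=
  ev_injective (by filter_upwards [hf, hg] with x h1 h2; rw [← h1, h2])

theorem IsRep.add {t : ℝ} {f g : AGerm (ι → ℂ)} {A B : Wiener ι} (hf : IsRep t f A)
    (hg : IsRep t g B) : IsRep t (f + g) (A + B) := by
  filter_upwards [hf, hg, (tendsto_const_smul_zero (ι := ι) (t : ℂ)).eventually (AGerm.rep_add f g),
    eventually_norm_le_one] with x h1 h2 h3 h4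
  rw [h3, Pi.add_apply, h1, h2, ev_add h4]

theorem IsRep.sub {t : ℝ} {f g : AGerm (ι → ℂ)} {A B : Wiener ι} (hf : IsRep t f A)
    (hg : IsRep t g B) : IsRep t (f - g) (A - B) := by
  filter_upwards [hf, hg, (tendsto_const_smul_zero (ι := ι) (t : ℂ)).eventually (AGerm.rep_sub f g),
    eventually_norm_le_one] with x h1 h2 h3 h4
  rw [h3, Pi.sub_apply, h1, h2, ev_sub h4]

theorem IsRep.mul {t : ℝ} {f g : AGerm (ι → ℂ)} {A B : Wiener ι} (hf : IsRep t f A)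
    (hg : IsRep t g B) : IsRep t (f * g) (A * B) := by
  filter_upwards [hf, hg, (tendsto_const_smul_zero (ι := ι) (t : ℂ)).eventually (AGerm.rep_mul f g),
    eventually_norm_le_one] with x h1 h2 h3 h4
  rw [h3, Pi.mul_apply, h1, h2, ev_mul h4]

theorem IsRep.zero (t : ℝ) : IsRep t (0 : AGerm (ι → ℂ)) 0 := by
  filter_upwards [(tendsto_const_smul_zero (ι := ι) (t : ℂ)).eventually AGerm.rep_zero] with x h
  rw [h, ev_zero']; rfl

theorem IsRep.val {t : ℝ} {f : AGerm (ι → ℂ)} {A : Wiener ι} (hf : IsRep t f A) :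
    ev 0 A = AGerm.val f := by
  rw [AGerm.val_eq, ← hf.self_of_nhds, smul_zero]

theorem analyticAt_coord (i : ι) : AnalyticAt ℂ (fun x : ι → ℂ => x i) 0 :=
  (ContinuousLinearMap.proj (R := ℂ) (φ := fun _ : ι => ℂ) i).analyticAt 0

/-- The germ of a coordinate. -/
noncomputable def coordGerm (i : ι) : AGerm (ι → ℂ) :=
  AGerm.mk (fun x => x i) (analyticAt_coord i)

theorem rep_coordGerm (i : ι) : (coordGerm i).rep =ᶠ[𝓝 0] fun x => x i :=
  AGerm.rep_mk _ (analyticAt_coord i)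

theorem isRep_coordGerm (t : ℝ) (i : ι) : IsRep t (coordGerm i) ((t : ℂ) • X i) := by
  filter_upwards [(tendsto_const_smul_zero (ι := ι) (t : ℂ)).eventually (rep_coordGerm i)] with x h
  rw [h, ev_smul, ev_X]; rfl

theorem der_coordGerm (i : ι) (v : ι → ℂ) : AGerm.der (coordGerm i) v = v i := by
  have h : HasFDerivAt (fun x : ι → ℂ => x i)
      (ContinuousLinearMap.proj (R := ℂ) (φ := fun _ : ι => ℂ) i) 0 :=
    (ContinuousLinearMap.proj (R := ℂ) (φ := fun _ : ι => ℂ) i).hasFDerivAt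
  rw [coordGerm, AGerm.der_mk _ h]
  rfl

variable [DecidableEq ι] {a b : ι} {μ : ℂ} {q : Wiener ι}

theorem isLoc_swapV : IsLoc (swapV a b) := (swapL a b).isLoc

namespace Wiener.IsMult

theorem isLoc_smap (h : IsMult a b μ q) (hμ : μ ≠ 0) : IsLoc (smap a b q) :=
  ⟨h.analyticAt_smap hμ, smap_zero q⟩

theorem ev_of_isRep (h : IsMult a b μ q) (hμ : μ ≠ 0) {t : ℝ} (ht0 : 0 < t) (ht : t ≤ 1)
    {f : AGerm (ι → ℂ)} {A B : Wiener ι} (hf : IsRep t f A)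
    (hg : IsRep t (AGerm.pull (smap a b q) (h.isLoc_smap hμ) f) B) :
    ∀ᶠ x in 𝓝 (0 : ι → ℂ), ev (smap a b (Wiener.scale (t : ℂ) q) x) A = ev x B := by
  filter_upwards [hg, ((h.scale ht0 ht).isLoc_smap hμ).tendsto.eventually hf, eventually_norm_le_one,
    (tendsto_const_smul_zero (ι := ι) (t : ℂ)).eventually
      (AGerm.rep_pull _ (h.isLoc_smap hμ) f)] with x h1 h2 h3 h4
  rw [← h2, ← h1, h4, Function.comp_apply, smap_smul ht0 ht q h3]

theorem isRep_pull (h : IsMult a b μ q) (hμ : μ ≠ 0) {t : ℝ} (ht0 : 0 < t) (ht : t ≤ 1)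
    {f : AGerm (ι → ℂ)} {A B : Wiener ι} (hf : IsRep t f A)
    (hAB : ∀ᶠ x in 𝓝 (0 : ι → ℂ), ev (smap a b (Wiener.scale (t : ℂ) q) x) A = ev x B) :
    IsRep t (AGerm.pull (smap a b q) (h.isLoc_smap hμ) f) B := by
  filter_upwards [hAB, ((h.scale ht0 ht).isLoc_smap hμ).tendsto.eventually hf,
    eventually_norm_le_one, (tendsto_const_smul_zero (ι := ι) (t : ℂ)).eventually
      (AGerm.rep_pull _ (h.isLoc_smap hμ) f)] with x h1 h2 h3 h4
  rw [h4, Function.comp_apply, smap_smul ht0 ht q h3, h2, h1]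

theorem pull_eq_of_supp (h : IsMult a b μ q) (hab : a ≠ b) (hμ : μ ≠ 0) {t : ℝ} (ht0 : 0 < t)
    (ht : t ≤ 1) {f : AGerm (ι → ℂ)} {A : Wiener ι} (hf : IsRep t f A)
    (hA : SuppIn {α | wt a b α = 0} A) :
    AGerm.pull (smap a b q) (h.isLoc_smap hμ) f = f := by
  refine IsRep.unique ht0.ne' (h.isRep_pull hμ ht0 ht hf ?_) hf
  filter_upwards [(h.scale ht0 ht).eventually_good hμ] with x ⟨_, h2, _⟩
  rw [ev_smap_of_wt hab hA h2, zpow_zero, one_mul]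

theorem supp_of_pull_eq (h : IsMult a b μ q) (hab : a ≠ b) (hμ : 1 < ‖μ‖) (hμ0 : μ ≠ 0) {t : ℝ}
    (ht0 : 0 < t) (ht : t ≤ 1) {f : AGerm (ι → ℂ)} {A : Wiener ι} (hf : IsRep t f A)
    (hs : AGerm.pull (smap a b q) (h.isLoc_smap hμ0) f = f) : SuppIn {α | wt a b α = 0} A :=
  (h.scale ht0 ht).suppIn_of_invariant hab hμ (h.ev_of_isRep hμ0 ht0 ht hf (hs.symm ▸ hf))

/-- The germ of the multiplier. -/
noncomputable def multGerm (h : IsMult a b μ q) (hμ : μ ≠ 0) : AGerm (ι → ℂ) :=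
  AGerm.mk _ (h.analyticAt_inv hμ)

theorem rep_multGerm (h : IsMult a b μ q) (hμ : μ ≠ 0) {t : ℝ} (ht0 : 0 < t) (ht : t ≤ 1) :
    ∀ᶠ x in 𝓝 (0 : ι → ℂ),
      (h.multGerm hμ).rep ((t : ℂ) • x) = (ev x (Wiener.scale (t : ℂ) q))⁻¹ := by
  have htn : ‖(t : ℂ)‖ ≤ 1 := by rw [Complex.norm_real, Real.norm_of_nonneg ht0.le]; exact ht
  filter_upwards [(tendsto_const_smul_zero (ι := ι) (t : ℂ)).eventually
    (AGerm.rep_mk _ (h.analyticAt_inv hμ)), eventually_norm_le_one] with x h1 h2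
  rw [multGerm, h1, ev_scale h2 htn]

theorem pull_multGerm (h : IsMult a b μ q) (hab : a ≠ b) (hμ : μ ≠ 0) :
    AGerm.pull (smap a b q) (h.isLoc_smap hμ) (h.multGerm hμ) = h.multGerm hμ := by
  rw [multGerm, AGerm.pull_mk]
  refine Subtype.ext (Germ.coe_eq.2 ?_)
  filter_upwards [h.eventually_good hμ] with x ⟨_, h2, _⟩
  rw [Function.comp_apply, ev_smap_of_wt hab h.supp h2, zpow_zero, one_mul]

/-- Semi-invariants have a weight. -/
theorem weight_of_semiinvariant (h : IsMult a b μ q) (hab : a ≠ b) (hμ : 1 < ‖μ‖) (hμ0 : μ ≠ 0)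
    {l : ℤ} {f k M : AGerm (ι → ℂ)} (hf0 : f ≠ 0)
    (hk : AGerm.pull (smap a b q) (h.isLoc_smap hμ0) k = k) (hk0 : AGerm.val k = 0)
    (hM : ∀ᶠ x in 𝓝 0, M.rep x = (h.multGerm hμ0).rep x ^ l)
    (hf : AGerm.pull (smap a b q) (h.isLoc_smap hμ0) f = (M + k) * f) :
    k = 0 ∧ ∃ t : ℝ, 0 < t ∧ t ≤ 1 ∧ ∃ A, IsRep t f A ∧ SuppIn {α | wt a b α = l} A := by
  obtain ⟨t, ⟨⟨⟨A, hA⟩, ⟨K, hK⟩⟩, ⟨B, hB⟩⟩, ht0, ht⟩ := (((eventually_exists_isRep f).and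
    (eventually_exists_isRep k)).and (eventually_exists_isRep
      (AGerm.pull (smap a b q) (h.isLoc_smap hμ0) f))).and (Ioc_mem_nhdsGT (zero_lt_one' ℝ)) |>.exists
  have h1 := (h.scale ht0 ht).suppIn_of_semiinvariant hab hμ (l := l) (f := A) (k := K)
    (h.ev_of_isRep hμ0 ht0 ht hK (hk.symm ▸ hK)) (by rw [hK.val, hk0]) ?_
  · refine ⟨?_, t, ht0, ht, A, hA, h1.1⟩
    rcases mul_eq_zero.1 h1.2 with h2 | h2
    · rw [h2] at hK; exact hK.unique ht0.ne' (IsRep.zero t)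
    · rw [h2] at hA; exact absurd (hA.unique ht0.ne' (IsRep.zero t)) hf0
  · have hts := tendsto_const_smul_zero (ι := ι) (t : ℂ)
    filter_upwards [h.ev_of_isRep hμ0 ht0 ht hA hB, hB, hA, hK, h.rep_multGerm hμ0 ht0 ht,
      hts.eventually hM, hts.eventually (AGerm.rep_mul (M + k) f),
      hts.eventually (AGerm.rep_add M k)] with x e1 e2 e3 e4 e5 e6 e7 e8
    rw [e1, ← e2, hf, e7, Pi.mul_apply, e8, Pi.add_apply, e6, e5, e4, e3]

/-- The model pair. -/
theorem isPair (h : IsMult a b μ q) (hab : a ≠ b) (hμ : 1 < ‖μ‖) (hμ0 : μ ≠ 0) :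
    IsPair (AGerm.pull (smap a b q) (h.isLoc_smap hμ0)) (AGerm.pull (swapV a b) isLoc_swapV) μ
      (h.multGerm hμ0) (coordGerm a) (coordGerm b) (Pi.single a 1) (Pi.single b 1) := by
  have hval : AGerm.val (h.multGerm hμ0) = μ := by
    change (ev 0 q)⁻¹ = μ
    rw [h.val, inv_inv]
  have hts := fun t : ℝ => tendsto_const_smul_zero (ι := ι) (t : ℂ)
  refine ⟨hval, h.pull_multGerm hab hμ0, ?_, ?_, by simp [der_coordGerm], by simp [der_coordGerm],
    fun f => ?_, fun g f hg hgf => ?_, fun f hf => ?_, fun f m' hf h1 h2 h3 => ?_,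
    fun f m' hf h1 h2 h3 => ?_⟩
  · refine AGerm.ext_rep ?_
    filter_upwards [AGerm.rep_mul (h.multGerm hμ0) (coordGerm a),
      AGerm.rep_mk _ (h.analyticAt_inv hμ0), rep_coordGerm a,
      AGerm.rep_pull _ (h.isLoc_smap hμ0) (coordGerm a),
      (h.isLoc_smap hμ0).tendsto.eventually (rep_coordGerm a)] with x h1 h2 h3 h4 h5
    rw [h1, Pi.mul_apply, multGerm, h2, h3, h4, Function.comp_apply, h5]
    simp [smap, sc]
  · refine AGerm.ext_rep ?_
    filter_upwards [AGerm.rep_mul (h.multGerm hμ0)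
      (AGerm.pull (smap a b q) (h.isLoc_smap hμ0) (coordGerm b)),
      AGerm.rep_mk _ (h.analyticAt_inv hμ0), rep_coordGerm b,
      AGerm.rep_pull _ (h.isLoc_smap hμ0) (coordGerm b),
      (h.isLoc_smap hμ0).tendsto.eventually (rep_coordGerm b),
      h.eventually_good hμ0] with x h1 h2 h3 h4 h5 ⟨_, h6, _⟩
    rw [h1, Pi.mul_apply, h4, multGerm, h2, h3, Function.comp_apply, h5]
    simp [smap, sc, hab.symm, h6]
  · obtain ⟨t, ⟨A, hA⟩, ht0, ht⟩ := ((eventually_exists_isRep f).and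
      (Ioc_mem_nhdsGT (zero_lt_one' ℝ))).exists
    obtain ⟨G, K, hG, hGK⟩ := (h.scale ht0 ht).exists_coboundary hab hμ A
    obtain ⟨g, hg⟩ := exists_isRep_of_ev ht0.ne' G
    obtain ⟨k, hk⟩ := exists_isRep_of_ev ht0.ne' K
    refine ⟨g, k, h.pull_eq_of_supp hab hμ0 ht0 ht hg hG, ?_⟩
    have hd : IsRep t (AGerm.pull (smap a b q) (h.isLoc_smap hμ0) k) (A - G + K) := by
      refine h.isRep_pull hμ0 ht0 ht hk ?_
      filter_upwards [hGK, eventually_norm_le_one] with x h1 h2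
      rw [ev_add h2, ev_sub h2, h1]; ring
    refine hA.unique ht0.ne' ?_
    have := hg.add (hd.sub hk)
    rwa [show G + (A - G + K - K) = A by ring] at this
  · obtain ⟨t, ⟨⟨A, hA⟩, ⟨G, hG⟩⟩, ht0, ht⟩ := (((eventually_exists_isRep f).and
      (eventually_exists_isRep g)).and (Ioc_mem_nhdsGT (zero_lt_one' ℝ))).exists
    have h1 := (h.scale ht0 ht).coboundary_eq_zero hab hμ (f := A) (g := G)
      (h.ev_of_isRep hμ0 ht0 ht hG (hg.symm ▸ hG)) ?_
    · rw [h1] at hG; exact hG.unique ht0.ne' (IsRep.zero t)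
    · have hsum : IsRep t (AGerm.pull (smap a b q) (h.isLoc_smap hμ0) f) (G + A) := by
        have := hG.add hA
        rwa [show g + f = AGerm.pull (smap a b q) (h.isLoc_smap hμ0) f by rw [hgf]; ring] at this
      filter_upwards [h.ev_of_isRep hμ0 ht0 ht hA hsum, eventually_norm_le_one] with x e1 e2
      rw [e1, ev_add e2]; ring
  · obtain ⟨t, ⟨A, hA⟩, ht0, ht⟩ := ((eventually_exists_isRep f).and
      (Ioc_mem_nhdsGT (zero_lt_one' ℝ))).exists
    have h1 := h.supp_of_pull_eq hab hμ hμ0 ht0 ht hA hf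
    refine IsRep.unique ht0.ne' ?_ hA
    filter_upwards [(isLoc_swapV (a := a) (b := b)).tendsto.eventually hA, eventually_norm_le_one,
      (hts t).eventually (AGerm.rep_pull _ (isLoc_swapV (a := a) (b := b)) f)] with x e1 e2 e3
    rw [e3, Function.comp_apply]
    change f.rep ((t : ℂ) • swapV a b x) = _
    rw [e1]
    change ev (fun i => x (Equiv.swap a b i)) A = _
    rw [← ev_hat a b e2, hat_of_wt_zero h1]
  · obtain ⟨hk, t, ht0, ht, A, hA, hsupp⟩ := h.weight_of_semiinvariant hab hμ hμ0 (l := 1)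
      (k := m' - h.multGerm hμ0) (M := h.multGerm hμ0) hf
      (by rw [map_sub, h2, h.pull_multGerm hab hμ0]) (by rw [map_sub, h3, hval, sub_self])
      (Eventually.of_forall fun x => (zpow_one _).symm) (by rw [h1]; ring)
    have htc : (t : ℂ) ≠ 0 := by exact_mod_cast ht0.ne'
    obtain ⟨g, hg⟩ := exists_isRep_of_ev ht0.ne' ((t : ℂ)⁻¹ • divX a b A)
    refine ⟨sub_eq_zero.1 hk, g, h.pull_eq_of_supp hab hμ0 ht0 ht hg
      ((suppIn_divX_zero hab A).smul _), hA.unique ht0.ne' ?_⟩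
    have h4 := (isRep_coordGerm t a).mul hg
    have h5 : A = ((t : ℂ) • X a) * ((t : ℂ)⁻¹ • divX a b A) := ev_injective (by
      filter_upwards [eventually_norm_le_one] with x hx
      rw [ev_mul hx, ev_smul, ev_smul, ev_X, ev_eq_mul_divX hsupp hx]; field_simp)
    rwa [← h5] at h4
  · obtain ⟨M, hM⟩ := (AGerm.isUnit_of_val_ne_zero (by rw [hval]; exact hμ0) :
      IsUnit (h.multGerm hμ0)).exists_right_inv
    have hMv : AGerm.val M = AGerm.val m' := by
      have h4 : μ * AGerm.val M = 1 := by rw [← hval, ← map_mul, hM, map_one]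
      exact mul_left_cancel₀ hμ0 (by rw [h4, mul_comm, h3])
    have hMs : AGerm.pull (smap a b q) (h.isLoc_smap hμ0) M = M := by
      have h5 := congrArg (AGerm.pull (smap a b q) (h.isLoc_smap hμ0)) hM
      rw [map_mul, map_one, h.pull_multGerm hab hμ0] at h5
      calc _ = M * h.multGerm hμ0 * AGerm.pull (smap a b q) (h.isLoc_smap hμ0) M := by
            rw [mul_comm M, hM, one_mul]
        _ = M := by rw [mul_assoc, h5, mul_one]
    obtain ⟨hk, t, ht0, ht, A, hA, hsupp⟩ := h.weight_of_semiinvariant hab hμ hμ0 (l := -1)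
      (k := m' - M) (M := M) hf
      (by rw [map_sub, h2, hMs]) (by rw [map_sub, hMv, sub_self])
      (by
        filter_upwards [AGerm.rep_mul (h.multGerm hμ0) M, AGerm.rep_one (V := ι → ℂ)] with x e1 e2
        rw [hM, e2] at e1
        rw [zpow_neg_one]
        exact eq_inv_of_mul_eq_one_right e1.symm) (by rw [h1]; ring)
    have htc : (t : ℂ) ≠ 0 := by exact_mod_cast ht0.ne'
    have hsupp' : SuppIn {α | wt b a α = 1} A := hsupp.mono fun α hα => by
      simp only [Set.mem_ofPred_eq] at *; rw [wt_symm, hα]; rfl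
    obtain ⟨g, hg⟩ := exists_isRep_of_ev ht0.ne' ((t : ℂ)⁻¹ • divX b a A)
    refine ⟨by rw [sub_eq_zero.1 hk, mul_comm, hM], g, h.pull_eq_of_supp hab hμ0 ht0 ht hg
      (((suppIn_divX_zero hab.symm A).mono fun α hα => by
        simp only [Set.mem_ofPred_eq] at *; rw [wt_symm, neg_eq_zero] at hα; exact hα).smul _),
      hA.unique ht0.ne' ?_⟩
    have h4 := (isRep_coordGerm t b).mul hg
    have h5 : A = ((t : ℂ) • X b) * ((t : ℂ)⁻¹ • divX b a A) := ev_injective (by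
      filter_upwards [eventually_norm_le_one] with x hx
      rw [ev_mul hx, ev_smul, ev_smul, ev_X, ev_eq_mul_divX hsupp' hx]; field_simp)
    rwa [← h5] at h4

end Wiener.IsMult

end model

section transport

variable {V W : Type*} [NormedAddCommGroup V] [NormedSpace ℂ V] [NormedAddCommGroup W]
  [NormedSpace ℂ W]

theorem IsPair.transport {s₀ t₀ : AGerm W →+* AGerm W} {μ : ℂ} {m ξ η : AGerm W} {a₀ b₀ : W}
    (h : IsPair s₀ t₀ μ m ξ η a₀ b₀) {s t : AGerm V →+* AGerm V} {φ : AGerm V →+* AGerm W}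
    {ψ : AGerm W →+* AGerm V} (hs : ∀ f, φ (s f) = s₀ (φ f)) (ht : ∀ f, φ (t f) = t₀ (φ f))
    (hψφ : ∀ f, ψ (φ f) = f) (hφψ : ∀ f, φ (ψ f) = f) (hv : ∀ f, AGerm.val (φ f) = AGerm.val f)
    {a b : V} (ha : AGerm.der (ψ ξ) a ≠ 0) (hb : AGerm.der (ψ η) b ≠ 0) :
    IsPair s t μ (ψ m) (ψ ξ) (ψ η) a b := by
  have inj : Function.Injective φ := Function.LeftInverse.injective hψφ
  refine ⟨by rw [← hv, hφψ, h.val_m], inj (by rw [hs, hφψ, h.inv_m]),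
    inj (by rw [hs, map_mul, hφψ, hφψ, h.eig_fst]), inj (by rw [map_mul, hs, hφψ, hφψ, h.eig_snd]),
    ha, hb, fun f => ?_, fun g k hg hgk => ?_, fun f hf => ?_, fun f m' hf h1 h2 h3 => ?_,
    fun f m' hf h1 h2 h3 => ?_⟩
  · obtain ⟨g, k, hg, hk⟩ := h.cob (φ f)
    refine ⟨ψ g, ψ k, inj (by rw [hs, hφψ, hg]), inj ?_⟩
    rw [map_add, map_sub, hs, hφψ, hφψ, hk]
  · refine inj ?_
    rw [map_zero]
    exact h.indep (φ g) (φ k) (by rw [← hs, hg]) (by rw [← hs, ← map_sub, ← hgk])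
  · exact inj (by rw [ht, h.refl _ (by rw [← hs, hf])])
  · obtain ⟨h4, g, hg, hfg⟩ := h.div_fst (φ f) (φ m') ((map_ne_zero_iff φ inj).2 hf)
      (by rw [← hs, h1, map_mul]) (by rw [← hs, h2]) (by rw [hv, h3])
    refine ⟨inj (by rw [h4, hφψ]), ψ g, inj (by rw [hs, hφψ, hg]), inj ?_⟩
    rw [hfg, map_mul, hφψ, hφψ]
  · obtain ⟨h4, g, hg, hfg⟩ := h.div_snd (φ f) (φ m') ((map_ne_zero_iff φ inj).2 hf)
      (by rw [← hs, h1, map_mul]) (by rw [← hs, h2]) (by rw [hv, h3])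
    refine ⟨inj (by rw [map_mul, hφψ, h4, map_one]), ψ g, inj (by rw [hs, hφψ, hg]), inj ?_⟩
    rw [hfg, map_mul, hφψ, hφψ]

variable [CompleteSpace V] {ι : Type*} [Fintype ι] [DecidableEq ι]

/-- A pair of germs of biholomorphisms, one of them an involution reversing the other one, with
hyperbolic linear part on a plane, has a multiplier and semi-invariants. -/
theorem exists_isPair (L : V ≃L[ℂ] (ι → ℂ)) {a b : ι} (hab : a ≠ b) {μ : ℂ} (hμ : 1 < ‖μ‖)
    {σ τ : V → V} (hσ : IsLoc σ) (hτ : IsLoc τ)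
    (hσ' : ∃ A : V →L[ℂ] V, HasFDerivAt σ A 0 ∧ ∀ x, L (A x) = sc a b μ (L x))
    (hτ' : ∃ A : V →L[ℂ] V, HasFDerivAt τ A 0 ∧ ∀ x, L (A x) = swapV a b (L x))
    (hττ : τ ∘ τ =ᶠ[𝓝 0] id) (hrev : (τ ∘ σ) ∘ (τ ∘ σ) =ᶠ[𝓝 0] id) :
    ∃ m ξ η : AGerm V, IsPair (AGerm.pull σ hσ) (AGerm.pull τ hτ) μ m ξ η
      (L.symm (Pi.single a 1)) (L.symm (Pi.single b 1)) := by
  have hμ0 : μ ≠ 0 := by rintro rfl; simp at hμ; linarith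
  obtain ⟨A, hA, hAL⟩ := hσ'
  obtain ⟨B, hB, hBL⟩ := hτ'
  let Φ : V → ι → ℂ := fun x => (1 / 2 : ℂ) • (L x + swapL a b (L (τ x)))
  have hLτ : IsLoc (fun x => swapL a b (L (τ x))) :=
    (swapL a b).isLoc.comp (L.isLoc.comp hτ)
  have hΦ : IsLoc Φ := ⟨(L.isLoc.1.add hLτ.1).fun_const_smul, by
    have h1 := hLτ.2
    simp only at h1
    simp only [Φ, h1, map_zero, add_zero, smul_zero]⟩
  have hΦ' : HasFDerivAt Φ (L : V →L[ℂ] ι → ℂ) 0 := by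
    have h1 : HasFDerivAt (fun x => swapL a b (L (τ x)))
        (((swapL a b).comp (L : V →L[ℂ] ι → ℂ)).comp B) 0 :=
      ((swapL a b).comp (L : V →L[ℂ] ι → ℂ)).hasFDerivAt.comp 0 hB
    refine (((L : V →L[ℂ] ι → ℂ).hasFDerivAt.add h1).const_smul (1 / 2 : ℂ)).congr_fderiv ?_
    ext1 x
    change (1 / 2 : ℂ) • (L x + swapV a b (L (B x))) = L x
    rw [hBL, swapV_swapV, ← two_smul ℂ, smul_smul]
    norm_num
  have hΦτ : ∀ᶠ x in 𝓝 (0 : V), Φ (τ x) = swapV a b (Φ x) := by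
    filter_upwards [hττ] with x hx
    have hx' : τ (τ x) = x := hx
    have h1 : swapL a b (Φ x) = Φ (τ x) := by
      simp only [Φ, map_smul, map_add, hx']
      rw [swapL_apply a b (swapL a b _), swapL_apply a b (L (τ x)), swapV_swapV, add_comm]
    exact h1.symm
  obtain ⟨Φ', hinv, hΦ'd⟩ := exists_isInv hΦ hΦ'
  let σ₁ : (ι → ℂ) → ι → ℂ := Φ ∘ σ ∘ Φ'
  have hσ₁ : IsLoc σ₁ := hΦ.comp (hσ.comp hinv.loc')
  have hσ₁' : HasFDerivAt σ₁ (scL a b μ) 0 := by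
    refine (hΦ'.comp_isLoc (hA.comp_isLoc hΦ'd hinv.loc'.2) (hσ.comp hinv.loc').2).congr_fderiv ?_
    ext1 x
    change L (A (L.symm x)) = scL a b μ x
    rw [hAL, L.apply_symm_apply, scL_apply]
  have hrev₁ : ∀ᶠ x in 𝓝 0, swapV a b (σ₁ (swapV a b (σ₁ x))) = x := by
    have h1 : ∀ᶠ x in 𝓝 0, swapV a b (σ₁ x) = Φ (τ (σ (Φ' x))) := by
      filter_upwards [(hσ.comp hinv.loc').tendsto.eventually hΦτ] with x hx
      exact hx.symm
    have hloc : IsLoc fun x => Φ (τ (σ (Φ' x))) := hΦ.comp (hτ.comp (hσ.comp hinv.loc'))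
    have hloc2 : IsLoc fun x => τ (σ (Φ' x)) := hτ.comp (hσ.comp hinv.loc')
    filter_upwards [h1, hloc.tendsto.eventually h1, hloc2.tendsto.eventually hinv.left,
      hinv.loc'.tendsto.eventually hrev, hinv.right] with x e1 e2 e3 e4 e5
    simp only [Function.comp_apply, id_eq] at e3 e4 e5
    rw [e1, e2, e3, e4, e5]
  obtain ⟨Ψ, hΨan, hΨ0, ⟨c, hc, hΨ'⟩, q, hq1, hq2, hq3, hΨσ, hΨsw⟩ :=
    exists_normalForm_pair hab hμ hσ₁.1 (by
      have := hasFDerivAt_iff_isLittleO_nhds_zero.1 hσ₁'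
      simpa [hσ₁.2, scL_apply] using this) hrev₁
  have hq : IsMult a b μ q := ⟨hq1, hq2, hq3⟩
  let cE : (ι → ℂ) ≃L[ℂ] (ι → ℂ) := ContinuousLinearEquiv.equivOfInverse
    (c • ContinuousLinearMap.id ℂ (ι → ℂ)) (c⁻¹ • ContinuousLinearMap.id ℂ (ι → ℂ))
    (fun x => inv_smul_smul₀ hc x) (fun x => smul_inv_smul₀ hc x)
  obtain ⟨Ψ', hinv2, hΨ'd⟩ := exists_isInv (A := cE) ⟨hΨan, hΨ0⟩ hΨ'
  have hΘ : IsInv (Φ' ∘ Ψ) (Ψ' ∘ Φ) := hinv.symm.comp hinv2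
  have hder : HasFDerivAt (Ψ' ∘ Φ) ((cE.symm : (ι → ℂ) →L[ℂ] ι → ℂ).comp (L : V →L[ℂ] ι → ℂ)) 0 :=
    hΨ'd.comp_isLoc hΦ' hΦ.2
  have hS := hq.isLoc_smap hμ0
  have hsw : IsLoc (swapV a b) := isLoc_swapV (a := a) (b := b)
  have hcS : σ ∘ (Φ' ∘ Ψ) =ᶠ[𝓝 0] (Φ' ∘ Ψ) ∘ smap a b q := by
    filter_upwards [hΨσ, (hσ.comp (hΘ.loc)).tendsto.eventually hinv.left] with x h1 h2
    simp only [Function.comp_apply, id_eq] at h2 ⊢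
    rw [← h2]
    exact congrArg Φ' h1
  have hcT : τ ∘ (Φ' ∘ Ψ) =ᶠ[𝓝 0] (Φ' ∘ Ψ) ∘ swapV a b := by
    filter_upwards [hΨsw, (hτ.comp (hΘ.loc)).tendsto.eventually hinv.left,
      hΘ.loc.tendsto.eventually hΦτ, (hinv2.loc).tendsto.eventually hinv.right] with x h1 h2 h3 h4
    simp only [Function.comp_apply, id_eq] at h2 h3 h4 ⊢
    rw [← h2, h3, h4, h1]
  refine ⟨_, _, _, (hq.isPair hab hμ hμ0).transport (φ := AGerm.pull _ hΘ.loc)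
    (ψ := AGerm.pull _ hΘ.loc') (fun f => ?_) (fun f => ?_) (fun f => ?_) (fun f => ?_)
    (fun f => AGerm.val_pull _ _ f) ?_ ?_⟩
  · rw [AGerm.pull_pull, AGerm.pull_pull, AGerm.pull_congr _ _ hcS]
  · rw [AGerm.pull_pull, AGerm.pull_pull, AGerm.pull_congr _ _ hcT]
  · exact AGerm.IsInv.pull_left hΘ.symm f
  · exact AGerm.IsInv.pull_left hΘ f
  · rw [AGerm.der_pull _ _ hder, ContinuousLinearMap.comp_apply, der_coordGerm]
    change c⁻¹ * (L (L.symm (Pi.single a 1))) a ≠ 0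
    simpa using hc
  · rw [AGerm.der_pull _ _ hder, ContinuousLinearMap.comp_apply, der_coordGerm]
    change c⁻¹ * (L (L.symm (Pi.single b 1))) b ≠ 0
    simpa using hc

/-- The same statement for `|μ| ≠ 1`. -/
theorem exists_isPair_of_norm_ne_one (L : V ≃L[ℂ] (ι → ℂ)) {a b : ι} (hab : a ≠ b) {μ : ℂ}
    (hμ0 : μ ≠ 0) (hμ : ‖μ‖ ≠ 1) {σ τ : V → V} (hσ : IsLoc σ) (hτ : IsLoc τ)
    (hσ' : ∃ A : V →L[ℂ] V, HasFDerivAt σ A 0 ∧ ∀ x, L (A x) = sc a b μ (L x))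
    (hτ' : ∃ A : V →L[ℂ] V, HasFDerivAt τ A 0 ∧ ∀ x, L (A x) = swapV a b (L x))
    (hττ : τ ∘ τ =ᶠ[𝓝 0] id) (hrev : (τ ∘ σ) ∘ (τ ∘ σ) =ᶠ[𝓝 0] id) :
    ∃ m ξ η : AGerm V, IsPair (AGerm.pull σ hσ) (AGerm.pull τ hτ) μ m ξ η
      (L.symm (Pi.single a 1)) (L.symm (Pi.single b 1)) := by
  rcases lt_or_gt_of_ne hμ with h | h
  · have h1 : 1 < ‖μ⁻¹‖ := by
      rw [norm_inv]; exact (one_lt_inv₀ (norm_pos_iff.2 hμ0)).2 h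
    obtain ⟨A, hA, hAL⟩ := hσ'
    obtain ⟨B, hB, hBL⟩ := hτ'
    obtain ⟨m, ξ, η, hp⟩ := exists_isPair L hab.symm h1 hσ hτ ⟨A, hA, fun x => by
        rw [hAL]; funext i; simp only [sc, inv_inv]
        by_cases hia : i = a
        · subst hia; simp [hab]
        · simp [hia]⟩ ⟨B, hB, fun x => by rw [hBL]; funext i; simp [swapV, Equiv.swap_comm]⟩ hττ hrev
    obtain ⟨m', hm'⟩ := (AGerm.isUnit_of_val_ne_zero (by rw [hp.val_m]; exact inv_ne_zero hμ0) :
      IsUnit m).exists_right_inv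
    have := hp.symm hm'
    rw [inv_inv] at this
    exact ⟨m', η, ξ, this⟩
  · exact exists_isPair L hab h hσ hτ hσ' hτ' hττ hrev

end transport

section system

variable {V : Type*} [NormedAddCommGroup V] [NormedSpace ℂ V] {J : Type*}

theorem AGerm.der_zero : AGerm.der (0 : AGerm V) = 0 := by
  have h := AGerm.der_sub (0 : AGerm V) 0
  rwa [sub_self, sub_self] at h

/-- The ring homomorphism induced by `τ_{1j} ∘ τ_{2k}`, `k` the partner of `j`. -/
def sHom (st : J → J) (t₁ t₂ : J → AGerm V →+* AGerm V) (j : J) : AGerm V →+* AGerm V :=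
  (t₂ (st j)).comp (t₁ j)

/-- A family of involutions with commuting reversible compositions, and a real structure. -/
structure IsSystem [DecidableEq J] (st : J → J) (t₁ t₂ : J → AGerm V →+* AGerm V)
    (c : AGerm V →+* AGerm V) (lm : J → ℂ) (m ξ η : J → AGerm V) (a b : J → V) : Prop where
  st_st : ∀ j, st (st j) = j
  inv₁ : ∀ j f, t₁ j (t₁ j f) = f
  comm₁ : ∀ i j f, t₁ i (t₁ j f) = t₁ j (t₁ i f)
  conj_t : ∀ j f, t₂ j f = c (t₁ j (c f))
  cc : ∀ f, c (c f) = f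
  val_t : ∀ j f, AGerm.val (t₁ j f) = AGerm.val f
  val_c : ∀ f, AGerm.val (c f) = conj (AGerm.val f)
  comm : ∀ i j f, sHom st t₁ t₂ i (sHom st t₁ t₂ j f) = sHom st t₁ t₂ j (sHom st t₁ t₂ i f)
  pair : ∀ j, IsPair (sHom st t₁ t₂ j) (t₁ j) (lm j ^ 2) (m j) (ξ j) (η j) (a j) (b j)
  der_a : ∀ i j f, i ≠ j → AGerm.der (sHom st t₁ t₂ i f) (a j) = AGerm.der f (a j)
  der_b : ∀ i j f, i ≠ j → AGerm.der (sHom st t₁ t₂ i f) (b j) = AGerm.der f (b j)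
  der_t : ∀ j f, AGerm.der (t₁ j f) (b j) = AGerm.der f (a j)
  lm_ne : ∀ j, lm j ≠ 0
  lm_sq_ne : ∀ j, lm j ^ 2 ≠ 1
  lm_fix : ∀ j, st j = j → conj (lm j) = lm j
  lm_st : ∀ j, st j ≠ j → conj (lm j) * lm (st j) = 1

namespace IsSystem

variable [DecidableEq J] {st : J → J} {t₁ t₂ : J → AGerm V →+* AGerm V} {c : AGerm V →+* AGerm V}
  {lm : J → ℂ} {m ξ η : J → AGerm V} {a b : J → V} (h : IsSystem st t₁ t₂ c lm m ξ η a b)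

include h

theorem inv₂ (j : J) (f : AGerm V) : t₂ j (t₂ j f) = f := by
  rw [h.conj_t, h.conj_t, h.cc, h.inv₁, h.cc]

theorem comm₂ (i j : J) (f : AGerm V) : t₂ i (t₂ j f) = t₂ j (t₂ i f) := by
  simp only [h.conj_t, h.cc]; rw [h.comm₁]

theorem val_t₂ (j : J) (f : AGerm V) : AGerm.val (t₂ j f) = AGerm.val f := by
  rw [h.conj_t, h.val_c, h.val_t, h.val_c, Complex.conj_conj]

theorem val_s (j : J) (f : AGerm V) : AGerm.val (sHom st t₁ t₂ j f) = AGerm.val f := by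
  rw [sHom, RingHom.comp_apply, h.val_t₂, h.val_t]

theorem s_left_inv (j : J) (f : AGerm V) : t₁ j (t₂ (st j) (sHom st t₁ t₂ j f)) = f := by
  rw [sHom, RingHom.comp_apply, h.inv₂, h.inv₁]

theorem s_injective (j : J) : Function.Injective (sHom st t₁ t₂ j) :=
  Function.LeftInverse.injective (g := fun f => t₁ j (t₂ (st j) f)) (h.s_left_inv j)

theorem t_injective (j : J) : Function.Injective (t₁ j) :=
  Function.LeftInverse.injective (h.inv₁ j)

theorem t₁_of_s {j : J} {f : AGerm V} (hf : sHom st t₁ t₂ j f = f) : t₁ j f = f :=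
  (h.pair j).refl f hf

theorem t₂_of_s {j : J} {f : AGerm V} (hf : sHom st t₁ t₂ j f = f) : t₂ (st j) f = f := by
  have h1 := h.t₁_of_s hf
  rwa [sHom, RingHom.comp_apply, h1] at hf

/-- The conjugate of `s_j` by the real structure is the inverse of `s_k`, `k` the partner. -/
theorem s_conj (j : J) (f : AGerm V) :
    sHom st t₁ t₂ (st j) (c (sHom st t₁ t₂ j f)) = c f := by
  simp only [sHom, RingHom.comp_apply, h.st_st, h.conj_t, h.cc]
  rw [h.inv₁, h.cc, h.inv₁]

theorem fst_ne_zero (j : J) : ξ j ≠ 0 := by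
  intro h0
  refine (h.pair j).der_fst ?_
  rw [h0, AGerm.der_zero]; rfl

theorem s_mult (i j : J) : sHom st t₁ t₂ i (m j) = m j := by
  refine ((h.pair j).div_fst (sHom st t₁ t₂ i (ξ j)) (sHom st t₁ t₂ i (m j))
    ((map_ne_zero_iff _ (h.s_injective i)).2 (h.fst_ne_zero j)) ?_ ?_ ?_).1
  · rw [h.comm, (h.pair j).eig_fst, map_mul]
  · rw [h.comm, (h.pair j).inv_m]
  · rw [h.val_s, (h.pair j).val_m]

theorem lm_sq_ne_zero (j : J) : lm j ^ 2 ≠ 0 := pow_ne_zero 2 (h.lm_ne j)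

theorem isUnit_mult (j : J) : IsUnit (m j) :=
  AGerm.isUnit_of_val_ne_zero (by rw [(h.pair j).val_m]; exact h.lm_sq_ne_zero j)

theorem s_inv_of_mul_eq_one {i : J} {f g : AGerm V} (hfg : f * g = 1)
    (hf : sHom st t₁ t₂ i f = f) : sHom st t₁ t₂ i g = g := by
  have h1 := congrArg (sHom st t₁ t₂ i) hfg
  rw [map_mul, hf, map_one] at h1
  calc _ = g * f * sHom st t₁ t₂ i g := by rw [mul_comm g, hfg, one_mul]
    _ = g := by rw [mul_assoc, h1, mul_one]

/-- A semi-invariant of `s_j` can be made invariant under all other `s_i`. -/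
theorem exists_simultaneous [Fintype J] {j : J} {n f : AGerm V} (hn : ∀ i, sHom st t₁ t₂ i n = n)
    (hf : sHom st t₁ t₂ j f = n * f) {d : V}
    (hd : ∀ i g, i ≠ j → AGerm.der (sHom st t₁ t₂ i g) d = AGerm.der g d) :
    ∃ x, AGerm.der x d = AGerm.der f d ∧ sHom st t₁ t₂ j x = n * x ∧
      ∀ i, i ≠ j → sHom st t₁ t₂ i x = x := by
  suffices H : ∀ S : Finset J, ∃ x, AGerm.der x d = AGerm.der f d ∧ sHom st t₁ t₂ j x = n * x ∧
      ∀ i ∈ S, i ≠ j → sHom st t₁ t₂ i x = x by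
    obtain ⟨x, h1, h2, h3⟩ := H Finset.univ
    exact ⟨x, h1, h2, fun i => h3 i (Finset.mem_univ i)⟩
  intro S
  induction S using Finset.induction_on with
  | empty => exact ⟨f, rfl, hf, by simp⟩
  | insert i S hi ih =>
    obtain ⟨x, h1, h2, h3⟩ := ih
    by_cases hij : i = j
    · refine ⟨x, h1, h2, fun k hk hkj => ?_⟩
      rcases Finset.mem_insert.1 hk with rfl | hk
      · exact absurd hij hkj
      · exact h3 k hk hkj
    obtain ⟨g, k, hg, hx⟩ := (h.pair i).cob x
    have key : ∀ l p, sHom st t₁ t₂ i p = p → sHom st t₁ t₂ l x = p * x →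
        sHom st t₁ t₂ l g = p * g := by
      intro l p hp hl
      refine sub_eq_zero.1 ((h.pair i).indep _ (p * k - sHom st t₁ t₂ l k) ?_ ?_)
      · rw [map_sub, map_mul, hp, h.comm, hg]
      · have h4 := hl
        rw [hx, map_add, map_sub, h.comm l i] at h4
        rw [map_sub, map_mul, hp]
        linear_combination h4
    refine ⟨g, ?_, key j n (hn i) h2, fun l hl hlj => ?_⟩
    · rw [← h1, hx, AGerm.der_add, AGerm.der_sub, add_apply,
        sub_apply, hd i k hij, sub_self, add_zero]
    · rcases Finset.mem_insert.1 hl with rfl | hl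
      · exact hg
      · have := key l 1 (map_one _) (by rw [one_mul]; exact h3 l hl hlj)
        rwa [one_mul] at this

/-- The first normalization of the semi-invariants. -/
theorem exists_uv [IsDomain (AGerm V)] [Fintype J] (j : J) : ∃ u v : AGerm V,
    t₁ j u = v ∧ t₁ j v = u ∧ (∀ i, i ≠ j → t₁ i u = u ∧ t₁ i v = v) ∧
    sHom st t₁ t₂ j u = m j * u ∧ m j * sHom st t₁ t₂ j v = v ∧
    (∀ i, i ≠ j → sHom st t₁ t₂ i u = u ∧ sHom st t₁ t₂ i v = v) ∧
    AGerm.der u (a j) ≠ 0 ∧ AGerm.der v (b j) ≠ 0 := by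
  obtain ⟨m', hm'⟩ := (h.isUnit_mult j).exists_right_inv
  have hm's : ∀ i, sHom st t₁ t₂ i m' = m' := fun i => h.s_inv_of_mul_eq_one hm' (h.s_mult i j)
  have hη : sHom st t₁ t₂ j (η j) = m' * η j := by
    calc _ = m j * m' * sHom st t₁ t₂ j (η j) := by rw [hm', one_mul]
      _ = m' * (m j * sHom st t₁ t₂ j (η j)) := by ring
      _ = _ := by rw [(h.pair j).eig_snd]
  obtain ⟨u, hu1, hu2, hu3⟩ := h.exists_simultaneous (fun i => h.s_mult i j) (h.pair j).eig_fst
    (d := a j) fun i g hij => h.der_a i j g hij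
  obtain ⟨y, hy1, hy2, hy3⟩ := h.exists_simultaneous hm's hη (d := b j)
    fun i g hij => h.der_b i j g hij
  have hua : AGerm.der u (a j) ≠ 0 := hu1.trans_ne (h.pair j).der_fst
  have hyb : AGerm.der y (b j) ≠ 0 := hy1.trans_ne (h.pair j).der_snd
  have hu0 : u ≠ 0 := by rintro rfl; exact hua (by rw [AGerm.der_zero]; rfl)
  have hy0 : y ≠ 0 := by rintro rfl; exact hyb (by rw [AGerm.der_zero]; rfl)
  have hvb : AGerm.der (t₁ j u) (b j) ≠ 0 := by rw [h.der_t]; exact hua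
  have hv0 : t₁ j u ≠ 0 := (map_ne_zero_iff _ (h.t_injective j)).2 hu0
  have hval0 : ∀ x : AGerm V, sHom st t₁ t₂ j x = m' * x → AGerm.val x = 0 := by
    intro x hx
    have h1 := congrArg AGerm.val hx
    rw [h.val_s, map_mul] at h1
    have h2 : lm j ^ 2 * AGerm.val m' = 1 := by
      rw [← (h.pair j).val_m, ← map_mul, hm', map_one]
    have h3 : (lm j ^ 2 - 1) * AGerm.val x = 0 := by
      linear_combination lm j ^ 2 * h1 + AGerm.val x * h2
    exact (mul_eq_zero.1 h3).resolve_left (sub_ne_zero.2 (h.lm_sq_ne j))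
  -- the reflected semi-invariant
  have htm : t₁ j (m j) = m j := h.t₁_of_s (h.s_mult j j)
  have htm' : t₁ j m' = m' := h.t₁_of_s (hm's j)
  have hst : ∀ f, sHom st t₁ t₂ j (t₁ j f) = t₂ (st j) f := fun f => by
    rw [sHom, RingHom.comp_apply, h.inv₁]
  have ht2u : t₂ (st j) (t₁ j u) = m j * u := hu2
  have ht2u' : t₂ (st j) u = m' * t₁ j u := by
    have h1 := congrArg (t₂ (st j)) ht2u
    rw [h.inv₂, map_mul, h.t₂_of_s (h.s_mult j j)] at h1
    rw [h1, ← mul_assoc, mul_comm m', hm', one_mul]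
  have hsv : sHom st t₁ t₂ j (t₁ j u) = m' * t₁ j u := by rw [hst, ht2u']
  have hm'val : AGerm.val m' * lm j ^ 2 = 1 := by
    rw [← (h.pair j).val_m, ← map_mul, mul_comm, hm', map_one]
  obtain ⟨-, g₁, hg₁, hyg₁⟩ := (h.pair j).div_snd y m' hy0 hy2 (hm's j) hm'val
  obtain ⟨-, g₂, hg₂, hvg₂⟩ := (h.pair j).div_snd (t₁ j u) m' hv0 hsv (hm's j) hm'val
  have hη0 : AGerm.val (η j) = 0 := hval0 _ hη
  have hg₁u : IsUnit g₁ := by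
    refine AGerm.isUnit_of_val_ne_zero fun h0 => hyb ?_
    rw [hyg₁, AGerm.der_mul, hη0, h0]; simp
  obtain ⟨g₁', hg₁'⟩ := hg₁u.exists_right_inv
  set w := g₁' * g₂ with hw
  have hyw : t₁ j u = y * w := by
    rw [hyg₁, hw, hvg₂]; linear_combination -(η j * g₂) * hg₁'
  have hjw : sHom st t₁ t₂ j w = w := by
    rw [hw, map_mul, hg₂, h.s_inv_of_mul_eq_one hg₁' hg₁]
  have hiw : ∀ i, i ≠ j → sHom st t₁ t₂ i w = w := by
    intro i hij
    have e1 : t₁ i w = w := by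
      have h1 : t₁ i (t₁ j u) = t₁ j u := by rw [h.comm₁, h.t₁_of_s (hu3 i hij)]
      rw [hyw, map_mul, h.t₁_of_s (hy3 i hij)] at h1
      exact mul_left_cancel₀ hy0 h1
    have e2 : t₂ (st i) w = w := by
      have h1 : t₂ (st i) (t₂ (st j) u) = t₂ (st j) u := by rw [h.comm₂, h.t₂_of_s (hu3 i hij)]
      rw [ht2u', hyw, map_mul, map_mul, h.t₂_of_s (hy3 i hij), h.t₂_of_s (hm's i)] at h1
      have hm'0 : m' ≠ 0 := by rintro rfl; simp at hm'
      exact mul_left_cancel₀ hy0 (mul_left_cancel₀ hm'0 h1)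
    rw [sHom, RingHom.comp_apply, e1, e2]
  have hsv' : ∀ i, i ≠ j → sHom st t₁ t₂ i (t₁ j u) = t₁ j u := fun i hij => by
    rw [hyw, map_mul, hiw i hij, hy3 i hij]
  refine ⟨u, t₁ j u, rfl, h.inv₁ j u, fun i hij => ⟨h.t₁_of_s (hu3 i hij), h.t₁_of_s (hsv' i hij)⟩,
    hu2, ?_, fun i hij => ⟨hu3 i hij, hsv' i hij⟩, hua, hvb⟩
  rw [hsv, ← mul_assoc, hm', one_mul]

end IsSystem

end system

section system

variable {V : Type*} [NormedAddCommGroup V] [NormedSpace ℂ V] {J : Type*}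

theorem AGerm.eq_of_sq_eq [IsDomain (AGerm V)] {x y : AGerm V} (h : x ^ 2 = y ^ 2)
    (hv : AGerm.val x = AGerm.val y) (h0 : AGerm.val y ≠ 0) : x = y := by
  rcases sq_eq_sq_iff_eq_or_eq_neg.1 h with h1 | h1
  · exact h1
  · rw [h1, map_neg] at hv
    exact absurd (self_eq_neg.1 hv.symm) h0

theorem AGerm.zero_smul_der (x : AGerm V) : (0 : ℂ) • AGerm.der x = 0 := by
  ext; simp

/-- Semi-invariants of a system, each of them transformed by a single pair of involutions. -/
structure IsEigen (st : J → J) (t₁ t₂ : J → AGerm V →+* AGerm V) (m u v : J → AGerm V)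
    (a b : J → V) : Prop where
  swap_fst : ∀ j, t₁ j (u j) = v j
  swap_snd : ∀ j, t₁ j (v j) = u j
  fix_fst : ∀ i j, i ≠ j → t₁ i (u j) = u j
  fix_snd : ∀ i j, i ≠ j → t₁ i (v j) = v j
  eig_fst : ∀ j, sHom st t₁ t₂ j (u j) = m j * u j
  eig_snd : ∀ j, m j * sHom st t₁ t₂ j (v j) = v j
  inv_fst : ∀ i j, i ≠ j → sHom st t₁ t₂ i (u j) = u j
  inv_snd : ∀ i j, i ≠ j → sHom st t₁ t₂ i (v j) = v j
  der_fst : ∀ j, AGerm.der (u j) (a j) ≠ 0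
  der_snd : ∀ j, AGerm.der (v j) (b j) ≠ 0

theorem IsEigen.scale {st : J → J} {t₁ t₂ : J → AGerm V →+* AGerm V} {m u v : J → AGerm V}
    {a b : J → V} (h : IsEigen st t₁ t₂ m u v a b) {r : J → AGerm V}
    (hr : ∀ j, AGerm.val (r j) ≠ 0) (hrt : ∀ i j, t₁ i (r j) = r j)
    (hrs : ∀ i j, sHom st t₁ t₂ i (r j) = r j) (hu : ∀ j, AGerm.val (u j) = 0)
    (hv : ∀ j, AGerm.val (v j) = 0) :
    IsEigen st t₁ t₂ m (fun j => r j * u j) (fun j => r j * v j) a b where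
  swap_fst j := by rw [map_mul, hrt, h.swap_fst]
  swap_snd j := by rw [map_mul, hrt, h.swap_snd]
  fix_fst i j hij := by rw [map_mul, hrt, h.fix_fst i j hij]
  fix_snd i j hij := by rw [map_mul, hrt, h.fix_snd i j hij]
  eig_fst j := by rw [map_mul, hrs, h.eig_fst]; ring
  eig_snd j := by rw [map_mul, hrs, mul_left_comm, h.eig_snd]
  inv_fst i j hij := by rw [map_mul, hrs, h.inv_fst i j hij]
  inv_snd i j hij := by rw [map_mul, hrs, h.inv_snd i j hij]
  der_fst j := by
    rw [AGerm.der_mul, hu, AGerm.zero_smul_der, add_zero]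
    exact mul_ne_zero (hr j) (h.der_fst j)
  der_snd j := by
    rw [AGerm.der_mul, hv, AGerm.zero_smul_der, add_zero]
    exact mul_ne_zero (hr j) (h.der_snd j)

namespace IsSystem

variable [DecidableEq J] {st : J → J} {t₁ t₂ : J → AGerm V →+* AGerm V} {c : AGerm V →+* AGerm V}
  {lm : J → ℂ} {m ξ η : J → AGerm V} {a b : J → V} (h : IsSystem st t₁ t₂ c lm m ξ η a b)

include h

theorem c_injective : Function.Injective c := Function.LeftInverse.injective (g := c) h.cc

theorem s_c {f : AGerm V} (hf : ∀ i, sHom st t₁ t₂ i f = f) (i : J) :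
    sHom st t₁ t₂ i (c f) = c f := by
  have h1 := h.s_conj (st i) f
  rwa [h.st_st, hf] at h1

theorem val_eq_zero_of_mul {j : J} {x n : AGerm V} (hx : sHom st t₁ t₂ j x = n * x)
    (hn : AGerm.val n ≠ 1) : AGerm.val x = 0 := by
  have h1 := congrArg AGerm.val hx
  rw [h.val_s, map_mul] at h1
  have h3 : (AGerm.val n - 1) * AGerm.val x = 0 := by linear_combination -h1
  exact (mul_eq_zero.1 h3).resolve_left (sub_ne_zero.2 hn)

theorem exists_unit_mul [IsDomain (AGerm V)] {u v : J → AGerm V} (hE : IsEigen st t₁ t₂ m u v a b)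
    {j : J} {y n : AGerm V} (hy0 : y ≠ 0) (hn : ∀ i, sHom st t₁ t₂ i n = n)
    (hy : sHom st t₁ t₂ j y = n * y) (hy' : ∀ i, i ≠ j → sHom st t₁ t₂ i y = y)
    (hv : AGerm.val n = lm j ^ 2) :
    n = m j ∧ ∃ w, (∀ i, sHom st t₁ t₂ i w = w) ∧ y = w * u j := by
  obtain ⟨hnm, g₁, hg₁, hyg₁⟩ := (h.pair j).div_fst y n hy0 hy (hn j) hv
  refine ⟨hnm, ?_⟩
  have hξ0 : AGerm.val (ξ j) = 0 := h.val_eq_zero_of_mul (h.pair j).eig_fst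
    (by rw [(h.pair j).val_m]; exact h.lm_sq_ne j)
  have hu0 : u j ≠ 0 := fun h0 => hE.der_fst j (by rw [h0, AGerm.der_zero]; rfl)
  obtain ⟨-, g₂, hg₂, hug₂⟩ := (h.pair j).div_fst (u j) (m j) hu0 (hE.eig_fst j) (h.s_mult j j)
    (h.pair j).val_m
  have hg₂u : IsUnit g₂ := by
    refine AGerm.isUnit_of_val_ne_zero fun h0 => hE.der_fst j ?_
    rw [hug₂, AGerm.der_mul, hξ0, h0]; simp
  obtain ⟨g', hg'⟩ := hg₂u.exists_right_inv
  have hyw : y = g' * g₁ * u j := by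
    rw [hug₂, hyg₁]; linear_combination -(ξ j * g₁) * hg'
  refine ⟨g' * g₁, fun i => ?_, hyw⟩
  by_cases hij : i = j
  · subst hij
    rw [map_mul, hg₁, h.s_inv_of_mul_eq_one hg' hg₂]
  · have h1 := hy' i hij
    rw [hyw, map_mul, hE.inv_fst i j hij] at h1
    exact mul_right_cancel₀ hu0 h1

theorem exists_unit_mul_snd [IsDomain (AGerm V)] {u v : J → AGerm V}
    (hE : IsEigen st t₁ t₂ m u v a b)
    {j : J} {y n : AGerm V} (hy0 : y ≠ 0) (hn : ∀ i, sHom st t₁ t₂ i n = n)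
    (hy : sHom st t₁ t₂ j y = n * y) (hy' : ∀ i, i ≠ j → sHom st t₁ t₂ i y = y)
    (hv : AGerm.val n * lm j ^ 2 = 1) :
    n * m j = 1 ∧ ∃ w, (∀ i, sHom st t₁ t₂ i w = w) ∧ y = w * v j := by
  obtain ⟨hnm, g₁, hg₁, hyg₁⟩ := (h.pair j).div_snd y n hy0 hy (hn j) hv
  refine ⟨hnm, ?_⟩
  have hv0 : v j ≠ 0 := fun h0 => hE.der_snd j (by rw [h0, AGerm.der_zero]; rfl)
  have hev : ∀ x, m j * sHom st t₁ t₂ j x = x → sHom st t₁ t₂ j x = n * x := fun x hx => by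
    calc _ = n * m j * sHom st t₁ t₂ j x := by rw [hnm, one_mul]
      _ = n * (m j * sHom st t₁ t₂ j x) := by ring
      _ = _ := by rw [hx]
  obtain ⟨-, g₂, hg₂, hug₂⟩ := (h.pair j).div_snd (v j) n hv0 (hev _ (hE.eig_snd j)) (hn j) hv
  have hη0 : AGerm.val (η j) = 0 := h.val_eq_zero_of_mul (hev _ (h.pair j).eig_snd) fun h1 =>
    h.lm_sq_ne j (by rwa [h1, one_mul] at hv)
  have hg₂u : IsUnit g₂ := by
    refine AGerm.isUnit_of_val_ne_zero fun h0 => hE.der_snd j ?_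
    rw [hug₂, AGerm.der_mul, hη0, h0]; simp
  obtain ⟨g', hg'⟩ := hg₂u.exists_right_inv
  have hyw : y = g' * g₁ * v j := by
    rw [hug₂, hyg₁]; linear_combination -(η j * g₁) * hg'
  refine ⟨g' * g₁, fun i => ?_, hyw⟩
  by_cases hij : i = j
  · subst hij
    rw [map_mul, hg₁, h.s_inv_of_mul_eq_one hg' hg₂]
  · have h1 := hy' i hij
    rw [hyw, map_mul, hE.inv_snd i j hij] at h1
    exact mul_right_cancel₀ hv0 h1

theorem exists_isEigen [IsDomain (AGerm V)] [Fintype J] : ∃ u v, IsEigen st t₁ t₂ m u v a b := by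
  choose u v h1 h2 h3 h4 h5 h6 h7 h8 using h.exists_uv
  exact ⟨u, v, h1, h2, fun i j hij => (h3 j i hij).1, fun i j hij => (h3 j i hij).2, h4, h5,
    fun i j hij => (h6 j i hij).1, fun i j hij => (h6 j i hij).2, h7, h8⟩

/-- The multiplier of the conjugate semi-invariant. -/
theorem exists_inv_conj_mult (j : J) : ∃ n, n * c (m j) = 1 ∧ (∀ i, sHom st t₁ t₂ i n = n) ∧
    AGerm.val n * conj (lm j) ^ 2 = 1 := by
  obtain ⟨m', hm'⟩ := (h.isUnit_mult j).exists_right_inv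
  have h1 : c m' * c (m j) = 1 := by rw [← map_mul, mul_comm, hm', map_one]
  refine ⟨c m', h1, h.s_c fun i => h.s_inv_of_mul_eq_one hm' (h.s_mult i j), ?_⟩
  rw [← map_pow, ← (h.pair j).val_m, ← h.val_c, ← map_mul, h1, map_one]

theorem s_conj_fst {u v : J → AGerm V} (hE : IsEigen st t₁ t₂ m u v a b) {j : J} {n : AGerm V}
    (hn : n * c (m j) = 1) :
    sHom st t₁ t₂ (st j) (c (u j)) = n * c (u j) ∧
      ∀ i, i ≠ st j → sHom st t₁ t₂ i (c (u j)) = c (u j) := by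
  constructor
  · have h1 := h.s_conj j (u j)
    rw [hE.eig_fst, map_mul, map_mul, h.s_c fun i => h.s_mult i j] at h1
    linear_combination n * h1 - (sHom st t₁ t₂ (st j) (c (u j))) * hn
  · intro i hi
    have h2 : st i ≠ j := fun h3 => hi (by rw [← h3, h.st_st])
    have h1 := h.s_conj (st i) (u j)
    rwa [hE.inv_fst _ _ h2, h.st_st] at h1

theorem conj_fst_of_fixed [IsDomain (AGerm V)] {u v : J → AGerm V}
    (hE : IsEigen st t₁ t₂ m u v a b) {j : J} (hj : st j = j) :
    c (m j) = m j ∧ ∃ w, (∀ i, sHom st t₁ t₂ i w = w) ∧ c (u j) = w * v j ∧ c w * w * m j = 1 := by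
  obtain ⟨n, hn, hns, hnv⟩ := h.exists_inv_conj_mult j
  obtain ⟨h1, h2⟩ := h.s_conj_fst hE hn
  rw [hj] at h1 h2
  have hu0 : u j ≠ 0 := fun h0 => hE.der_fst j (by rw [h0, AGerm.der_zero]; rfl)
  obtain ⟨h3, w, hw, huw⟩ := h.exists_unit_mul_snd hE ((map_ne_zero_iff _ h.c_injective).2 hu0) hns
    h1 h2 (by rw [h.lm_fix j hj] at hnv; exact hnv)
  have hn0 : n ≠ 0 := by rintro rfl; simp at hn
  refine ⟨mul_left_cancel₀ hn0 (hn.trans h3.symm), w, hw, huw, ?_⟩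
  have h4 : c (v j) = w * m j * u j := by
    have h5 : c (v j) = t₂ j (c (u j)) := by rw [h.conj_t, h.cc, hE.swap_fst]
    have h6 : t₂ (st j) (v j) = m j * u j := by
      rw [← hE.swap_fst, ← hE.eig_fst]; rfl
    have h7 := h.t₂_of_s (hw j)
    rw [hj] at h6 h7
    rw [h5, huw, map_mul, h7, h6, mul_assoc]
  have h8 := h.cc (u j)
  rw [huw, map_mul, h4] at h8
  refine mul_right_cancel₀ hu0 ?_
  rw [one_mul]; linear_combination h8

theorem conj_fst_of_pair [IsDomain (AGerm V)] {u v : J → AGerm V}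
    (hE : IsEigen st t₁ t₂ m u v a b) {j : J} (hj : st j ≠ j) :
    c (m j) * m (st j) = 1 ∧ ∃ w, (∀ i, sHom st t₁ t₂ i w = w) ∧ c (u j) = w * u (st j) := by
  obtain ⟨n, hn, hns, hnv⟩ := h.exists_inv_conj_mult j
  obtain ⟨h1, h2⟩ := h.s_conj_fst hE hn
  have hu0 : u j ≠ 0 := fun h0 => hE.der_fst j (by rw [h0, AGerm.der_zero]; rfl)
  have hv : AGerm.val n = lm (st j) ^ 2 := by
    linear_combination (lm (st j)) ^ 2 * hnv - AGerm.val n * (conj (lm j) * lm (st j) + 1) *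
      h.lm_st j hj
  obtain ⟨h3, w, hw, huw⟩ := h.exists_unit_mul hE ((map_ne_zero_iff _ h.c_injective).2 hu0) hns
    h1 h2 hv
  exact ⟨by rw [← h3, mul_comm, hn], w, hw, huw⟩

/-- Square roots of the multipliers. -/
theorem exists_root [IsDomain (AGerm V)] {u v : J → AGerm V} (hE : IsEigen st t₁ t₂ m u v a b) :
    ∃ Λ : J → AGerm V, (∀ j, Λ j ^ 2 = m j) ∧ (∀ j, AGerm.val (Λ j) = lm j) ∧
      (∀ i j, sHom st t₁ t₂ i (Λ j) = Λ j) ∧ (∀ j, st j = j → c (Λ j) = Λ j) ∧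
      ∀ j, st j ≠ j → c (Λ j) * Λ (st j) = 1 := by
  choose Λ h1 h2 using fun j => AGerm.exists_sqrt (h.lm_ne j) (h.pair j).val_m
  refine ⟨Λ, h1, h2, fun i j => ?_, fun j hj => ?_, fun j hj => ?_⟩
  · refine AGerm.eq_of_sq_eq ?_ (h.val_s _ _) (by rw [h2]; exact h.lm_ne j)
    rw [← map_pow, h1, h.s_mult]
  · refine AGerm.eq_of_sq_eq ?_ (by rw [h.val_c, h2, h.lm_fix j hj]) (by rw [h2]; exact h.lm_ne j)
    rw [← map_pow, h1, (h.conj_fst_of_fixed hE hj).1]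
  · refine AGerm.eq_of_sq_eq ?_ (by rw [map_mul, h.val_c, h2, h2, h.lm_st j hj, map_one])
      (by rw [map_one]; exact one_ne_zero)
    rw [mul_pow, ← map_pow, h1, h1, (h.conj_fst_of_pair hE hj).1, one_pow]

/-- The normalized semi-invariants of a system. -/
theorem exists_normalized [IsDomain (AGerm V)] [Fintype J] (pos : J → Prop)
    (hpos : ∀ j, st j ≠ j → (pos (st j) ↔ ¬ pos j)) (hcC : ∀ z, c (AGerm.C z) = AGerm.C (conj z))
    (htC : ∀ j z, t₁ j (AGerm.C z) = AGerm.C z) :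
    ∃ Λ u v : J → AGerm V, IsEigen st t₁ t₂ (fun j => Λ j ^ 2) u v a b ∧
      (∀ j, AGerm.val (Λ j) = lm j) ∧ (∀ j, AGerm.val (u j) = 0) ∧ (∀ j, AGerm.val (v j) = 0) ∧
      (∀ i j, sHom st t₁ t₂ i (Λ j) = Λ j) ∧
      (∀ j, st j = j → c (Λ j) = Λ j ∧ c (v j) = Λ j * u j ∧ Λ j * c (u j) = v j) ∧
      ∀ j, st j ≠ j → c (Λ j) * Λ (st j) = 1 ∧ c (u j) = u (st j) ∧
        Λ (st j) ^ 2 * c (v j) = v (st j) := by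
  obtain ⟨u, v, hE⟩ := h.exists_isEigen
  obtain ⟨Λ, hΛm, hΛv, hΛs, hΛf, hΛp⟩ := h.exists_root hE
  have hu : ∀ j, AGerm.val (u j) = 0 := fun j => h.val_eq_zero_of_mul (hE.eig_fst j)
    (by rw [(h.pair j).val_m]; exact h.lm_sq_ne j)
  have hv : ∀ j, AGerm.val (v j) = 0 := fun j => by rw [← hE.swap_fst, h.val_t, hu]
  have key : ∃ r : J → AGerm V, (∀ j, AGerm.val (r j) ≠ 0) ∧ (∀ i j, sHom st t₁ t₂ i (r j) = r j) ∧
      (∀ j, st j = j → Λ j * c (r j * u j) = r j * v j) ∧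
      ∀ j, st j ≠ j → c (r j * u j) = r (st j) * u (st j) := by
    have hF : ∀ j, ∃ r, AGerm.val r ≠ 0 ∧ (∀ i, sHom st t₁ t₂ i r = r) ∧
        (st j = j → Λ j * c (r * u j) = r * v j) := by
      intro j
      by_cases hj : st j = j
      · obtain ⟨-, w, hw, huw, hww⟩ := h.conj_fst_of_fixed hE hj
        have hθ : c (w * Λ j) * (w * Λ j) = 1 := by
          rw [map_mul, hΛf j hj, ← hww, ← hΛm]; ring
        have H : ∀ β : ℂ, β + AGerm.val (w * Λ j) * conj β ≠ 0 → ∃ r, AGerm.val r ≠ 0 ∧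
            (∀ i, sHom st t₁ t₂ i r = r) ∧ (st j = j → Λ j * c (r * u j) = r * v j) := by
          intro β hβ
          have hc : ∀ z i, sHom st t₁ t₂ i (AGerm.C z) = AGerm.C z := by
            intro z i
            rw [sHom, RingHom.comp_apply, htC, h.conj_t, hcC, htC, hcC, Complex.conj_conj]
          refine ⟨AGerm.C β + w * Λ j * AGerm.C (conj β), ?_, fun i => ?_, fun _ => ?_⟩
          · rwa [map_add, map_mul _ (w * Λ j), AGerm.val_C, AGerm.val_C]
          · simp only [map_add, map_mul, hw, hΛs, hc]
          · rw [map_mul c, huw, map_add, map_mul c (w * Λ j), hcC, hcC, Complex.conj_conj]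
            linear_combination (AGerm.C β) * v j * hθ
        by_cases h1 : AGerm.val (w * Λ j) = -1
        · refine H Complex.I ?_
          rw [h1, Complex.conj_I]; ring_nf; simp
        · refine H 1 ?_
          rw [map_one, mul_one]
          intro h2
          exact h1 (by linear_combination h2)
      · exact ⟨1, by simp, fun i => map_one _, fun h1 => absurd h1 hj⟩
    choose r hr1 hr2 hr3 using hF
    have hP : ∀ j, ∃ w, (∀ i, sHom st t₁ t₂ i w = w) ∧ (st j ≠ j → c (u (st j)) = w * u j) := by
      intro j
      by_cases hj : st j = j
      · exact ⟨1, fun i => map_one _, fun h1 => absurd hj h1⟩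
      · obtain ⟨-, w, hw, huw⟩ := h.conj_fst_of_pair hE (j := st j)
          (by rw [h.st_st]; exact fun h1 => hj h1.symm)
        exact ⟨w, hw, fun _ => by rw [huw, h.st_st]⟩
    choose w hw1 hw2 using hP
    have hw3 : ∀ j, st j ≠ j → c (w j) * w (st j) = 1 := by
      intro j hj
      have h1 := h.cc (u (st j))
      rw [hw2 j hj, map_mul] at h1
      have h2 := hw2 (st j) (by rw [h.st_st]; exact fun h1 => hj h1.symm)
      rw [h.st_st] at h2
      have hu0 : u (st j) ≠ 0 := fun h0 => hE.der_fst (st j) (by rw [h0, AGerm.der_zero]; rfl)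
      rw [h2] at h1
      refine mul_right_cancel₀ hu0 ?_
      rw [one_mul]; linear_combination h1
    classical
    refine ⟨fun j => if st j = j then r j else if pos j then w j else 1, fun j => ?_, fun i j => ?_,
      fun j hj => ?_, fun j hj => ?_⟩
    · by_cases hj : st j = j
      · simp only [hj, if_true]; exact hr1 j
      · simp only [hj, if_false]
        split_ifs with hp
        · intro h0
          have h1 := congrArg AGerm.val (hw3 j hj)
          rw [map_mul, h.val_c, h0] at h1
          simp at h1
        · simp
    · dsimp only
      split_ifs
      · exact hr2 j i
      · exact hw1 j i
      · exact map_one _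
    · simp only [hj, if_true]; exact hr3 j hj
    · have hj' : st (st j) ≠ st j := by rw [h.st_st]; exact fun h1 => hj h1.symm
      have h2 := hw2 (st j) hj'
      rw [h.st_st] at h2
      simp only [hj, hj', if_false]
      by_cases hp : pos j
      · have hp' : ¬ pos (st j) := fun h1 => (hpos j hj).1 h1 hp
        rw [if_pos hp, if_neg hp', map_mul, h2, one_mul, ← mul_assoc, hw3 j hj, one_mul]
      · rw [if_neg hp, if_pos ((hpos j hj).2 hp), one_mul, h2]
  obtain ⟨r, hr1, hr2, hr3, hr4⟩ := key
  have hE' := hE.scale hr1 (fun i j => h.t₁_of_s (hr2 i j)) hr2 hu hv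
  have hm : (fun j => Λ j ^ 2) = m := funext hΛm
  refine ⟨Λ, fun j => r j * u j, fun j => r j * v j, hm ▸ hE', hΛv, fun j => ?_, fun j => ?_, hΛs,
    fun j hj => ⟨hΛf j hj, ?_, hr3 j hj⟩, fun j hj => ⟨hΛp j hj, hr4 j hj, ?_⟩⟩
  · rw [map_mul, hu, mul_zero]
  · rw [map_mul, hv, mul_zero]
  · dsimp only
    rw [← hr3 j hj, map_mul, h.cc, hΛf j hj]
  · have h5 : c (r j * v j) = t₂ j (c (r j * u j)) := by
      rw [h.conj_t, h.cc, hE'.swap_fst j]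
    have h6 := hE'.eig_snd (st j)
    have h7 : sHom st t₁ t₂ (st j) (r (st j) * v (st j)) = t₂ j (r (st j) * u (st j)) := by
      rw [sHom, RingHom.comp_apply, hE'.swap_snd (st j), h.st_st]
    rw [h7] at h6
    dsimp only
    rw [h5, hr4 j hj, hΛm, h6]

end IsSystem

end system

section products

variable {ι κ J : Type*} [Fintype ι] [Fintype κ] [Fintype J]

/-- An analytic function that vanishes at real points vanishes. -/
theorem eventually_eq_zero_of_real {f : (ι → ℂ) → ℂ} (hf : AnalyticAt ℂ f 0)
    (h : ∀ᶠ x : ι → ℝ in 𝓝 0, f (fun i => (x i : ℂ)) = 0) : ∀ᶠ x in 𝓝 0, f x = 0 := by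
  obtain ⟨t, ht0, a, ha⟩ := exists_ev_eq hf
  have htc : (t : ℂ) ≠ 0 := by exact_mod_cast ht0.ne'
  have ha0 : a = 0 := by
    ext α
    rw [co_zero]
    refine co_eq_zero_of_isLittleO (d := α.degree) (fun x hx => ?_) le_rfl
    have h1 : Tendsto (fun r : ℝ => (t * r) • x) (𝓝[>] 0) (𝓝 0) := by
      refine Tendsto.mono_left ?_ nhdsWithin_le_nhds
      have : Continuous fun r : ℝ => (t * r) • x := by fun_prop
      simpa using this.tendsto 0
    refine (isLittleO_zero _ _).congr' ?_ EventuallyEq.rfl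
    filter_upwards [h1.eventually h, Ioc_mem_nhdsGT one_pos] with r hr hr1
    have hx1 : ‖(r : ℂ) • fun i => (x i : ℂ)‖ ≤ 1 := by
      refine (pi_norm_le_iff_of_nonneg zero_le_one).2 fun i => ?_
      rw [Pi.smul_apply, norm_smul, Complex.norm_real, Complex.norm_real,
        Real.norm_of_nonneg hr1.1.le, Real.norm_of_nonneg (hx i).1]
      exact mul_le_one₀ hr1.2 (hx i).1 (hx i).2
    rw [← ha _ hx1, ← hr]
    congr 1; funext i; simp [mul_assoc]
  filter_upwards [(tendsto_const_smul_zero (ι := ι) (t : ℂ)⁻¹).eventually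
    eventually_norm_le_one] with x hx
  have h1 := ha ((t : ℂ)⁻¹ • x) hx
  rwa [smul_inv_smul₀ htc, ha0, ev_zero'] at h1

/-- A series in the monomials `y(x)`. -/
theorem exists_ev_eq_ev {θ : (κ →₀ ℕ) → ι →₀ ℕ} (hθ : Function.Injective θ)
    {y : (ι → ℂ) → κ → ℂ} (hy : ∀ x β, pw x (θ β) = pw (y x) β) {f : Wiener ι}
    (hf : SuppIn (Set.range θ) f) : ∃ g : Wiener κ, ∀ x, ev x f = ev (y x) g := by
  refine ⟨ofCo (fun β => f.co (θ β)) ((summable f).comp_injective hθ), fun x => ?_⟩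
  rw [ev, ev, lift, lift]
  simp only [co_ofCo, ← hy]
  refine (hθ.tsum_eq (f := fun α => f.co α • pw x α) fun α hα => ?_).symm
  by_contra h1
  exact hα (by simp [hf α h1])

/-- The exponents of `∏ j, (x_j y_j) ^ β_j`. -/
noncomputable def diagExp (β : J →₀ ℕ) : J ⊕ J →₀ ℕ :=
  Finsupp.equivFunOnFinite.symm (Sum.elim β β)

/-- The exponents of `∏ j, x_j ^ β_j * y_j ^ (2 * γ_j)`. -/
noncomputable def evenExp (β : J ⊕ J →₀ ℕ) : J ⊕ J →₀ ℕ :=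
  Finsupp.equivFunOnFinite.symm (Sum.elim (fun j => β (Sum.inl j)) fun j => 2 * β (Sum.inr j))

theorem suppIn_range_diagExp {f : Wiener (J ⊕ J)}
    (hf : ∀ j, SuppIn {α | wt (Sum.inl j) (Sum.inr j) α = 0} f) :
    SuppIn (Set.range (diagExp (J := J))) f := by
  intro α hα
  by_contra h0
  refine hα ⟨Finsupp.equivFunOnFinite.symm fun j => α (Sum.inl j), ?_⟩
  ext (j | j)
  · simp [diagExp]
  · have h1 : wt (Sum.inl j) (Sum.inr j) α = 0 := (hf j).mem h0
    simp only [wt] at h1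
    simp only [diagExp, Finsupp.equivFunOnFinite_symm_apply_apply, Sum.elim_inr]
    omega

theorem exists_eq_comp_mul [DecidableEq J] {f : (J ⊕ J → ℂ) → ℂ} (hf : AnalyticAt ℂ f 0)
    {M : J → (J ⊕ J → ℂ) → ℂ} (hM : ∀ j, DifferentiableAt ℂ (M j) 0) (hM0 : ∀ j, M j 0 ≠ 0)
    (hM1 : ∀ j, ‖M j 0‖ ≠ 1)
    (hfM : ∀ j, ∀ᶠ x in 𝓝 0, f (sc (Sum.inl j) (Sum.inr j) (M j x) x) = f x) :
    ∃ F : (J → ℂ) → ℂ, AnalyticAt ℂ F 0 ∧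
      ∀ᶠ x in 𝓝 0, f x = F fun j => x (Sum.inl j) * x (Sum.inr j) := by
  obtain ⟨t, ht0, a, ha⟩ := exists_ev_eq hf
  have htc : (t : ℂ) ≠ 0 := by exact_mod_cast ht0.ne'
  have hts := tendsto_const_smul_zero (ι := J ⊕ J) (t : ℂ)
  have hsupp : ∀ j, SuppIn {α | wt (Sum.inl j) (Sum.inr j) α = 0} a := by
    intro j
    have hab : (Sum.inl j : J ⊕ J) ≠ Sum.inr j := by simp
    have hMt : DifferentiableAt ℂ (fun x => M j ((t : ℂ) • x)) 0 :=
      DifferentiableAt.fun_comp' (0 : J ⊕ J → ℂ) (by rw [smul_zero]; exact hM j)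
        (differentiableAt_id.const_smul (t : ℂ))
    have hMt0 : M j ((t : ℂ) • (0 : J ⊕ J → ℂ)) = M j 0 := by rw [smul_zero]
    have hne : ∀ᶠ x in 𝓝 (0 : J ⊕ J → ℂ), M j ((t : ℂ) • x) ≠ 0 :=
      hMt.continuousAt.eventually_ne (by rw [hMt0]; exact hM0 j)
    obtain ⟨A, hA, -⟩ := hasFDerivAt_sc (a := Sum.inl j) (b := Sum.inr j) hMt
      (by rw [hMt0]; exact hM0 j)
    have hball : ∀ᶠ x in 𝓝 (0 : J ⊕ J → ℂ),
        ‖sc (Sum.inl j) (Sum.inr j) (M j ((t : ℂ) • x)) x‖ ≤ 1 := by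
      have h1 := hA.continuousAt.tendsto
      have h2 : sc (Sum.inl j) (Sum.inr j) (M j ((t : ℂ) • (0 : J ⊕ J → ℂ))) 0 = 0 := by
        funext i; simp [sc]
      rw [h2] at h1
      exact h1.eventually eventually_norm_le_one
    have hN : ∀ᶠ x in 𝓝 (0 : J ⊕ J → ℂ), ev (sc (Sum.inl j) (Sum.inr j) (M j ((t : ℂ) • x)) x)
        (a - wtPart (Sum.inl j) (Sum.inr j) 0 a)
        - 1 * ev x (a - wtPart (Sum.inl j) (Sum.inr j) 0 a) = ev x (0 : Wiener (J ⊕ J)) := by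
      filter_upwards [hne, hball, hts.eventually (hfM j),
        Metric.closedBall_mem_nhds (0 : J ⊕ J → ℂ) one_pos] with x h1 h2 h3 h4
      have h5 : ‖x‖ ≤ 1 := by simpa using h4
      have h6 : sc (Sum.inl j) (Sum.inr j) (M j ((t : ℂ) • x)) ((t : ℂ) • x)
          = (t : ℂ) • sc (Sum.inl j) (Sum.inr j) (M j ((t : ℂ) • x)) x := by
        funext i; simp only [sc, Pi.smul_apply, smul_eq_mul]; split_ifs <;> ring
      rw [ev_sub h2, ev_sub h5, ev_sc_of_wt_zero hab h1 x (suppIn_wtPart 0 a), ← ha _ h2, ← ha _ h5,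
        ← h6, h3, ev_zero']
      ring
    have h0 : a - wtPart (Sum.inl j) (Sum.inr j) 0 a = 0 := by
      rcases lt_or_gt_of_ne (hM1 j) with hlt | hgt
      · have h1 : 1 < ‖(M j 0)⁻¹‖ := by
          rw [norm_inv]; exact (one_lt_inv₀ (norm_pos_iff.2 (hM0 j))).2 hlt
        refine eq_zero_of_twisted hab.symm h1 (l := 0) (m := fun x => (M j ((t : ℂ) • x))⁻¹)
          (m' := fun _ => 1) (G := 0) (hMt.inv (by rw [hMt0]; exact hM0 j)) (by rw [smul_zero])
          continuousAt_const (by simp)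
          (fun α hα => co_sub_wtPart 0 a (by rw [wt_symm] at hα; omega)) (fun _ _ => co_zero _) ?_
        filter_upwards [hN] with x hx
        rw [← hx]
        congr 2
        funext i
        simp only [sc, inv_inv]
        rcases i with i | i <;> simp
      · exact eq_zero_of_twisted hab hgt (l := 0) (m' := fun _ => 1) (G := 0) hMt hMt0
          continuousAt_const (by simp) (fun α hα => co_sub_wtPart 0 a hα) (fun _ _ => co_zero _) hN
    rw [sub_eq_zero.1 h0]; exact suppIn_wtPart 0 a
  have hinj : Function.Injective (diagExp (J := J)) := fun β γ hβγ => by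
    ext j
    have := DFunLike.congr_fun hβγ (Sum.inl j)
    simpa [diagExp] using this
  obtain ⟨g, hg⟩ := exists_ev_eq_ev hinj
    (y := fun x j => x (Sum.inl j) * x (Sum.inr j)) (fun x β => by
      simp only [pw, diagExp, Fintype.prod_sum_type, Finsupp.equivFunOnFinite_symm_apply_apply,
        Sum.elim_inl, Sum.elim_inr, mul_pow, Finset.prod_mul_distrib]) (suppIn_range_diagExp hsupp)
  refine ⟨fun y => ev (((t : ℂ)⁻¹ ^ 2) • y) g, analyticAt_ev_inv_smul g _, ?_⟩
  filter_upwards [(tendsto_const_smul_zero (ι := J ⊕ J) (t : ℂ)⁻¹).eventually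
    eventually_norm_le_one] with x hx
  have h1 := ha ((t : ℂ)⁻¹ • x) hx
  rw [smul_inv_smul₀ htc, hg] at h1
  rw [h1]
  congr 1; funext j; simp; ring

theorem co_eq_zero_of_even [DecidableEq ι] {a : Wiener ι} {i : ι}
    (h : ∀ᶠ x in 𝓝 0, ev (Function.update x i (-x i)) a = ev x a) {α : ι →₀ ℕ} (hα : Odd (α i)) :
    a.co α = 0 := by
  have hpw : ∀ (x : ι → ℂ) (β : ι →₀ ℕ), pw (Function.update x i (-x i)) β = (-1) ^ β i * pw x β := by
    intro x β
    rw [pw, pw, ← Finset.mul_prod_erase _ _ (Finset.mem_univ i),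
      ← Finset.mul_prod_erase _ (fun k => x k ^ β k) (Finset.mem_univ i), Function.update_self,
      neg_pow, mul_assoc]
    congr 2
    refine Finset.prod_congr rfl fun k hk => ?_
    rw [Function.update_of_ne (Finset.ne_of_mem_erase hk)]
  set b : Wiener ι := ofCo (fun β => if Odd (β i) then a.co β else 0)
    (Summable.of_nonneg_of_le (fun _ => norm_nonneg _) (fun β => by split_ifs <;> simp) (summable a))
    with hb
  have hb0 : b = 0 := by
    refine co_eq_zero_of_eventually ?_
    filter_upwards [h, Metric.closedBall_mem_nhds (0 : ι → ℂ) one_pos] with x h1 h2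
    have h5 : ‖x‖ ≤ 1 := by simpa using h2
    have h6 : ‖Function.update x i (-x i)‖ ≤ 1 := by
      refine (pi_norm_le_iff_of_nonneg zero_le_one).2 fun k => ?_
      by_cases hk : k = i
      · subst hk; rw [Function.update_self, norm_neg]; exact (norm_le_pi_norm x k).trans h5
      · rw [Function.update_of_ne hk]; exact (norm_le_pi_norm x k).trans h5
    have key : 2 * ev x b = ev x a - ev (Function.update x i (-x i)) a := by
      rw [ev, ev, ev, lift, lift, lift, ← tsum_mul_left,
        ← (lift_summable (pw_le h5) a).tsum_sub (lift_summable (pw_le h6) a)]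
      refine tsum_congr fun β => ?_
      rw [hpw, hb, co_ofCo]
      by_cases hβ : Odd (β i)
      · rw [if_pos hβ, hβ.neg_one_pow]; simp only [smul_eq_mul]; ring
      · rw [if_neg hβ, (Nat.not_odd_iff_even.1 hβ).neg_one_pow, one_mul]; simp
    rw [h1, sub_self] at key
    simpa using key
  have h1 : b.co α = 0 := by rw [hb0, co_zero]
  rwa [hb, co_ofCo, if_pos hα] at h1

/-- A function that is even in the second group of variables. -/
theorem exists_eq_comp_sq [DecidableEq J] {f : (J ⊕ J → ℂ) → ℂ} (hf : AnalyticAt ℂ f 0)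
    (h : ∀ j, ∀ᶠ x in 𝓝 0, f (Function.update x (Sum.inr j) (-x (Sum.inr j))) = f x) :
    ∃ g : (J ⊕ J → ℂ) → ℂ, AnalyticAt ℂ g 0 ∧
      ∀ᶠ x in 𝓝 0, f x = g (Sum.elim (fun j => x (Sum.inl j)) fun j => x (Sum.inr j) ^ 2) := by
  obtain ⟨t, ht0, a, ha⟩ := exists_ev_eq hf
  have htc : (t : ℂ) ≠ 0 := by exact_mod_cast ht0.ne'
  have hts := tendsto_const_smul_zero (ι := J ⊕ J) (t : ℂ)
  have hodd : ∀ j (α : J ⊕ J →₀ ℕ), Odd (α (Sum.inr j)) → a.co α = 0 := by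
    intro j α hα
    refine co_eq_zero_of_even ?_ hα
    filter_upwards [hts.eventually (h j), Metric.closedBall_mem_nhds (0 : J ⊕ J → ℂ) one_pos]
      with x h1 h2
    have h5 : ‖x‖ ≤ 1 := by simpa using h2
    have h6 : ‖Function.update x (Sum.inr j) (-x (Sum.inr j))‖ ≤ 1 := by
      refine (pi_norm_le_iff_of_nonneg zero_le_one).2 fun k => ?_
      by_cases hk : k = Sum.inr j
      · subst hk; rw [Function.update_self, norm_neg]; exact (norm_le_pi_norm x _).trans h5
      · rw [Function.update_of_ne hk]; exact (norm_le_pi_norm x k).trans h5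
    rw [← ha _ h5, ← ha _ h6, ← h1]
    congr 1; funext k
    by_cases hk : k = Sum.inr j
    · subst hk; simp
    · simp [Function.update_of_ne hk]
  have hinj : Function.Injective (evenExp (J := J)) := fun β γ hβγ => by
    ext (j | j)
    · simpa [evenExp] using DFunLike.congr_fun hβγ (Sum.inl j)
    · simpa [evenExp] using DFunLike.congr_fun hβγ (Sum.inr j)
  obtain ⟨g, hg⟩ := exists_ev_eq_ev hinj
    (y := fun x => Sum.elim (fun j => x (Sum.inl j)) fun j => x (Sum.inr j) ^ 2) (fun x β => by
      simp only [pw, evenExp, Fintype.prod_sum_type, Finsupp.equivFunOnFinite_symm_apply_apply,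
        Sum.elim_inl, Sum.elim_inr, pow_mul]) (f := a) (fun α hα => by
      by_contra h0
      refine hα ⟨Finsupp.equivFunOnFinite.symm (Sum.elim (fun j => α (Sum.inl j))
        fun j => α (Sum.inr j) / 2), ?_⟩
      ext (j | j)
      · simp [evenExp]
      · have h1 : ¬ Odd (α (Sum.inr j)) := fun h1 => h0 (hodd j α h1)
        simp only [evenExp, Finsupp.equivFunOnFinite_symm_apply_apply, Sum.elim_inr]
        exact Nat.two_mul_div_two_of_even (Nat.not_odd_iff_even.1 h1))
  have hD : AnalyticAt ℂ (fun x : J ⊕ J → ℂ =>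
      (Sum.elim (fun j => (t : ℂ)⁻¹ * x (Sum.inl j)) fun j => (t : ℂ)⁻¹ ^ 2 * x (Sum.inr j) :
        J ⊕ J → ℂ)) 0 := by
    rw [analyticAt_pi_iff]
    rintro (j | j)
    · exact analyticAt_const.mul (analyticAt_coord _)
    · exact analyticAt_const.mul (analyticAt_coord _)
  refine ⟨fun y => ev (Sum.elim (fun j => (t : ℂ)⁻¹ * y (Sum.inl j))
    fun j => (t : ℂ)⁻¹ ^ 2 * y (Sum.inr j)) g, AnalyticAt.fun_comp (g := fun y => ev y g) ?_ hD, ?_⟩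
  · convert analyticAt_ev g using 1
    funext j; rcases j with j | j <;> simp
  filter_upwards [(tendsto_const_smul_zero (ι := J ⊕ J) (t : ℂ)⁻¹).eventually
    eventually_norm_le_one] with x hx
  have h1 := ha ((t : ℂ)⁻¹ • x) hx
  rw [smul_inv_smul₀ htc, hg] at h1
  rw [h1]
  congr 1; funext j; rcases j with j | j <;> simp; ring

/-- Small vectors have small componentwise square roots. -/
theorem eventually_of_mul {Q : (J → ℂ) → Prop}
    (h : ∀ᶠ x : (J → ℂ) × (J → ℂ) in 𝓝 0, Q fun j => x.1 j * x.2 j) : ∀ᶠ y in 𝓝 0, Q y := by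
  choose r hr using fun z : ℂ => IsAlgClosed.exists_pow_nat_eq z two_pos
  have hrn : ∀ z, ‖r z‖ = Real.sqrt ‖z‖ := fun z => by
    nth_rewrite 2 [← hr z]
    rw [norm_pow, Real.sqrt_sq (norm_nonneg _)]
  have hr0 : Tendsto r (𝓝 0) (𝓝 0) := by
    rw [tendsto_zero_iff_norm_tendsto_zero]
    simp only [hrn]
    have : Continuous fun z : ℂ => Real.sqrt ‖z‖ := by fun_prop
    simpa using this.tendsto 0
  have h1 : Tendsto (fun y : J → ℂ => fun j => r (y j)) (𝓝 0) (𝓝 0) :=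
    tendsto_pi_nhds.2 fun j => hr0.comp ((continuous_apply j).tendsto' (0 : J → ℂ) 0 rfl)
  filter_upwards [(h1.prodMk_nhds h1).eventually h] with y hy
  convert hy using 1
  funext j
  rw [← sq]; exact (hr (y j)).symm

end products

section coordinates

variable {V : Type*} [NormedAddCommGroup V] [NormedSpace ℂ V]

theorem partner_partner (j : CIdx e s) : partner (partner j) = j := by
  rcases j with i | i | i <;> rfl

theorem rho_rho (x : C2p e s) : rho (rho x) = x := by
  ext j <;> simp [rho, conjVec]

theorem rhoZ_rhoZ (y : Cp e s) : rhoZ (rhoZ y) = y := by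
  funext j; simp [rhoZ, partner_partner]

theorem tendsto_rho : Tendsto (rho : C2p e s → C2p e s) (𝓝 0) (𝓝 0) := by
  have h : Continuous (rho : C2p e s → C2p e s) := by unfold rho conjVec; fun_prop
  exact h.tendsto' 0 0 (by ext j <;> simp [rho, conjVec])

theorem tendsto_rhoZ : Tendsto (rhoZ : Cp e s → Cp e s) (𝓝 0) (𝓝 0) := by
  have h : Continuous (rhoZ : Cp e s → Cp e s) := by unfold rhoZ; fun_prop
  exact h.tendsto' 0 0 (by funext j; simp [rhoZ])

theorem tendsto_real : Tendsto (fun z : Cp e s => ((z, conjVec z) : C2p e s)) (𝓝 0) (𝓝 0) := by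
  have h : Continuous (fun z : Cp e s => ((z, conjVec z) : C2p e s)) := by
    unfold conjVec; fun_prop
  exact h.tendsto' 0 0 (by ext j <;> simp [conjVec])

theorem rho_real (z : Cp e s) : rho (z, conjVec z) = (z, conjVec z) := by
  ext j <;> simp [rho, conjVec]

theorem eq_real_of_rho {x : C2p e s} (h : rho x = x) : x = (x.1, conjVec x.1) := by
  ext j
  · rfl
  · nth_rewrite 1 [← h]; rfl

theorem analyticAt_coordFst (j : CIdx e s) : AnalyticAt ℂ (fun x : C2p e s => x.1 j) 0 :=
  (analyticAt_coord j).comp_isLoc (ContinuousLinearMap.fst ℂ (Cp e s) (Cp e s)).isLoc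

theorem analyticAt_coordSnd (j : CIdx e s) : AnalyticAt ℂ (fun x : C2p e s => x.2 j) 0 :=
  (analyticAt_coord j).comp_isLoc (ContinuousLinearMap.snd ℂ (Cp e s) (Cp e s)).isLoc

theorem analyticAt_Cp {f : V → Cp e s} {x : V} (h : ∀ j, AnalyticAt ℂ (fun x => f x j) x) :
    AnalyticAt ℂ f x := analyticAt_pi_iff.2 h

theorem AnalyticAt.apply_Cp {f : V → Cp e s} {x : V} (h : AnalyticAt ℂ f x) (j : CIdx e s) :
    AnalyticAt ℂ (fun x => f x j) x := analyticAt_pi_iff.1 h j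

theorem analyticAt_C2p {f : V → C2p e s} {x : V} (h1 : ∀ j, AnalyticAt ℂ (fun x => (f x).1 j) x)
    (h2 : ∀ j, AnalyticAt ℂ (fun x => (f x).2 j) x) : AnalyticAt ℂ f x :=
  (analyticAt_Cp h1).prod (analyticAt_Cp h2)

theorem isBigO_fst (j : CIdx e s) : (fun x : C2p e s => x.1 j) =O[𝓝 0] fun x => x :=
  IsBigO.of_bound 1 (Eventually.of_forall fun x => by
    rw [one_mul]; exact (norm_le_pi_norm x.1 j).trans (norm_fst_le x))

theorem isBigO_snd (j : CIdx e s) : (fun x : C2p e s => x.2 j) =O[𝓝 0] fun x => x :=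
  IsBigO.of_bound 1 (Eventually.of_forall fun x => by
    rw [one_mul]; exact (norm_le_pi_norm x.2 j).trans (norm_snd_le x))

theorem hasFDerivAt_C2p {f : V → C2p e s} {A : V →L[ℂ] C2p e s} (h0 : f 0 = 0)
    (h1 : ∀ j, (fun x => (f x).1 j - (A x).1 j) =o[𝓝 0] fun x => x)
    (h2 : ∀ j, (fun x => (f x).2 j - (A x).2 j) =o[𝓝 0] fun x => x) : HasFDerivAt f A 0 := by
  rw [hasFDerivAt_iff_isLittleO_nhds_zero]
  simp only [zero_add, h0, sub_zero]
  refine IsLittleO.prod_left (f' := fun x => (f x - A x).1) (g' := fun x => (f x - A x).2) ?_ ?_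
  · exact isLittleO_pi.2 h1
  · exact isLittleO_pi.2 h2

theorem isLittleO_sub_mul {c l : V → ℂ} (hc : ContinuousAt c 0) (hl : l =O[𝓝 0] fun x => x) :
    (fun x => (c x - c 0) * l x) =o[𝓝 0] fun x => x := by
  have h1 : (fun x => c x - c 0) =o[𝓝 0] fun _ => (1 : ℝ) := by
    rw [isLittleO_one_iff]
    simpa using hc.tendsto.sub_const (c 0)
  have h2 := (h1.mul_isBigO hl.norm_right).norm_right
  simp only [one_mul, norm_norm] at h2
  exact h2.of_norm_right

/-- The componentwise product of the two groups of variables. -/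
def diagMul (x : C2p e s) : Cp e s := fun j => x.1 j * x.2 j

theorem isLoc_diagMul : IsLoc (diagMul : C2p e s → Cp e s) :=
  ⟨analyticAt_Cp fun j => (analyticAt_coordFst j).mul (analyticAt_coordSnd j), by funext j; simp [diagMul]⟩

/-- The factors of the second coordinates of the normal form. -/
def kap (y : Cp e s) : Cp e s
  | Sum.inl i => y (Sum.inl i)
  | Sum.inr _ => 1

theorem kap_ne_zero {y : Cp e s} (h : ∀ j, y j ≠ 0) (j : CIdx e s) : kap y j ≠ 0 := by
  rcases j with i | k
  · exact h _
  · exact one_ne_zero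

/-- The linear map `(ξ, η) ↦ (Z, W)` with parameters `y`. -/
noncomputable def pairMap (y : Cp e s) (x : C2p e s) : C2p e s :=
  (fun j => x.1 j + y j * x.2 j, fun j => kap y (partner j) *
    (x.1 (partner j) + (y (partner j))⁻¹ * x.2 (partner j)))

theorem pairMap_injective {y : Cp e s} (h0 : ∀ j, y j ≠ 0) (h1 : ∀ j, y j ^ 2 ≠ 1) :
    ∀ x, pairMap y x = 0 → x = 0 := by
  intro x hx
  have e1 : ∀ j, x.1 j + y j * x.2 j = 0 := fun j => congrFun (congrArg Prod.fst hx) j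
  have e2 : ∀ j, x.1 j + (y j)⁻¹ * x.2 j = 0 := fun j => by
    have h2 := congrFun (congrArg Prod.snd hx) (partner j)
    simp only [pairMap, partner_partner] at h2
    exact (mul_eq_zero.1 h2).resolve_left (kap_ne_zero h0 j)
  have e3 : ∀ j, x.2 j = 0 := fun j => by
    have h3 : (y j ^ 2 - 1) * x.2 j = 0 := by
      have h4 := mul_inv_cancel₀ (h0 j)
      linear_combination y j * (e1 j) - y j * e2 j + x.2 j * h4
    exact (mul_eq_zero.1 h3).resolve_left (sub_ne_zero.2 (h1 j))
  ext j
  · have := e1 j; rw [e3, mul_zero, add_zero] at this; exact this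
  · exact e3 j

/-- The map `pairMap` as a linear equivalence. -/
noncomputable def pairEquiv (y : Cp e s) (h0 : ∀ j, y j ≠ 0) (h1 : ∀ j, y j ^ 2 ≠ 1) :
    C2p e s ≃L[ℂ] C2p e s :=
  (LinearEquiv.ofInjectiveEndo
    ({ toFun := pairMap y
       map_add' := fun x x' => by ext j <;> simp [pairMap] <;> ring
       map_smul' := fun c x => by ext j <;> simp [pairMap] <;> ring } : C2p e s →ₗ[ℂ] C2p e s)
    ((injective_iff_map_eq_zero _).2 (pairMap_injective h0 h1))).toContinuousLinearEquiv

theorem pairEquiv_apply (y : Cp e s) (h0 : ∀ j, y j ≠ 0) (h1 : ∀ j, y j ^ 2 ≠ 1) (x : C2p e s) :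
    pairEquiv y h0 h1 x = pairMap y x := rfl

/-- The coordinates `(Z, W)` of the complexified normal form. -/
noncomputable def normMap (Λ : Cp e s → Cp e s) (x : C2p e s) : C2p e s :=
  pairMap (Λ (diagMul x)) x

section analytic

variable {Λ : Cp e s → Cp e s}

theorem analyticAt_comp_diagMul (hΛ : AnalyticAt ℂ Λ 0) (j : CIdx e s) :
    AnalyticAt ℂ (fun x => Λ (diagMul x) j) 0 :=
  (hΛ.apply_Cp j).comp_isLoc isLoc_diagMul

theorem analyticAt_kap (hΛ : AnalyticAt ℂ Λ 0) (j : CIdx e s) :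
    AnalyticAt ℂ (fun x => kap (Λ (diagMul x)) j) 0 := by
  rcases j with i | k
  · exact analyticAt_comp_diagMul hΛ _
  · exact analyticAt_const

theorem isLoc_normMap (hΛ : AnalyticAt ℂ Λ 0) (h0 : ∀ j, Λ 0 j ≠ 0) : IsLoc (normMap Λ) := by
  refine ⟨analyticAt_C2p (fun j => ?_) (fun j => ?_), by ext j <;> simp [normMap, pairMap]⟩
  · exact (analyticAt_coordFst j).add ((analyticAt_comp_diagMul hΛ j).mul (analyticAt_coordSnd j))
  · exact (analyticAt_kap hΛ _).mul ((analyticAt_coordFst _).add (((analyticAt_comp_diagMul hΛ _).inv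
      (by rw [isLoc_diagMul.2]; exact h0 _)).mul (analyticAt_coordSnd _)))

theorem hasFDerivAt_normMap (hΛ : AnalyticAt ℂ Λ 0) (h0 : ∀ j, Λ 0 j ≠ 0)
    (h1 : ∀ j, Λ 0 j ^ 2 ≠ 1) :
    HasFDerivAt (normMap Λ) (pairEquiv (Λ 0) h0 h1 : C2p e s →L[ℂ] C2p e s) 0 := by
  have hc := fun j => (analyticAt_comp_diagMul hΛ j).continuousAt
  have hk := fun j => (analyticAt_kap hΛ j).continuousAt
  have hd0 : diagMul (0 : C2p e s) = 0 := isLoc_diagMul.2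
  refine hasFDerivAt_C2p (isLoc_normMap hΛ h0).2 (fun j => ?_) (fun j => ?_)
  · refine (isLittleO_sub_mul (hc j) (isBigO_snd j)).congr_left fun x => ?_
    simp only [ContinuousLinearEquiv.coe_coe, pairEquiv_apply, normMap, pairMap, hd0]; ring
  · have hci := ((hk (partner j)).mul ((hc (partner j)).inv₀ (by rw [hd0]; exact h0 _)))
    refine ((isLittleO_sub_mul (hk (partner j)) (isBigO_fst (partner j))).add
      (isLittleO_sub_mul hci (isBigO_snd (partner j)))).congr_left fun x => ?_
    simp only [ContinuousLinearEquiv.coe_coe, pairEquiv_apply, normMap, pairMap, hd0, Pi.mul_apply,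
      Pi.inv_apply]
    ring

theorem exists_isInv_normMap (hΛ : AnalyticAt ℂ Λ 0) (h0 : ∀ j, Λ 0 j ≠ 0)
    (h1 : ∀ j, Λ 0 j ^ 2 ≠ 1) : ∃ K, IsInv (normMap Λ) K :=
  let ⟨K, hK, _⟩ := exists_isInv (isLoc_normMap hΛ h0) (hasFDerivAt_normMap hΛ h0 h1)
  ⟨K, hK⟩

end analytic

/-- The real structure in the coordinates `(ξ, η)`, one component. -/
noncomputable def rhoAux (a b : Cp e s) : Cp e s
  | Sum.inl i => conj (b (Sum.inl i))
  | Sum.inr k => conj (a (partner (Sum.inr k)))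

/-- The real structure in the coordinates `(ξ, η)`. -/
noncomputable def rhoN (x : C2p e s) : C2p e s := (rhoAux x.1 x.2, rhoAux x.2 x.1)

theorem diagMul_rhoN (x : C2p e s) : diagMul (rhoN x) = rhoZ (diagMul x) := by
  funext j
  rcases j with i | k
  · simp [diagMul, rhoN, rhoAux, rhoZ, partner, mul_comm]
  · simp [diagMul, rhoN, rhoAux, rhoZ]

theorem tendsto_rhoN : Tendsto (rhoN : C2p e s → C2p e s) (𝓝 0) (𝓝 0) := by
  have h : Continuous (rhoN : C2p e s → C2p e s) := by
    refine Continuous.prodMk (continuous_pi fun j => ?_) (continuous_pi fun j => ?_) <;>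
    · rcases j with i | k <;> simp only [rhoAux] <;> fun_prop
  exact h.tendsto' 0 0 (by ext j <;> rcases j with i | k <;> simp [rhoN, rhoAux])

/-- The reality condition on `Λ`. -/
structure IsConjSymm (Λ : Cp e s → Cp e s) (y : Cp e s) : Prop where
  ne : ∀ j, Λ y j ≠ 0
  inl : ∀ i, conj (Λ y (Sum.inl i)) = Λ (rhoZ y) (Sum.inl i)
  inr : ∀ k, Λ (rhoZ y) (Sum.inr k) * conj (Λ y (partner (Sum.inr k))) = 1

theorem normMap_rhoN {Λ : Cp e s → Cp e s} {x : C2p e s} (h : IsConjSymm Λ (diagMul x)) :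
    normMap Λ (rhoN x) = rho (normMap Λ x) := by
  have hne : ∀ k, Λ (rhoZ (diagMul x)) (Sum.inr k) ≠ 0 := fun k =>
    left_ne_zero_of_mul_eq_one (h.inr k)
  have hinr : ∀ k, conj (Λ (diagMul x) (partner (Sum.inr k)))
      = (Λ (rhoZ (diagMul x)) (Sum.inr k))⁻¹ := fun k => eq_inv_of_mul_eq_one_right (h.inr k)
  rw [normMap, normMap, diagMul_rhoN]
  ext j
  · rcases j with i | k
    · have := h.ne (Sum.inl i)
      have h2 := h.inl i
      have h3 : Λ (rhoZ (diagMul x)) (Sum.inl i) ≠ 0 := by rw [← h2]; simpa using this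
      simp only [pairMap, rhoN, rhoAux, rho, conjVec, kap, partner, map_mul, map_add, map_inv₀, h2]
      field_simp; ring
    · simp only [pairMap, rhoN, rhoAux, rho, conjVec, map_mul, map_add, map_inv₀, hinr, inv_inv]
      rcases k with i | i <;> simp [kap, partner]
  · rcases j with i | k
    · have := h.ne (Sum.inl i)
      have h2 := h.inl i
      have h3 : Λ (rhoZ (diagMul x)) (Sum.inl i) ≠ 0 := by rw [← h2]; simpa using this
      simp only [pairMap, rhoN, rhoAux, rho, conjVec, kap, partner, map_mul, map_add, h2]
      field_simp; ring
    · simp only [pairMap, rhoN, rhoAux, rho, conjVec, map_mul, map_add]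
      rcases k with i | i
      · have := hinr (Sum.inr i)
        simp only [partner] at this
        simp [kap, partner, this]
      · have := hinr (Sum.inl i)
        simp only [partner] at this
        simp [kap, partner, this]

end coordinates

section parameters

variable {γe : Fin e → ℝ} {γs : Fin s → ℂ}

/-- The conditions on the parameters. -/
structure IsParam (γe : Fin e → ℝ) (γs : Fin s → ℂ) : Prop where
  ell : ∀ i, 0 < γe i ∧ γe i < 1 / 2
  cpl : ∀ i, (γs i).re < 1 / 2 ∧ 0 ≤ (γs i).im ∧ γs i ≠ 0

namespace IsParam

variable (h : IsParam γe γs)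
include h

theorem one_lt_lam_inl (i : Fin e) : 1 < (1 + Real.sqrt (1 - 4 * γe i ^ 2)) / (2 * γe i) := by
  obtain ⟨h1, h2⟩ := h.ell i
  rw [one_lt_div (by linarith)]
  have := Real.sqrt_nonneg (1 - 4 * γe i ^ 2)
  linarith

theorem lam_inl_eq (i : Fin e) : (γe i : ℂ) * (lam γe γs (Sum.inl i) ^ 2 + 1)
    = lam γe γs (Sum.inl i) := by
  obtain ⟨h1, h2⟩ := h.ell i
  have h3 := Real.sq_sqrt (show 0 ≤ 1 - 4 * γe i ^ 2 by nlinarith)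
  simp only [lam]
  norm_cast
  set r := Real.sqrt (1 - 4 * γe i ^ 2)
  field_simp
  linear_combination h3

theorem one_sub_ne (i : Fin s) : 1 - conj (γs i) ≠ 0 := by
  intro h0
  have h1 := congrArg Complex.re h0
  have := (h.cpl i).1
  simp at h1; linarith

theorem lam_sq (i : Fin s) : lam γe γs (Sum.inr (Sum.inl i)) ^ 2 = (conj (γs i))⁻¹ - 1 := by
  simp only [lam, one_div]
  exact Complex.cpow_nat_inv_pow _ two_ne_zero

theorem inv_sub_one_ne (i : Fin s) : (conj (γs i))⁻¹ - 1 ≠ 0 := by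
  have h1 : conj (γs i) ≠ 0 := by simpa using (h.cpl i).2.2
  intro h0
  refine h.one_sub_ne i ?_
  have h2 := mul_inv_cancel₀ h1
  linear_combination (conj (γs i)) * h0 - h2

theorem lam_inr_ne (i : Fin s) : lam γe γs (Sum.inr (Sum.inl i)) ≠ 0 := by
  intro h0
  refine h.inv_sub_one_ne i ?_
  rw [← h.lam_sq (γe := γe), h0]; simp

theorem lam_inr_inr (i : Fin s) : lam γe γs (Sum.inr (Sum.inr i))
    = (conj (lam γe γs (Sum.inr (Sum.inl i))))⁻¹ := rfl

theorem lam_ne_zero (j : CIdx e s) : lam γe γs j ≠ 0 := by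
  rcases j with i | i | i
  · simp only [lam]
    exact_mod_cast (zero_lt_one.trans (h.one_lt_lam_inl i)).ne'
  · exact h.lam_inr_ne i
  · rw [h.lam_inr_inr]
    exact inv_ne_zero ((map_ne_zero _).2 (h.lam_inr_ne i))

theorem norm_lam_sq_inr (i : Fin s) : ‖lam γe γs (Sum.inr (Sum.inl i)) ^ 2‖ ≠ 1 := by
  have h1 : conj (γs i) ≠ 0 := by simpa using (h.cpl i).2.2
  rw [h.lam_sq]
  intro h2
  have h3 : ‖1 - conj (γs i)‖ = ‖conj (γs i)‖ := by
    have h4 : 1 - conj (γs i) = ((conj (γs i))⁻¹ - 1) * conj (γs i) := by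
      rw [sub_mul, inv_mul_cancel₀ h1, one_mul]
    rw [h4, norm_mul, h2, one_mul]
  have h5 : Complex.normSq (1 - conj (γs i)) = Complex.normSq (conj (γs i)) := by
    rw [Complex.normSq_eq_norm_sq, Complex.normSq_eq_norm_sq, h3]
  have := (h.cpl i).1
  simp [Complex.normSq_apply] at h5
  nlinarith

theorem norm_lam_sq_ne (j : CIdx e s) : ‖lam γe γs j ^ 2‖ ≠ 1 := by
  rcases j with i | i | i
  · have h1 := h.one_lt_lam_inl i
    simp only [lam]
    rw [norm_pow, Complex.norm_real, Real.norm_of_nonneg (by linarith)]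
    nlinarith
  · exact h.norm_lam_sq_inr i
  · rw [h.lam_inr_inr, inv_pow, norm_inv, ← map_pow, Complex.norm_conj]
    exact fun h1 => h.norm_lam_sq_inr (γe := γe) i (inv_eq_one.1 h1)

theorem lam_sq_ne_one (j : CIdx e s) : lam γe γs j ^ 2 ≠ 1 := fun h1 =>
  h.norm_lam_sq_ne j (by rw [h1, norm_one])

theorem conj_lam_inl (i : Fin e) : conj (lam γe γs (Sum.inl i)) = lam γe γs (Sum.inl i) :=
  Complex.conj_ofReal _

theorem conj_lam_inr (k : Fin s ⊕ Fin s) :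
    conj (lam γe γs (Sum.inr k)) * lam γe γs (partner (Sum.inr k)) = 1 := by
  rcases k with i | i
  · simp only [partner]
    rw [h.lam_inr_inr]
    exact mul_inv_cancel₀ ((map_ne_zero _).2 (h.lam_inr_ne i))
  · simp only [partner]
    rw [h.lam_inr_inr, map_inv₀, Complex.conj_conj]
    exact inv_mul_cancel₀ (h.lam_inr_ne i)

/-- The coefficients of the quadric in terms of `λ`. -/
theorem quadCoef_mul (j : CIdx e s) : quadCoef γe γs (partner j) *
    (kap (lam γe γs) j * (1 + (lam γe γs j ^ 2)⁻¹)) = 1 := by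
  have hl := h.lam_ne_zero j
  rcases j with i | i | i
  · have h1 := h.lam_inl_eq i
    simp only [partner, quadCoef, kap]
    field_simp
    linear_combination h1
  · have h1 : conj (γs i) ≠ 0 := by simpa using (h.cpl i).2.2
    simp only [partner, quadCoef, kap, h.lam_sq]
    have h2 := h.inv_sub_one_ne i
    have h3 : (conj (γs i))⁻¹ - 1 = (1 - conj (γs i)) / conj (γs i) := by field_simp
    have h4 := h.one_sub_ne i
    rw [h3]; field_simp; ring
  · have h1 : γs i ≠ 0 := (h.cpl i).2.2
    simp only [partner, quadCoef, kap, h.lam_inr_inr]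
    rw [inv_pow, inv_inv, ← map_pow, h.lam_sq, map_sub, map_inv₀, Complex.conj_conj, map_one]
    field_simp; ring

theorem quadCoef_ne_zero (j : CIdx e s) : quadCoef γe γs (partner j) ≠ 0 :=
  left_ne_zero_of_mul_eq_one (h.quadCoef_mul j)

end IsParam

namespace IsAdmissible

variable {Λ : Cp e s → Cp e s} (hΛ : IsAdmissible γe γs Λ) (h : IsParam γe γs)
include hΛ h

theorem ne_zero (j : CIdx e s) : Λ 0 j ≠ 0 := by rw [hΛ.2.1]; exact h.lam_ne_zero j

theorem sq_ne_one (j : CIdx e s) : Λ 0 j ^ 2 ≠ 1 := by rw [hΛ.2.1]; exact h.lam_sq_ne_one j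

theorem eventually_ne : ∀ᶠ y in 𝓝 0, ∀ j, Λ y j ≠ 0 :=
  eventually_all.2 fun j => (hΛ.1.apply_Cp j).continuousAt.eventually_ne (hΛ.ne_zero h j)

theorem eventually_sq_ne : ∀ᶠ y in 𝓝 0, ∀ j, Λ y j ^ 2 ≠ 1 :=
  eventually_all.2 fun j => ((hΛ.1.apply_Cp j).continuousAt.pow 2).eventually_ne (hΛ.sq_ne_one h j)

theorem eventually_isConjSymm : ∀ᶠ y in 𝓝 0, IsConjSymm Λ y := by
  have h1 := eventually_all.2 hΛ.2.2.1
  have h2 := eventually_all.2 hΛ.2.2.2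
  have h3 := hΛ.eventually_ne h
  filter_upwards [h1, h2, h3, tendsto_rhoZ.eventually h2, tendsto_rhoZ.eventually h3]
    with y e1 e2 e3 e4 e5
  refine ⟨e3, fun i => by rw [e1 i, Complex.conj_conj], fun k => ?_⟩
  rcases k with i | i
  · simp only [partner]
    have h4 := e4 i
    rw [rhoZ_rhoZ] at h4
    rw [← h4, mul_inv_cancel₀ (e5 _)]
  · simp only [partner]
    have h4 := congrArg conj (e2 i)
    rw [map_inv₀, Complex.conj_conj] at h4
    rw [← h4, inv_mul_cancel₀ ((map_ne_zero _).2 (e3 _))]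

end IsAdmissible

end parameters

section solution

/-- An analytic function on `ℂ^(2p)` is determined by its values at the points `(z, z̄)`. -/
theorem eventuallyEq_of_real {f g : C2p e s → Cp e s} (hf : AnalyticAt ℂ f 0)
    (hg : AnalyticAt ℂ g 0) (h : ∀ᶠ z : Cp e s in 𝓝 0, f (z, conjVec z) = g (z, conjVec z)) :
    f =ᶠ[𝓝 0] g := by
  let R : (CIdx e s ⊕ CIdx e s → ℂ) → C2p e s := fun v =>
    (fun j => v (Sum.inl j) + Complex.I * v (Sum.inr j),
      fun j => v (Sum.inl j) - Complex.I * v (Sum.inr j))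
  let S : C2p e s → CIdx e s ⊕ CIdx e s → ℂ := fun x =>
    Sum.elim (fun j => (x.1 j + x.2 j) / 2) fun j => (x.1 j - x.2 j) / (2 * Complex.I)
  have hR : IsLoc R := by
    refine ⟨analyticAt_C2p (fun j => ?_) (fun j => ?_), by ext j <;> simp [R]⟩
    · exact (analyticAt_coord _).add (analyticAt_const.mul (analyticAt_coord _))
    · exact (analyticAt_coord _).sub (analyticAt_const.mul (analyticAt_coord _))
  have hS : Tendsto S (𝓝 0) (𝓝 0) := by
    have hc : Continuous S := by
      refine continuous_pi fun j => ?_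
      rcases j with j | j <;> simp only [S, Sum.elim_inl, Sum.elim_inr] <;> fun_prop
    exact hc.tendsto' 0 0 (by funext j; rcases j with j | j <;> simp [S])
  have hRS : ∀ x, R (S x) = x := fun x => by
    have hI : (2 * Complex.I) ≠ 0 := by simp
    ext j <;> simp only [R, S, Sum.elim_inl, Sum.elim_inr] <;> field_simp <;> ring
  have key : ∀ j, ∀ᶠ x in 𝓝 0, f x j - g x j = 0 := by
    intro j
    have h1 : AnalyticAt ℂ ((fun x => f x j - g x j) ∘ R) 0 :=
      ((hf.apply_Cp j).sub (hg.apply_Cp j)).comp_isLoc hR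
    have ht : Tendsto (fun x : CIdx e s ⊕ CIdx e s → ℝ => fun j : CIdx e s =>
        ((x (Sum.inl j) : ℂ) + Complex.I * x (Sum.inr j))) (𝓝 0) (𝓝 0) := by
      have hc : Continuous (fun x : CIdx e s ⊕ CIdx e s → ℝ => fun j : CIdx e s =>
        ((x (Sum.inl j) : ℂ) + Complex.I * x (Sum.inr j))) := by fun_prop
      exact hc.tendsto' 0 0 (by funext j; simp)
    have h2 := eventually_eq_zero_of_real h1 (by
      filter_upwards [ht.eventually h] with x hx
      have h3 : R (fun i => (x i : ℂ)) = ((fun j => ((x (Sum.inl j) : ℂ) + Complex.I * x (Sum.inr j))),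
          conjVec fun j => ((x (Sum.inl j) : ℂ) + Complex.I * x (Sum.inr j))) := by
        ext k
        · rfl
        · simp [R, conjVec, sub_eq_add_neg]
      simp only [Function.comp_apply]
      rw [h3, hx, sub_self])
    filter_upwards [hS.eventually h2] with x hx
    simpa only [Function.comp_apply, hRS] using hx
  filter_upwards [eventually_all.2 key] with x hx
  funext j
  exact sub_eq_zero.1 (hx j)

/-- The complexified right-hand sides of the quadratic equations. -/
noncomputable def cRHS (Λ : Cp e s → Cp e s) (y : Cp e s) (x : C2p e s) : Cp e s
  | Sum.inl i => coefA Λ y (Sum.inl i) * (x.1 (Sum.inl i) * x.2 (Sum.inl i))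
      - coefB Λ y (Sum.inl i) * (x.1 (Sum.inl i) ^ 2 + x.2 (Sum.inl i) ^ 2)
  | Sum.inr k => coefA Λ y (Sum.inr k) * (x.1 (Sum.inr k) * x.2 (partner (Sum.inr k)))
      - coefB Λ y (Sum.inr k) *
        (x.1 (Sum.inr k) ^ 2 + Λ y (Sum.inr k) ^ 2 * x.2 (partner (Sum.inr k)) ^ 2)

theorem quadRHS_eq (Λ : Cp e s → Cp e s) (y z : Cp e s) :
    quadRHS Λ y z = cRHS Λ y (z, conjVec z) := by
  funext j; rcases j with i | k <;> rfl

theorem cRHS_normMap {Λ : Cp e s → Cp e s} {x : C2p e s} (h0 : ∀ j, Λ (diagMul x) j ≠ 0)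
    (h1 : ∀ j, Λ (diagMul x) j ^ 2 ≠ 1) : cRHS Λ (diagMul x) (normMap Λ x) = diagMul x := by
  funext j
  have e0 := h0 j
  have e1 : 1 - Λ (diagMul x) j ^ 2 ≠ 0 := sub_ne_zero.2 (h1 j).symm
  rcases j with i | k
  · simp only [cRHS, coefA, coefB, normMap, pairMap, kap, partner]
    rw [show diagMul x (Sum.inl i) = x.1 (Sum.inl i) * x.2 (Sum.inl i) from rfl]
    field_simp; ring
  · have e2 : kap (Λ (diagMul x)) (partner (partner (Sum.inr k))) = 1 := by
      rw [partner_partner]; rfl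
    simp only [cRHS, coefA, coefB, normMap, pairMap, e2]
    simp only [partner_partner]
    rw [show diagMul x (Sum.inr k) = x.1 (Sum.inr k) * x.2 (Sum.inr k) from rfl]
    field_simp; ring

variable {γe : Fin e → ℝ} {γs : Fin s → ℂ} {Λ : Cp e s → Cp e s}

theorem hasStrictFDerivAt_cRHS (hΛ : IsAdmissible γe γs Λ) (h : IsParam γe γs) :
    HasStrictFDerivAt (fun q : Cp e s × C2p e s => cRHS Λ q.1 q.2) (0 : Cp e s × C2p e s →L[ℂ] Cp e s)
      0 := by
  have hL : ∀ j, AnalyticAt ℂ (fun q : Cp e s × C2p e s => Λ q.1 j) 0 := fun j =>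
    (hΛ.1.apply_Cp j).comp_isLoc (ContinuousLinearMap.fst ℂ (Cp e s) (C2p e s)).isLoc
  have hx : ∀ j, AnalyticAt ℂ (fun q : Cp e s × C2p e s => q.2.1 j) 0 := fun j =>
    (analyticAt_coordFst j).comp_isLoc (ContinuousLinearMap.snd ℂ (Cp e s) (C2p e s)).isLoc
  have hy : ∀ j, AnalyticAt ℂ (fun q : Cp e s × C2p e s => q.2.2 j) 0 := fun j =>
    (analyticAt_coordSnd j).comp_isLoc (ContinuousLinearMap.snd ℂ (Cp e s) (C2p e s)).isLoc
  have hd : ∀ j, (1 - Λ (0 : Cp e s × C2p e s).1 j ^ 2) ^ 2 ≠ 0 := fun j =>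
    pow_ne_zero 2 (sub_ne_zero.2 (hΛ.sq_ne_one h j).symm)
  have hA : ∀ j, AnalyticAt ℂ (fun q : Cp e s × C2p e s => coefA Λ q.1 j) 0 := by
    intro j
    rcases j with i | k
    · exact (analyticAt_const.add ((hL _).pow 2)).div ((analyticAt_const.sub ((hL _).pow 2)).pow 2)
        (hd _)
    · exact ((hL _).add ((hL _).pow 3)).div ((analyticAt_const.sub ((hL _).pow 2)).pow 2) (hd _)
  have hB : ∀ j, AnalyticAt ℂ (fun q : Cp e s × C2p e s => coefB Λ q.1 j) 0 := fun j =>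
    (hL j).div ((analyticAt_const.sub ((hL _).pow 2)).pow 2) (hd _)
  have han : AnalyticAt ℂ (fun q : Cp e s × C2p e s => cRHS Λ q.1 q.2) 0 := by
    refine analyticAt_Cp fun j => ?_
    rcases j with i | k
    · exact ((hA _).mul ((hx _).mul (hy _))).sub ((hB _).mul (((hx _).pow 2).add ((hy _).pow 2)))
    · exact ((hA _).mul ((hx _).mul (hy _))).sub
        ((hB _).mul (((hx _).pow 2).add (((hL _).pow 2).mul ((hy _).pow 2))))
  have hxO : ∀ j, (fun q : Cp e s × C2p e s => q.2.1 j) =O[𝓝 0] fun q => q := fun j =>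
    IsBigO.of_bound 1 (Eventually.of_forall fun q => by
      rw [one_mul]; exact (norm_le_pi_norm q.2.1 j).trans ((norm_fst_le q.2).trans (norm_snd_le q)))
  have hyO : ∀ j, (fun q : Cp e s × C2p e s => q.2.2 j) =O[𝓝 0] fun q => q := fun j =>
    IsBigO.of_bound 1 (Eventually.of_forall fun q => by
      rw [one_mul]; exact (norm_le_pi_norm q.2.2 j).trans ((norm_snd_le q.2).trans (norm_snd_le q)))
  have hD : HasFDerivAt (fun q : Cp e s × C2p e s => cRHS Λ q.1 q.2)
      (0 : Cp e s × C2p e s →L[ℂ] Cp e s) 0 := by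
    rw [hasFDerivAt_iff_isLittleO_nhds_zero, isLittleO_pi]
    intro j
    rcases j with i | k
    · refine (((isLittleO_sub_mul ((hA (Sum.inl i)).continuousAt.mul (hx (Sum.inl i)).continuousAt)
        (hyO (Sum.inl i))).sub (isLittleO_sub_mul ((hB (Sum.inl i)).continuousAt.mul
        (hx (Sum.inl i)).continuousAt) (hxO (Sum.inl i)))).sub (isLittleO_sub_mul
        ((hB (Sum.inl i)).continuousAt.mul (hy (Sum.inl i)).continuousAt)
        (hyO (Sum.inl i)))).congr_left fun q => ?_
      simp [cRHS]; ring
    · refine (((isLittleO_sub_mul ((hA (Sum.inr k)).continuousAt.mul (hx (Sum.inr k)).continuousAt)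
        (hyO (partner (Sum.inr k)))).sub (isLittleO_sub_mul ((hB (Sum.inr k)).continuousAt.mul
        (hx (Sum.inr k)).continuousAt) (hxO (Sum.inr k)))).sub (isLittleO_sub_mul
        (((hB (Sum.inr k)).continuousAt.mul ((hL (Sum.inr k)).continuousAt.pow 2)).mul
          (hy (partner (Sum.inr k))).continuousAt)
        (hyO (partner (Sum.inr k))))).congr_left fun q => ?_
      simp [cRHS]; ring
  have := han.hasStrictFDerivAt
  rwa [hD.fderiv] at this

theorem isSolution_unique (hΛ : IsAdmissible γe γs Λ) (h : IsParam γe γs) {ζ₁ ζ₂ : C2p e s → Cp e s}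
    (h1 : IsSolution Λ ζ₁) (h2 : IsSolution Λ ζ₂) : ζ₁ =ᶠ[𝓝 0] ζ₂ := by
  refine eventuallyEq_of_real h1.1 h2.1 ?_
  have ht : ∀ {ζ : C2p e s → Cp e s}, IsSolution Λ ζ → Tendsto (fun z : Cp e s =>
      ((ζ (z, conjVec z), (z, conjVec z)) : Cp e s × C2p e s)) (𝓝 0) (𝓝 0) := fun hζ =>
    ((hζ.1.tendsto_zero hζ.2.1).comp tendsto_real).prodMk_nhds tendsto_real
  have hl := ((hasStrictFDerivAt_cRHS hΛ h).isLittleO).def (show (0 : ℝ) < 1 / 2 by norm_num)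
  have htt : Tendsto (fun z : Cp e s => (((ζ₁ (z, conjVec z), (z, conjVec z)) : Cp e s × C2p e s),
      ((ζ₂ (z, conjVec z), (z, conjVec z)) : Cp e s × C2p e s))) (𝓝 0) (𝓝 (0, 0)) :=
    (ht h1).prodMk_nhds (ht h2)
  filter_upwards [htt.eventually hl, h1.2.2, h2.2.2] with z e1 e2 e3
  rw [quadRHS_eq] at e2 e3
  simp only [zero_apply, sub_zero] at e1
  rw [← e2, ← e3, Prod.mk_sub_mk, sub_self, Prod.norm_mk, norm_zero,
    max_eq_left (norm_nonneg _)] at e1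
  have h4 : ‖ζ₁ (z, conjVec z) - ζ₂ (z, conjVec z)‖ ≤ 0 := by linarith
  exact sub_eq_zero.1 (norm_le_zero_iff.1 h4)

theorem isSolution_diagMul (hΛ : IsAdmissible γe γs Λ) (h : IsParam γe γs)
    {K : C2p e s → C2p e s} (hK : IsInv (normMap Λ) K) : IsSolution Λ (diagMul ∘ K) := by
  refine ⟨(isLoc_diagMul.comp hK.loc').1, (isLoc_diagMul.comp hK.loc').2, ?_⟩
  have h1 := (isLoc_diagMul.comp hK.loc').tendsto
  filter_upwards [tendsto_real.eventually hK.right,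
    tendsto_real.eventually (h1.eventually (hΛ.eventually_ne h)),
    tendsto_real.eventually (h1.eventually (hΛ.eventually_sq_ne h))] with z e1 e2 e3
  have h4 := cRHS_normMap e2 e3
  simp only [Function.comp_apply, id_eq] at *
  rw [e1] at h4
  rw [quadRHS_eq, h4]

theorem IsSolution.eventuallyEq (hΛ : IsAdmissible γe γs Λ) (h : IsParam γe γs)
    {ζ : C2p e s → Cp e s} (hζ : IsSolution Λ ζ) {K : C2p e s → C2p e s}
    (hK : IsInv (normMap Λ) K) : ζ =ᶠ[𝓝 0] diagMul ∘ K :=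
  isSolution_unique hΛ h hζ (isSolution_diagMul hΛ h hK)

/-- The inverse of the normalizing coordinates respects the real structures. -/
theorem inv_normMap_rho (hΛ : IsAdmissible γe γs Λ) (h : IsParam γe γs)
    {K : C2p e s → C2p e s} (hK : IsInv (normMap Λ) K) :
    ∀ᶠ x in 𝓝 0, K (rho x) = rhoN (K x) := by
  have h1 := (isLoc_diagMul.comp hK.loc').tendsto
  filter_upwards [hK.right, h1.eventually (hΛ.eventually_isConjSymm h),
    (tendsto_rhoN.comp hK.loc'.tendsto).eventually hK.left] with x e1 e2 e3
  have h4 := normMap_rhoN e2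
  simp only [Function.comp_apply, id_eq] at *
  rw [e1] at h4
  rw [← h4, e3]

/-- The solution satisfies the reality condition. -/
theorem IsSolution.rhoZ_eq (hΛ : IsAdmissible γe γs Λ) (h : IsParam γe γs)
    {ζ : C2p e s → Cp e s} (hζ : IsSolution Λ ζ) :
    ∀ᶠ z : Cp e s in 𝓝 0, rhoZ (ζ (z, conjVec z)) = ζ (z, conjVec z) := by
  obtain ⟨K, hK⟩ := exists_isInv_normMap hΛ.1 (hΛ.ne_zero h) (hΛ.sq_ne_one h)
  filter_upwards [tendsto_real.eventually (hζ.eventuallyEq hΛ h hK),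
    tendsto_real.eventually (inv_normMap_rho hΛ h hK)] with z e1 e2
  rw [rho_real] at e2
  rw [e1, Function.comp_apply, ← diagMul_rhoN, ← e2]

/-- The linear equivalence given by a diagonal matrix. -/
noncomputable def diagEquiv (d : Cp e s) (hd : ∀ j, d j ≠ 0) : Cp e s ≃L[ℂ] Cp e s :=
  ContinuousLinearEquiv.piCongrRight fun j => ContinuousLinearEquiv.unitsEquivAut ℂ (Units.mk0 (d j) (hd j))

theorem diagEquiv_apply (d : Cp e s) (hd : ∀ j, d j ≠ 0) (y : Cp e s) (j : CIdx e s) :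
    diagEquiv d hd y j = y j * d j := rfl

theorem hasFDerivAt_mul_self {V : Type*} [NormedAddCommGroup V] [NormedSpace ℂ V]
    {c l : V → ℂ} {l' : V →L[ℂ] ℂ} (hc : DifferentiableAt ℂ c 0) (hl : HasFDerivAt l l' 0)
    (h0 : l 0 = 0) : HasFDerivAt (fun x => l x * c x) (c 0 • l') 0 := by
  refine (hl.mul hc.hasFDerivAt).congr_fderiv ?_
  ext v; simp [h0]

theorem exists_inverseFactor (hΛ : IsAdmissible γe γs Λ) (h : IsParam γe γs) :
    ∃ Λ', IsInverseFactor Λ Λ' ∧ (∀ j, Λ' 0 j ≠ 0) ∧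
      ∀ᶠ y in 𝓝 0, ∀ j, Λ' (fun k => y k * Λ y k) j * Λ y j = 1 := by
  have hloc : IsLoc (fun y : Cp e s => fun k => y k * Λ y k) :=
    ⟨analyticAt_Cp fun j => (analyticAt_coord j).mul (hΛ.1.apply_Cp j), by funext j; simp⟩
  have hd : HasFDerivAt (fun y : Cp e s => fun k => y k * Λ y k)
      (diagEquiv (Λ 0) (hΛ.ne_zero h) : Cp e s →L[ℂ] Cp e s) 0 := by
    rw [hasFDerivAt_pi']
    intro j
    refine (hasFDerivAt_mul_self (hΛ.1.apply_Cp j).differentiableAt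
      (ContinuousLinearMap.proj (R := ℂ) (φ := fun _ : CIdx e s => ℂ) j).hasFDerivAt rfl).congr_fderiv ?_
    ext v; simp [diagEquiv_apply, mul_comm]
  obtain ⟨ψ, hψ, -⟩ := exists_isInv hloc hd
  have hΛψ : ∀ j, AnalyticAt ℂ (fun y => Λ (ψ y) j) 0 := fun j =>
    (hΛ.1.apply_Cp j).comp_isLoc hψ.loc'
  have hne := hΛ.eventually_ne h
  refine ⟨fun y j => (Λ (ψ y) j)⁻¹, ⟨analyticAt_Cp fun j => (hΛψ j).inv ?_, ?_, ?_⟩, fun j => ?_, ?_⟩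
  · rw [hψ.loc'.2]; exact hΛ.ne_zero h j
  · filter_upwards [hψ.left, hne] with y e1 e2 j
    simp only [Function.comp_apply, id_eq] at e1
    rw [e1, mul_inv_cancel_right₀ (e2 j)]
  · filter_upwards [hψ.right, hψ.loc'.tendsto.eventually hne] with y e1 e2 j
    have h4 : (fun k => y k * (Λ (ψ y) k)⁻¹) = ψ y := by
      funext k
      have h5 := congrFun e1 k
      simp only [Function.comp_apply, id_eq] at h5
      nth_rewrite 1 [← h5]
      rw [mul_inv_cancel_right₀ (e2 k)]
    rw [h4, inv_mul_cancel_right₀ (e2 j)]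
  · dsimp only
    rw [hψ.loc'.2]; exact inv_ne_zero (hΛ.ne_zero h j)
  · filter_upwards [hψ.left, hne] with y e1 e2 j
    simp only [Function.comp_apply, id_eq] at e1
    rw [e1, inv_mul_cancel₀ (e2 j)]

/-- The real equations of the normal form. -/
theorem exists_real_equations (hΛ : IsAdmissible γe γs Λ) (h : IsParam γe γs)
    {ζ : C2p e s → Cp e s} (hζ : IsSolution Λ ζ) :
    ∃ Λ' : Cp e s → Cp e s, IsInverseFactor Λ Λ' ∧ (∀ j, Λ' 0 j ≠ 0) ∧
      ∀ᶠ z : C2p e s in 𝓝 0, z ∈ normalForm Λ ζ →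
        (∀ i : Fin e, z.2 (Sum.inl i) = conj (z.2 (Sum.inl i))) ∧
        (∀ i : Fin s, z.2 (Sum.inr (Sum.inl i)) * Λ' z.2 (Sum.inr (Sum.inl i)) ^ 2 =
          conj (z.2 (Sum.inr (Sum.inr i)))) := by
  obtain ⟨Λ', h1, h2, h3⟩ := exists_inverseFactor hΛ h
  refine ⟨Λ', h1, h2, ?_⟩
  have ht : Tendsto (fun z : C2p e s => z.1) (𝓝 0) (𝓝 0) := continuous_fst.tendsto' 0 0 rfl
  have hζ0 := (hζ.1.tendsto_zero hζ.2.1).comp tendsto_real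
  have key : ∀ᶠ z : Cp e s in 𝓝 0, rhoZ (ζ (z, conjVec z)) = ζ (z, conjVec z) ∧
      IsConjSymm Λ (ζ (z, conjVec z)) ∧ ∀ j, Λ' (fun k => ζ (z, conjVec z) k *
        Λ (ζ (z, conjVec z)) k) j * Λ (ζ (z, conjVec z)) j = 1 := by
    filter_upwards [hζ.rhoZ_eq hΛ h, hζ0.eventually (hΛ.eventually_isConjSymm h),
      hζ0.eventually h3] with z e1 e2 e3
    exact ⟨e1, e2, e3⟩
  filter_upwards [ht.eventually key] with z ⟨e1, e2, e3⟩ hz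
  have hz' : z.2 = fun j => Λ (ζ (z.1, conjVec z.1)) j * ζ (z.1, conjVec z.1) j := hz
  generalize ζ (z.1, conjVec z.1) = y at *
  refine ⟨fun i => ?_, fun i => ?_⟩
  · have h5 := congrFun e1 (Sum.inl i)
    simp only [rhoZ, partner] at h5
    rw [hz', map_mul, e2.inl, h5, e1]
  · have h5 := congrFun e1 (Sum.inr (Sum.inl i))
    have h6 := e2.inr (Sum.inl i)
    have h7 := e3 (Sum.inr (Sum.inl i))
    simp only [rhoZ, partner] at h5 h6
    rw [e1] at h6
    have h8 : (fun j => Λ y j * y j) = fun k => y k * Λ y k := by funext k; rw [mul_comm]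
    rw [hz', map_mul, h5]
    simp only [h8]
    have h9 : Λ' (fun k => y k * Λ y k) (Sum.inr (Sum.inl i))
        = conj (Λ y (Sum.inr (Sum.inr i))) :=
      mul_right_cancel₀ (e2.ne _) (h7.trans (by rw [mul_comm, h6]))
    rw [h9]
    linear_combination y (Sum.inr (Sum.inl i)) * conj (Λ y (Sum.inr (Sum.inr i))) * h6

end solution

section equivalence

theorem IsInv.isBiholGerm {φ ψ : C2p e s → C2p e s} (h : IsInv φ ψ) : IsBiholGerm φ := by
  refine ⟨h.loc.1, h.loc.2, ?_⟩
  have h1 := h.loc.1.differentiableAt.hasFDerivAt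
  have h2 := h.loc'.1.differentiableAt.hasFDerivAt
  have e1 := ((h2.comp_isLoc h1 h.loc.2).congr_of_eventuallyEq h.left.symm).unique (hasFDerivAt_id 0)
  have e2 := ((h1.comp_isLoc h2 h.loc'.2).congr_of_eventuallyEq h.right.symm).unique
    (hasFDerivAt_id 0)
  exact ⟨ContinuousLinearEquiv.equivOfInverse _ _ (fun x => DFunLike.congr_fun e1 x)
    fun x => DFunLike.congr_fun e2 x, rfl⟩

theorem IsBiholGerm.exists_isInv {φ : C2p e s → C2p e s} (h : IsBiholGerm φ) :
    ∃ ψ, IsInv φ ψ := by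
  obtain ⟨h1, h2, A, hA⟩ := h
  have h3 := h1.differentiableAt.hasFDerivAt
  rw [← hA] at h3
  obtain ⟨ψ, hψ, -⟩ := _root_.exists_isInv ⟨h1, h2⟩ h3
  exact ⟨ψ, hψ⟩

variable {γe : Fin e → ℝ} {γs : Fin s → ℂ} {Λ : Cp e s → Cp e s}

/-- A set equivalent to a normal form can be flattened. -/
theorem exists_flattening (hΛ : IsAdmissible γe γs Λ) (h : IsParam γe γs) {ζ : C2p e s → Cp e s}
    (hζ : IsSolution Λ ζ) {M : Set (C2p e s)} (hM : HolEquivalent M (normalForm Λ ζ)) :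
    ∃ Φ : C2p e s → C2p e s, IsBiholGerm Φ ∧
      ∀ᶠ z : C2p e s in 𝓝 0, z ∈ M →
        (∀ i : Fin e, (Φ z).2 (Sum.inl i) = conj ((Φ z).2 (Sum.inl i))) ∧
        (∀ i : Fin s, (Φ z).2 (Sum.inr (Sum.inl i)) = conj ((Φ z).2 (Sum.inr (Sum.inr i)))) := by
  obtain ⟨Λ', h1, h2, h3⟩ := exists_real_equations hΛ h hζ
  obtain ⟨Φ, hΦ, hΦM⟩ := hM
  obtain ⟨Ψ, hΨ⟩ := hΦ.exists_isInv
  let w : Cp e s → Cp e s := fun y j =>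
    match j with
    | Sum.inr (Sum.inl i) => Λ' y (Sum.inr (Sum.inl i)) ^ 2
    | _ => 1
  have hw : ∀ j, AnalyticAt ℂ (fun x : C2p e s => w x.2 j) 0 := by
    intro j
    rcases j with i | i | i
    · exact analyticAt_const
    · exact ((h1.1.apply_Cp _).comp_isLoc
        (ContinuousLinearMap.snd ℂ (Cp e s) (Cp e s)).isLoc).pow 2
    · exact analyticAt_const
  have hw0 : ∀ j, w 0 j ≠ 0 := by
    intro j
    rcases j with i | i | i
    · exact one_ne_zero
    · exact pow_ne_zero 2 (h2 _)
    · exact one_ne_zero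
  let F : C2p e s → C2p e s := fun x => (x.1, fun j => w x.2 j * x.2 j)
  have hF : IsLoc F := ⟨analyticAt_C2p (fun j => analyticAt_coordFst j)
    fun j => (hw j).mul (analyticAt_coordSnd j), by ext j <;> simp [F]⟩
  have hFd : HasFDerivAt F (((ContinuousLinearEquiv.refl ℂ (Cp e s)).prodCongr
      (diagEquiv (w 0) hw0) : C2p e s ≃L[ℂ] C2p e s) : C2p e s →L[ℂ] C2p e s) 0 := by
    refine hasFDerivAt_C2p hF.2 (fun j => ?_) fun j => ?_
    · simp [F]
    · refine (isLittleO_sub_mul (hw j).continuousAt (isBigO_snd j)).congr_left fun x => ?_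
      simp [F, diagEquiv_apply]; ring
  obtain ⟨F', hF', -⟩ := exists_isInv hF hFd
  refine ⟨F ∘ Φ, (hF'.comp hΨ).isBiholGerm, ?_⟩
  filter_upwards [hΦM, hΨ.loc.tendsto.eventually h3] with z e1 e2 hz
  obtain ⟨e3, e4⟩ := e2 (e1.1 hz)
  refine ⟨fun i => ?_, fun i => ?_⟩
  · simp only [Function.comp_apply, F, w, one_mul]
    exact e3 i
  · simp only [Function.comp_apply, F, w, one_mul]
    rw [← e4 i, mul_comm]

end equivalence

section realization

variable {γe : Fin e → ℝ} {γs : Fin s → ℂ}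

/-- The linear map `(Z, W) ↦ (i Z_*, -i W_*)`. -/
noncomputable def rot (x : C2p e s) : C2p e s :=
  (fun j => Complex.I * x.1 (partner j), fun j => -Complex.I * x.2 (partner j))

/-- The inverse of `rot`. -/
noncomputable def unrot (x : C2p e s) : C2p e s :=
  (fun j => -Complex.I * x.1 (partner j), fun j => Complex.I * x.2 (partner j))

theorem isInv_rot : IsInv (rot : C2p e s → C2p e s) unrot := by
  refine ⟨⟨analyticAt_C2p (fun j => ?_) fun j => ?_, by ext j <;> simp [rot]⟩,
    ⟨analyticAt_C2p (fun j => ?_) fun j => ?_, by ext j <;> simp [unrot]⟩,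
    Eventually.of_forall fun x => ?_, Eventually.of_forall fun x => ?_⟩
  · exact analyticAt_const.mul (analyticAt_coordFst _)
  · exact analyticAt_const.mul (analyticAt_coordSnd _)
  · exact analyticAt_const.mul (analyticAt_coordFst _)
  · exact analyticAt_const.mul (analyticAt_coordSnd _)
  · ext j <;> simp [rot, unrot, partner_partner, ← mul_assoc]
  · ext j <;> simp [rot, unrot, partner_partner, ← mul_assoc]

theorem rho_rot (x : C2p e s) : rho (rot x) = rot (rho x) := by
  ext j <;> simp [rho, rot, conjVec]

theorem unrot_real (z : Cp e s) : unrot (z, conjVec z) =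
    ((unrot (z, conjVec z)).1, conjVec (unrot (z, conjVec z)).1) := by
  ext j <;> simp [unrot, conjVec]

/-- The ratio `(μ - 1) / (μ + 1)`, `μ = λ²`. -/
noncomputable def ratio (γe : Fin e → ℝ) (γs : Fin s → ℂ) (j : CIdx e s) : ℂ :=
  (lam γe γs j ^ 2 - 1) / (lam γe γs j ^ 2 + 1)

theorem IsParam.lam_sq_add_ne (h : IsParam γe γs) (j : CIdx e s) : lam γe γs j ^ 2 + 1 ≠ 0 := by
  intro h0
  have h1 := right_ne_zero_of_mul (right_ne_zero_of_mul_eq_one (h.quadCoef_mul j))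
  refine h1 ?_
  have h2 := h.lam_ne_zero j
  field_simp
  linear_combination h0

theorem IsParam.ratio_ne_zero (h : IsParam γe γs) (j : CIdx e s) : ratio γe γs j ≠ 0 :=
  div_ne_zero (sub_ne_zero.2 (h.lam_sq_ne_one j)) (h.lam_sq_add_ne j)

/-- The defining function of the realization, in the coordinates `(ξ, η)`. -/
noncomputable def realE (γe : Fin e → ℝ) (γs : Fin s → ℂ) (Λ : Cp e s → Cp e s) (y : C2p e s) :
    Cp e s := fun j => -(ratio γe γs (partner j) *
      (y.1 (partner j) - Λ (diagMul y) (partner j) * y.2 (partner j))) ^ 2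

theorem analyticAt_realE {Λ : Cp e s → Cp e s} (hΛ : AnalyticAt ℂ Λ 0) :
    AnalyticAt ℂ (realE γe γs Λ) 0 :=
  analyticAt_Cp fun _ => ((analyticAt_const.mul ((analyticAt_coordFst _).sub
    ((analyticAt_comp_diagMul hΛ _).mul (analyticAt_coordSnd _)))).pow 2).neg

theorem isBigO_mul_of_zero {V : Type*} [NormedAddCommGroup V] [NormedSpace ℂ V] {c l : V → ℂ}
    (hc : AnalyticAt ℂ c 0) (hc0 : c 0 = 0) (hl : l =O[𝓝 0] fun x => x) :
    (fun x => c x * l x) =O[𝓝 0] fun x => ‖x‖ ^ 2 := by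
  have h1 : c =O[𝓝 0] fun x => x := by
    have := hc.differentiableAt.hasFDerivAt.isBigO_sub
    simpa [hc0] using this
  simpa [sq] using h1.norm_right.mul hl.norm_right

theorem IsLoc.isBigO {V W : Type*} [NormedAddCommGroup V] [NormedSpace ℂ V] [NormedAddCommGroup W]
    [NormedSpace ℂ W] {φ : V → W} (h : IsLoc φ) : φ =O[𝓝 0] fun x => x := by
  have := h.1.differentiableAt.hasFDerivAt.isBigO_sub
  simpa [h.2] using this

theorem isBigO_realE_sub {Λ : Cp e s → Cp e s} (hΛ : IsAdmissible γe γs Λ) (h : IsParam γe γs) :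
    (fun y => realE γe γs Λ y - productQuadric γe γs (rot (normMap Λ y))) =O[𝓝 0]
      fun y => ‖y‖ ^ 3 := by
  rw [isBigO_pi]
  intro j
  obtain ⟨k, rfl⟩ : ∃ k, j = partner k := ⟨partner j, (partner_partner j).symm⟩
  set g := quadCoef γe γs (partner k) with hg
  set r := ratio γe γs k with hr
  have hL := analyticAt_comp_diagMul hΛ.1 k
  have hL0 : Λ (diagMul 0) k ≠ 0 := by rw [isLoc_diagMul.2]; exact hΛ.ne_zero h k
  have hkap := analyticAt_kap hΛ.1 k
  have hK := h.quadCoef_mul k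
  have hl0 := h.lam_ne_zero k
  have hl1 := h.lam_sq_add_ne k
  have hkl : g * kap (lam γe γs) k = lam γe γs k ^ 2 / (lam γe γs k ^ 2 + 1) := by
    rw [eq_div_iff hl1]
    field_simp at hK
    linear_combination hK
  have h1 := isBigO_mul_of_zero (c := fun y => r + 1 - 2 * g * kap (Λ (diagMul y)) k)
    (analyticAt_const.sub (analyticAt_const.mul hkap)) (by
      rw [isLoc_diagMul.2, hΛ.2.1, mul_assoc, hkl, hr, ratio]; field_simp; ring) (isBigO_fst k)
  have h2 := isBigO_mul_of_zero (c := fun y => (1 - r) * Λ (diagMul y) k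
      - 2 * g * kap (Λ (diagMul y)) k * (Λ (diagMul y) k)⁻¹)
    ((analyticAt_const.mul hL).sub ((analyticAt_const.mul hkap).mul (hL.inv hL0))) (by
      rw [isLoc_diagMul.2, hΛ.2.1, mul_assoc 2, hkl, hr, ratio]; field_simp; ring) (isBigO_snd k)
  have h3 : (fun y : C2p e s => r * (y.1 k - Λ (diagMul y) k * y.2 k)
      - ((y.1 k + Λ (diagMul y) k * y.2 k) - 2 * g * kap (Λ (diagMul y)) k *
        (y.1 k + (Λ (diagMul y) k)⁻¹ * y.2 k))) =O[𝓝 0] fun y => y := by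
    refine IsLoc.isBigO ⟨?_, by simp⟩
    have a1 := analyticAt_coordFst (e := e) (s := s) k
    have a2 := analyticAt_coordSnd (e := e) (s := s) k
    exact (analyticAt_const.mul (a1.sub (hL.mul a2))).sub ((a1.add (hL.mul a2)).sub
      ((analyticAt_const.mul hkap).mul (a1.add ((hL.inv hL0).mul a2))))
  have h4 := (h1.add h2).mul h3.norm_right
  refine (h4.neg_left.congr_left fun y => ?_).congr_right fun y => by ring
  simp only [realE, productQuadric, rot, normMap, pairMap, Pi.sub_apply, partner_partner, ← hg, ← hr]
  ring_nf
  simp only [Complex.I_sq]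
  ring

end realization

section deck

variable {γe : Fin e → ℝ} {γs : Fin s → ℂ} {Λ : Cp e s → Cp e s}

instance : IsDomain (AGerm (C2p e s)) :=
  AGerm.isDomain_of_equiv
    (LinearEquiv.sumArrowLequivProdArrow (CIdx e s) (CIdx e s) ℂ ℂ).symm.toContinuousLinearEquiv

theorem eventually_zero_or_of_mul {f g : C2p e s → ℂ} (hf : AnalyticAt ℂ f 0)
    (hg : AnalyticAt ℂ g 0) (h : ∀ᶠ x in 𝓝 0, f x * g x = 0) :
    (∀ᶠ x in 𝓝 0, f x = 0) ∨ ∀ᶠ x in 𝓝 0, g x = 0 := by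
  have h1 : AGerm.mk f hf * AGerm.mk g hg = 0 := Subtype.ext (Germ.coe_eq.2 h)
  rcases mul_eq_zero.1 h1 with h2 | h2
  · exact Or.inl (Germ.coe_eq.1 (congrArg Subtype.val h2))
  · exact Or.inr (Germ.coe_eq.1 (congrArg Subtype.val h2))

/-- Conjugation of germs of maps by a change of coordinates. -/
theorem IsInv.conj_comp {V W : Type*} [NormedAddCommGroup V] [NormedSpace ℂ V]
    [NormedAddCommGroup W] [NormedSpace ℂ W] {N : V → W} {N' : W → V} (h : IsInv N N') (a : V → V)
    {b : V → V} (hb : Tendsto b (𝓝 0) (𝓝 0)) :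
    (N ∘ a ∘ N') ∘ (N ∘ b ∘ N') =ᶠ[𝓝 0] N ∘ (a ∘ b) ∘ N' := by
  filter_upwards [(hb.comp h.loc'.tendsto).eventually h.left] with x hx
  simp only [Function.comp_apply, id_eq] at *
  rw [hx]

theorem IsInv.conj_congr {V W : Type*} [NormedAddCommGroup V] [NormedSpace ℂ V]
    [NormedAddCommGroup W] [NormedSpace ℂ W] {N : V → W} {N' : W → V} (h : IsInv N N') {a b : V → V}
    (hab : a =ᶠ[𝓝 0] b) : N ∘ a ∘ N' =ᶠ[𝓝 0] N ∘ b ∘ N' := by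
  filter_upwards [h.loc'.tendsto.eventually hab] with x hx
  simp only [Function.comp_apply, hx]

open Classical in
/-- The exchange of `ξ_j` and `Λ_j η_j` for `j` in a set of indices. -/
noncomputable def swapN (Λ : Cp e s → Cp e s) (S : Finset (CIdx e s)) (y : C2p e s) : C2p e s :=
  (fun j => if j ∈ S then Λ (diagMul y) j * y.2 j else y.1 j,
    fun j => if j ∈ S then (Λ (diagMul y) j)⁻¹ * y.1 j else y.2 j)

theorem diagMul_swapN {S : Finset (CIdx e s)} {y : C2p e s} (h : ∀ j, Λ (diagMul y) j ≠ 0) :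
    diagMul (swapN Λ S y) = diagMul y := by
  funext j
  have := h j
  simp only [diagMul, swapN]
  split_ifs
  · field_simp
  · rfl

theorem swapN_swapN {S : Finset (CIdx e s)} {y : C2p e s} (h : ∀ j, Λ (diagMul y) j ≠ 0) :
    swapN Λ S (swapN Λ S y) = y := by
  have hd := diagMul_swapN (S := S) h
  have e1 : ∀ j, (swapN Λ S (swapN Λ S y)).1 j = y.1 j := fun j => by
    rw [swapN, hd]
    dsimp only
    by_cases hj : j ∈ S
    · have := h j; simp only [swapN, hj, if_true]; field_simp
    · simp only [swapN, hj, if_false]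
  have e2 : ∀ j, (swapN Λ S (swapN Λ S y)).2 j = y.2 j := fun j => by
    rw [swapN, hd]
    dsimp only
    by_cases hj : j ∈ S
    · have := h j; simp only [swapN, hj, if_true]; field_simp
    · simp only [swapN, hj, if_false]
  exact Prod.ext (funext e1) (funext e2)

theorem isLoc_swapN (hΛ : IsAdmissible γe γs Λ) (h : IsParam γe γs) (S : Finset (CIdx e s)) :
    IsLoc (swapN Λ S) := by
  have hL := fun j => analyticAt_comp_diagMul hΛ.1 j
  have hL0 : ∀ j, Λ (diagMul 0) j ≠ 0 := fun j => by
    rw [isLoc_diagMul.2]; exact hΛ.ne_zero h j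
  refine ⟨analyticAt_C2p (fun j => ?_) fun j => ?_, by ext j <;> simp [swapN]⟩
  · by_cases hj : j ∈ S
    · simp only [swapN, hj, if_true]; exact (hL j).mul (analyticAt_coordSnd j)
    · simp only [swapN, hj, if_false]; exact analyticAt_coordFst j
  · by_cases hj : j ∈ S
    · simp only [swapN, hj, if_true]; exact ((hL j).inv (hL0 j)).mul (analyticAt_coordFst j)
    · simp only [swapN, hj, if_false]; exact analyticAt_coordSnd j

theorem eventually_diagMul_ne (hΛ : IsAdmissible γe γs Λ) (h : IsParam γe γs) :
    ∀ᶠ y : C2p e s in 𝓝 0, ∀ j, Λ (diagMul y) j ≠ 0 :=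
  isLoc_diagMul.tendsto.eventually (hΛ.eventually_ne h)

theorem isInv_swapN (hΛ : IsAdmissible γe γs Λ) (h : IsParam γe γs) (S : Finset (CIdx e s)) :
    IsInv (swapN Λ S) (swapN Λ S) := by
  have h1 : swapN Λ S ∘ swapN Λ S =ᶠ[𝓝 0] id := by
    filter_upwards [eventually_diagMul_ne hΛ h] with y hy
    exact swapN_swapN hy
  exact ⟨isLoc_swapN hΛ h S, isLoc_swapN hΛ h S, h1, h1⟩

/-- Maps that agree in the coordinates `(ξ, Λ η)` agree. -/
theorem eventuallyEq_of_uv (hΛ : IsAdmissible γe γs Λ) (h : IsParam γe γs) {φ ψ : C2p e s → C2p e s}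
    (hφ : IsLoc φ) (hψ : IsLoc ψ) (h1 : ∀ j, ∀ᶠ y in 𝓝 0, (φ y).1 j = (ψ y).1 j)
    (h2 : ∀ j, ∀ᶠ y in 𝓝 0, Λ (diagMul (φ y)) j * (φ y).2 j = Λ (diagMul (ψ y)) j * (ψ y).2 j) :
    φ =ᶠ[𝓝 0] ψ := by
  obtain ⟨Λ', -, -, h3⟩ := exists_inverseFactor hΛ h
  have hd := isLoc_diagMul (e := e) (s := s)
  filter_upwards [eventually_all.2 h1, eventually_all.2 h2, (hd.comp hφ).tendsto.eventually h3,
    (hd.comp hψ).tendsto.eventually h3, (hd.comp hψ).tendsto.eventually (hΛ.eventually_ne h)]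
    with y e1 e2 e3 e4 e5
  simp only [Function.comp_apply] at *
  have e6 : (fun k => diagMul (φ y) k * Λ (diagMul (φ y)) k)
      = fun k => diagMul (ψ y) k * Λ (diagMul (ψ y)) k := by
    funext k
    rw [show diagMul (φ y) k = (φ y).1 k * (φ y).2 k from rfl,
      show diagMul (ψ y) k = (ψ y).1 k * (ψ y).2 k from rfl, e1 k]
    linear_combination (ψ y).1 k * e2 k
  have e7 : ∀ j, Λ (diagMul (φ y)) j = Λ (diagMul (ψ y)) j := fun j => by
    have e8 := e3 j
    have e9 := e4 j
    rw [e6] at e8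
    exact mul_left_cancel₀ (left_ne_zero_of_mul_eq_one e9) (e8.trans e9.symm)
  refine Prod.ext (funext e1) (funext fun j => ?_)
  have e8 := e2 j
  rw [e7] at e8
  exact mul_left_cancel₀ (e5 j) e8

/-- The defining function of the realization. -/
noncomputable def realDef (γe : Fin e → ℝ) (γs : Fin s → ℂ) (Λ : Cp e s → Cp e s)
    (N' : C2p e s → C2p e s) : C2p e s → Cp e s := realE γe γs Λ ∘ N'

theorem realE_swapN {S : Finset (CIdx e s)} {y : C2p e s} (h : ∀ j, Λ (diagMul y) j ≠ 0) :
    realE γe γs Λ (swapN Λ S y) = realE γe γs Λ y := by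
  funext j
  rw [realE, diagMul_swapN h, realE]
  have := h (partner j)
  by_cases hj : partner j ∈ S
  · simp only [swapN, hj, if_true]; field_simp; ring
  · simp only [swapN, hj, if_false]

theorem normMap_fst_swapN {S : Finset (CIdx e s)} {y : C2p e s} (h : ∀ j, Λ (diagMul y) j ≠ 0) :
    (normMap Λ (swapN Λ S y)).1 = (normMap Λ y).1 := by
  funext j
  rw [normMap, diagMul_swapN h, normMap]
  have := h j
  by_cases hj : j ∈ S
  · simp only [pairMap, swapN, hj, if_true]; field_simp; ring
  · simp only [pairMap, swapN, hj, if_false]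

section

variable {K : C2p e s → C2p e s} (hK : IsInv (normMap Λ) K)

/-- The coordinates `(ξ, η)` of the realization. -/
theorem isInv_realization (hK : IsInv (normMap Λ) K) : IsInv (rot ∘ normMap Λ) (K ∘ unrot) :=
  isInv_rot.comp hK

include hK

theorem piOne_realDef : piOne (realDef γe γs Λ (K ∘ unrot)) ∘ (rot ∘ normMap Λ) =ᶠ[𝓝 0]
    fun y => ((rot (normMap Λ y)).1, realE γe γs Λ y) := by
  filter_upwards [(isInv_realization hK).left] with y hy
  simp only [Function.comp_apply, id_eq, piOne, realDef] at *
  rw [hy]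

theorem isDeck_swapN (hΛ : IsAdmissible γe γs Λ) (h : IsParam γe γs) (S : Finset (CIdx e s)) :
    IsDeck (realDef γe γs Λ (K ∘ unrot)) ((rot ∘ normMap Λ) ∘ swapN Λ S ∘ (K ∘ unrot)) := by
  have hN := isInv_realization hK
  have hsw := isInv_swapN hΛ h S
  refine ⟨(hN.comp (hsw.comp hN.symm)).isBiholGerm, ?_⟩
  have hp := piOne_realDef (γe := γe) (γs := γs) hK
  filter_upwards [hN.right, hN.loc'.tendsto.eventually hp,
    (hsw.loc.comp hN.loc').tendsto.eventually hp,
    hN.loc'.tendsto.eventually (eventually_diagMul_ne hΛ h)] with x e1 e2 e3 e4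
  simp only [Function.comp_apply, id_eq] at *
  rw [e3, realE_swapN e4]
  nth_rewrite 3 [← e1]
  rw [e2]
  refine Prod.ext ?_ rfl
  simp only [rot, normMap_fst_swapN e4]

theorem exists_eq_swapN (hΛ : IsAdmissible γe γs Λ) (h : IsParam γe γs) {φ : C2p e s → C2p e s}
    (hφ : IsDeck (realDef γe γs Λ (K ∘ unrot)) φ) :
    ∃ S, φ =ᶠ[𝓝 0] (rot ∘ normMap Λ) ∘ swapN Λ S ∘ (K ∘ unrot) := by
  classical
  have hN := isInv_realization hK
  set N := rot ∘ normMap Λ with hNdef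
  set N' := K ∘ unrot with hN'def
  have hp := piOne_realDef (γe := γe) (γs := γs) hK
  have hφl : IsLoc φ := ⟨hφ.1.1, hφ.1.2.1⟩
  set ψ := N' ∘ φ ∘ N with hψ
  have hψl : IsLoc ψ := hN.loc'.comp (hφl.comp hN.loc)
  have key : ∀ᶠ y in 𝓝 0, (rot (normMap Λ (ψ y))).1 = (rot (normMap Λ y)).1 ∧
      realE γe γs Λ (ψ y) = realE γe γs Λ y := by
    filter_upwards [hp, hψl.tendsto.eventually hp, hN.loc.tendsto.eventually hφ.2,
      (hφl.comp hN.loc).tendsto.eventually hN.right] with y e1 e2 e3 e4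
    have e5 : N (ψ y) = φ (N y) := e4
    rw [Function.comp_apply] at e1 e2
    rw [show (rot ∘ normMap Λ) (ψ y) = φ (N y) from e5] at e2
    have e6 : piOne (realDef γe γs Λ (K ∘ unrot)) (φ (N y)) =
      piOne (realDef γe γs Λ (K ∘ unrot)) (N y) := e3
    rw [e2, show piOne (realDef γe γs Λ (K ∘ unrot)) (N y) = _ from e1] at e6
    exact Prod.ext_iff.1 e6
  have hsum : ∀ k, ∀ᶠ y in 𝓝 0, (ψ y).1 k + Λ (diagMul (ψ y)) k * (ψ y).2 k
      = y.1 k + Λ (diagMul y) k * y.2 k := fun k => by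
    filter_upwards [key] with y hy
    have h1 := congrFun hy.1 (partner k)
    simp only [rot, partner_partner] at h1
    exact mul_left_cancel₀ Complex.I_ne_zero h1
  have hdiff : ∀ k, ∀ᶠ y in 𝓝 0, ((ψ y).1 k - Λ (diagMul (ψ y)) k * (ψ y).2 k
      - (y.1 k - Λ (diagMul y) k * y.2 k)) * ((ψ y).1 k - Λ (diagMul (ψ y)) k * (ψ y).2 k
      + (y.1 k - Λ (diagMul y) k * y.2 k)) = 0 := fun k => by
    filter_upwards [key] with y hy
    have h1 := congrFun hy.2 (partner k)
    simp only [realE, partner_partner] at h1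
    refine mul_left_cancel₀ (pow_ne_zero 2 (h.ratio_ne_zero k)) ?_
    linear_combination -h1
  have ha : ∀ k, AnalyticAt ℂ (fun y : C2p e s => y.1 k - Λ (diagMul y) k * y.2 k) 0 := fun k =>
    (analyticAt_coordFst k).sub ((analyticAt_comp_diagMul hΛ.1 k).mul (analyticAt_coordSnd k))
  have haψ : ∀ k, AnalyticAt ℂ (fun y : C2p e s => (ψ y).1 k - Λ (diagMul (ψ y)) k * (ψ y).2 k) 0 :=
    fun k => (ha k).comp_isLoc hψl
  let S : Finset (CIdx e s) := Finset.univ.filter fun k => ¬ ∀ᶠ y in 𝓝 0,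
    (ψ y).1 k - Λ (diagMul (ψ y)) k * (ψ y).2 k - (y.1 k - Λ (diagMul y) k * y.2 k) = 0
  have hS1 : ∀ k, k ∉ S → ∀ᶠ y in 𝓝 0, (ψ y).1 k = y.1 k ∧
      Λ (diagMul (ψ y)) k * (ψ y).2 k = Λ (diagMul y) k * y.2 k := fun k hk => by
    have h1 : ∀ᶠ y in 𝓝 0, (ψ y).1 k - Λ (diagMul (ψ y)) k * (ψ y).2 k
        - (y.1 k - Λ (diagMul y) k * y.2 k) = 0 := by
      by_contra h2; exact hk (Finset.mem_filter.2 ⟨Finset.mem_univ k, h2⟩)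
    filter_upwards [h1, hsum k] with y e1 e2
    exact ⟨by linear_combination (1 / 2) * e1 + (1 / 2) * e2,
      by linear_combination (1 / 2) * e2 - (1 / 2) * e1⟩
  have hS2 : ∀ k, k ∈ S → ∀ᶠ y in 𝓝 0, (ψ y).1 k = Λ (diagMul y) k * y.2 k ∧
      Λ (diagMul (ψ y)) k * (ψ y).2 k = y.1 k := fun k hk => by
    have h1 := (eventually_zero_or_of_mul ((haψ k).fun_sub (ha k)) ((haψ k).fun_add (ha k))
      (hdiff k)).resolve_left (Finset.mem_filter.1 hk).2
    filter_upwards [h1, hsum k] with y e1 e2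
    exact ⟨by linear_combination (1 / 2) * e1 + (1 / 2) * e2,
      by linear_combination (1 / 2) * e2 - (1 / 2) * e1⟩
  have hψS : ψ =ᶠ[𝓝 0] swapN Λ S := by
    refine eventuallyEq_of_uv hΛ h hψl (isLoc_swapN hΛ h S) (fun j => ?_) fun j => ?_
    · by_cases hj : j ∈ S
      · filter_upwards [hS2 j hj] with y hy
        simp only [swapN, hj, if_true]; exact hy.1
      · filter_upwards [hS1 j hj] with y hy
        simp only [swapN, hj, if_false]; exact hy.1
    · by_cases hj : j ∈ S
      · filter_upwards [hS2 j hj, eventually_diagMul_ne hΛ h] with y hy h0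
        rw [diagMul_swapN h0]
        simp only [swapN, hj, if_true]
        rw [hy.2, mul_inv_cancel_left₀ (h0 j)]
      · filter_upwards [hS1 j hj, eventually_diagMul_ne hΛ h] with y hy h0
        rw [diagMul_swapN h0]
        simp only [swapN, hj, if_false]; exact hy.2
  refine ⟨S, ?_⟩
  filter_upwards [hN.right, hN.loc'.tendsto.eventually hψS, (hφl.tendsto).eventually hN.right]
    with x e1 e2 e3
  have e4 : N (N' x) = x := e1
  have e5 : N' (φ (N (N' x))) = swapN Λ S (N' x) := e2
  have e6 : N (N' (φ x)) = φ x := e3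
  rw [e4] at e5
  rw [← e6, e5]; rfl

theorem swapN_germ_injective (hΛ : IsAdmissible γe γs Λ) (h : IsParam γe γs)
    {S T : Finset (CIdx e s)} (hST : (rot ∘ normMap Λ) ∘ swapN Λ S ∘ (K ∘ unrot) =ᶠ[𝓝 0]
      (rot ∘ normMap Λ) ∘ swapN Λ T ∘ (K ∘ unrot)) : S ⊆ T := by
  have hN := isInv_realization hK
  have h1 : swapN Λ S =ᶠ[𝓝 0] swapN Λ T := by
    filter_upwards [hN.loc.tendsto.eventually hST, hN.left,
      (isLoc_swapN hΛ h S).tendsto.eventually hN.left,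
      (isLoc_swapN hΛ h T).tendsto.eventually hN.left] with y e1 e2 e3 e4
    simp only [Function.comp_apply, id_eq] at *
    rw [← e3, ← e4]
    rw [e2] at e1
    rw [e1]
  intro j hjS
  by_contra hjT
  have ht : Tendsto (fun t : ℝ => ((fun _ => (t : ℂ), 0) : C2p e s)) (𝓝[>] 0) (𝓝 0) := by
    refine Tendsto.mono_left ?_ nhdsWithin_le_nhds
    have hc : Continuous fun t : ℝ => ((fun _ => (t : ℂ), 0) : C2p e s) := by fun_prop
    exact hc.tendsto' 0 0 (by ext j <;> simp)
  obtain ⟨t, h2, h3⟩ := ((ht.eventually h1).and self_mem_nhdsWithin).exists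
  have h4 := congrFun (congrArg Prod.fst h2) j
  simp only [swapN, hjS, hjT, if_true, if_false, Pi.zero_apply, mul_zero] at h4
  exact (ne_of_gt (Set.mem_Ioi.1 h3)) (by exact_mod_cast h4.symm)

theorem ncard_deckGerms_realDef (hΛ : IsAdmissible γe γs Λ) (h : IsParam γe γs) :
    (deckGerms (realDef γe γs Λ (K ∘ unrot))).ncard = 2 ^ Fintype.card (CIdx e s) := by
  let f : Finset (CIdx e s) → Germ (𝓝 (0 : C2p e s)) (C2p e s) := fun S =>
    (((rot ∘ normMap Λ) ∘ swapN Λ S ∘ (K ∘ unrot) : C2p e s → C2p e s) : Germ _ _)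
  have hf : Function.Injective f := fun S T hST =>
    Finset.Subset.antisymm (swapN_germ_injective hK hΛ h (Germ.coe_eq.1 hST))
      (swapN_germ_injective hK hΛ h (Germ.coe_eq.1 hST.symm))
  have hr : deckGerms (realDef γe γs Λ (K ∘ unrot)) = f '' Set.univ := by
    ext g
    constructor
    · rintro ⟨τ, hτ, rfl⟩
      obtain ⟨S, hS⟩ := exists_eq_swapN hK hΛ h hτ
      exact ⟨S, Set.mem_univ _, (Germ.coe_eq.2 hS).symm⟩
    · rintro ⟨S, -, rfl⟩
      exact ⟨_, isDeck_swapN hK hΛ h S, rfl⟩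
  rw [hr, Set.ncard_image_of_injective _ hf, Set.ncard_univ, Nat.card_eq_fintype_card,
    Fintype.card_finset]

theorem isBigO_swapN_sub (hΛ : IsAdmissible γe γs Λ) (h : IsParam γe γs) (j : CIdx e s) :
    (fun x => ((rot ∘ normMap Λ) ∘ swapN Λ {j} ∘ (K ∘ unrot)) x - quadricInvolution γe γs j x)
      =O[𝓝 0] fun x => ‖x‖ ^ 2 := by
  have hN := isInv_realization hK
  set g := quadCoef γe γs (partner j) with hg
  have hL := analyticAt_comp_diagMul hΛ.1 j
  have hL0 : Λ (diagMul 0) j ≠ 0 := by rw [isLoc_diagMul.2]; exact hΛ.ne_zero h j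
  have hkap := analyticAt_kap hΛ.1 j
  have hg0 : g ≠ 0 := h.quadCoef_ne_zero j
  have a1 := analyticAt_coordFst (e := e) (s := s) j
  have a2 := analyticAt_coordSnd (e := e) (s := s) j
  have h1 := isBigO_mul_of_zero
    (c := fun y => Complex.I * (g⁻¹ - kap (Λ (diagMul y)) j * (1 + (Λ (diagMul y) j ^ 2)⁻¹)))
    (l := fun y => y.1 j + Λ (diagMul y) j * y.2 j)
    (analyticAt_const.mul (analyticAt_const.sub (hkap.mul (analyticAt_const.add
      ((hL.pow 2).inv (pow_ne_zero 2 hL0)))))) (by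
        rw [isLoc_diagMul.2, hΛ.2.1]
        rw [← eq_inv_of_mul_eq_one_right (h.quadCoef_mul j), sub_self, mul_zero])
    (IsLoc.isBigO ⟨a1.add (hL.mul a2), by simp⟩)
  have h2 := (h1.comp_tendsto hN.loc'.tendsto).trans (hN.loc'.isBigO.norm_norm.pow 2)
  refine IsBigO.prod_left ?_ ?_
  all_goals
    rw [isBigO_pi]
    intro i
  · refine (isBigO_zero _ _).congr' ?_ EventuallyEq.rfl
    filter_upwards [hN.right, hN.loc'.tendsto.eventually (eventually_diagMul_ne hΛ h)] with x e1 e2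
    simp only [Function.comp_apply, id_eq] at *
    nth_rewrite 2 [← e1]
    simp only [quadricInvolution, Pi.sub_apply, rot, normMap_fst_swapN e2, sub_self]
  · by_cases hij : i = j
    · subst hij
      refine h2.congr' ?_ EventuallyEq.rfl
      filter_upwards [hN.right, hN.loc'.tendsto.eventually (eventually_diagMul_ne hΛ h)] with x e1 e2
      simp only [Function.comp_apply, id_eq] at *
      rw [show quadricInvolution γe γs i x = quadricInvolution γe γs i (rot (normMap Λ (K (unrot x))))
        by rw [e1]]
      have e3 := e2 i
      simp only [quadricInvolution, Pi.sub_apply, rot, normMap, diagMul_swapN e2,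
        Function.update_self, pairMap, partner_partner, ← hg]
      simp only [swapN, Finset.mem_singleton, if_true]
      field_simp
      ring
    · refine (isBigO_zero _ _).congr' ?_ EventuallyEq.rfl
      filter_upwards [hN.right, hN.loc'.tendsto.eventually (eventually_diagMul_ne hΛ h)] with x e1 e2
      simp only [Function.comp_apply, id_eq] at *
      nth_rewrite 2 [← e1]
      simp only [quadricInvolution, Pi.sub_apply, rot, normMap, diagMul_swapN e2,
        Function.update_of_ne hij, pairMap, partner_partner]
      simp only [swapN, Finset.mem_singleton, hij, if_false, sub_self]

end

end deck

section realized

variable {γe : Fin e → ℝ} {γs : Fin s → ℂ} {Λ : Cp e s → Cp e s}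

/-- The map `(ξ_j, η_j) ↦ (Λ_j² ξ_j, Λ_j⁻² η_j)`. -/
noncomputable def mulN (Λ : Cp e s → Cp e s) (j : CIdx e s) (y : C2p e s) : C2p e s :=
  (fun k => if k = j then Λ (diagMul y) k ^ 2 * y.1 k else y.1 k,
    fun k => if k = j then (Λ (diagMul y) k ^ 2)⁻¹ * y.2 k else y.2 k)

theorem diagMul_mulN {j : CIdx e s} {y : C2p e s} (h : ∀ j, Λ (diagMul y) j ≠ 0) :
    diagMul (mulN Λ j y) = diagMul y := by
  funext k
  have := h k
  simp only [diagMul, mulN]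
  split_ifs
  · field_simp
  · rfl

theorem mulN_comm {i j : CIdx e s} {y : C2p e s} (h : ∀ j, Λ (diagMul y) j ≠ 0) :
    mulN Λ i (mulN Λ j y) = mulN Λ j (mulN Λ i y) := by
  rw [mulN, diagMul_mulN h]
  conv_rhs => rw [mulN, diagMul_mulN h]
  refine Prod.ext (funext fun k => ?_) (funext fun k => ?_) <;>
  · simp only [mulN]
    split_ifs <;> ring

theorem swapN_rhoN {j : CIdx e s} {y : C2p e s} (h : IsConjSymm Λ (diagMul y))
    (h' : ∀ j, Λ (rhoZ (diagMul y)) j ≠ 0) :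
    swapN Λ {j} (rhoN (swapN Λ {partner j} (rhoN y))) = mulN Λ j y := by
  have hd1 : diagMul (swapN Λ {partner j} (rhoN y)) = rhoZ (diagMul y) := by
    rw [diagMul_swapN (by rw [diagMul_rhoN]; exact h'), diagMul_rhoN]
  have hd2 : diagMul (rhoN (swapN Λ {partner j} (rhoN y))) = diagMul y := by
    rw [diagMul_rhoN, hd1, rhoZ_rhoZ]
  have h0 := h.ne
  have hA : Λ (diagMul (rhoN y)) = Λ (rhoZ (diagMul y)) := by rw [diagMul_rhoN]
  have hb1 : ∀ i : Fin s, conj (Λ (rhoZ (diagMul y)) (Sum.inr (Sum.inr i)))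
      = (Λ (diagMul y) (Sum.inr (Sum.inl i)))⁻¹ := fun i => by
    have h2 := congrArg conj (h.inr (Sum.inr i))
    rw [map_mul, map_one, Complex.conj_conj] at h2
    exact eq_inv_of_mul_eq_one_left h2
  have hb2 : ∀ i : Fin s, conj (Λ (rhoZ (diagMul y)) (Sum.inr (Sum.inl i)))
      = (Λ (diagMul y) (Sum.inr (Sum.inr i)))⁻¹ := fun i => by
    have h2 := congrArg conj (h.inr (Sum.inl i))
    rw [map_mul, map_one, Complex.conj_conj] at h2
    exact eq_inv_of_mul_eq_one_left h2
  have hp : ∀ k, partner k = partner j ↔ k = j := fun k =>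
    ⟨fun h2 => by rw [← partner_partner j, ← h2, partner_partner], fun h2 => by rw [h2]⟩
  rw [swapN, hd2]
  refine Prod.ext (funext fun k => ?_) (funext fun k => ?_) <;>
  · have h1 := h0 k
    have h2 := hp k
    simp only [Finset.mem_singleton, mulN, swapN, hA]
    rcases k with i | i | i <;> simp only [partner] at h2 <;>
    simp only [rhoN, rhoAux, partner, h2] <;> split_ifs <;>
    simp only [map_mul, map_inv₀, ← h.inl, hb1, hb2, Complex.conj_conj, inv_inv] <;> field_simp

section

variable {K : C2p e s → C2p e s} (hK : IsInv (normMap Λ) K)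
include hK

theorem sigmaMap_swapN (hΛ : IsAdmissible γe γs Λ) (h : IsParam γe γs) (j : CIdx e s) :
    sigmaMap (fun j => (rot ∘ normMap Λ) ∘ swapN Λ {j} ∘ (K ∘ unrot)) j =ᶠ[𝓝 0]
      (rot ∘ normMap Λ) ∘ mulN Λ j ∘ (K ∘ unrot) := by
  have hN := isInv_realization hK
  have hd := isLoc_diagMul (e := e) (s := s)
  have hcs : ∀ᶠ y : C2p e s in 𝓝 0, IsConjSymm Λ (diagMul y) :=
    hd.tendsto.eventually (hΛ.eventually_isConjSymm h)
  have hne' : ∀ᶠ y : C2p e s in 𝓝 0, ∀ j, Λ (rhoZ (diagMul y)) j ≠ 0 :=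
    hd.tendsto.eventually (tendsto_rhoZ.eventually (hΛ.eventually_ne h))
  have hsw := fun j => (isLoc_swapN hΛ h {j}).tendsto
  have htr : Tendsto (fun y => rhoN (swapN Λ {partner j} (rhoN y))) (𝓝 0) (𝓝 0) :=
    tendsto_rhoN.comp ((hsw (partner j)).comp tendsto_rhoN)
  have key : ∀ᶠ y : C2p e s in 𝓝 0, rho (rot (normMap Λ y)) = rot (normMap Λ (rhoN y)) := by
    filter_upwards [hcs] with y hy
    rw [rho_rot, normMap_rhoN hy]
  have ht := hN.loc'.tendsto
  filter_upwards [hN.right, ht.eventually hcs, ht.eventually hne', ht.eventually key,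
    ht.eventually (tendsto_rhoN.eventually hN.left),
    ht.eventually (((hsw (partner j)).comp tendsto_rhoN).eventually key),
    ht.eventually (htr.eventually hN.left)] with x e1 e2 e3 e4 e5 e6 e7
  have e8 := swapN_rhoN (j := j) e2 e3
  simp only [Function.comp_apply, id_eq, sigmaMap] at *
  rw [e1] at e4
  rw [e4, e5, e6, e7, e8]

theorem isAbelian_realDef (hΛ : IsAdmissible γe γs Λ) (h : IsParam γe γs) :
    HasAbelianCRSingularity γe γs (realDef γe γs Λ (K ∘ unrot)) := by
  have hN := isInv_realization hK
  refine ⟨ncard_deckGerms_realDef hK hΛ h, fun j => (rot ∘ normMap Λ) ∘ swapN Λ {j} ∘ (K ∘ unrot),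
    fun j => ⟨isDeck_swapN hK hΛ h {j}, isBigO_swapN_sub hK hΛ h j⟩, fun i j => ?_⟩
  have hmt : ∀ j, Tendsto (mulN Λ j) (𝓝 0) (𝓝 0) := fun j => by
    have hsw := fun j => (isLoc_swapN hΛ h {j}).tendsto
    have hd := isLoc_diagMul (e := e) (s := s)
    refine ((hsw j).comp (tendsto_rhoN.comp ((hsw (partner j)).comp tendsto_rhoN))).congr' ?_
    filter_upwards [hd.tendsto.eventually (hΛ.eventually_isConjSymm h),
      hd.tendsto.eventually (tendsto_rhoZ.eventually (hΛ.eventually_ne h))] with y e1 e2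
    exact swapN_rhoN e1 e2
  have hs := fun j => sigmaMap_swapN hK hΛ h j
  have hst : ∀ j, Tendsto ((rot ∘ normMap Λ) ∘ mulN Λ j ∘ (K ∘ unrot)) (𝓝 0) (𝓝 0) := fun j =>
    hN.loc.tendsto.comp ((hmt j).comp hN.loc'.tendsto)
  have hcomp : ∀ i j, sigmaMap (fun j => (rot ∘ normMap Λ) ∘ swapN Λ {j} ∘ (K ∘ unrot)) i ∘
      sigmaMap (fun j => (rot ∘ normMap Λ) ∘ swapN Λ {j} ∘ (K ∘ unrot)) j =ᶠ[𝓝 0]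
      (rot ∘ normMap Λ) ∘ (mulN Λ i ∘ mulN Λ j) ∘ (K ∘ unrot) := fun i j => by
    refine EventuallyEq.trans ?_ (hN.conj_comp (mulN Λ i) (hmt j))
    filter_upwards [hs j, (hst j).eventually (hs i)] with x e1 e2
    rw [Function.comp_apply, e1, e2]; rfl
  refine (hcomp i j).trans (EventuallyEq.trans (hN.conj_congr ?_) (hcomp j i).symm)
  filter_upwards [eventually_diagMul_ne hΛ h] with y hy
  exact mulN_comm hy

theorem isThirdOrder_realDef (hΛ : IsAdmissible γe γs Λ) (h : IsParam γe γs) :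
    IsThirdOrderPerturbation γe γs (realDef γe γs Λ (K ∘ unrot)) := by
  have hN := isInv_realization hK
  refine ⟨(analyticAt_realE hΛ.1).comp_isLoc hN.loc', ?_⟩
  have h1 := ((isBigO_realE_sub hΛ h).comp_tendsto hN.loc'.tendsto).trans
    (hN.loc'.isBigO.norm_norm.pow 3)
  refine h1.congr' ?_ EventuallyEq.rfl
  filter_upwards [hN.right] with x hx
  simp only [Function.comp_apply, id_eq, realDef] at *
  rw [hx]

/-- The equivalence of the realization with the normal form. -/
theorem holEquivalent_realDef (hΛ : IsAdmissible γe γs Λ) (h : IsParam γe γs)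
    {ζ : C2p e s → Cp e s} (hζ : IsSolution Λ ζ) :
    HolEquivalent (realGraph (realDef γe γs Λ (K ∘ unrot))) (normalForm Λ ζ) := by
  let Φ : C2p e s → C2p e s := fun z => (fun k => -Complex.I * z.1 (partner k),
    fun k => (z.2 (partner k) / ratio γe γs k ^ 2 - z.1 (partner k) ^ 2) / 4)
  let Ψ : C2p e s → C2p e s := fun z => (fun k => Complex.I * z.1 (partner k),
    fun k => ratio γe γs (partner k) ^ 2 * (4 * z.2 (partner k) - z.1 (partner k) ^ 2))
  have hr := h.ratio_ne_zero
  have hΦ : IsInv Φ Ψ := by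
    refine ⟨⟨analyticAt_C2p (fun j => ?_) fun j => ?_, by ext j <;> simp [Φ]⟩,
      ⟨analyticAt_C2p (fun j => ?_) fun j => ?_, by ext j <;> simp [Ψ]⟩,
      Eventually.of_forall fun x => ?_, Eventually.of_forall fun x => ?_⟩
    · exact analyticAt_const.mul (analyticAt_coordFst _)
    · exact (((analyticAt_coordSnd _).div_const).sub ((analyticAt_coordFst _).pow 2)).div_const
    · exact analyticAt_const.mul (analyticAt_coordFst _)
    · exact analyticAt_const.mul
        ((analyticAt_const.mul (analyticAt_coordSnd _)).sub ((analyticAt_coordFst _).pow 2))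
    · ext j
      · simp [Φ, Ψ, partner_partner, ← mul_assoc]
      · have := hr (partner j)
        simp only [Φ, Ψ, Function.comp_apply, partner_partner, id_eq, mul_pow, neg_sq, Complex.I_sq]
        field_simp; ring
    · ext j
      · simp [Φ, Ψ, partner_partner, ← mul_assoc]
      · have := hr j
        simp only [Φ, Ψ, Function.comp_apply, partner_partner, id_eq, mul_pow, Complex.I_sq]
        field_simp; ring
  refine ⟨Φ, hΦ.isBiholGerm, ?_⟩
  have ht : Tendsto (fun z : C2p e s => z.1) (𝓝 0) (𝓝 0) := continuous_fst.tendsto' 0 0 rfl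
  have ht2 : Tendsto (fun z : C2p e s => unrot (z.1, conjVec z.1)) (𝓝 0) (𝓝 0) :=
    isInv_rot.loc'.tendsto.comp (tendsto_real.comp ht)
  filter_upwards [ht2.eventually hK.right, ht2.eventually (hζ.eventuallyEq hΛ h hK)] with z e1 e2
  set y := K (unrot (z.1, conjVec z.1)) with hy
  have e3 : normMap Λ y = unrot (z.1, conjVec z.1) := e1
  have e4 : unrot (z.1, conjVec z.1) = ((Φ z).1, conjVec (Φ z).1) := unrot_real z.1
  rw [e4] at e2
  have e5 : ζ ((Φ z).1, conjVec (Φ z).1) = diagMul y := by rw [e2, Function.comp_apply, ← e4]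
  have e6 : ∀ k, y.1 k + Λ (diagMul y) k * y.2 k = -Complex.I * z.1 (partner k) := fun k =>
    congrFun (congrArg Prod.fst e3) k
  have m1 : z ∈ realGraph (realDef γe γs Λ (K ∘ unrot)) ↔
      ∀ k, z.2 (partner k) = -(ratio γe γs k * (y.1 k - Λ (diagMul y) k * y.2 k)) ^ 2 := by
    refine Iff.trans (show _ ↔ z.2 = realE γe γs Λ y from Iff.rfl) ⟨fun h1 k => ?_, fun h1 => ?_⟩
    · rw [h1, realE, partner_partner]
    · funext j
      rw [← partner_partner j, h1, realE, partner_partner]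
  have m2 : Φ z ∈ normalForm Λ ζ ↔ ∀ k, (Φ z).2 k = Λ (diagMul y) k * (y.1 k * y.2 k) := by
    refine Iff.trans (show _ ↔ (Φ z).2 = fun j => Λ (ζ ((Φ z).1, conjVec (Φ z).1)) j *
      ζ ((Φ z).1, conjVec (Φ z).1) j from Iff.rfl) ?_
    rw [e5, funext_iff]; rfl
  rw [m1, m2]
  refine forall_congr' fun k => ?_
  have hk := hr k
  have h6 := e6 k
  have h7 : (y.1 k + Λ (diagMul y) k * y.2 k) ^ 2 = - z.1 (partner k) ^ 2 := by
    rw [h6, mul_pow, neg_sq, Complex.I_sq]; ring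
  have h8 : (Φ z).2 k = (z.2 (partner k) / ratio γe γs k ^ 2 - z.1 (partner k) ^ 2) / 4 := rfl
  rw [h8]
  constructor
  · intro h9
    rw [h9]; field_simp
    linear_combination -h7
  · intro h9
    field_simp at h9
    linear_combination h9 + ratio γe γs k ^ 2 * h7

end

/-- Every normal form is realized by a perturbation of the quadric. -/
theorem exists_realization (hΛ : IsAdmissible γe γs Λ) (h : IsParam γe γs)
    {ζ : C2p e s → Cp e s} (hζ : IsSolution Λ ζ) :
    ∃ M : Set (C2p e s), IsAbelianPerturbation γe γs M ∧ HolEquivalent M (normalForm Λ ζ) := by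
  obtain ⟨K, hK⟩ := exists_isInv_normMap hΛ.1 (hΛ.ne_zero h) (hΛ.sq_ne_one h)
  exact ⟨_, ⟨_, Eventually.of_forall fun _ => Iff.rfl, isThirdOrder_realDef hK hΛ h,
    isAbelian_realDef hK hΛ h⟩, holEquivalent_realDef hK hΛ h hζ⟩

end realized

section deckGroup

variable {E : C2p e s → Cp e s}

theorem IsDeck.exists_isInv {φ : C2p e s → C2p e s} (h : IsDeck E φ) : ∃ ψ, IsInv φ ψ :=
  IsBiholGerm.exists_isInv h.1

theorem IsDeck.isLoc {φ : C2p e s → C2p e s} (h : IsDeck E φ) : IsLoc φ := ⟨h.1.1, h.1.2.1⟩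

theorem IsDeck.comp {φ ψ : C2p e s → C2p e s} (hφ : IsDeck E φ) (hψ : IsDeck E ψ) :
    IsDeck E (φ ∘ ψ) := by
  obtain ⟨φ', h1⟩ := hφ.exists_isInv
  obtain ⟨ψ', h2⟩ := hψ.exists_isInv
  refine ⟨(h1.comp h2).isBiholGerm, ?_⟩
  filter_upwards [hψ.2, hψ.isLoc.tendsto.eventually hφ.2] with x e1 e2
  simp only [Function.comp_apply] at *
  rw [e2, e1]

theorem isDeck_id : IsDeck E id :=
  ⟨((ContinuousLinearEquiv.refl ℂ (C2p e s)).isInv).isBiholGerm, EventuallyEq.rfl⟩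

theorem IsDeck.iterate {φ : C2p e s → C2p e s} (h : IsDeck E φ) (k : ℕ) : IsDeck E φ^[k] := by
  induction k with
  | zero => exact isDeck_id
  | succ k ih => exact ih.comp h

/-- In a finite group of deck transformations, only the identity is tangent to the identity. -/
theorem IsDeck.eq_id (hfin : (deckGerms E).Finite) {φ : C2p e s → C2p e s} (h : IsDeck E φ)
    (hd : HasFDerivAt φ (ContinuousLinearMap.id ℂ (C2p e s)) 0) : φ =ᶠ[𝓝 0] id := by
  have hni : ¬ Function.Injective fun k : ℕ =>
      ((φ^[k] : C2p e s → C2p e s) : Germ (𝓝 (0 : C2p e s)) (C2p e s)) := fun hi =>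
    Set.infinite_of_injective_forall_mem (s := deckGerms E) hi
      (fun k => by rw [deckGerms]; exact ⟨_, h.iterate k, rfl⟩) hfin
  obtain ⟨m, hm, hφm⟩ : ∃ m, m ≠ 0 ∧ φ^[m] =ᶠ[𝓝 0] id := by
    have key : ∀ k l : ℕ, k < l → φ^[k] =ᶠ[𝓝 0] φ^[l] → ∃ m, m ≠ 0 ∧ φ^[m] =ᶠ[𝓝 0] id := by
      intro k l hkl hE
      obtain ⟨m, rfl⟩ := Nat.exists_eq_add_of_lt hkl
      obtain ⟨ψ, hψ⟩ := (h.iterate k).exists_isInv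
      refine ⟨m + 1, by omega, ?_⟩
      filter_upwards [hψ.right, hψ.loc'.tendsto.eventually hE] with x e1 e2
      rw [show k + m + 1 = (m + 1) + k by ring, Function.iterate_add_apply] at e2
      rw [show φ^[k] (ψ x) = x from e1] at e2
      exact e2.symm
    simp only [Function.Injective, not_forall] at hni
    obtain ⟨k, l, hE, hkl⟩ := hni
    rcases lt_or_gt_of_ne hkl with h1 | h1
    · exact key k l h1 (Germ.coe_eq.1 hE)
    · exact key l k h1 (Germ.coe_eq.1 hE).symm
  have hiter : ∀ k, HasFDerivAt φ^[k] (ContinuousLinearMap.id ℂ (C2p e s)) 0 := by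
    intro k
    induction k with
    | zero => exact hasFDerivAt_id 0
    | succ k ih => exact (ih.comp_isLoc hd h.isLoc.2)
  let H : C2p e s → C2p e s := fun x => ∑ k ∈ Finset.range m, φ^[k] x
  have hmc : (m : ℂ) ≠ 0 := by exact_mod_cast hm
  have hH : IsLoc H := ⟨Finset.analyticAt_fun_sum _ fun k _ => (h.iterate k).1.1,
    Finset.sum_eq_zero fun k _ => (h.iterate k).1.2.1⟩
  have hHd : HasFDerivAt H ((ContinuousLinearEquiv.smulLeft (Units.mk0 (m : ℂ) hmc) :
      C2p e s ≃L[ℂ] C2p e s) : C2p e s →L[ℂ] C2p e s) 0 := by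
    refine (HasFDerivAt.fun_sum fun k _ => hiter k).congr_fderiv ?_
    refine ContinuousLinearMap.ext fun x => ?_
    rw [Finset.sum_const, Finset.card_range]
    exact (Nat.cast_smul_eq_nsmul ℂ m x).symm
  obtain ⟨G, hG, -⟩ := _root_.exists_isInv hH hHd
  have hHφ : ∀ᶠ x in 𝓝 0, H (φ x) = H x := by
    filter_upwards [hφm] with x hx
    have h1 := Finset.sum_range_succ (fun k => φ^[k] x) m
    rw [Finset.sum_range_succ', hx] at h1
    exact add_right_cancel h1
  filter_upwards [hHφ, hG.left, h.isLoc.tendsto.eventually hG.left] with x e1 e2 e3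
  simp only [Function.comp_apply, id_eq] at *
  rw [← e3, e1, e2]

end deckGroup

section conjugation

/-- The coordinates of `ℂ^p × ℂ^p` as a single family. -/
noncomputable def sumE (e s : ℕ) : C2p e s ≃L[ℂ] (CIdx e s ⊕ CIdx e s → ℂ) :=
  (LinearEquiv.sumArrowLequivProdArrow (CIdx e s) (CIdx e s) ℂ ℂ).symm.toContinuousLinearEquiv

theorem sumE_inl (x : C2p e s) (j : CIdx e s) : sumE e s x (Sum.inl j) = x.1 j := rfl
theorem sumE_inr (x : C2p e s) (j : CIdx e s) : sumE e s x (Sum.inr j) = x.2 j := rfl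

theorem analyticAt_conj_rho {f : C2p e s → ℂ} (hf : AnalyticAt ℂ f 0) :
    AnalyticAt ℂ (fun x => conj (f (rho x))) 0 := by
  have h1 := (hf.comp_isLoc (ContinuousLinearEquiv.prodComm ℂ (Cp e s) (Cp e s)).isLoc).comp_isLoc
    (sumE e s).symm.isLoc
  exact (analyticAt_conj_conj h1).comp_isLoc (sumE e s).isLoc

theorem isLoc_rho_conj {φ : C2p e s → C2p e s} (h : IsLoc φ) : IsLoc (rho ∘ φ ∘ rho) := by
  have h0 : rho (0 : C2p e s) = 0 := by ext j <;> simp [rho, conjVec]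
  refine ⟨analyticAt_C2p (fun j => ?_) fun j => ?_, by simp [h0, h.2]⟩
  · exact analyticAt_conj_rho ((analyticAt_coordSnd j).comp_isLoc h)
  · exact analyticAt_conj_rho ((analyticAt_coordFst j).comp_isLoc h)

theorem rho_sub (x y : C2p e s) : rho (x - y) = rho x - rho y := by
  ext j <;> simp [rho, conjVec]

theorem norm_rho (x : C2p e s) : ‖rho x‖ = ‖x‖ := by
  have h : ∀ y : Cp e s, ‖conjVec y‖ = ‖y‖ := fun y => by
    simp only [Pi.norm_def, conjVec, RCLike.nnnorm_conj]
  rw [Prod.norm_def, Prod.norm_def, rho, h, h, max_comm]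

theorem hasFDerivAt_rho_conj {φ : C2p e s → C2p e s} {A B : C2p e s →L[ℂ] C2p e s}
    (h0 : φ 0 = 0) (hA : HasFDerivAt φ A 0) (hB : ∀ x, B x = rho (A (rho x))) :
    HasFDerivAt (rho ∘ φ ∘ rho) B 0 := by
  have hr0 : rho (0 : C2p e s) = 0 := by ext j <;> simp [rho, conjVec]
  rw [hasFDerivAt_iff_isLittleO_nhds_zero] at *
  have h1 := hA.comp_tendsto (tendsto_rho (e := e) (s := s))
  refine (IsLittleO.of_norm_right (IsLittleO.of_norm_left ?_))
  refine (h1.norm_norm).congr (fun x => ?_) fun x => ?_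
  · simp only [Function.comp_apply, zero_add, hr0, h0, hB, sub_zero]
    rw [← norm_rho, rho_sub]
  · exact norm_rho x

/-- The conjugation of germs `f ↦ conj (f ∘ ρ)`. -/
noncomputable def conjC : AGerm (C2p e s) →+* AGerm (C2p e s) where
  toFun x := AGerm.mk (fun y => conj (x.rep (rho y))) (analyticAt_conj_rho x.analyticAt_rep)
  map_one' := Subtype.ext (Germ.coe_eq.2 (by
    filter_upwards [tendsto_rho.eventually AGerm.rep_one] with y hy; simp [hy]))
  map_zero' := Subtype.ext (Germ.coe_eq.2 (by
    filter_upwards [tendsto_rho.eventually AGerm.rep_zero] with y hy; simp [hy]))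
  map_add' f g := Subtype.ext (Germ.coe_eq.2 (by
    filter_upwards [tendsto_rho.eventually (AGerm.rep_add f g)] with y hy; simp [hy]))
  map_mul' f g := Subtype.ext (Germ.coe_eq.2 (by
    filter_upwards [tendsto_rho.eventually (AGerm.rep_mul f g)] with y hy; simp [hy]))

theorem rep_conjC (x : AGerm (C2p e s)) : (conjC x).rep =ᶠ[𝓝 0] fun y => conj (x.rep (rho y)) :=
  AGerm.rep_mk _ (analyticAt_conj_rho x.analyticAt_rep)

theorem conjC_conjC (x : AGerm (C2p e s)) : conjC (conjC x) = x := by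
  refine AGerm.ext_rep ?_
  filter_upwards [rep_conjC (conjC x), tendsto_rho.eventually (rep_conjC x)] with y h1 h2
  rw [h1, h2, rho_rho, Complex.conj_conj]

theorem val_conjC (x : AGerm (C2p e s)) : AGerm.val (conjC x) = conj (AGerm.val x) := by
  have hr0 : rho (0 : C2p e s) = 0 := by ext j <;> simp [rho, conjVec]
  rw [AGerm.val_eq, (rep_conjC x).self_of_nhds, AGerm.val_eq]
  exact congrArg (fun y => conj (x.rep y)) hr0

theorem conjC_C (z : ℂ) : conjC (AGerm.C z : AGerm (C2p e s)) = AGerm.C (conj z) := by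
  refine Subtype.ext (Germ.coe_eq.2 ?_)
  filter_upwards [tendsto_rho.eventually (AGerm.rep_mk (fun _ : C2p e s => z) analyticAt_const)]
    with y hy
  exact congrArg conj hy

theorem pull_rho_conj {φ : C2p e s → C2p e s} (h : IsLoc φ) (x : AGerm (C2p e s)) :
    AGerm.pull (rho ∘ φ ∘ rho) (isLoc_rho_conj h) x = conjC (AGerm.pull φ h (conjC x)) := by
  refine AGerm.ext_rep ?_
  filter_upwards [AGerm.rep_pull _ (isLoc_rho_conj h) x, rep_conjC (AGerm.pull φ h (conjC x)),
    tendsto_rho.eventually (AGerm.rep_pull φ h (conjC x)),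
    (h.tendsto.comp tendsto_rho).eventually (rep_conjC x)] with y h1 h2 h3 h4
  rw [h1, h2, h3]
  simp only [Function.comp_apply] at *
  rw [h4, Complex.conj_conj]

end conjugation

section linear

variable {γe : Fin e → ℝ} {γs : Fin s → ℂ}

/-- The involution `T_{1j}` as a continuous linear map. -/
noncomputable def quadInvL (γe : Fin e → ℝ) (γs : Fin s → ℂ) (j : CIdx e s) :
    C2p e s →L[ℂ] C2p e s :=
  LinearMap.toContinuousLinearMap
    { toFun := quadricInvolution γe γs j
      map_add' := fun x y => by
        refine Prod.ext rfl (funext fun i => ?_)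
        by_cases hi : i = j
        · subst hi; simp [quadricInvolution]; ring
        · simp [quadricInvolution, Function.update_of_ne hi]
      map_smul' := fun c x => by
        refine Prod.ext rfl (funext fun i => ?_)
        by_cases hi : i = j
        · subst hi; simp [quadricInvolution]; ring
        · simp [quadricInvolution, Function.update_of_ne hi] }

theorem quadInvL_apply (j : CIdx e s) (x : C2p e s) :
    quadInvL γe γs j x = quadricInvolution γe γs j x := rfl

theorem quadricInvolution_self (j : CIdx e s) (x : C2p e s) :
    quadricInvolution γe γs j (quadricInvolution γe γs j x) = x := by
  refine Prod.ext rfl (funext fun i => ?_)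
  by_cases hi : i = j
  · subst hi; simp [quadricInvolution]
  · simp [quadricInvolution]

theorem quadricInvolution_comm (i j : CIdx e s) (x : C2p e s) :
    quadricInvolution γe γs i (quadricInvolution γe γs j x)
      = quadricInvolution γe γs j (quadricInvolution γe γs i x) := by
  by_cases hij : i = j
  · rw [hij]
  refine Prod.ext rfl (funext fun k => ?_)
  by_cases hi : k = i
  · subst hi; simp [quadricInvolution, Function.update_of_ne hij]
  · by_cases hj : k = j
    · subst hj; simp [quadricInvolution, Function.update_of_ne hi]
    · simp [quadricInvolution, Function.update_of_ne hi, Function.update_of_ne hj]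

/-- The linear coordinates in which all `T_{1j}` are exchanges. -/
noncomputable def linN (γe : Fin e → ℝ) (γs : Fin s → ℂ) (y : C2p e s) : C2p e s :=
  (fun j => y.1 (partner j) + y.2 (partner j),
    fun j => -kap (lam γe γs) j * (y.1 j + (lam γe γs j ^ 2)⁻¹ * y.2 j))

theorem linN_injective (h : IsParam γe γs) : ∀ y : C2p e s, linN γe γs y = 0 → y = 0 := by
  intro y hy
  have e1 : ∀ j, y.1 j + y.2 j = 0 := fun j => by
    have := congrFun (congrArg Prod.fst hy) (partner j)
    simpa only [linN, partner_partner, Prod.fst_zero, Pi.zero_apply] using this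
  have e2 : ∀ j, y.1 j + (lam γe γs j ^ 2)⁻¹ * y.2 j = 0 := fun j =>
    (mul_eq_zero.1 (congrFun (congrArg Prod.snd hy) j)).resolve_left
      (neg_ne_zero.2 (kap_ne_zero h.lam_ne_zero j))
  have e3 : ∀ j, y.2 j = 0 := fun j => by
    have h3 : (lam γe γs j ^ 2 - 1) * y.2 j = 0 := by
      have h4 := mul_inv_cancel₀ (pow_ne_zero 2 (h.lam_ne_zero j))
      linear_combination lam γe γs j ^ 2 * (e1 j) - lam γe γs j ^ 2 * e2 j + y.2 j * h4
    exact (mul_eq_zero.1 h3).resolve_left (sub_ne_zero.2 (h.lam_sq_ne_one j))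
  refine Prod.ext (funext fun j => ?_) (funext e3)
  have := e1 j; rw [e3, add_zero] at this; exact this

/-- The map `linN` as a linear equivalence. -/
noncomputable def linE (h : IsParam γe γs) : C2p e s ≃L[ℂ] C2p e s :=
  (LinearEquiv.ofInjectiveEndo
    ({ toFun := linN γe γs
       map_add' := fun x x' => by ext j <;> simp [linN] <;> ring
       map_smul' := fun c x => by ext j <;> simp [linN] <;> ring } : C2p e s →ₗ[ℂ] C2p e s)
    ((injective_iff_map_eq_zero _).2 (linN_injective h))).toContinuousLinearEquiv

theorem linE_apply (h : IsParam γe γs) (y : C2p e s) : linE h y = linN γe γs y := rfl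

/-- The exchange of the `j`-th components. -/
def swapPair (j : CIdx e s) (y : C2p e s) : C2p e s :=
  (Function.update y.1 j (y.2 j), Function.update y.2 j (y.1 j))

/-- The multiplication of the `j`-th components by `m` and `m⁻¹`. -/
noncomputable def scalPair (j : CIdx e s) (m : ℂ) (y : C2p e s) : C2p e s :=
  (Function.update y.1 j (m * y.1 j), Function.update y.2 j (m⁻¹ * y.2 j))

theorem sumE_swapPair (j : CIdx e s) (y : C2p e s) :
    sumE e s (swapPair j y) = swapV (Sum.inl j) (Sum.inr j) (sumE e s y) := by
  funext k
  rcases k with k | k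
  · by_cases hk : k = j
    · subst hk; simp [swapV, sumE_inl, sumE_inr, swapPair]
    · rw [swapV, Equiv.swap_apply_of_ne_of_ne (by simpa using hk) (by simp)]
      simp [sumE_inl, swapPair, Function.update_of_ne hk]
  · by_cases hk : k = j
    · subst hk; simp [swapV, sumE_inl, sumE_inr, swapPair]
    · rw [swapV, Equiv.swap_apply_of_ne_of_ne (by simp) (by simpa using hk)]
      simp [sumE_inr, swapPair, Function.update_of_ne hk]

theorem sumE_scalPair (j : CIdx e s) (m : ℂ) (y : C2p e s) :
    sumE e s (scalPair j m y) = sc (Sum.inl j) (Sum.inr j) m (sumE e s y) := by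
  funext k
  rcases k with k | k
  · by_cases hk : k = j
    · subst hk; simp [sc, sumE_inl, scalPair]
    · simp [sc, sumE_inl, scalPair, hk]
  · by_cases hk : k = j
    · subst hk; simp [sc, sumE_inr, scalPair]
    · simp [sc, sumE_inr, scalPair, hk]

theorem quadricInvolution_linN (h : IsParam γe γs) (j : CIdx e s) (y : C2p e s) :
    quadricInvolution γe γs j (linN γe γs y) = linN γe γs (swapPair j y) := by
  have hg := eq_inv_of_mul_eq_one_right (h.quadCoef_mul j)
  refine Prod.ext (funext fun i => ?_) (funext fun i => ?_)
  · by_cases hi : partner i = j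
    · subst hi; simp [quadricInvolution, linN, swapPair, add_comm]
    · simp [quadricInvolution, linN, swapPair, Function.update_of_ne hi]
  · by_cases hi : i = j
    · subst hi
      simp only [quadricInvolution, linN, swapPair, Function.update_self, partner_partner, ← hg]
      ring
    · simp [quadricInvolution, linN, swapPair, Function.update_of_ne hi]

theorem IsParam.conj_quadCoef (h : IsParam γe γs) (j : CIdx e s) :
    (conj (quadCoef γe γs j))⁻¹ * kap (lam γe γs) j = 1 + lam γe γs j ^ 2 := by
  rcases j with i | i | i
  · have h1 := h.lam_inl_eq i
    have h2 : (γe i : ℂ) ≠ 0 := by exact_mod_cast (h.ell i).1.ne'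
    simp only [quadCoef, kap, Complex.conj_ofReal]
    field_simp
    linear_combination -h1
  · have h1 : conj (γs i) ≠ 0 := by simpa using (h.cpl i).2.2
    simp only [quadCoef, kap, h.lam_sq]
    ring
  · have h1 : γs i ≠ 0 := (h.cpl i).2.2
    have h2 : 1 - γs i ≠ 0 := by
      have := (map_ne_zero (starRingEnd ℂ)).2 (h.one_sub_ne i)
      simpa using this
    have h3 : (γs i)⁻¹ - 1 = (1 - γs i) / γs i := by field_simp
    simp only [quadCoef, kap, h.lam_inr_inr]
    rw [inv_pow, ← map_pow, h.lam_sq, map_sub, map_sub, map_inv₀, Complex.conj_conj, map_one, h3]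
    field_simp; ring

theorem sigma_linN (h : IsParam γe γs) (j : CIdx e s) (y : C2p e s) :
    quadricInvolution γe γs j (rho (quadricInvolution γe γs (partner j) (rho (linN γe γs y))))
      = linN γe γs (scalPair j (lam γe γs j ^ 2) y) := by
  have hk := h.conj_quadCoef j
  have hl := h.lam_ne_zero j
  have h1 : rho (quadricInvolution γe γs (partner j) (rho (linN γe γs y))) = linN γe γs
      (Function.update y.1 j ((lam γe γs j ^ 2)⁻¹ * y.2 j),
        Function.update y.2 j (lam γe γs j ^ 2 * y.1 j)) := by
    refine Prod.ext (funext fun i => ?_) (funext fun i => ?_)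
    · by_cases hi : i = partner j
      · subst hi
        simp only [rho, conjVec, quadricInvolution, Function.update_self, linN, partner_partner,
          map_sub, map_neg, map_mul, map_inv₀, map_add, Complex.conj_conj]
        have h3 : (lam γe γs j ^ 2)⁻¹ * lam γe γs j ^ 2 = 1 := inv_mul_cancel₀ (pow_ne_zero 2 hl)
        linear_combination (y.1 j + (lam γe γs j ^ 2)⁻¹ * y.2 j) * hk + y.2 j * h3
      · have hi' : partner i ≠ j := fun h2 => hi (by rw [← h2, partner_partner])
        simp [rho, conjVec, quadricInvolution, linN, Function.update_of_ne hi,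
          Function.update_of_ne hi']
    · by_cases hi : i = j
      · subst hi
        simp only [rho, conjVec, quadricInvolution, linN, Function.update_self, Complex.conj_conj]
        field_simp; ring
      · simp [rho, conjVec, quadricInvolution, linN, Function.update_of_ne hi]
  rw [h1, quadricInvolution_linN h]
  simp [swapPair, scalPair]

end linear

section abelianSystem

variable {γe : Fin e → ℝ} {γs : Fin s → ℂ} {E : C2p e s → Cp e s}

/-- The conjugate of a complex linear map by `ρ`. -/
noncomputable def rhoConjL (A : C2p e s →L[ℂ] C2p e s) : C2p e s →L[ℂ] C2p e s :=
  LinearMap.toContinuousLinearMap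
    { toFun := fun x => rho (A (rho x))
      map_add' := fun x y => by
        have h : ∀ x y : C2p e s, rho (x + y) = rho x + rho y := fun x y => by
          ext j <;> simp [rho, conjVec]
        rw [h, map_add, h]
      map_smul' := fun c x => by
        have h : ∀ (c : ℂ) (x : C2p e s), rho (c • x) = conj c • rho x := fun c x => by
          ext j <;> simp [rho, conjVec]
        rw [h, map_smul, h, Complex.conj_conj]; rfl }

theorem hasFDerivAt_deck {j : CIdx e s} {τ : C2p e s → C2p e s} (h0 : τ 0 = 0)
    (h : (fun x => τ x - quadricInvolution γe γs j x) =O[𝓝 0] fun x => ‖x‖ ^ 2) :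
    HasFDerivAt τ (quadInvL γe γs j) 0 := by
  rw [hasFDerivAt_iff_isLittleO_nhds_zero]
  simp only [zero_add, h0, sub_zero]
  exact h.trans_isLittleO (isLittleO_norm_pow_id one_lt_two)

theorem linE_symm_swap (h : IsParam γe γs) (j : CIdx e s) (x : C2p e s) :
    (linE h).symm (quadInvL γe γs j x) = swapPair j ((linE h).symm x) := by
  rw [ContinuousLinearEquiv.symm_apply_eq, linE_apply, ← quadricInvolution_linN h, ← linE_apply h,
    ContinuousLinearEquiv.apply_symm_apply, quadInvL_apply]

theorem linE_symm_scal (h : IsParam γe γs) (j : CIdx e s) (x : C2p e s) :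
    (linE h).symm (quadInvL γe γs j (rhoConjL (quadInvL γe γs (partner j)) x))
      = scalPair j (lam γe γs j ^ 2) ((linE h).symm x) := by
  rw [ContinuousLinearEquiv.symm_apply_eq, linE_apply, ← sigma_linN h, ← linE_apply h,
    ContinuousLinearEquiv.apply_symm_apply]; rfl

theorem swapPair_single (j : CIdx e s) :
    swapPair j (0, Pi.single j 1) = ((Pi.single j 1, 0) : C2p e s) := by
  refine Prod.ext (funext fun i => ?_) (funext fun i => ?_) <;>
  · by_cases hi : i = j
    · subst hi; simp [swapPair]
    · simp [swapPair, hi]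

theorem scalPair_of_eq_zero {j : CIdx e s} {x : C2p e s} (m : ℂ) (h1 : x.1 j = 0)
    (h2 : x.2 j = 0) : scalPair j m x = x := by
  rw [scalPair, h1, h2, mul_zero, mul_zero, ← h1, Function.update_eq_self, h1, ← h2,
    Function.update_eq_self]

/-- The involutions of an abelian CR singularity form a system. -/
theorem exists_isSystem (h : IsParam γe γs) (hE : HasAbelianCRSingularity γe γs E) :
    ∃ (τ : CIdx e s → C2p e s → C2p e s) (hτ : ∀ j, IsLoc (τ j)), (∀ j, IsDeck E (τ j)) ∧
      ∃ m ξ η, IsSystem partner (fun j => AGerm.pull (τ j) (hτ j))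
        (fun j => AGerm.pull (rho ∘ τ j ∘ rho) (isLoc_rho_conj (hτ j))) conjC (lam γe γs) m ξ η
        (fun j => linE h (Pi.single j 1, 0)) (fun j => linE h (0, Pi.single j 1)) ∧
      (∀ j f y, AGerm.der (AGerm.pull (τ j) (hτ j) f) (linE h y) = AGerm.der f (linE h (swapPair j y))) ∧
      ∀ j hσ f y, AGerm.der (AGerm.pull (sigmaMap τ j) hσ f) (linE h y)
        = AGerm.der f (linE h (scalPair j (lam γe γs j ^ 2) y)) := by
  obtain ⟨hcard, τ, hτD, hcomm⟩ := hE
  have hfin : (deckGerms E).Finite :=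
    Set.finite_of_ncard_ne_zero (by rw [hcard]; positivity)
  have hτ : ∀ j, IsLoc (τ j) := fun j => (hτD j).1.isLoc
  have hd : ∀ j, HasFDerivAt (τ j) (quadInvL γe γs j) 0 := fun j =>
    hasFDerivAt_deck (hτ j).2 (hτD j).2
  have hρ : ∀ j, HasFDerivAt (rho ∘ τ j ∘ rho) (rhoConjL (quadInvL γe γs j)) 0 := fun j =>
    hasFDerivAt_rho_conj (hτ j).2 (hd j) fun x => rfl
  have hσd : ∀ j, HasFDerivAt (sigmaMap τ j)
      ((quadInvL γe γs j).comp (rhoConjL (quadInvL γe γs (partner j)))) 0 := fun j =>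
    (hd j).comp_isLoc (hρ _) (isLoc_rho_conj (hτ _)).2
  have hσ : ∀ j, IsLoc (sigmaMap τ j) := fun j => (hτ j).comp (isLoc_rho_conj (hτ _))
  have hinv : ∀ j, τ j ∘ τ j =ᶠ[𝓝 0] id := fun j => by
    refine ((hτD j).1.comp (hτD j).1).eq_id hfin ?_
    refine ((hd j).comp_isLoc (hd j) (hτ j).2).congr_fderiv ?_
    exact ContinuousLinearMap.ext fun x => quadricInvolution_self j x
  have hcm : ∀ i j, (τ i ∘ τ j) ∘ (τ i ∘ τ j) =ᶠ[𝓝 0] id := fun i j => by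
    have h1 := (hτD i).1.comp (hτD j).1
    refine (h1.comp h1).eq_id hfin ?_
    have h2 := (hd i).comp_isLoc (hd j) (hτ j).2
    refine (h2.comp_isLoc h2 h1.isLoc.2).congr_fderiv (ContinuousLinearMap.ext fun x => ?_)
    change quadricInvolution γe γs i (quadricInvolution γe γs j (quadricInvolution γe γs i
      (quadricInvolution γe γs j x))) = x
    rw [quadricInvolution_comm, quadricInvolution_comm i, quadricInvolution_self,
      quadricInvolution_self]
  have hrinv : ∀ j, (rho ∘ τ j ∘ rho) ∘ (rho ∘ τ j ∘ rho) =ᶠ[𝓝 0] id := fun j => by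
    filter_upwards [tendsto_rho.eventually (hinv j)] with x hx
    simp only [Function.comp_apply, id_eq] at *
    rw [rho_rho, hx, rho_rho]
  have hrev : ∀ j, (τ j ∘ sigmaMap τ j) ∘ (τ j ∘ sigmaMap τ j) =ᶠ[𝓝 0] id := fun j => by
    have h1 : τ j ∘ sigmaMap τ j =ᶠ[𝓝 0] rho ∘ τ (partner j) ∘ rho :=
      (isLoc_rho_conj (hτ (partner j))).tendsto.eventually (hinv j)
    have h2 := ((hτ j).comp (hσ j)).tendsto.eventually h1
    filter_upwards [h1, h2, hrinv (partner j)] with x e1 e2 e3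
    simp only [Function.comp_apply, id_eq] at *
    rw [e2, e1, e3]
  have hpull : ∀ j, sHom partner (fun j => AGerm.pull (τ j) (hτ j))
      (fun j => AGerm.pull (rho ∘ τ j ∘ rho) (isLoc_rho_conj (hτ j))) j
        = AGerm.pull (sigmaMap τ j) (hσ j) := fun j =>
    RingHom.ext fun f => AGerm.pull_pull (isLoc_rho_conj (hτ _)) (hτ j) f
  have hinv₁ : ∀ j f, AGerm.pull (τ j) (hτ j) (AGerm.pull (τ j) (hτ j) f) = f := fun j f => by
    rw [AGerm.pull_pull]
    refine AGerm.ext_rep ?_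
    filter_upwards [AGerm.rep_pull _ ((hτ j).comp (hτ j)) f, hinv j] with x e1 e2
    rw [e1, Function.comp_apply, e2, id]
  have hP : ∀ j, ∃ m ξ η, IsPair (AGerm.pull (sigmaMap τ j) (hσ j)) (AGerm.pull (τ j) (hτ j))
      (lam γe γs j ^ 2) m ξ η (linE h (Pi.single j 1, 0)) (linE h (0, Pi.single j 1)) := fun j => by
    obtain ⟨m, ξ, η, hp⟩ := exists_isPair_of_norm_ne_one ((linE h).symm.trans (sumE e s))
      (a := Sum.inl j) (b := Sum.inr j) (by simp) (pow_ne_zero 2 (h.lam_ne_zero j))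
      (h.norm_lam_sq_ne j) (hσ j) (hτ j)
      ⟨_, hσd j, fun x => by
        rw [ContinuousLinearEquiv.trans_apply, ContinuousLinearMap.comp_apply, linE_symm_scal,
          sumE_scalPair]; rfl⟩
      ⟨_, hd j, fun x => by
        rw [ContinuousLinearEquiv.trans_apply, linE_symm_swap, sumE_swapPair]; rfl⟩
      (hinv j) (hrev j)
    refine ⟨m, ξ, η, ?_⟩
    have h1 : ((linE h).symm.trans (sumE e s)).symm (Pi.single (Sum.inl j) 1)
        = linE h (Pi.single j 1, 0) := by
      rw [ContinuousLinearEquiv.symm_apply_eq, ContinuousLinearEquiv.trans_apply,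
        ContinuousLinearEquiv.symm_apply_apply]
      funext k
      rcases k with k | k <;> simp [sumE_inl, sumE_inr, Pi.single_apply]
    have h2 : ((linE h).symm.trans (sumE e s)).symm (Pi.single (Sum.inr j) 1)
        = linE h (0, Pi.single j 1) := by
      rw [ContinuousLinearEquiv.symm_apply_eq, ContinuousLinearEquiv.trans_apply,
        ContinuousLinearEquiv.symm_apply_apply]
      funext k
      rcases k with k | k <;> simp [sumE_inl, sumE_inr, Pi.single_apply]
    rwa [h1, h2] at hp
  have hder : ∀ i hσ f y, AGerm.der (AGerm.pull (sigmaMap τ i) hσ f) (linE h y)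
      = AGerm.der f (linE h (scalPair i (lam γe γs i ^ 2) y)) := by
    intro i _ f y
    rw [AGerm.der_pull _ _ (hσd i), ContinuousLinearMap.comp_apply, ContinuousLinearMap.comp_apply]
    congr 1
    rw [← (linE h).symm.injective.eq_iff, linE_symm_scal, ContinuousLinearEquiv.symm_apply_apply,
      ContinuousLinearEquiv.symm_apply_apply]
  have hdert : ∀ j f y, AGerm.der (AGerm.pull (τ j) (hτ j) f) (linE h y)
      = AGerm.der f (linE h (swapPair j y)) := by
    intro j f y
    rw [AGerm.der_pull _ _ (hd j), ContinuousLinearMap.comp_apply]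
    congr 1
    rw [← (linE h).symm.injective.eq_iff, linE_symm_swap, ContinuousLinearEquiv.symm_apply_apply,
      ContinuousLinearEquiv.symm_apply_apply]
  choose m ξ η hp using hP
  refine ⟨τ, hτ, fun j => (hτD j).1, m, ξ, η, ⟨partner_partner, hinv₁, fun i j f => ?_,
    fun j f => pull_rho_conj (hτ j) f, conjC_conjC, fun j f => AGerm.val_pull _ _ f, val_conjC,
    fun i j f => ?_, fun j => ?_, fun i j f hij => ?_, fun i j f hij => ?_, fun j f => ?_,
    h.lam_ne_zero, h.lam_sq_ne_one, fun j hj => ?_, fun j hj => ?_⟩, hdert, hder⟩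
  · have h1 : ∀ g, AGerm.pull (τ j) (hτ j) (AGerm.pull (τ i) (hτ i) (AGerm.pull (τ j) (hτ j)
        (AGerm.pull (τ i) (hτ i) g))) = g := fun g => by
      simp only [AGerm.pull_pull]
      refine AGerm.ext_rep ?_
      filter_upwards [AGerm.rep_pull _ (((hτ i).comp (hτ j)).comp ((hτ i).comp (hτ j))) g,
        hcm i j] with x e1 e2
      rw [Function.comp_apply, e2, id] at e1
      exact e1
    have h2 := congrArg (AGerm.pull (τ i) (hτ i)) (congrArg (AGerm.pull (τ j) (hτ j)) (h1 f))
    rw [hinv₁, hinv₁] at h2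
    exact h2.symm
  · rw [hpull, hpull, AGerm.pull_pull, AGerm.pull_pull,
      AGerm.pull_congr _ ((hσ i).comp (hσ j)) (hcomm j i)]
  · rw [hpull]; exact hp j
  · rw [hpull]; rw [hder, scalPair_of_eq_zero _ (by simp [hij]) rfl]
  · rw [hpull]; rw [hder, scalPair_of_eq_zero _ rfl (by simp [hij])]
  · rw [hdert, swapPair_single]
  · rcases j with j | j | j
    · exact h.conj_lam_inl j
    · exact absurd hj (by simp [partner])
    · exact absurd hj (by simp [partner])
  · rcases j with j | j
    · exact absurd rfl hj
    · exact h.conj_lam_inr j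

end abelianSystem

section normalCoordinates

variable {γe : Fin e → ℝ} {γs : Fin s → ℂ} {E : C2p e s → Cp e s}

/-- The componentwise multiplication of both groups of variables. -/
noncomputable def scaleE (α β : Cp e s) (hα : ∀ j, α j ≠ 0) (hβ : ∀ j, β j ≠ 0) :
    C2p e s ≃L[ℂ] C2p e s :=
  (diagEquiv α hα).prodCongr (diagEquiv β hβ)

theorem scaleE_apply {α β : Cp e s} (hα : ∀ j, α j ≠ 0) (hβ : ∀ j, β j ≠ 0) (x : C2p e s) :
    scaleE α β hα hβ x = (fun j => α j * x.1 j, fun j => β j * x.2 j) := by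
  refine Prod.ext (funext fun j => ?_) (funext fun j => ?_)
  · exact (diagEquiv_apply α hα x.1 j).trans (mul_comm _ _)
  · exact (diagEquiv_apply β hβ x.2 j).trans (mul_comm _ _)

/-- Coordinates in which the involutions `τ_j` exchange two coordinates and the `σ_j` are scalings
by invariant functions. -/
structure IsNormalCoord (h : IsParam γe γs) (τ : CIdx e s → C2p e s → C2p e s)
    (φ : C2p e s → C2p e s) (L : C2p e s → Cp e s) (α : Cp e s) : Prop where
  loc : IsLoc φ
  an : AnalyticAt ℂ L 0
  zero : L 0 = lam γe γs
  ne : ∀ j, α j ≠ 0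
  der : HasFDerivAt φ (((linE h).symm.trans (scaleE α α ne ne) : C2p e s ≃L[ℂ] C2p e s) :
    C2p e s →L[ℂ] C2p e s) 0
  swap : ∀ j, ∀ᶠ x in 𝓝 0, φ (τ j x) = swapPair j (φ x)
  scal : ∀ j, ∀ᶠ x in 𝓝 0, φ (sigmaMap τ j x) = scalPair j (L x j ^ 2) (φ x)
  inv : ∀ j, ∀ᶠ x in 𝓝 0, L (sigmaMap τ j x) = L x
  conj_inl : ∀ i : Fin e, ∀ᶠ x in 𝓝 0, conj (L (rho x) (Sum.inl i)) = L x (Sum.inl i) ∧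
    conj ((φ (rho x)).2 (Sum.inl i)) = L x (Sum.inl i) * (φ x).1 (Sum.inl i) ∧
    L x (Sum.inl i) * conj ((φ (rho x)).1 (Sum.inl i)) = (φ x).2 (Sum.inl i)
  conj_inr : ∀ k : Fin s ⊕ Fin s, ∀ᶠ x in 𝓝 0,
    conj (L (rho x) (Sum.inr k)) * L x (partner (Sum.inr k)) = 1 ∧
    conj ((φ (rho x)).1 (Sum.inr k)) = (φ x).1 (partner (Sum.inr k)) ∧
    L x (partner (Sum.inr k)) ^ 2 * conj ((φ (rho x)).2 (Sum.inr k)) = (φ x).2 (partner (Sum.inr k))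

theorem linear_eq_of_single {ℓ : C2p e s →L[ℂ] ℂ} {j : CIdx e s}
    (h1 : ∀ i, i ≠ j → ℓ (Pi.single i 1, 0) = 0) (h2 : ∀ i, ℓ (0, Pi.single i 1) = 0) (y : C2p e s) :
    ℓ y = ℓ (Pi.single j 1, 0) * y.1 j := by
  have e1 := LinearMap.pi_apply_eq_sum_univ
    ((ℓ.comp (ContinuousLinearMap.inl ℂ (Cp e s) (Cp e s))) : Cp e s →ₗ[ℂ] ℂ) y.1
  have e2 := LinearMap.pi_apply_eq_sum_univ
    ((ℓ.comp (ContinuousLinearMap.inr ℂ (Cp e s) (Cp e s))) : Cp e s →ₗ[ℂ] ℂ) y.2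
  have hs : ∀ i : CIdx e s, (fun k => if i = k then (1 : ℂ) else 0) = Pi.single i 1 := fun i => by
    funext k; simp [Pi.single_apply, eq_comm]
  simp only [ContinuousLinearMap.coe_coe, ContinuousLinearMap.comp_apply, hs,
    ContinuousLinearMap.inl_apply, ContinuousLinearMap.inr_apply, h2, smul_zero,
    Finset.sum_const_zero] at e1 e2
  rw [Finset.sum_eq_single j (fun i _ hi => by rw [h1 i hi, smul_zero]) (by simp)] at e1
  have e3 : y = (y.1, 0) + (0, y.2) := by simp
  rw [e3, map_add, e1, e2, add_zero, smul_eq_mul, mul_comm]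
  simp

theorem exists_isNormalCoord (h : IsParam γe γs) (hE : HasAbelianCRSingularity γe γs E) :
    ∃ τ φ L α, (∀ j, IsDeck E (τ j)) ∧ IsNormalCoord h τ φ L α := by
  obtain ⟨τ, hτ, hD, m, ξ, η, hS, hdt, hds⟩ := exists_isSystem h hE
  obtain ⟨Λ, u, v, hG, hΛv, hu, hv, hΛs, hfix, hpair⟩ := hS.exists_normalized
    (fun j => ∃ i, j = Sum.inr (Sum.inl i)) (by
      rintro (i | i | i) hi
      · exact absurd rfl hi
      · simp [partner]
      · simp [partner]) conjC_C fun j z => AGerm.pull_C _ _ z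
  have hσ : ∀ j, IsLoc (sigmaMap τ j) := fun j => (hτ j).comp (isLoc_rho_conj (hτ _))
  have hpull : ∀ j, sHom partner (fun j => AGerm.pull (τ j) (hτ j))
      (fun j => AGerm.pull (rho ∘ τ j ∘ rho) (isLoc_rho_conj (hτ j))) j
        = AGerm.pull (sigmaMap τ j) (hσ j) := fun j =>
    RingHom.ext fun f => AGerm.pull_pull (isLoc_rho_conj (hτ _)) (hτ j) f
  have hμ1 : ∀ j, lam γe γs j ^ 2 - 1 ≠ 0 := fun j => sub_ne_zero.2 (h.lam_sq_ne_one j)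
  let α : Cp e s := fun j => AGerm.der (u j) (linE h (Pi.single j 1, 0))
  have hα : ∀ j, α j ≠ 0 := hG.der_fst
  have hscf : ∀ (i : CIdx e s) (m : ℂ),
      scalPair i m (Pi.single i 1, 0) = m • ((Pi.single i 1, 0) : C2p e s) := fun i m => by
    refine Prod.ext (funext fun k => ?_) (funext fun k => ?_)
    · by_cases hk : k = i
      · subst hk; simp [scalPair]
      · simp [scalPair, hk]
    · simp [scalPair]
  have hscs : ∀ (i : CIdx e s) (m : ℂ),
      scalPair i m (0, Pi.single i 1) = m⁻¹ • ((0, Pi.single i 1) : C2p e s) := fun i m => by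
    refine Prod.ext (funext fun k => ?_) (funext fun k => ?_)
    · simp [scalPair]
    · by_cases hk : k = i
      · subst hk; simp [scalPair]
      · simp [scalPair, hk]
  have hdu : ∀ j y, AGerm.der (u j) (linE h y) = α j * y.1 j := by
    intro j y
    refine linear_eq_of_single (ℓ := (AGerm.der (u j)).comp (linE h : C2p e s →L[ℂ] C2p e s))
      (fun i hi => ?_) (fun i => ?_) y
    · change AGerm.der (u j) (linE h (Pi.single i 1, 0)) = 0
      have h1 := hds i (hσ i) (u j) (Pi.single i 1, 0)
      rw [← hpull, hG.inv_fst i j hi, hscf, map_smul, map_smul, smul_eq_mul] at h1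
      refine (mul_eq_zero.1 (?_ : (lam γe γs i ^ 2 - 1) * _ = 0)).resolve_left (hμ1 i)
      linear_combination -h1
    · change AGerm.der (u j) (linE h (0, Pi.single i 1)) = 0
      have h1 := hds i (hσ i) (u j) (0, Pi.single i 1)
      rw [← hpull, hscs, map_smul, map_smul, smul_eq_mul] at h1
      have h0 := mul_inv_cancel₀ (pow_ne_zero 2 (h.lam_ne_zero i))
      by_cases hij : i = j
      · subst hij
        rw [hG.eig_fst, AGerm.der_mul, hu, AGerm.zero_smul_der, add_zero, map_pow, hΛv] at h1
        change lam γe γs i ^ 2 * _ = _ at h1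
        have h4 : (lam γe γs i ^ 2) ^ 2 - 1 ≠ 0 := fun h5 => by
          have h6 := congrArg norm (sub_eq_zero.1 h5)
          rw [norm_pow, norm_one] at h6
          exact h.norm_lam_sq_ne i ((pow_eq_one_iff_of_nonneg (norm_nonneg _) two_ne_zero).1 h6)
        refine (mul_eq_zero.1 (?_ : ((lam γe γs i ^ 2) ^ 2 - 1) * _ = 0)).resolve_left h4
        linear_combination lam γe γs i ^ 2 * h1 +
          AGerm.der (u i) (linE h (0, Pi.single i 1)) * h0
      · rw [hG.inv_fst i j hij] at h1
        refine (mul_eq_zero.1 (?_ : (lam γe γs i ^ 2 - 1) * _ = 0)).resolve_left (hμ1 i)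
        linear_combination lam γe γs i ^ 2 * h1 +
          AGerm.der (u j) (linE h (0, Pi.single i 1)) * h0
  have hdv : ∀ j y, AGerm.der (v j) (linE h y) = α j * y.2 j := by
    intro j y
    rw [← hG.swap_fst, hdt, hdu]; simp [swapPair]
  let φ : C2p e s → C2p e s := fun x => (fun j => (u j).rep x, fun j => (v j).rep x)
  have hφ0 : φ 0 = 0 := by
    refine Prod.ext (funext fun j => ?_) (funext fun j => ?_)
    · change (u j).rep 0 = 0; rw [← AGerm.val_eq, hu]
    · change (v j).rep 0 = 0; rw [← AGerm.val_eq, hv]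
  have hrs : ∀ i (f : AGerm (C2p e s)), (AGerm.pull (sigmaMap τ i) (hσ i) f).rep =ᶠ[𝓝 0]
      f.rep ∘ sigmaMap τ i := fun i f => AGerm.rep_pull _ _ f
  refine ⟨τ, φ, fun x j => (Λ j).rep x, α, hD,
    ⟨analyticAt_C2p (fun j => (u j).analyticAt_rep) fun j => (v j).analyticAt_rep, hφ0⟩,
    analyticAt_Cp fun j => (Λ j).analyticAt_rep, funext fun j => ?_, hα, ?_, fun i => ?_, fun i => ?_,
    fun i => ?_, fun i => ?_, fun k => ?_⟩
  · rw [← AGerm.val_eq, hΛv]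
  · refine hasFDerivAt_C2p hφ0 (fun j => ?_) fun j => ?_
    · have h1 := (u j).hasFDerivAt_rep
      rw [hasFDerivAt_iff_isLittleO_nhds_zero] at h1
      refine h1.congr_left fun x => ?_
      rw [zero_add, ← AGerm.val_eq, hu, sub_zero]
      obtain ⟨y, rfl⟩ := (linE h).surjective x
      rw [hdu]; simp [scaleE_apply, φ]
    · have h1 := (v j).hasFDerivAt_rep
      rw [hasFDerivAt_iff_isLittleO_nhds_zero] at h1
      refine h1.congr_left fun x => ?_
      rw [zero_add, ← AGerm.val_eq, hv, sub_zero]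
      obtain ⟨y, rfl⟩ := (linE h).surjective x
      rw [hdv]; simp [scaleE_apply, φ]
  · have h1 : ∀ j, ∀ᶠ x in 𝓝 0, (φ (τ i x)).1 j = (swapPair i (φ x)).1 j := fun j => by
      filter_upwards [AGerm.rep_pull _ (hτ i) (u j)] with x hx
      refine hx.symm.trans ?_
      by_cases hj : j = i
      · subst hj; rw [hG.swap_fst]; simp [swapPair, φ]
      · rw [hG.fix_fst i j (Ne.symm hj)]; simp [swapPair, φ, hj]
    have h2 : ∀ j, ∀ᶠ x in 𝓝 0, (φ (τ i x)).2 j = (swapPair i (φ x)).2 j := fun j => by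
      filter_upwards [AGerm.rep_pull _ (hτ i) (v j)] with x hx
      refine hx.symm.trans ?_
      by_cases hj : j = i
      · subst hj; rw [hG.swap_snd]; simp [swapPair, φ]
      · rw [hG.fix_snd i j (Ne.symm hj)]; simp [swapPair, φ, hj]
    filter_upwards [eventually_all.2 h1, eventually_all.2 h2] with x e1 e2
    exact Prod.ext (funext e1) (funext e2)
  · have hm : ∀ᶠ x in 𝓝 0, (Λ i).rep x ≠ 0 := (Λ i).analyticAt_rep.continuousAt.eventually_ne
      (by rw [← AGerm.val_eq, hΛv]; exact h.lam_ne_zero i)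
    have h1 : ∀ j, ∀ᶠ x in 𝓝 0, (φ (sigmaMap τ i x)).1 j
        = (scalPair i ((Λ i).rep x ^ 2) (φ x)).1 j := fun j => by
      by_cases hj : j = i
      · subst hj
        have h3 := hG.eig_fst j
        rw [hpull, pow_two] at h3
        filter_upwards [hrs j (u j), AGerm.rep_mul (Λ j * Λ j) (u j), AGerm.rep_mul (Λ j) (Λ j)]
          with x e1 e2 e3
        rw [h3, e2, Pi.mul_apply, e3] at e1
        simp only [scalPair, Function.update_self, φ]
        rw [pow_two]; exact e1.symm
      · have h3 := hG.inv_fst i j (Ne.symm hj)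
        rw [hpull] at h3
        filter_upwards [hrs i (u j)] with x e1
        rw [h3] at e1
        simp only [scalPair, Function.update_of_ne hj, φ]; exact e1.symm
    have h2 : ∀ j, ∀ᶠ x in 𝓝 0, (φ (sigmaMap τ i x)).2 j
        = (scalPair i ((Λ i).rep x ^ 2) (φ x)).2 j := fun j => by
      by_cases hj : j = i
      · subst hj
        have h3 := hG.eig_snd j
        rw [hpull, pow_two] at h3
        filter_upwards [hrs j (v j), AGerm.rep_mul (Λ j * Λ j)
          (AGerm.pull (sigmaMap τ j) (hσ j) (v j)), AGerm.rep_mul (Λ j) (Λ j), hm] with x e1 e2 e3 e4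
        rw [h3, Pi.mul_apply, e1, e3] at e2
        simp only [scalPair, Function.update_self, φ]
        rw [e2, pow_two]
        simp only [Pi.mul_apply, Function.comp_apply]
        rw [inv_mul_cancel_left₀ (mul_ne_zero e4 e4)]
      · have h3 := hG.inv_snd i j (Ne.symm hj)
        rw [hpull] at h3
        filter_upwards [hrs i (v j)] with x e1
        rw [h3] at e1
        simp only [scalPair, Function.update_of_ne hj, φ]; exact e1.symm
    filter_upwards [eventually_all.2 h1, eventually_all.2 h2] with x e1 e2
    exact Prod.ext (funext e1) (funext e2)
  · have h1 : ∀ j, ∀ᶠ x in 𝓝 0, (Λ j).rep (sigmaMap τ i x) = (Λ j).rep x := fun j => by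
      have h3 := hΛs i j
      rw [hpull] at h3
      filter_upwards [hrs i (Λ j)] with x e1
      rw [h3] at e1; exact e1.symm
    filter_upwards [eventually_all.2 h1] with x e1
    exact funext e1
  · obtain ⟨h1, h2, h3⟩ := hfix (Sum.inl i) rfl
    filter_upwards [rep_conjC (Λ (Sum.inl i)), rep_conjC (v (Sum.inl i)), rep_conjC (u (Sum.inl i)),
      AGerm.rep_mul (Λ (Sum.inl i)) (u (Sum.inl i)),
      AGerm.rep_mul (Λ (Sum.inl i)) (conjC (u (Sum.inl i)))] with x e1 e2 e3 e4 e5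
    rw [h1] at e1
    rw [h2, e4] at e2
    rw [h3, Pi.mul_apply, e3] at e5
    exact ⟨e1.symm, e2.symm, e5.symm⟩
  · have hk : partner (Sum.inr k : CIdx e s) ≠ Sum.inr k := by
      rcases k with k | k <;> simp [partner]
    obtain ⟨h1, h2, h3⟩ := hpair (Sum.inr k) hk
    rw [pow_two] at h3
    filter_upwards [rep_conjC (Λ (Sum.inr k)), rep_conjC (v (Sum.inr k)), rep_conjC (u (Sum.inr k)),
      AGerm.rep_mul (conjC (Λ (Sum.inr k))) (Λ (partner (Sum.inr k))), AGerm.rep_one (V := C2p e s),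
      AGerm.rep_mul (Λ (partner (Sum.inr k)) * Λ (partner (Sum.inr k))) (conjC (v (Sum.inr k))),
      AGerm.rep_mul (Λ (partner (Sum.inr k))) (Λ (partner (Sum.inr k)))] with x e1 e2 e3 e4 e5 e6 e7
    rw [h1, e5, Pi.mul_apply, e1] at e4
    rw [h2] at e3
    rw [h3, Pi.mul_apply, e2, e7, Pi.mul_apply, ← pow_two] at e6
    exact ⟨e4.symm, e3.symm, e6.symm⟩

end normalCoordinates

section normalCoordinates

variable {γe : Fin e → ℝ} {γs : Fin s → ℂ} {h : IsParam γe γs} {τ : CIdx e s → C2p e s → C2p e s}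
  {φ : C2p e s → C2p e s} {L : C2p e s → Cp e s} {α : Cp e s}

/-- The coordinates `(ξ, η)` with `ξ = u`, `η = v / Λ`. -/
noncomputable def divCoord (φ : C2p e s → C2p e s) (L : C2p e s → Cp e s) (x : C2p e s) : C2p e s :=
  ((φ x).1, fun j => (φ x).2 j / L x j)

namespace IsNormalCoord

variable (hN : IsNormalCoord h τ φ L α)

include hN

theorem exists_isInv : ∃ φ', IsInv φ φ' ∧ HasFDerivAt φ'
    (((linE h).symm.trans (scaleE α α hN.ne hN.ne)).symm : C2p e s →L[ℂ] C2p e s) 0 :=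
  _root_.exists_isInv hN.loc hN.der

theorem L_ne (j : CIdx e s) : L 0 j ≠ 0 := by rw [hN.zero]; exact h.lam_ne_zero j

theorem eventually_ne : ∀ᶠ x in 𝓝 0, ∀ j, L x j ≠ 0 :=
  eventually_all.2 fun j => (hN.an.apply_Cp j).continuousAt.eventually_ne (hN.L_ne j)

theorem isLoc_divCoord : IsLoc (divCoord φ L) := by
  have h1 : ∀ j, AnalyticAt ℂ (fun x => (φ x).1 j) 0 := fun j =>
    (analyticAt_coordFst j).comp_isLoc hN.loc
  have h2 : ∀ j, AnalyticAt ℂ (fun x => (φ x).2 j) 0 := fun j =>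
    (analyticAt_coordSnd j).comp_isLoc hN.loc
  refine ⟨analyticAt_C2p h1 fun j => (h2 j).div (hN.an.apply_Cp j) (hN.L_ne j), ?_⟩
  refine Prod.ext (funext fun j => ?_) (funext fun j => ?_) <;> simp [divCoord, hN.loc.2]

theorem exists_isInv_divCoord : ∃ ψ, IsInv (divCoord φ L) ψ := by
  have hβ : ∀ j, α j / lam γe γs j ≠ 0 := fun j => div_ne_zero (hN.ne j) (h.lam_ne_zero j)
  obtain ⟨ψ, hψ, -⟩ := _root_.exists_isInv (A := (linE h).symm.trans
    (scaleE α (fun j => α j / lam γe γs j) hN.ne hβ)) hN.isLoc_divCoord (by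
      have h1 := hN.der
      rw [hasFDerivAt_iff_isLittleO_nhds_zero] at h1
      simp only [zero_add, hN.loc.2, sub_zero] at h1
      have h2 : ∀ j, (fun x => (φ x).1 j - α j * ((linE h).symm x).1 j) =o[𝓝 0] fun x => x :=
        fun j => (isBigO_of_le _ fun x => (norm_le_pi_norm _ j).trans (norm_fst_le _)).trans_isLittleO
          h1 |>.congr_left fun x => by simp [scaleE_apply]
      have h3 : ∀ j, (fun x => (φ x).2 j - α j * ((linE h).symm x).2 j) =o[𝓝 0] fun x => x :=
        fun j => (isBigO_of_le _ fun x => (norm_le_pi_norm _ j).trans (norm_snd_le _)).trans_isLittleO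
          h1 |>.congr_left fun x => by simp [scaleE_apply]
      refine hasFDerivAt_C2p hN.isLoc_divCoord.2 (fun j => ?_) fun j => ?_
      · exact (h2 j).congr_left fun x => by simp [scaleE_apply, divCoord]
      · have h4 : (fun x => (φ x).2 j) =O[𝓝 0] fun x => x :=
          (isBigO_of_le _ fun x => (norm_le_pi_norm _ j).trans (norm_snd_le _)).trans hN.loc.isBigO
        have h5 := isLittleO_sub_mul ((hN.an.apply_Cp j).continuousAt.inv₀ (hN.L_ne j)) h4
        refine (h5.add ((h3 j).const_mul_left (lam γe γs j)⁻¹)).congr_left fun x => ?_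
        simp only [scaleE_apply, divCoord, hN.zero, Pi.inv_apply, ContinuousLinearEquiv.coe_coe,
          ContinuousLinearEquiv.trans_apply]
        ring)
  exact ⟨ψ, hψ⟩

theorem divCoord_rho : ∀ᶠ x in 𝓝 0, divCoord φ L (rho x) = rhoN (divCoord φ L x) := by
  filter_upwards [eventually_all.2 hN.conj_inl, eventually_all.2 hN.conj_inr, hN.eventually_ne,
    tendsto_rho.eventually hN.eventually_ne] with x e1 e2 e3 e4
  have hcc : ∀ {a b : ℂ}, conj a = b → a = conj b := fun {a b} hab => by
    rw [← hab, Complex.conj_conj]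
  refine Prod.ext (funext fun j => ?_) (funext fun j => ?_)
  · rcases j with i | k
    · obtain ⟨h1, h2, h3⟩ := e1 i
      simp only [divCoord, rhoN, rhoAux]
      refine hcc ?_
      rw [eq_div_iff (e3 _), mul_comm, h3]
    · obtain ⟨h1, h2, h3⟩ := e2 k
      exact hcc h2
  · rcases j with i | k
    · obtain ⟨h1, h2, h3⟩ := e1 i
      simp only [divCoord, rhoN, rhoAux]
      refine hcc ?_
      rw [map_div₀, h1, h2, mul_div_cancel_left₀ _ (e3 _)]
    · obtain ⟨h1, h2, h3⟩ := e2 k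
      simp only [divCoord, rhoN, rhoAux]
      refine hcc ?_
      have h5 := e3 (partner (Sum.inr k))
      rw [map_div₀, eq_inv_of_mul_eq_one_left h1, ← h3]
      field_simp

theorem divCoord_sigma (j : CIdx e s) : ∀ᶠ x in 𝓝 0,
    divCoord φ L (sigmaMap τ j x) = scalPair j (L x j ^ 2) (divCoord φ L x) := by
  filter_upwards [hN.scal j, hN.inv j] with x e1 e2
  rw [divCoord, e1, e2]
  refine Prod.ext rfl (funext fun i => ?_)
  by_cases hi : i = j
  · subst hi; simp [scalPair, divCoord, mul_div_assoc]
  · simp [scalPair, divCoord, Function.update_of_ne hi]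

/-- The multipliers are functions of the products of the coordinates. -/
theorem exists_multiplier (hσ : ∀ j, IsLoc (sigmaMap τ j)) : ∃ F : Cp e s → Cp e s,
    IsAdmissible γe γs F ∧ ∀ᶠ x in 𝓝 0, L x = F (diagMul (divCoord φ L x)) := by
  obtain ⟨ψ, hψ⟩ := hN.exists_isInv_divCoord
  have hθ : IsLoc (ψ ∘ (sumE e s).symm) := hψ.loc'.comp (sumE e s).symm.isLoc
  have hLθ : ∀ j, AnalyticAt ℂ (fun x => L (ψ ((sumE e s).symm x)) j) 0 := fun j =>
    (hN.an.apply_Cp j).comp_isLoc hθ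
  have hθ0 : ψ ((sumE e s).symm 0) = 0 := hθ.2
  have key : ∀ j, ∃ F : Cp e s → ℂ, AnalyticAt ℂ F 0 ∧ ∀ᶠ x in 𝓝 0,
      L (ψ ((sumE e s).symm x)) j = F fun j => x (Sum.inl j) * x (Sum.inr j) := fun j => by
    refine exists_eq_comp_mul (hLθ j) (M := fun i x => L (ψ ((sumE e s).symm x)) i ^ 2)
      (fun i => ((hLθ i).pow 2).differentiableAt) (fun i => ?_) (fun i => ?_) fun i => ?_
    · rw [hθ0]; exact pow_ne_zero 2 (hN.L_ne i)
    · rw [hθ0, hN.zero]; exact h.norm_lam_sq_ne i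
    · filter_upwards [hθ.tendsto.eventually (hN.divCoord_sigma i), hθ.tendsto.eventually (hN.inv i),
        (hσ i).tendsto.comp hθ.tendsto |>.eventually hψ.left,
        (sumE e s).symm.isLoc.tendsto.eventually hψ.right] with x e1 e2 e3 e4
      simp only [Function.comp_apply, id_eq] at *
      rw [e4] at e1
      rw [e1] at e3
      have h5 : (sumE e s).symm (sc (Sum.inl i) (Sum.inr i) (L (ψ ((sumE e s).symm x)) i ^ 2) x)
          = scalPair i (L (ψ ((sumE e s).symm x)) i ^ 2) ((sumE e s).symm x) := by
        rw [ContinuousLinearEquiv.symm_apply_eq, sumE_scalPair,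
          ContinuousLinearEquiv.apply_symm_apply]
      rw [h5, e3, e2]
  choose F hF hFL using key
  have hFL' : ∀ᶠ x in 𝓝 0, L x = fun j => F j (diagMul (divCoord φ L x)) := by
    filter_upwards [hψ.left, ((sumE e s).isLoc.tendsto.comp hψ.loc.tendsto).eventually
      (eventually_all.2 hFL)] with x e1 e2
    funext j
    have := e2 j
    simp only [Function.comp_apply, id_eq, ContinuousLinearEquiv.symm_apply_apply] at *
    rw [e1] at this
    exact this
  have hF0 : (fun j => F j 0) = lam γe γs := by
    have := hFL'.self_of_nhds
    rw [hN.isLoc_divCoord.2, isLoc_diagMul.2, hN.zero] at this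
    exact this.symm
  have hFρ : ∀ᶠ x in 𝓝 0, L (rho x) = fun j => F j (rhoZ (diagMul (divCoord φ L x))) := by
    filter_upwards [tendsto_rho.eventually hFL', hN.divCoord_rho] with x e1 e2
    rw [e1, e2, diagMul_rhoN]
  refine ⟨fun y j => F j y, ⟨analyticAt_Cp hF, hF0, fun i => ?_, fun i => ?_⟩, hFL'⟩
  · refine eventually_of_mul (Q := fun y => F (Sum.inl i) y = conj (F (Sum.inl i) (rhoZ y))) ?_
    filter_upwards [hψ.right, hψ.loc'.tendsto.eventually hFL', hψ.loc'.tendsto.eventually hFρ,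
      hψ.loc'.tendsto.eventually (hN.conj_inl i)] with x e1 e2 e3 e4
    simp only [Function.comp_apply, id_eq] at *
    rw [e1] at e2 e3
    have h1 := e4.1
    rw [e2, e3] at h1
    exact h1.symm
  · refine eventually_of_mul (Q := fun y => (F (Sum.inr (Sum.inl i)) y)⁻¹
      = conj (F (Sum.inr (Sum.inr i)) (rhoZ y))) ?_
    filter_upwards [hψ.right, hψ.loc'.tendsto.eventually hFL', hψ.loc'.tendsto.eventually hFρ,
      hψ.loc'.tendsto.eventually (hN.conj_inr (Sum.inr i))] with x e1 e2 e3 e4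
    simp only [Function.comp_apply, id_eq] at *
    rw [e1] at e2 e3
    have h1 := e4.1
    rw [e2, e3] at h1
    exact (eq_inv_of_mul_eq_one_left h1).symm

/-- Functions invariant under all involutions depend on sums and products only. -/
theorem exists_symmetric {f : C2p e s → ℂ} (hf : AnalyticAt ℂ f 0)
    (hfτ : ∀ j, ∀ᶠ x in 𝓝 0, f (τ j x) = f x) (hτ : ∀ j, IsLoc (τ j)) :
    ∃ g : C2p e s → ℂ, AnalyticAt ℂ g 0 ∧
      ∀ᶠ x in 𝓝 0, f x = g ((φ x).1 + (φ x).2, diagMul (φ x)) := by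
  obtain ⟨ψ, hψ, -⟩ := hN.exists_isInv
  let S : (CIdx e s ⊕ CIdx e s → ℂ) → C2p e s := fun x =>
    (fun j => (x (Sum.inl j) + x (Sum.inr j)) / 2, fun j => (x (Sum.inl j) - x (Sum.inr j)) / 2)
  have hS : IsLoc S := by
    refine ⟨analyticAt_C2p (fun j => ?_) fun j => ?_, ?_⟩
    · exact (((analyticAt_coord (Sum.inl j)).add (analyticAt_coord (Sum.inr j))).div_const)
    · exact (((analyticAt_coord (Sum.inl j)).sub (analyticAt_coord (Sum.inr j))).div_const)
    · refine Prod.ext (funext fun j => ?_) (funext fun j => ?_) <;> simp [S]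
  obtain ⟨g, hg, hgf⟩ := exists_eq_comp_sq (f := f ∘ (ψ ∘ S)) (hf.comp_isLoc (hψ.loc'.comp hS))
    fun j => by
      have ht := (hψ.loc'.comp hS).tendsto
      filter_upwards [ht.eventually (hfτ j), ht.eventually (hN.swap j), hS.tendsto.eventually hψ.right,
        ((hτ j).tendsto.comp ht).eventually hψ.left] with x e1 e2 e3 e4
      simp only [Function.comp_apply, id_eq] at *
      rw [e3] at e2
      rw [e2] at e4
      have h5 : S (Function.update x (Sum.inr j) (-x (Sum.inr j))) = swapPair j (S x) := by
        refine Prod.ext (funext fun i => ?_) (funext fun i => ?_) <;>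
        · by_cases hi : i = j
          · subst hi; simp [S, swapPair, sub_eq_add_neg]
          · simp [S, swapPair, hi]
      rw [h5, e4, e1]
  let T : C2p e s → (CIdx e s ⊕ CIdx e s → ℂ) := fun x =>
    Sum.elim (fun j => x.1 j) fun j => x.1 j ^ 2 - 4 * x.2 j
  have hT : IsLoc T := by
    refine ⟨analyticAt_pi_iff.2 fun j => ?_, ?_⟩
    · rcases j with j | j
      · exact analyticAt_coordFst j
      · exact ((analyticAt_coordFst j).pow 2).sub (analyticAt_const.mul (analyticAt_coordSnd j))
    · funext j; rcases j with j | j <;> simp [T]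
  refine ⟨g ∘ T, hg.comp_isLoc hT, ?_⟩
  let R : C2p e s → (CIdx e s ⊕ CIdx e s → ℂ) := fun x =>
    Sum.elim (fun j => x.1 j + x.2 j) fun j => x.1 j - x.2 j
  have hR : IsLoc R := by
    refine ⟨analyticAt_pi_iff.2 fun j => ?_, ?_⟩
    · rcases j with j | j
      · exact (analyticAt_coordFst j).add (analyticAt_coordSnd j)
      · exact (analyticAt_coordFst j).sub (analyticAt_coordSnd j)
    · funext j; rcases j with j | j <;> simp [R]
  filter_upwards [(hR.comp hN.loc).tendsto.eventually hgf, hψ.left] with x e1 e2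
  have h1 : S (R (φ x)) = φ x := by
    refine Prod.ext (funext fun j => ?_) (funext fun j => ?_) <;> simp [S, R]
  simp only [Function.comp_apply, id_eq] at *
  rw [h1, e2] at e1
  rw [e1]
  congr 1
  funext j
  rcases j with j | j
  · simp [R, T]
  · simp only [R, T, Sum.elim_inr, diagMul, Pi.add_apply]; ring

end IsNormalCoord

end normalCoordinates

section normalization

variable {γe : Fin e → ℝ} {γs : Fin s → ℂ} {h : IsParam γe γs} {τ : CIdx e s → C2p e s → C2p e s}
  {φ : C2p e s → C2p e s} {L : C2p e s → Cp e s} {α : Cp e s} {E : C2p e s → Cp e s}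

theorem IsThirdOrderPerturbation.zero (hE : IsThirdOrderPerturbation γe γs E) : E 0 = 0 := by
  obtain ⟨c, hc⟩ := hE.2.bound
  have h1 := hc.self_of_nhds
  have h2 : productQuadric γe γs (0 : C2p e s) = 0 := by funext j; simp [productQuadric]
  simpa [h2] using h1

theorem IsThirdOrderPerturbation.hasFDerivAt (hE : IsThirdOrderPerturbation γe γs E) :
    HasFDerivAt E (0 : C2p e s →L[ℂ] Cp e s) 0 := by
  rw [hasFDerivAt_iff_isLittleO_nhds_zero]
  simp only [zero_add, hE.zero, sub_zero, zero_apply]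
  have h1 := hE.2.trans_isLittleO (isLittleO_norm_pow_id (by norm_num : 1 < 3))
  have h2 : (fun x : C2p e s => productQuadric γe γs x) =o[𝓝 0] fun x => x := by
    refine isLittleO_pi.2 fun j => ?_
    have h3 : (fun x : C2p e s => x.1 j + 2 * quadCoef γe γs j * x.2 (partner j)) =O[𝓝 0]
        fun x => x := (isBigO_fst j).add ((isBigO_snd _).const_mul_left _)
    have h4 : ContinuousAt (fun x : C2p e s => x.1 j + 2 * quadCoef γe γs j * x.2 (partner j)) 0 := by
      fun_prop
    refine (isLittleO_sub_mul h4 h3).congr_left fun x => ?_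
    simp only [productQuadric, Prod.fst_zero, Prod.snd_zero, Pi.zero_apply]; ring
  exact (h1.add h2).congr_left fun x => sub_add_cancel _ _

theorem productQuadric_smul (c : ℂ) (x : C2p e s) :
    productQuadric γe γs (c • x) = c ^ 2 • productQuadric γe γs x := by
  funext j; simp [productQuadric]; ring

theorem productQuadric_linN_eq_zero (h : IsParam γe γs) {y : Cp e s}
    (hy : productQuadric γe γs (linN γe γs (y, -y)) = 0) : y = 0 := by
  funext j
  have h1 := pow_eq_zero_iff two_ne_zero |>.1 (congrFun hy (partner j))
  simp only [linN, partner_partner, Pi.neg_apply, add_neg_cancel, zero_add] at h1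
  have h2 := (mul_eq_zero.1 h1).resolve_left (mul_ne_zero two_ne_zero (h.quadCoef_ne_zero j))
  have h3 := (mul_eq_zero.1 h2).resolve_left (neg_ne_zero.2 (kap_ne_zero h.lam_ne_zero j))
  have h4 := mul_inv_cancel₀ (pow_ne_zero 2 (h.lam_ne_zero j))
  refine (mul_eq_zero.1 (?_ : (lam γe γs j ^ 2 - 1) * y j = 0)).resolve_left
    (sub_ne_zero.2 (h.lam_sq_ne_one j))
  linear_combination lam γe γs j ^ 2 * h3 + y j * h4

/-- The map `(u, v) ↦ (u + v, u v)`. -/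
def symMap (y : C2p e s) : C2p e s := (y.1 + y.2, diagMul y)

theorem hasFDerivAt_symMap : HasFDerivAt (symMap : C2p e s → C2p e s)
    ((ContinuousLinearMap.fst ℂ (Cp e s) (Cp e s) + ContinuousLinearMap.snd ℂ (Cp e s) (Cp e s)).prod
      0) 0 := by
  refine hasFDerivAt_C2p (Prod.ext (add_zero _) isLoc_diagMul.2) (fun j => ?_) fun j => ?_
  · exact (isLittleO_zero _ _).congr_left fun x => by simp [symMap]
  · have h1 : ContinuousAt (fun x : C2p e s => x.1 j) 0 := by fun_prop
    exact (isLittleO_sub_mul h1 (isBigO_snd j)).congr_left fun x => by simp [symMap, diagMul]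

namespace IsNormalCoord

variable (hN : IsNormalCoord h τ φ L α)

include hN

theorem deriv_fst (hE : IsThirdOrderPerturbation γe γs E) {Ξ : C2p e s → C2p e s}
    {D : C2p e s →L[ℂ] C2p e s} (hD : HasFDerivAt Ξ D 0)
    (hG : ∀ᶠ x in 𝓝 0, Ξ (symMap (φ x)) = (x.1, E x)) (a : Cp e s) :
    D (a, 0) = (fun j => a (partner j) / α (partner j), 0) := by
  have h1 := hasFDerivAt_symMap.comp_isLoc hN.der hN.loc.2
  have h2 := hD.comp_isLoc h1 (by
    rw [Function.comp_apply, hN.loc.2]; exact Prod.ext (add_zero _) isLoc_diagMul.2)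
  have h3 : HasFDerivAt (fun x : C2p e s => (x.1, E x))
    ((ContinuousLinearMap.fst ℂ (Cp e s) (Cp e s)).prod 0) 0 := hasFDerivAt_fst.prodMk hE.hasFDerivAt
  have h4 := DFunLike.congr_fun (h2.unique (h3.congr_of_eventuallyEq hG))
    (linE h (fun j => a j / α j, 0))
  have h5 : ((ContinuousLinearMap.fst ℂ (Cp e s) (Cp e s) + ContinuousLinearMap.snd ℂ (Cp e s)
      (Cp e s)).prod 0 : C2p e s →L[ℂ] C2p e s) (scaleE α α hN.ne hN.ne (fun j => a j / α j, 0))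
      = (a, 0) := by
    refine Prod.ext (funext fun j => ?_) rfl
    simp [scaleE_apply, mul_div_cancel₀ _ (hN.ne j)]
  simp only [ContinuousLinearMap.comp_apply, ContinuousLinearEquiv.coe_coe,
    ContinuousLinearEquiv.trans_apply, ContinuousLinearEquiv.symm_apply_apply] at h4
  rw [h5] at h4
  rw [h4]
  refine Prod.ext (funext fun j => ?_) rfl
  simp [linE_apply, linN]

theorem deriv_snd (hE : IsThirdOrderPerturbation γe γs E) {Ξ : C2p e s → C2p e s} (h0 : Ξ 0 = 0)
    {D : C2p e s →L[ℂ] C2p e s} (hD : HasFDerivAt Ξ D 0)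
    (hG : ∀ᶠ x in 𝓝 0, Ξ (symMap (φ x)) = (x.1, E x)) (y : Cp e s) :
    (D (0, fun j => -(α j * y j) ^ 2)).2 = productQuadric γe γs (linN γe γs (y, -y)) := by
  obtain ⟨ψ, hψ, hψd⟩ := hN.exists_isInv
  let v : C2p e s := scaleE α α hN.ne hN.ne (y, -y)
  have hv : ((linE h).symm.trans (scaleE α α hN.ne hN.ne)).symm v = linN γe γs (y, -y) := by
    rw [ContinuousLinearEquiv.symm_apply_eq, ContinuousLinearEquiv.trans_apply, ← linE_apply h,
      ContinuousLinearEquiv.symm_apply_apply]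
  have hlim := (hψd.hasLineDerivAt v).tendsto_slope_zero
  simp only [zero_add, hψ.loc'.2, sub_zero, ContinuousLinearEquiv.coe_coe, hv] at hlim
  have hcQ : Continuous (productQuadric γe γs) := by
    refine continuous_pi fun j => ?_
    simp only [productQuadric]; fun_prop
  have hQ := (hcQ.tendsto _).comp hlim
  have htv : Tendsto (fun t : ℂ => t • v) (𝓝[≠] 0) (𝓝 0) := by
    have : Continuous fun t : ℂ => t • v := by fun_prop
    exact (this.tendsto' 0 0 (zero_smul _ _)).mono_left nhdsWithin_le_nhds
  have hO : (fun t : ℂ => ψ (t • v)) =O[𝓝[≠] 0] fun t => t := by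
    refine (hψ.loc'.isBigO.comp_tendsto htv).trans ?_
    refine IsBigO.of_bound ‖v‖ (Eventually.of_forall fun t => ?_)
    simp [norm_smul, mul_comm]
  have hrem : Tendsto (fun t : ℂ => (t ^ 2)⁻¹ • (E (ψ (t • v)) - productQuadric γe γs (ψ (t • v))))
      (𝓝[≠] 0) (𝓝 0) := by
    refine IsLittleO.tendsto_inv_smul_nhds_zero ?_
    refine ((hE.2.comp_tendsto (hψ.loc'.tendsto.comp htv)).trans (hO.norm_left.pow 3)).trans_isLittleO
      ?_
    exact (isLittleO_pow_pow (𝕜 := ℂ) (by norm_num : 2 < 3)).mono nhdsWithin_le_nhds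
  have hsq : Tendsto (fun t : ℂ => t ^ 2) (𝓝[≠] 0) (𝓝[≠] 0) := by
    refine tendsto_nhdsWithin_iff.2 ⟨?_, ?_⟩
    · exact ((continuous_pow 2).tendsto' (0 : ℂ) 0 (by simp)).mono_left nhdsWithin_le_nhds
    · filter_upwards [self_mem_nhdsWithin] with t ht
      exact pow_ne_zero 2 ht
  have hΞ := ((hD.hasLineDerivAt (0, fun j => -(α j * y j) ^ 2)).tendsto_slope_zero).comp hsq
  simp only [zero_add, h0, sub_zero] at hΞ
  have hΞ2 := ((continuous_snd.tendsto _).comp hΞ)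
  have hsum := hrem.add hQ
  rw [zero_add] at hsum
  refine tendsto_nhds_unique hΞ2 (hsum.congr' ?_)
  filter_upwards [htv.eventually hψ.right, (hψ.loc'.tendsto.comp htv).eventually hG] with t e1 e2
  simp only [Function.comp_apply, id_eq] at *
  have e3 : symMap (t • v) = t ^ 2 • ((0, fun j => -(α j * y j) ^ 2) : C2p e s) := by
    refine Prod.ext (funext fun j => ?_) (funext fun j => ?_)
    · simp [symMap, v, scaleE_apply]
    · simp [symMap, v, scaleE_apply, diagMul]; ring
  rw [e1, e3] at e2
  rw [e2, productQuadric_smul, inv_pow, ← smul_add, sub_add_cancel]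
  rfl

theorem exists_isInv_of_comp (hE : IsThirdOrderPerturbation γe γs E) {Ξ : C2p e s → C2p e s}
    (hΞ : AnalyticAt ℂ Ξ 0) (hG : ∀ᶠ x in 𝓝 0, Ξ (symMap (φ x)) = (x.1, E x)) :
    ∃ Φ, IsInv Ξ Φ := by
  have h0 : Ξ 0 = 0 := by
    have h1 := hG.self_of_nhds
    rw [hN.loc.2, hE.zero] at h1
    have h2 : symMap (0 : C2p e s) = 0 := Prod.ext (add_zero _) isLoc_diagMul.2
    rw [h2] at h1; exact h1
  have hD := hΞ.differentiableAt.hasFDerivAt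
  have hinj : ∀ x, fderiv ℂ Ξ 0 x = 0 → x = 0 := by
    rintro ⟨a, b⟩ hab
    choose r hr using fun j => IsAlgClosed.exists_pow_nat_eq (-b j) two_pos
    have hb : (fun j => -(α j * (r j / α j)) ^ 2) = b := funext fun j => by
      rw [mul_div_cancel₀ _ (hN.ne j), hr, neg_neg]
    have h1 := hN.deriv_snd hE h0 hD hG fun j => r j / α j
    have h2 := hN.deriv_fst hE hD hG a
    have h3 : ((a, b) : C2p e s) = (a, 0) + (0, b) := by simp
    rw [h3, map_add, h2] at hab
    have h4 := congrArg Prod.snd hab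
    rw [Prod.snd_add, zero_add, ← hb, h1] at h4
    have h5 := productQuadric_linN_eq_zero h h4
    have h6 : b = 0 := by
      rw [← hb]
      funext j
      have h7 : r j / α j = 0 := congrFun h5 j
      rw [h7]; simp
    rw [h6, show ((0, 0) : C2p e s) = 0 from rfl, map_zero, add_zero] at hab
    refine Prod.ext (funext fun j => ?_) h6
    have h8 := congrFun (congrArg Prod.fst hab) (partner j)
    simp only [partner_partner] at h8
    exact (div_eq_zero_iff.1 h8).resolve_right (hN.ne j)
  let A : C2p e s ≃L[ℂ] C2p e s := (LinearEquiv.ofInjectiveEndo (fderiv ℂ Ξ 0 : C2p e s →ₗ[ℂ] C2p e s)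
    ((injective_iff_map_eq_zero _).2 hinj)).toContinuousLinearEquiv
  have hA : fderiv ℂ Ξ 0 = (A : C2p e s →L[ℂ] C2p e s) := ContinuousLinearMap.ext fun x => rfl
  obtain ⟨Φ, hΦ, -⟩ := _root_.exists_isInv ⟨hΞ, h0⟩ (hA ▸ hD)
  exact ⟨Φ, hΦ⟩

end IsNormalCoord

/-- Every third order perturbation with an abelian CR singularity is equivalent to a normal form. -/
theorem exists_normalForm (h : IsParam γe γs) {M : Set (C2p e s)}
    (hM : IsAbelianPerturbation γe γs M) : ∃ Λ ζ, IsAdmissible γe γs Λ ∧ IsSolution Λ ζ ∧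
      HolEquivalent M (normalForm Λ ζ) := by
  obtain ⟨E, hME, hE, hA⟩ := hM
  obtain ⟨τ, φ, L, α, hD, hN⟩ := exists_isNormalCoord h hA
  have hτ : ∀ j, IsLoc (τ j) := fun j => (hD j).isLoc
  have hσ : ∀ j, IsLoc (sigmaMap τ j) := fun j => (hτ j).comp (isLoc_rho_conj (hτ _))
  obtain ⟨F, hF, hFL⟩ := hN.exists_multiplier hσ
  have hS1 := fun j => hN.exists_symmetric (analyticAt_coordFst j)
    (fun i => (hD i).2.mono fun x hx => congrFun (congrArg Prod.fst hx) j) hτ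
  have hS2 := fun j => hN.exists_symmetric (hE.1.apply_Cp j)
    (fun i => (hD i).2.mono fun x hx => congrFun (congrArg Prod.snd hx) j) hτ
  choose g1 hg1 hg1' using hS1
  choose g2 hg2 hg2' using hS2
  let Ξ : C2p e s → C2p e s := fun y => (fun j => g1 j y, fun j => g2 j y)
  have hG : ∀ᶠ x in 𝓝 0, Ξ (symMap (φ x)) = (x.1, E x) := by
    filter_upwards [eventually_all.2 hg1', eventually_all.2 hg2'] with x e1 e2
    exact Prod.ext (funext fun j => (e1 j).symm) (funext fun j => (e2 j).symm)
  obtain ⟨Φ, hΦ⟩ := hN.exists_isInv_of_comp hE (Ξ := Ξ) (analyticAt_C2p hg1 hg2) hG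
  obtain ⟨ψ, hψ⟩ := hN.exists_isInv_divCoord
  obtain ⟨K, hK⟩ := exists_isInv_normMap hF.1 (hF.ne_zero h) (hF.sq_ne_one h)
  have hsym : IsLoc (symMap : C2p e s → C2p e s) :=
    ⟨analyticAt_C2p (fun j => (analyticAt_coordFst j).add (analyticAt_coordSnd j))
      fun j => (analyticAt_coordFst j).mul (analyticAt_coordSnd j),
      Prod.ext (add_zero _) isLoc_diagMul.2⟩
  have hfacts : ∀ᶠ x in 𝓝 0, (normMap F (divCoord φ L x)).1 = (symMap (φ x)).1 ∧
      (fun j => F (diagMul (divCoord φ L x)) j * diagMul (divCoord φ L x) j)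
        = (symMap (φ x)).2 := by
    filter_upwards [hFL, hN.eventually_ne] with x e1 e2
    constructor
    · funext j
      change (φ x).1 j + F (diagMul (divCoord φ L x)) j * ((φ x).2 j / L x j) = _
      rw [← e1, mul_div_cancel₀ _ (e2 j)]; rfl
    · funext j
      rw [← e1]
      simp only [diagMul, divCoord, symMap]
      have := e2 j
      field_simp
  refine ⟨F, diagMul ∘ K, hF, isSolution_diagMul hF h hK, Φ, hΦ.symm.isBiholGerm, ?_⟩
  have hz : Tendsto (fun z : C2p e s => ((z.1, conjVec z.1) : C2p e s)) (𝓝 0) (𝓝 0) :=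
    tendsto_real.comp (continuous_fst.tendsto' _ _ rfl)
  have hZ : Tendsto (fun z : C2p e s => (((Φ z).1, conjVec (Φ z).1) : C2p e s)) (𝓝 0) (𝓝 0) :=
    hz.comp hΦ.loc'.tendsto
  have hx' := hψ.loc'.tendsto.comp (hK.loc'.tendsto.comp hZ)
  filter_upwards [hME, hΦ.right, hz.eventually hG, hz.eventually hfacts, hz.eventually hN.divCoord_rho,
    (hsym.tendsto.comp (hN.loc.tendsto.comp hz)).eventually hΦ.left,
    (hN.isLoc_divCoord.tendsto.comp hz).eventually hK.left,
    ((isLoc_diagMul.tendsto.comp hN.isLoc_divCoord.tendsto).comp hz).eventually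
      (hF.eventually_isConjSymm h),
    hZ.eventually hK.right, hZ.eventually (inv_normMap_rho hF h hK),
    (hK.loc'.tendsto.comp hZ).eventually hψ.right, hx'.eventually hN.divCoord_rho,
    hx'.eventually hψ.left, (tendsto_rho.comp hx').eventually hψ.left, hx'.eventually hG,
    hx'.eventually hfacts] with z a1 a2 a3 a4 a5 a6 a7 a8 b1 b2 b3 b4 b5 b6 b7 b8
  rw [a1]
  simp only [Function.comp_apply, id_eq] at *
  constructor
  · intro hzE
    have hzΞ : Ξ (symMap (φ (z.1, conjVec z.1))) = z := a3.trans (Prod.ext rfl hzE.symm)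
    rw [hzΞ] at a6
    rw [rho_real] at a5
    have c1 := normMap_rhoN a8
    rw [← a5] at c1
    have c2 := eq_real_of_rho c1.symm
    rw [a4.1] at c2
    change (Φ z).2 = fun j => F (diagMul (K ((Φ z).1, conjVec (Φ z).1))) j
      * diagMul (K ((Φ z).1, conjVec (Φ z).1)) j
    rw [a6, ← c2, a7, a4.2]
  · intro hzF
    change (Φ z).2 = fun j => F (diagMul (K ((Φ z).1, conjVec (Φ z).1))) j
      * diagMul (K ((Φ z).1, conjVec (Φ z).1)) j at hzF
    rw [rho_real] at b2
    have c1 := b4.trans ((congrArg rhoN b3).trans b2.symm)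
    rw [c1] at b6
    have c2 := eq_real_of_rho b6.symm
    rw [b3, b1] at b8
    have c3 := b7
    have c4 : symMap (φ (ψ (K ((Φ z).1, conjVec (Φ z).1)))) = Φ z :=
      Prod.ext b8.1.symm (b8.2.symm.trans hzF.symm)
    rw [c4, a2] at c3
    have d1 := congrArg Prod.fst c3
    calc z.2 = _ := congrArg Prod.snd c3
      _ = _ := congrArg E c2
      _ = E (z.1, conjVec z.1) := congrArg (fun w => E (w, conjVec w)) d1.symm

end normalization

theorem mainTheorem3 (nE nS : ℕ) (γe : Fin nE → ℝ) (γs : Fin nS → ℂ)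
    (hγe : ∀ i, 0 < γe i ∧ γe i < 1 / 2)
    (hγs : ∀ i, (γs i).re < 1 / 2 ∧ 0 ≤ (γs i).im ∧ γs i ≠ 0) :
    -- the quadratic equations have exactly one convergent solution
    (∀ Λ : Cp nE nS → Cp nE nS, IsAdmissible γe γs Λ →
      (∃ ζ : C2p nE nS → Cp nE nS, IsSolution Λ ζ) ∧
      ∀ ζ₁ ζ₂ : C2p nE nS → Cp nE nS,
        IsSolution Λ ζ₁ → IsSolution Λ ζ₂ → ζ₁ =ᶠ[𝓝 0] ζ₂) ∧
    -- every `M` is holomorphically equivalent to a normal form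
    (∀ M : Set (C2p nE nS), IsAbelianPerturbation γe γs M →
      ∃ (Λ : Cp nE nS → Cp nE nS) (ζ : C2p nE nS → Cp nE nS),
        IsAdmissible γe γs Λ ∧ IsSolution Λ ζ ∧ HolEquivalent M (normalForm Λ ζ)) ∧
    -- the series `Λ` are otherwise arbitrary
    (∀ (Λ : Cp nE nS → Cp nE nS) (ζ : C2p nE nS → Cp nE nS),
      IsAdmissible γe γs Λ → IsSolution Λ ζ →
      ∃ M : Set (C2p nE nS), IsAbelianPerturbation γe γs M ∧
        HolEquivalent M (normalForm Λ ζ)) ∧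
    -- real equations satisfied by the normal form
    (∀ (Λ : Cp nE nS → Cp nE nS) (ζ : C2p nE nS → Cp nE nS),
      IsAdmissible γe γs Λ → IsSolution Λ ζ →
      ∃ Λ' : Cp nE nS → Cp nE nS, IsInverseFactor Λ Λ' ∧
        ∀ᶠ z : C2p nE nS in 𝓝 0, z ∈ normalForm Λ ζ →
          (∀ i : Fin nE, z.2 (Sum.inl i) = conj (z.2 (Sum.inl i))) ∧
          (∀ i : Fin nS, z.2 (Sum.inr (Sum.inl i)) * Λ' z.2 (Sum.inr (Sum.inl i)) ^ 2 =
            conj (z.2 (Sum.inr (Sum.inr i))))) ∧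
    -- holomorphic flattening into a linear subspace
    (∀ M : Set (C2p nE nS), IsAbelianPerturbation γe γs M →
      ∃ Φ : C2p nE nS → C2p nE nS, IsBiholGerm Φ ∧
        ∀ᶠ z : C2p nE nS in 𝓝 0, z ∈ M →
          (∀ i : Fin nE, (Φ z).2 (Sum.inl i) = conj ((Φ z).2 (Sum.inl i))) ∧
          (∀ i : Fin nS, (Φ z).2 (Sum.inr (Sum.inl i)) =
            conj ((Φ z).2 (Sum.inr (Sum.inr i))))) := by
  have h : IsParam γe γs := ⟨hγe, hγs⟩
  refine ⟨fun Λ hΛ => ⟨?_, fun ζ₁ ζ₂ => isSolution_unique hΛ h⟩, fun M => exists_normalForm h,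
    fun Λ ζ hΛ hζ => exists_realization hΛ h hζ, fun Λ ζ hΛ hζ => ?_, fun M hM => ?_⟩
  · obtain ⟨K, hK⟩ := exists_isInv_normMap hΛ.1 (hΛ.ne_zero h) (hΛ.sq_ne_one h)
    exact ⟨_, isSolution_diagMul hΛ h hK⟩
  · obtain ⟨Λ', h1, -, h2⟩ := exists_real_equations hΛ h hζ
    exact ⟨Λ', h1, h2⟩
  · obtain ⟨Λ, ζ, hΛ, hζ, hMN⟩ := exists_normalForm h hM
    exact exists_flattening hΛ h hζ hMN
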